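/- **Setting.** Let $(\tilde x,\tilde y,\tilde z)$ be Cartesian coordinates near the point $\Lambda=0\in\mathbb R^3$, with $\tilde\rho^2=\tilde x^2+\tilde y^2$ and $\varphi$ the angle about the $\tilde z$-axis. Let $f$ (complex valued) and $\beta$ (real valued) be real-analytic functions of $(\tilde x,\tilde y,\tilde z)$ near $0$, independent of $\varphi$. Put $$\phi=\sqrt{\tilde\rho^2+\tilde z^2}\,f,\qquad h=R^2d\varphi^2+e^{2\beta}(dR^2+dZ^2),\qquad R=\frac{\tilde\rho}{\tilde\rho^2+\tilde z^2},\quad Z=\frac{\tilde z}{\tilde\rho^2+\tilde z^2}.$$ Call $(f,\beta)$ a *stationary axisymmetric vacuum solution* (near infinity, analytic in $(\tilde x,\tilde y,\tilde z)$) if the rescaled metric $$\hat h=\tilde\rho^2e^{-2\beta}d\varphi^2+d\tilde\rho^2+d\tilde z^2=\hat\Omega^2h,\qquad \hat\Omega=(\tilde\rho^2+\tilde z^2)e^{-\beta},$$ has coefficients in $(\tilde x,\tilde y,\tilde z)$ that are real-analytic at $\Lambda$, and if the stationary vacuum field equations $$R_{ab}=\frac{2}{(\phi\bar\phi-1)^2}D_{(a}\phi\,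 D_{b)}\bar\phi,\qquad D^aD_a\phi=\frac{2\bar\phi}{\phi\bar\phi-1}(D^a\phi)D_a\phi$$ (Ricci tensor and covariant derivative of $h$; the second is the Ernst equation) hold in a punctured neighbourhood of $\Lambda$. **Multipole moments.** Let $\kappa$ be a real-analytic function of $(\tilde x,\tilde y,\tilde z)$ near $0$, independent of $\varphi$, with $\kappa(\Lambda)=0$ and $\partial_{\tilde z}\kappa(\Lambda)=c$. Put $\Omega=e^{\kappa}\hat\Omega$, $\tilde h=\Omega^2h=e^{2\kappa}\hat h$ and $\tilde\phi=\phi/\sqrt\Omega=e^{(\beta-\kappa)/2}f$ (extended to $\Lambda$). With $\tilde D$ and $\tilde R_{ab}$ the covariant derivative and Ricci tensor of $\tilde h$, and $C[\cdot]$ the totally symmetric trace-free part with respect to $\tilde h$, define tensor fields near $\Lambda$ by $P=\tilde\phi$ and $$P_{a_1\dots a_n}=C\Big[\tilde D_{a_1}P_{a_2\dots a_n}-\tfrac{(n-1)(2n-3)}{2}\tilde R_{a_1a_2}P_{a_3\dots a_n}\Big].$$ Numbers $m_0,m_1,\dots\in\mathbb C$ are the *multipole moments* of $(f,\beta)$ with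 respect to $\kappa$ if $P_{a_1\dots a_n}(\Lambda)=m_n\,C[z_{a_1}\cdots z_{a_n}]$ for all $n\ge 0$, where $z_a=(d\tilde z)_a$. **Theorem.** Let $(m_n)_{n\ge0}$ be a sequence of complex numbers and let $c\in\mathbb R$. 1. Suppose that the power series $y(\rho)=\sum_{n\ge0}\frac{m_n}{n!}\rho^n$ has positive radius of convergence. Then there is a stationary axisymmetric vacuum solution $(f,\beta)$, analytic in $(\tilde x,\tilde y,\tilde z)$, whose multipole moments are $m_n$ with respect to every $\kappa$ as above (with $\partial_{\tilde z}\kappa(\Lambda)=c$). Moreover $f$ is unique: if $(f',\beta')$ is any such solution which has multipole moments $m_n$ with respect to some $\kappa'$ as above (with the same $c$), then $f'=f$ in a neighbourhood of $\Lambda$. 2. Conversely, if some stationary axisymmetric vacuum solution, analytic in $(\tilde x,\tilde y,\tilde z)$, has multipole moments $m_n$ with respect to some $\kappa$ as above, then $y$ has positive radius of convergence. -/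

import Mathlib

open scoped Topology ComplexConjugate

noncomputable section

namespace AxiErnst

/-- A neighbourhood of the origin of this space is the conformally compactified manifold of
Killing trajectories, in the coordinates `(x̃, ỹ, z̃) = (p 0, p 1, p 2)`; the origin is the added
point `Λ` at infinity. -/
abbrev E3 : Type := EuclideanSpace ℝ (Fin 3)

/-! ### Tensor calculus in coordinates -/

/-- Partial derivative `∂_i u`. -/
def pd {F : Type*} [NormedAddCommGroup F] [NormedSpace ℝ F] (i : Fin 3) (u : E3 → F) (p : E3) : F :=
  fderiv ℝ u p (EuclideanSpace.single i 1)

/-- A field of metric coefficients `g_{ij}`. -/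
abbrev MetricField : Type := E3 → Matrix (Fin 3) (Fin 3) ℝ

/-- Christoffel symbols `Γ^k_{ij}`. -/
def christoffel (g : MetricField) (k i j : Fin 3) (p : E3) : ℝ :=
  (1 / 2) * ∑ l, (g p)⁻¹ k l *
    (pd i (fun q => g q j l) p + pd j (fun q => g q i l) p - pd l (fun q => g q i j) p)

/-- Ricci tensor `R_{ij}` (positive on round spheres). -/
def ricci (g : MetricField) (i j : Fin 3) (p : E3) : ℝ :=
  (∑ k, (pd k (christoffel g k i j) p - pd j (christoffel g k i k) p)) +
    ∑ k, ∑ l, (christoffel g k k l p * christoffel g l i j p -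
      christoffel g k j l p * christoffel g l i k p)

/-- `D^a D_a u` for a complex valued function `u`. -/
def laplacian (g : MetricField) (u : E3 → ℂ) (p : E3) : ℂ :=
  ∑ i, ∑ j, (((g p)⁻¹ i j : ℝ) : ℂ) *
    (pd i (pd j u) p - ∑ k, (christoffel g k i j p : ℂ) * pd k u p)

/-- `(D^a u) D_a v` for complex valued functions `u`, `v` (complex bilinear). -/
def gradProd (g : MetricField) (u v : E3 → ℂ) (p : E3) : ℂ :=
  ∑ i, ∑ j, (((g p)⁻¹ i j : ℝ) : ℂ) * (pd i u p * pd j v p)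

/-- Components `T_{a_1 … a_n}` of a complex covariant tensor at a point. -/
abbrev Tensor (n : ℕ) : Type := (Fin n → Fin 3) → ℂ

/-- Covariant derivative `D_{a_1} T_{a_2 … a_{n+1}}`. -/
def covDeriv (g : MetricField) {n : ℕ} (T : E3 → Tensor n) (p : E3) : Tensor (n + 1) := fun I =>
  pd (I 0) (fun q => T q (Fin.tail I)) p -
    ∑ s : Fin n, ∑ k : Fin 3,
      (christoffel g k (I 0) (I s.succ) p : ℂ) * T p (Function.update (Fin.tail I) s k)

/-- Total symmetrization `T_{(a_1 … a_n)}`. -/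
def symmetrize {n : ℕ} (T : Tensor n) : Tensor n := fun I =>
  (n.factorial : ℂ)⁻¹ * ∑ σ : Equiv.Perm (Fin n), T (I ∘ σ)

/-- `M_{a_1 a_2} Q_{a_3 … a_{n+2}}`. -/
def matMul {n : ℕ} (M : Fin 3 → Fin 3 → ℝ) (Q : Tensor n) : Tensor (n + 2) := fun I =>
  (M (I 0) (I 1) : ℂ) * Q (fun s => I s.succ.succ)

/-- `S = C[T]`: `S` is the totally symmetric and trace-free part of `T` with respect to the metric
`g` at a point. That is, `S` is symmetric and trace-free, and
`T_{(a_1 … a_n)} = S_{a_1 … a_n} + g_{(a_1 a_2} Q_{a_3 … a_n)}` for some `Q`. -/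
def IsSymmTraceFreePart (g : Matrix (Fin 3) (Fin 3) ℝ) :
    {n : ℕ} → (T S : Tensor n) → Prop
  | 0, T, S => S = T
  | 1, T, S => S = T
  | n + 2, T, S =>
      (∀ (σ : Equiv.Perm (Fin (n + 2))) (I : Fin (n + 2) → Fin 3), S (I ∘ σ) = S I) ∧
      (∀ J : Fin n → Fin 3,
        ∑ a : Fin 3, ∑ b : Fin 3,
          ((g⁻¹ a b : ℝ) : ℂ) * S (Fin.cons a (Fin.cons b J : Fin (n + 1) → Fin 3)) = 0) ∧
      ∃ Q : Tensor n, symmetrize T = S + symmetrize (matMul g Q)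

/-! ### Axisymmetric fields and Weyl metrics -/

/-- Near the origin, `u` is a function of `ρ̃ = √(x̃² + ỹ²)` and `z̃` only. -/
def Axisymmetric {F : Type*} (u : E3 → F) : Prop :=
  ∀ᶠ p in 𝓝 (0 : E3), ∀ q : E3,
    q 0 ^ 2 + q 1 ^ 2 = p 0 ^ 2 + p 1 ^ 2 → q 2 = p 2 → u q = u p

/-- The quadratic form `ρ̃² dφ² = (x̃ dỹ - ỹ dx̃)² / ρ̃²` off the axis (and `0` on the axis). -/
def angularForm (p : E3) : Matrix (Fin 3) (Fin 3) ℝ :=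
  Matrix.of fun i j =>
    (![-p 1, p 0, 0] : Fin 3 → ℝ) i * (![-p 1, p 0, 0] : Fin 3 → ℝ) j / (p 0 ^ 2 + p 1 ^ 2)

/-- The Weyl metric `h = R² dφ² + e^{2β} (dR² + dZ²)` where `R = ρ̃ / (ρ̃² + z̃²)` and
`Z = z̃ / (ρ̃² + z̃²)`, in the coordinates `(x̃, ỹ, z̃)`. The inversion is conformal, hence
`dR² + dZ² = (dρ̃² + dz̃²) / (ρ̃² + z̃²)²`, while `dρ̃² + dz̃²` is the Euclidean metric minus
`ρ̃² dφ²`. -/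
def weylMetric (β : E3 → ℝ) : MetricField := fun p =>
  (‖p‖ ^ 4)⁻¹ • (angularForm p + Real.exp (2 * β p) • (1 - angularForm p))

/-- The rescaled metric `ĥ = ρ̃² e^{-2β} dφ² + dρ̃² + dz̃²`. -/
def hatMetric (β : E3 → ℝ) : MetricField := fun p =>
  Real.exp (-2 * β p) • angularForm p + (1 - angularForm p)

/-- The conformal factor `Ω = e^κ (ρ̃² + z̃²) e^{-β}`. -/
def conformalFactor (β κ : E3 → ℝ) (p : E3) : ℝ :=
  Real.exp (κ p) * (‖p‖ ^ 2 * Real.exp (-β p))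

/-- The rescaled metric `h̃ = e^{2κ} ĥ`. -/
def tildeMetric (β κ : E3 → ℝ) : MetricField := fun p =>
  Real.exp (2 * κ p) • hatMetric β p

/-- The Ernst potential `φ = √(ρ̃² + z̃²) f`. -/
def potential (f : E3 → ℂ) (p : E3) : ℂ := (‖p‖ : ℂ) * f p

/-- The rescaled potential `φ̃ = e^{β/2 - κ/2} f`, the extension of `φ / √Ω` to `Λ`. -/
def tildePotential (f : E3 → ℂ) (β κ : E3 → ℝ) (p : E3) : ℂ :=
  (Real.exp (β p / 2 - κ p / 2) : ℂ) * f p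

theorem tildeMetric_eq (β κ : E3 → ℝ) {p : E3} (hp : p ≠ 0) :
    tildeMetric β κ p = conformalFactor β κ p ^ 2 • weylMetric β p := by
  have hn : ‖p‖ ≠ 0 := norm_ne_zero_iff.mpr hp
  have h1 : Real.exp (2 * κ p) = Real.exp (κ p) ^ 2 := by
    rw [← Real.exp_nat_mul]; norm_num
  have h2 : Real.exp (2 * β p) = (Real.exp (-β p) ^ 2)⁻¹ := by
    rw [← Real.exp_nat_mul, ← Real.exp_neg]; norm_num
  have h3 : Real.exp (-2 * β p) = Real.exp (-β p) ^ 2 := by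
    rw [← Real.exp_nat_mul]; norm_num
  have h4 : Real.exp (-β p) ≠ 0 := (Real.exp_pos _).ne'
  ext i j
  simp only [tildeMetric, hatMetric, weylMetric, conformalFactor, Matrix.smul_apply,
    Matrix.add_apply, smul_eq_mul, h1, h2, h3]
  field_simp

theorem tildePotential_eq (f : E3 → ℂ) (β κ : E3 → ℝ) {p : E3} (hp : p ≠ 0) :
    tildePotential f β κ p = potential f p / (√(conformalFactor β κ p) : ℝ) := by
  have hn : ‖p‖ ≠ 0 := norm_ne_zero_iff.mpr hp
  have h1 : √(conformalFactor β κ p) = ‖p‖ * (Real.exp (β p / 2 - κ p / 2))⁻¹ := by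
    rw [Real.sqrt_eq_iff_mul_self_eq (by unfold conformalFactor; positivity) (by positivity),
      conformalFactor, ← Real.exp_neg]
    have : Real.exp (-(β p / 2 - κ p / 2)) * Real.exp (-(β p / 2 - κ p / 2)) =
        Real.exp (κ p) * Real.exp (-β p) := by
      rw [← Real.exp_add, ← Real.exp_add]; congr 1; ring
    linear_combination -‖p‖ ^ 2 * this
  have h2 : (‖p‖ : ℂ) ≠ 0 := by exact_mod_cast hn
  have h3 : (Real.exp (β p / 2 - κ p / 2) : ℂ) ≠ 0 := by
    exact_mod_cast (Real.exp_pos _).ne'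
  rw [h1, tildePotential, potential, Complex.ofReal_mul, Complex.ofReal_inv]
  field_simp

/-! ### Field equations and multipole moments -/

/-- The stationary vacuum field equations on the manifold of Killing trajectories, at a point:
`R_{ab} = 2 (φ φ̄ - 1)⁻² D_{(a} φ D_{b)} φ̄` and `D^a D_a φ = 2 φ̄ (φ φ̄ - 1)⁻¹ (D^a φ) D_a φ`. -/
def FieldEquationsAt (h : MetricField) (φ : E3 → ℂ) (p : E3) : Prop :=
  (∀ a b : Fin 3, (ricci h a b p : ℂ) =
    2 / (φ p * conj (φ p) - 1) ^ 2 *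
      ((pd a φ p * pd b (fun q => conj (φ q)) p + pd b φ p * pd a (fun q => conj (φ q)) p) / 2)) ∧
  laplacian h φ p = 2 * conj (φ p) / (φ p * conj (φ p) - 1) * gradProd h φ φ p

/-- `f` and `β` define a stationary axisymmetric vacuum solution near infinity, in the class of
functions analytic in `(x̃, ỹ, z̃)`, whose manifold of trajectories is asymptotically flat (the
rescaled metric extends regularly to a neighbourhood of `Λ`). -/
structure IsAxisymmetricVacuum (f : E3 → ℂ) (β : E3 → ℝ) : Prop where
  analytic_f : AnalyticAt ℝ f 0
  axisymmetric_f : Axisymmetric f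
  analytic_β : AnalyticAt ℝ β 0
  axisymmetric_β : Axisymmetric β
  analytic_metric : ∀ i j, AnalyticAt ℝ (fun p => hatMetric β p i j) 0
  fieldEquations : ∀ᶠ p in 𝓝[≠] (0 : E3), FieldEquationsAt (weylMetric β) (potential f) p

/-- An admissible exponent `κ` of the conformal factor: analytic, axisymmetric, `κ(Λ) = 0`, with
translation part `κ'(0) = c`. -/
structure IsConformalGauge (c : ℝ) (κ : E3 → ℝ) : Prop where
  analytic : AnalyticAt ℝ κ 0
  axisymmetric : Axisymmetric κ
  map_zero : κ 0 = 0
  deriv_zero : pd 2 κ 0 = c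

/-- The recursion for the moment tensors `P, P_{a_1}, P_{a_1 a_2}, …` (as germs of tensor fields at
`Λ`) for a metric `g` and a potential `ψ`:
`P_{a_1 … a_n} = C[D_{a_1} P_{a_2 … a_n} - (n-1)(2n-3)/2 · R_{a_1 a_2} P_{a_3 … a_n}]`. -/
structure IsMomentSequence (g : MetricField) (ψ : E3 → ℂ) (P : (n : ℕ) → E3 → Tensor n) :
    Prop where
  analytic : ∀ n I, AnalyticAt ℝ (fun p => P n p I) 0
  zero : ∀ᶠ p in 𝓝 (0 : E3), P 0 p = fun _ => ψ p
  one : ∀ᶠ p in 𝓝 (0 : E3), IsSymmTraceFreePart (g p) (covDeriv g (P 0) p) (P 1 p)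
  add_two : ∀ n : ℕ, ∀ᶠ p in 𝓝 (0 : E3),
    IsSymmTraceFreePart (g p)
      (covDeriv g (P (n + 1)) p -
        (((n : ℂ) + 1) * (2 * (n : ℂ) + 1) / 2) • matMul (fun i j => ricci g i j p) (P n p))
      (P (n + 2) p)

/-- The multipole moments are the `m_n` with `P_{a_1 … a_n}(Λ) = m_n C[z_{a_1} ⋯ z_{a_n}]`,
where `z_a = (dz̃)_a`. -/
def HasMultipoleMoments (f : E3 → ℂ) (β κ : E3 → ℝ) (m : ℕ → ℂ) : Prop :=
  ∃ P : (n : ℕ) → E3 → Tensor n,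
    IsMomentSequence (tildeMetric β κ) (tildePotential f β κ) P ∧
    ∀ n, IsSymmTraceFreePart (tildeMetric β κ 0)
      (fun I => m n * ∏ s, if I s = 2 then 1 else 0) (P n 0)

/-- `y(ρ) = ∑ m_n ρ^n / n!` has positive radius of convergence. -/
def HasPositiveRadius (m : ℕ → ℂ) : Prop :=
  0 < (FormalMultilinearSeries.ofScalars ℂ (fun n => m n / (n.factorial : ℂ))).radius

end AxiErnst

end

open scoped Topology ComplexConjugate

noncomputable section

namespace AxiErnst

/-! ### Gradients -/

/-! An axisymmetric analytic function near Λ is a convergent power series in r² = ρ̃² + z̃² and z̃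
(`exists_series_of_axisymmetric`). It therefore extends to complex arguments and can be restricted
to the complex null cone r² = 0, where the single variable t = z̃ is left. This restriction carries
the whole problem.

Field equations. For the Weyl metric β drops out of the Ernst equation, which becomes a semilinear
equation for f with the flat Laplacian (`fieldEquationsAt_iff`). The Ricci equations then amount to
explicit formulas for the two first derivatives of β (`beta_of_ricci`, `ricci_of_beta`). Their
integrability follows from the Ernst equation (`beta_closed`), and regularity of the rescaled metric
means that β = 0 on the axis. What remains is `lap a = ernstRhs a` for the power series a of f. In
the variables (r², z̃) the Laplacian determines the coefficients recursively in the power of r², so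
f is determined by its restriction to the null cone (`ernst_unique`). Every analytic restriction
occurs (`ernst_exists`): the solution is a fixed point, and it converges by an estimate in a
weighted norm.

Moments. Contract the moment tensors with a complex null vector η whose z̃-component is 1. Traces
disappear, symmetrization is immaterial, and Taylor coefficients at Λ along η are those of the
restriction to the null cone. The tensor recursion becomes a scalar recursion in t that involves κ′
and one curvature function (`IsGaugeData.moment_recursion`). Let f̄ denote the series with conjugate
coefficients; on the null cone β′ = t (f + 2t f′)(f̄ + 2t f̄′). Choose r(t) with r² − 2t r r′ =
e^{2β}, r(0) = 1 and 2r′(0) = −c (`IsNullGauge`), and use ρ = t/r² as the variable. After a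
rescaling, κ and the curvature enter only through a function h with h(Λ) = 0, and an algebraic
identity shows that no derivative of h survives (`map_gauge`). Hence m_n is the n-th derivative of r
f with respect to ρ at 0 (`IsGaugeData.contract_moment`). In other words y(ρ) = r(t) f(t) with ρ =
t/r(t)², and κ matters only through c. Symmetric trace-free tensors are determined by their values
on null vectors (`eq_zero_of_contract_nullCurve`), so this describes the moments completely
(`IsGaugeData.hasMultipoleMoments_iff`).

Conclusion. Given a solution, r is obtained by integrations, so y is analytic (`exists_isNullGauge`,
`exists_iteratedDeriv_eq`). Given y, take ρ as the independent variable: v = 1/r² satisfies v″ = 2(y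
+ 2ρ y′)(ȳ + 2ρ ȳ′) with v(0) = 1 and v′(0) = c, and t = ρ/v, f = y √v is a convergent datum on the
null cone (`exists_series_of_potential`). For uniqueness, the moments determine the restriction of f
to the null cone coefficient by coefficient (`null_eq_of_moments`). -/

/-- The linear form with components `d`. -/
def gradForm {F : Type*} [NormedAddCommGroup F] [NormedSpace ℝ F] (d : Fin 3 → F) : E3 →L[ℝ] F :=
  ∑ i, (EuclideanSpace.proj i : E3 →L[ℝ] ℝ).smulRight (d i)

/-- `u` is differentiable at `p` with partial derivatives `d`. -/
def HasGrad {F : Type*} [NormedAddCommGroup F] [NormedSpace ℝ F] (u : E3 → F) (d : Fin 3 → F)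
    (p : E3) : Prop := HasFDerivAt u (gradForm d) p

section
variable {F : Type*} [NormedAddCommGroup F] [NormedSpace ℝ F]

theorem gradForm_apply (d : Fin 3 → F) (w : E3) : gradForm d w = ∑ i, w i • d i := by
  simp [gradForm]

theorem gradForm_single (d : Fin 3 → F) (i : Fin 3) :
    gradForm d (EuclideanSpace.single i 1) = d i := by
  rw [gradForm_apply, Finset.sum_eq_single i]
  · simp
  · intro b _ hb; simp [hb]
  · simp

/-- The bridge from Fréchet derivatives to components: the calculus rules below rewrite the
derivative they obtain in this form and then read off the partial derivatives. -/
theorem clm_eq_gradForm (l : E3 →L[ℝ] F) :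
    l = gradForm (fun i => l (EuclideanSpace.single i 1)) := by
  ext w
  conv_lhs => rw [← (EuclideanSpace.basisFun (Fin 3) ℝ).sum_repr w]
  simp [gradForm_apply, map_sum]

theorem hasGrad_of_differentiableAt {u : E3 → F} {p : E3} (h : DifferentiableAt ℝ u p) :
    HasGrad u (fun i => pd i u p) p := by
  have := h.hasFDerivAt
  rw [clm_eq_gradForm (fderiv ℝ u p)] at this
  exact this

theorem HasGrad.pd_eq {u : E3 → F} {d : Fin 3 → F} {p : E3} (h : HasGrad u d p) (i : Fin 3) :
    pd i u p = d i := by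
  rw [pd, HasFDerivAt.fderiv h, gradForm_single]

theorem hasGrad_const (c : F) (p : E3) : HasGrad (fun _ => c) (fun _ => 0) p := by
  have := hasFDerivAt_const (𝕜 := ℝ) c p
  rw [clm_eq_gradForm (0 : E3 →L[ℝ] F)] at this
  exact this

theorem HasGrad.congr {u v : E3 → F} {d : Fin 3 → F} {p : E3} (h : HasGrad u d p)
    (huv : v =ᶠ[𝓝 p] u) : HasGrad v d p := HasFDerivAt.congr_of_eventuallyEq h huv

theorem HasGrad.of_eq {u : E3 → F} {d d' : Fin 3 → F} {p : E3} (h : HasGrad u d p)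
    (e : ∀ i, d i = d' i) : HasGrad u d' p := by
  rwa [← (funext e : d = d')]

theorem HasGrad.add {u v : E3 → F} {d d' : Fin 3 → F} {p : E3} (h : HasGrad u d p)
    (h' : HasGrad v d' p) : HasGrad (fun q => u q + v q) (fun i => d i + d' i) p := by
  have := HasFDerivAt.add h h'
  rw [clm_eq_gradForm (gradForm d + gradForm d')] at this
  simpa only [_root_.add_apply, gradForm_single] using! this

theorem HasGrad.sub {u v : E3 → F} {d d' : Fin 3 → F} {p : E3} (h : HasGrad u d p)
    (h' : HasGrad v d' p) : HasGrad (fun q => u q - v q) (fun i => d i - d' i) p := by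
  have := HasFDerivAt.sub h h'
  rw [clm_eq_gradForm (gradForm d - gradForm d')] at this
  simpa only [_root_.sub_apply, gradForm_single] using! this

theorem HasGrad.neg {u : E3 → F} {d : Fin 3 → F} {p : E3} (h : HasGrad u d p) :
    HasGrad (fun q => -u q) (fun i => -d i) p := by
  have := HasFDerivAt.neg h
  rw [clm_eq_gradForm (-gradForm d)] at this
  simpa only [_root_.neg_apply, gradForm_single] using! this

theorem HasGrad.differentiableAt {u : E3 → F} {d : Fin 3 → F} {p : E3} (h : HasGrad u d p) :
    DifferentiableAt ℝ u p := HasFDerivAt.differentiableAt h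

theorem HasGrad.sum {ι : Type*} (S : Finset ι) {u : ι → E3 → F} {d : ι → Fin 3 → F} {p : E3}
    (h : ∀ k ∈ S, HasGrad (u k) (d k) p) :
    HasGrad (fun q => ∑ k ∈ S, u k q) (fun i => ∑ k ∈ S, d k i) p := by
  have := HasFDerivAt.fun_sum h
  rw [clm_eq_gradForm (∑ i ∈ S, gradForm (d i))] at this
  simpa only [_root_.sum_apply, gradForm_single] using! this
end

section
variable {𝔸 : Type*} [NormedField 𝔸] [NormedAlgebra ℝ 𝔸]

theorem HasGrad.mul {u v : E3 → 𝔸} {d d' : Fin 3 → 𝔸} {p : E3} (h : HasGrad u d p)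
    (h' : HasGrad v d' p) :
    HasGrad (fun q => u q * v q) (fun i => d i * v p + u p * d' i) p := by
  have := HasFDerivAt.mul h h'
  rw [clm_eq_gradForm (u p • gradForm d' + v p • gradForm d)] at this
  refine HasGrad.of_eq this fun i => ?_
  simp only [_root_.add_apply, _root_.smul_apply, gradForm_single,
    smul_eq_mul]
  ring

theorem HasGrad.inv {u : E3 → 𝔸} {d : Fin 3 → 𝔸} {p : E3} (h : HasGrad u d p) (h0 : u p ≠ 0) :
    HasGrad (fun q => (u q)⁻¹) (fun i => -d i / u p ^ 2) p := by
  have := (hasFDerivAt_inv' (𝕜 := ℝ) h0).comp p h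
  rw [clm_eq_gradForm (_ ∘SL gradForm d)] at this
  refine HasGrad.of_eq this fun i => ?_
  simp only [ContinuousLinearMap.comp_apply, gradForm_single]
  simp
  field_simp

theorem HasGrad.div {u v : E3 → 𝔸} {d d' : Fin 3 → 𝔸} {p : E3} (h : HasGrad u d p)
    (h' : HasGrad v d' p) (h0 : v p ≠ 0) :
    HasGrad (fun q => u q / v q) (fun i => (d i * v p - u p * d' i) / v p ^ 2) p := by
  have := h.mul (h'.inv h0)
  simp only [← div_eq_mul_inv] at this
  refine this.of_eq fun i => ?_
  field_simp
  ring
end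

theorem HasGrad.exp {u : E3 → ℝ} {d : Fin 3 → ℝ} {p : E3} (h : HasGrad u d p) :
    HasGrad (fun q => Real.exp (u q)) (fun i => Real.exp (u p) * d i) p := by
  have := HasFDerivAt.exp h
  rw [clm_eq_gradForm (_ • gradForm d)] at this
  refine HasGrad.of_eq this fun i => ?_
  simp [gradForm_single]

theorem HasGrad.log {u : E3 → ℝ} {d : Fin 3 → ℝ} {p : E3} (h : HasGrad u d p) (h0 : u p ≠ 0) :
    HasGrad (fun q => Real.log (u q)) (fun i => d i / u p) p := by
  have := HasFDerivAt.log h h0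
  rw [clm_eq_gradForm (_ • gradForm d)] at this
  refine HasGrad.of_eq this fun i => ?_
  simp [gradForm_single]
  ring

theorem hasGrad_coord (k : Fin 3) (p : E3) :
    HasGrad (fun q => q k) (fun i => if i = k then 1 else 0) p := by
  have := (EuclideanSpace.proj k : E3 →L[ℝ] ℝ).hasFDerivAt (x := p)
  refine HasGrad.of_eq (this.congr_fderiv (clm_eq_gradForm _)) fun i => ?_
  simp [eq_comm]

/-- The vector field `x̃ ∂_ỹ - ỹ ∂_x̃`. -/
def rot (p : E3) : Fin 3 → ℝ := ![-p 1, p 0, 0]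
/-- The vector field `x̃ ∂_x̃ + ỹ ∂_ỹ`. -/
def rad (p : E3) : Fin 3 → ℝ := ![p 0, p 1, 0]
/-- The vector `∂_z̃`. -/
def axisVec : Fin 3 → ℝ := ![0, 0, 1]
/-- The derivative of `rot`. -/
def rotD (i j : Fin 3) : ℝ := (![![0, 1, 0], ![-1, 0, 0], ![0, 0, 0]] : Fin 3 → Fin 3 → ℝ) i j
/-- The derivative of `rad`. -/
def radD (i j : Fin 3) : ℝ := (![![1, 0, 0], ![0, 1, 0], ![0, 0, 0]] : Fin 3 → Fin 3 → ℝ) i j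
/-- The function `x̃² + ỹ²`. -/
def rhoSq (p : E3) : ℝ := p 0 ^ 2 + p 1 ^ 2
/-- The Kronecker symbol. -/
def kron (i j : Fin 3) : ℝ := if i = j then 1 else 0

theorem hasGrad_rot (k : Fin 3) (p : E3) : HasGrad (fun q => rot q k) (fun i => rotD i k) p := by
  fin_cases k
  · refine (hasGrad_coord 1 p).neg.of_eq fun i => ?_
    fin_cases i <;> simp [rotD]
  · refine (hasGrad_coord 0 p).of_eq fun i => ?_
    fin_cases i <;> simp [rotD]
  · refine (hasGrad_const 0 p).of_eq fun i => ?_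
    fin_cases i <;> simp [rotD]

theorem hasGrad_rad (k : Fin 3) (p : E3) : HasGrad (fun q => rad q k) (fun i => radD i k) p := by
  fin_cases k
  · refine (hasGrad_coord 0 p).of_eq fun i => ?_
    fin_cases i <;> simp [radD]
  · refine (hasGrad_coord 1 p).of_eq fun i => ?_
    fin_cases i <;> simp [radD]
  · refine (hasGrad_const 0 p).of_eq fun i => ?_
    fin_cases i <;> simp [radD]

theorem hasGrad_rhoSq (p : E3) : HasGrad rhoSq (fun i => 2 * rad p i) p := by
  have := ((hasGrad_coord 0 p).mul (hasGrad_coord 0 p)).add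
    ((hasGrad_coord 1 p).mul (hasGrad_coord 1 p))
  refine (this.congr (Filter.Eventually.of_forall fun q => ?_)).of_eq fun i => ?_
  · simp only [rhoSq]; ring
  · fin_cases i <;> simp [rad] <;> ring

/-! ### Ricci curvature of conformally rescaled axisymmetric metrics -/

/-- Partial derivatives of an axisymmetric function whose derivatives with respect to `ρ̃²` and
`z̃` are `us` and `uz`. -/
def axiGrad {𝔸 : Type*} [NormedField 𝔸] [NormedAlgebra ℝ 𝔸] (us uz : 𝔸) (p : E3) (i : Fin 3) : 𝔸 :=
  (2 * rad p i) • us + axisVec i • uz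

/-- The metric `e^{2μ} (δ_{ij} + (D - 1) v_i v_j / ρ̃²)` with `D = e^{-2β}`, `v = rot`. -/
def axiMetric (μ β : E3 → ℝ) : MetricField := fun p =>
  Matrix.of fun i j => Real.exp (2 * μ p) *
    (kron i j + (Real.exp (-2 * β p) - 1) / rhoSq p * (rot p i * rot p j))

/-- Christoffel symbols of `axiMetric`. -/
def axiChristoffel (D s : ℝ) (v e μ β : Fin 3 → ℝ) (k i j : Fin 3) : ℝ :=
  -(β i * v j + β j * v i) * v k / s - (D - 1) * (e i * v j + e j * v i) * v k / s ^ 2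
    + (β k * D / s + (D - 1) * e k / s ^ 2) * (v i * v j)
    + (D - 1) / s * (rotD i k * v j + rotD j k * v i)
    + kron k i * μ j + kron k j * μ i - (kron i j + (D - 1) / s * (v i * v j)) * μ k

/-- The metric is conformal to the identity plus a rank-one term in `rot`, and `rot` has squared
length ρ̃², so this is the Sherman–Morrison formula. -/
theorem axiMetric_inv (μ β : E3 → ℝ) {p : E3} (hp : rhoSq p ≠ 0) :
    (axiMetric μ β p)⁻¹ = Matrix.of fun i j => (Real.exp (2 * μ p))⁻¹ *
    (kron i j - (Real.exp (-2 * β p) - 1) / (rhoSq p * Real.exp (-2 * β p)) *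
      (rot p i * rot p j)) := by
  apply Matrix.inv_eq_right_inv
  have h1 := (Real.exp_pos (2 * μ p)).ne'
  have h2 := (Real.exp_pos (-2 * β p)).ne'
  ext i j
  simp only [Matrix.mul_apply, Fin.sum_univ_three, axiMetric, Matrix.of_apply]
  generalize Real.exp (2 * μ p) = A at *
  generalize Real.exp (-2 * β p) = D at *
  have hs : rhoSq p = p 0 ^ 2 + p 1 ^ 2 := rfl
  generalize rhoSq p = s at *
  fin_cases i <;> fin_cases j <;> simp [kron, rot] <;> field_simp <;> rw [hs] <;> ring

theorem hasGrad_axiMetric {μ β : E3 → ℝ} {dm db : Fin 3 → ℝ} {p : E3} (hp : rhoSq p ≠ 0)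
    (hm : HasGrad μ dm p) (hb : HasGrad β db p) (i j : Fin 3) :
    HasGrad (fun q => axiMetric μ β q i j) (fun m => Real.exp (2 * μ p) *
      (2 * dm m * (kron i j + (Real.exp (-2 * β p) - 1) / rhoSq p * (rot p i * rot p j)) +
        ((-2 * db m * Real.exp (-2 * β p)) / rhoSq p -
          2 * (Real.exp (-2 * β p) - 1) * rad p m / rhoSq p ^ 2) * (rot p i * rot p j) +
        (Real.exp (-2 * β p) - 1) / rhoSq p * (rotD m i * rot p j + rot p i * rotD m j))) p := by
  have h1 := ((hasGrad_const (2 : ℝ) p).mul hm).exp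
  have h2 := ((hasGrad_const (-2 : ℝ) p).mul hb).exp
  have h3 := (h2.sub (hasGrad_const 1 p)).div (hasGrad_rhoSq p) hp
  have h4 := (hasGrad_rot i p).mul (hasGrad_rot j p)
  refine (h1.mul ((hasGrad_const (kron i j) p).add (h3.mul h4))).of_eq fun m => ?_
  field_simp
  ring

theorem christoffel_axiMetric {g : MetricField} {μ β : E3 → ℝ} {ms mz bs bz : ℝ} {p : E3}
    (hp : rhoSq p ≠ 0) (hg : g =ᶠ[𝓝 p] axiMetric μ β)
    (hm : HasGrad μ (axiGrad ms mz p) p) (hb : HasGrad β (axiGrad bs bz p) p) (k i j : Fin 3) :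
    christoffel g k i j p = axiChristoffel (Real.exp (-2 * β p)) (rhoSq p) (rot p) (rad p)
      (axiGrad ms mz p) (axiGrad bs bz p) k i j := by
  have h : ∀ a b m, pd m (fun q => g q a b) p = pd m (fun q => axiMetric μ β q a b) p := by
    intro a b m
    simp only [pd]
    rw [Filter.EventuallyEq.fderiv_eq]
    filter_upwards [hg] with q hq
    rw [hq]
  have hA := (Real.exp_pos (2 * μ p)).ne'
  have hD := (Real.exp_pos (-2 * β p)).ne'
  simp only [christoffel, h, (hasGrad_axiMetric hp hm hb _ _).pd_eq, hg.eq_of_nhds,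
    axiMetric_inv μ β hp, Fin.sum_univ_three, Matrix.of_apply]
  generalize Real.exp (2 * μ p) = A at *
  generalize Real.exp (-2 * β p) = D at *
  -- ρ̃² stays an opaque nonzero symbol while denominators are cleared, and is expanded only for the
  -- final polynomial identity.
  have hs : rhoSq p = p 0 ^ 2 + p 1 ^ 2 := rfl
  generalize rhoSq p = s at *
  clear h hg hm hb
  fin_cases k <;> fin_cases i <;> fin_cases j <;>
    simp [kron, rot, rotD, rad, axiGrad, axisVec, axiChristoffel] <;> field_simp <;>
    (try simp only [hs]) <;> ring

/-- The second derivatives of an axisymmetric function. -/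
def axiHess {𝔸 : Type*} [NormedField 𝔸] [NormedAlgebra ℝ 𝔸] (us uss usz uzz : 𝔸) (p : E3)
    (m i : Fin 3) : 𝔸 :=
  (2 * radD m i) • us + (2 * rad p i) • axiGrad uss usz p m + axisVec i • axiGrad usz uzz p m

theorem hasGrad_axiGrad {us uz : E3 → ℝ} {uss usz uzz : ℝ} {p : E3}
    (hs : HasGrad us (axiGrad uss usz p) p) (hz : HasGrad uz (axiGrad usz uzz p) p) (i : Fin 3) :
    HasGrad (fun q => axiGrad (us q) (uz q) q i)
      (fun m => axiHess (us p) uss usz uzz p m i) p := by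
  refine ((((hasGrad_const (2 : ℝ) p).mul (hasGrad_rad i p)).mul hs).add
    ((hasGrad_const (axisVec i) p).mul hz)).of_eq fun m => ?_
  simp [axiHess]

/-- The partial derivatives of `axiChristoffel`. -/
def axiChristoffelD (D s : ℝ) (v e μ β : Fin 3 → ℝ) (dμ dβ : Fin 3 → Fin 3 → ℝ)
    (k i j m : Fin 3) : ℝ :=
  -(dβ m i * v j + β i * rotD m j + dβ m j * v i + β j * rotD m i) * v k / s
    - (β i * v j + β j * v i) * rotD m k / s
    + (β i * v j + β j * v i) * v k * (2 * e m) / s ^ 2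
    + 2 * β m * D * (e i * v j + e j * v i) * v k / s ^ 2
    - (D - 1) * (radD m i * v j + e i * rotD m j + radD m j * v i + e j * rotD m i) * v k / s ^ 2
    - (D - 1) * (e i * v j + e j * v i) * rotD m k / s ^ 2
    + (D - 1) * (e i * v j + e j * v i) * v k * (4 * e m) / s ^ 3
    + (dβ m k * D / s - 2 * β k * β m * D / s - β k * D * (2 * e m) / s ^ 2
      - 2 * β m * D * e k / s ^ 2 + (D - 1) * radD m k / s ^ 2
      - (D - 1) * e k * (4 * e m) / s ^ 3) * (v i * v j)
    + (β k * D / s + (D - 1) * e k / s ^ 2) * (rotD m i * v j + v i * rotD m j)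
    + (-2 * β m * D / s - (D - 1) * (2 * e m) / s ^ 2) * (rotD i k * v j + rotD j k * v i)
    + (D - 1) / s * (rotD i k * rotD m j + rotD j k * rotD m i)
    + kron k i * dμ m j + kron k j * dμ m i
    - (kron i j + (D - 1) / s * (v i * v j)) * dμ m k
    - ((-2 * β m * D / s - (D - 1) * (2 * e m) / s ^ 2) * (v i * v j)
      + (D - 1) / s * (rotD m i * v j + v i * rotD m j)) * μ k

theorem hasGrad_axiChristoffel {β bs bz ms mz : E3 → ℝ}
    {mss msz mzz bss bsz bzz : ℝ} {p : E3} (hp : rhoSq p ≠ 0)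
    (hms : HasGrad ms (axiGrad mss msz p) p) (hmz : HasGrad mz (axiGrad msz mzz p) p)
    (hb : HasGrad β (axiGrad (bs p) (bz p) p) p)
    (hbs : HasGrad bs (axiGrad bss bsz p) p) (hbz : HasGrad bz (axiGrad bsz bzz p) p)
    (k i j : Fin 3) :
    HasGrad (fun q => axiChristoffel (Real.exp (-2 * β q)) (rhoSq q) (rot q) (rad q)
      (axiGrad (ms q) (mz q) q) (axiGrad (bs q) (bz q) q) k i j)
      (axiChristoffelD (Real.exp (-2 * β p)) (rhoSq p) (rot p) (rad p)
      (axiGrad (ms p) (mz p) p) (axiGrad (bs p) (bz p) p) (axiHess (ms p) mss msz mzz p)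
      (axiHess (bs p) bss bsz bzz p) k i j) p := by
  have hD := ((hasGrad_const (-2 : ℝ) p).mul hb).exp
  have hD1 := hD.sub (hasGrad_const 1 p)
  have hs := hasGrad_rhoSq p
  have hs2 := (hasGrad_rhoSq p).mul (hasGrad_rhoSq p)
  have hp2 : rhoSq p * rhoSq p ≠ 0 := mul_ne_zero hp hp
  have v := fun i => hasGrad_rot i p
  have e := fun i => hasGrad_rad i p
  have B := fun i => hasGrad_axiGrad hbs hbz i
  have M := fun i => hasGrad_axiGrad hms hmz i
  have c := fun x : ℝ => hasGrad_const x p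
  have T1 := ((((B i).mul (v j)).add ((B j).mul (v i))).mul (v k)).div hs hp
  have T2 := ((hD1.mul (((e i).mul (v j)).add ((e j).mul (v i)))).mul (v k)).div hs2 hp2
  have T3 := ((((B k).mul hD).div hs hp).add ((hD1.mul (e k)).div hs2 hp2)).mul ((v i).mul (v j))
  have T4 := (hD1.div hs hp).mul (((c (rotD i k)).mul (v j)).add ((c (rotD j k)).mul (v i)))
  have T5 := ((c (kron k i)).mul (M j)).add ((c (kron k j)).mul (M i))
  have T6 := ((c (kron i j)).add ((hD1.div hs hp).mul ((v i).mul (v j)))).mul (M k)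
  refine ((((((T1.neg).sub T2).add T3).add T4).add T5).sub T6).congr
    (Filter.Eventually.of_forall fun q => ?_) |>.of_eq fun m => ?_
  · simp only [axiChristoffel]; ring
  · simp only [axiChristoffelD]
    field_simp
    ring

/-- The components of the Ricci tensor of `axiMetric μ β`, in terms of the derivatives of `μ`
and `β` with respect to `ρ̃²` and `z̃`. -/
def axiRicci (D ms mz mss msz mzz bs bz bss bsz bzz : ℝ) (p : E3) (i j : Fin 3) : ℝ :=
  let s := rhoSq p
  let Z := 4 * ms + 4 * s * mss + mzz - 4 * s * bs * ms - bz * mz + 4 * s * ms ^ 2 + mz ^ 2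
  let Prr := 6 * bs - 4 * s * bs ^ 2 + 4 * s * bss - (2 * ms + 4 * s * mss) + 4 * s * ms ^ 2 - Z
  let Prz := bz / s - 2 * bs * bz + 2 * bsz - 2 * msz + 2 * ms * mz
  let Pzz := bzz - bz ^ 2 - mzz + mz ^ 2 - Z
  let Φ := 6 * bs - 4 * s * bs ^ 2 + 4 * s * bss - bz ^ 2 + bzz -
    (2 * ms - 4 * s * bs * ms - bz * mz) - Z
  Prr * (rad p i * rad p j) / s + Prz * (rad p i * axisVec j + axisVec i * rad p j)
    + Pzz * (axisVec i * axisVec j) + Φ * D * (rot p i * rot p j) / s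

-- The Christoffel symbols are known on a neighbourhood of `p`, not only at `p`, so they may be
-- differentiated; each component is then a rational identity in the coordinates and the jets. One
-- formula serves both the Weyl metric and the rescaled metric, which differ only in `μ`.
set_option maxHeartbeats 4000000 in
theorem ricci_axiMetric {g : MetricField} {μ β bs bz ms mz : E3 → ℝ}
    {mss msz mzz bss bsz bzz : ℝ} {p : E3} (hp : rhoSq p ≠ 0) (hg : g =ᶠ[𝓝 p] axiMetric μ β)
    (hm : ∀ᶠ q in 𝓝 p, HasGrad μ (axiGrad (ms q) (mz q) q) q)
    (hb : ∀ᶠ q in 𝓝 p, HasGrad β (axiGrad (bs q) (bz q) q) q)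
    (hms : HasGrad ms (axiGrad mss msz p) p) (hmz : HasGrad mz (axiGrad msz mzz p) p)
    (hbs : HasGrad bs (axiGrad bss bsz p) p) (hbz : HasGrad bz (axiGrad bsz bzz p) p)
    (i j : Fin 3) :
    ricci g i j p = axiRicci (Real.exp (-2 * β p)) (ms p) (mz p) mss msz mzz
      (bs p) (bz p) bss bsz bzz p i j := by
  have hs0 : ∀ᶠ q in 𝓝 p, rhoSq q ≠ 0 :=
    (hasGrad_rhoSq p).differentiableAt.continuousAt.eventually_ne hp
  have hc : ∀ k i j, christoffel g k i j =ᶠ[𝓝 p] fun q =>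
      axiChristoffel (Real.exp (-2 * β q)) (rhoSq q) (rot q) (rad q)
      (axiGrad (ms q) (mz q) q) (axiGrad (bs q) (bz q) q) k i j := by
    intro k i j
    filter_upwards [hs0, hm, hb, hg.eventually_nhds] with q h1 h2 h3 h4
    exact christoffel_axiMetric h1 h4 h2 h3 k i j
  have hd : ∀ k i j m, pd m (christoffel g k i j) p = _ := fun k i j m =>
    ((hasGrad_axiChristoffel hp hms hmz hb.self_of_nhds hbs hbz k i j).congr (hc k i j)).pd_eq m
  simp only [ricci, hd, (hc _ _ _).eq_of_nhds, Fin.sum_univ_three]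
  have hD := (Real.exp_pos (-2 * β p)).ne'
  generalize Real.exp (-2 * β p) = D at *
  have hs : rhoSq p = p 0 ^ 2 + p 1 ^ 2 := rfl
  generalize bs p = bs at *
  generalize bz p = bz at *
  generalize ms p = ms at *
  generalize mz p = mz at *
  clear hd hc hs0 hm hb hg hms hmz hbs hbz
  simp only [axiRicci]
  generalize rhoSq p = s at *
  fin_cases i <;> fin_cases j <;>
    simp [kron, rot, rotD, rad, radD, axiGrad, axiHess, axisVec, axiChristoffel,
      axiChristoffelD] <;> field_simp <;> (try simp only [hs]) <;> ring

/-! ### The Weyl metric -/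

theorem angularForm_apply (p : E3) (i j : Fin 3) :
    angularForm p i j = rot p i * rot p j / rhoSq p := rfl

theorem norm_sq_eq (p : E3) : ‖p‖ ^ 2 = rhoSq p + p 2 ^ 2 := by
  rw [EuclideanSpace.norm_sq_eq, Fin.sum_univ_three]
  simp [rhoSq]

theorem norm_sq_pos_of_rhoSq_ne_zero {p : E3} (hp : rhoSq p ≠ 0) : 0 < rhoSq p + p 2 ^ 2 := by
  have : 0 ≤ rhoSq p := by unfold rhoSq; positivity
  have : 0 < rhoSq p := lt_of_le_of_ne this (Ne.symm hp)
  positivity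

theorem tildeMetric_eq_axiMetric (β κ : E3 → ℝ) : tildeMetric β κ = axiMetric κ β := by
  ext p i j
  simp only [tildeMetric, hatMetric, axiMetric, Matrix.smul_apply, Matrix.add_apply,
    Matrix.sub_apply, angularForm_apply, Matrix.of_apply, smul_eq_mul, Matrix.one_apply, kron]
  ring

theorem weylMetric_eq_axiMetric (β : E3 → ℝ) {p : E3} (hp : rhoSq p ≠ 0) :
    weylMetric β p = axiMetric (fun q => β q - Real.log (rhoSq q + q 2 ^ 2)) β p := by
  have h0 := norm_sq_pos_of_rhoSq_ne_zero hp
  have h1 : Real.exp (2 * (β p - Real.log (rhoSq p + p 2 ^ 2))) =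
      Real.exp (2 * β p) / (rhoSq p + p 2 ^ 2) ^ 2 := by
    rw [mul_sub, Real.exp_sub, two_mul (Real.log _), Real.exp_add, Real.exp_log h0, ← sq]
  have h2 : ‖p‖ ^ 4 = (rhoSq p + p 2 ^ 2) ^ 2 := by rw [← norm_sq_eq]; ring
  have h3 : Real.exp (-2 * β p) = (Real.exp (2 * β p))⁻¹ := by rw [← Real.exp_neg]; ring_nf
  ext i j
  simp only [weylMetric, axiMetric, Matrix.smul_apply, Matrix.add_apply,
    Matrix.sub_apply, angularForm_apply, Matrix.of_apply, smul_eq_mul, Matrix.one_apply, kron,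
    h1, h2, h3]
  have := (Real.exp_pos (2 * β p)).ne'
  field_simp
  ring

theorem HasGrad.ofReal {u : E3 → ℝ} {d : Fin 3 → ℝ} {p : E3} (h : HasGrad u d p) :
    HasGrad (fun q => (u q : ℂ)) (fun i => (d i : ℂ)) p := by
  have := (Complex.ofRealCLM.hasFDerivAt (x := u p)).comp p h
  refine HasGrad.of_eq (this.congr_fderiv (clm_eq_gradForm _)) fun i => ?_
  simp [gradForm_single]

theorem HasGrad.conj {u : E3 → ℂ} {d : Fin 3 → ℂ} {p : E3} (h : HasGrad u d p) :
    HasGrad (fun q => conj (u q)) (fun i => conj (d i)) p := by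
  have := ((Complex.conjCLE : ℂ →L[ℝ] ℂ).hasFDerivAt (x := u p)).comp p h
  refine HasGrad.of_eq (this.congr_fderiv (clm_eq_gradForm _)) fun i => ?_
  simp [gradForm_single]

theorem hasGrad_axiGrad_complex {us uz : E3 → ℂ} {uss usz uzz : ℂ} {p : E3}
    (hs : HasGrad us (axiGrad uss usz p) p) (hz : HasGrad uz (axiGrad usz uzz p) p) (i : Fin 3) :
    HasGrad (fun q => axiGrad (us q) (uz q) q i)
      (fun m => axiHess (us p) uss usz uzz p m i) p := by
  refine (((((hasGrad_const (2 : ℝ) p).mul (hasGrad_rad i p)).ofReal.mul hs).add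
    ((hasGrad_const (axisVec i : ℂ) p).mul hz)).congr
      (Filter.Eventually.of_forall fun q => ?_)).of_eq fun m => ?_
  · simp [axiGrad]
  · simp [axiHess]

/-- Apart from the overall conformal factor, which also multiplies `gradProd`, only the difference
of the derivatives of `μ` and `β` enters. For the Weyl metric this difference comes from −log r², so
`β` disappears from the Ernst equation. -/
theorem laplacian_axiMetric {g : MetricField} {μ β : E3 → ℝ} {ms mz bs bz : ℝ} {u us uz : E3 → ℂ}
    {uss usz uzz : ℂ} {p : E3} (hp : rhoSq p ≠ 0) (hg : g =ᶠ[𝓝 p] axiMetric μ β)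
    (hm : HasGrad μ (axiGrad ms mz p) p) (hb : HasGrad β (axiGrad bs bz p) p)
    (hu : ∀ᶠ q in 𝓝 p, HasGrad u (axiGrad (us q) (uz q) q) q)
    (hus : HasGrad us (axiGrad uss usz p) p) (huz : HasGrad uz (axiGrad usz uzz p) p) :
    laplacian g u p = (Real.exp (2 * μ p) : ℂ)⁻¹ * (4 * us p + 4 * rhoSq p * uss + uzz
      + 4 * rhoSq p * (ms - bs) * us p + (mz - bz) * uz p) := by
  have h1 : ∀ i j, pd i (pd j u) p = axiHess (us p) uss usz uzz p i j := fun i j =>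
    ((hasGrad_axiGrad_complex hus huz j).congr (hu.mono fun q hq => hq.pd_eq j)).pd_eq i
  simp only [laplacian, h1, hu.self_of_nhds.pd_eq, hg.eq_of_nhds, axiMetric_inv μ β hp,
    christoffel_axiMetric hp hg hm hb, Fin.sum_univ_three, Matrix.of_apply]
  have hA : ((Real.exp (2 * μ p) : ℝ) : ℂ) ≠ 0 := by exact_mod_cast (Real.exp_pos _).ne'
  have hD : ((Real.exp (-2 * β p) : ℝ) : ℂ) ≠ 0 := by exact_mod_cast (Real.exp_pos _).ne'
  have hp' : ((rhoSq p : ℝ) : ℂ) ≠ 0 := by exact_mod_cast hp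
  generalize Real.exp (2 * μ p) = A at *
  generalize Real.exp (-2 * β p) = D at *
  have hs : ((rhoSq p : ℝ) : ℂ) = p 0 ^ 2 + p 1 ^ 2 := by simp [rhoSq]
  generalize us p = us at *
  generalize uz p = uz at *
  clear h1 hg hm hb hu hus huz
  simp [kron, rot, rotD, rad, radD, axiGrad, axiHess, axisVec, axiChristoffel]
  generalize (rhoSq p : ℂ) = s at *
  field_simp
  simp only [hs]
  ring

theorem gradProd_axiMetric {g : MetricField} {μ β : E3 → ℝ} {u v : E3 → ℂ} {us uz vs vz : ℂ}
    {p : E3} (hp : rhoSq p ≠ 0) (hg : g p = axiMetric μ β p)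
    (hu : HasGrad u (axiGrad us uz p) p) (hv : HasGrad v (axiGrad vs vz p) p) :
    gradProd g u v p =
      (Real.exp (2 * μ p) : ℂ)⁻¹ * (4 * rhoSq p * us * vs + uz * vz) := by
  simp only [gradProd, hu.pd_eq, hv.pd_eq, hg, axiMetric_inv μ β hp, Fin.sum_univ_three,
    Matrix.of_apply]
  have hA : ((Real.exp (2 * μ p) : ℝ) : ℂ) ≠ 0 := by exact_mod_cast (Real.exp_pos _).ne'
  have hD : ((Real.exp (-2 * β p) : ℝ) : ℂ) ≠ 0 := by exact_mod_cast (Real.exp_pos _).ne'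
  have hp' : ((rhoSq p : ℝ) : ℂ) ≠ 0 := by exact_mod_cast hp
  generalize Real.exp (2 * μ p) = A at *
  generalize Real.exp (-2 * β p) = D at *
  have hs : ((rhoSq p : ℝ) : ℂ) = p 0 ^ 2 + p 1 ^ 2 := by simp [rhoSq]
  simp [kron, rot, rad, axiGrad, axisVec]
  generalize (rhoSq p : ℂ) = s at *
  field_simp
  simp only [hs]
  ring

theorem hasGrad_normSq (p : E3) :
    HasGrad (fun q : E3 => rhoSq q + q 2 ^ 2) (axiGrad 1 (2 * p 2) p) p := by
  have := (hasGrad_rhoSq p).add ((hasGrad_coord 2 p).mul (hasGrad_coord 2 p))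
  refine (this.congr (Filter.Eventually.of_forall fun q => ?_)).of_eq fun i => ?_
  · simp only; ring
  · fin_cases i <;> simp [axiGrad, axisVec, rad]; ring

theorem hasGrad_norm {p : E3} (hp : p ≠ 0) :
    HasGrad (fun q : E3 => ‖q‖) (axiGrad (1 / (2 * ‖p‖)) (p 2 / ‖p‖) p) p := by
  have h1 : ‖p‖ ≠ 0 := norm_ne_zero_iff.mpr hp
  have h2 : DifferentiableAt ℝ (fun q : E3 => ‖q‖) p := differentiableAt_id.norm ℝ hp
  have h3 := hasGrad_of_differentiableAt h2
  have h4 := (h3.mul h3).congr (v := fun q : E3 => rhoSq q + q 2 ^ 2)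
    (Filter.Eventually.of_forall fun q => by simp only [← norm_sq_eq]; ring)
  refine h3.of_eq fun i => ?_
  have h5 := (h4.pd_eq i).symm.trans ((hasGrad_normSq p).pd_eq i)
  simp only [axiGrad, smul_eq_mul] at h5 ⊢
  field_simp
  linear_combination (1 / 2) * h5

/-- The Ernst equation for `φ = r f`, in terms of derivatives with respect to `s = ρ̃²` and
`z = z̃`, with `q = s + z²`. Here `g` is the conjugate of `f`. -/
def ErnstJet (s z f g fs fz fss fzz : ℂ) : Prop :=
  ((s + z ^ 2) * f * g - 1) * (4 * fs + 4 * s * fss + fzz) =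
    2 * g * (f ^ 2 + 2 * f * (2 * s * fs + z * fz) + (s + z ^ 2) * (4 * s * fs ^ 2 + fz ^ 2))

theorem hasGrad_potential {f : E3 → ℂ} {fs fz : ℂ} {p : E3} (hp : p ≠ 0)
    (hf : HasGrad f (axiGrad fs fz p) p) :
    HasGrad (potential f) (axiGrad (‖p‖ * fs + f p / (2 * ‖p‖)) (‖p‖ * fz + f p * p 2 / ‖p‖) p)
      p := by
  have h1 : (‖p‖ : ℂ) ≠ 0 := by exact_mod_cast norm_ne_zero_iff.mpr hp
  refine ((hasGrad_norm hp).ofReal.mul hf).of_eq fun i => ?_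
  simp [axiGrad]
  field_simp
  ring

/-- The factor r of the potential is not analytic at Λ. Once it is pulled out of the gradients and
cancelled, only r² remains, and the equations can later be read as relations between power series.
-/
theorem fieldEquationsAt_iff {β bs bz : E3 → ℝ} {bss bsz bzz : ℝ} {f fs fz : E3 → ℂ}
    {fss fsz fzz : ℂ} {p : E3} (hp : rhoSq p ≠ 0)
    (hb : ∀ᶠ q in 𝓝 p, HasGrad β (axiGrad (bs q) (bz q) q) q)
    (hbs : HasGrad bs (axiGrad bss bsz p) p) (hbz : HasGrad bz (axiGrad bsz bzz p) p)
    (hf : ∀ᶠ q in 𝓝 p, HasGrad f (axiGrad (fs q) (fz q) q) q)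
    (hfs : HasGrad fs (axiGrad fss fsz p) p) (hfz : HasGrad fz (axiGrad fsz fzz p) p)
    (h1 : ((rhoSq p : ℂ) + p 2 ^ 2) * f p * conj (f p) - 1 ≠ 0) :
    FieldEquationsAt (weylMetric β) (potential f) p ↔
      (∀ i j, (axiRicci (Real.exp (-2 * β p)) (bs p - 1 / ‖p‖ ^ 2) (bz p - 2 * p 2 / ‖p‖ ^ 2)
        (bss + 1 / ‖p‖ ^ 4) (bsz + 2 * p 2 / ‖p‖ ^ 4)
        (bzz - 2 / ‖p‖ ^ 2 + 4 * p 2 ^ 2 / ‖p‖ ^ 4) (bs p) (bz p) bss bsz bzz p i j : ℂ) =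
        ‖p‖ ^ 2 / (((rhoSq p : ℂ) + p 2 ^ 2) * f p * conj (f p) - 1) ^ 2 *
        (axiGrad (fs p + f p / (2 * ‖p‖ ^ 2)) (fz p + f p * p 2 / ‖p‖ ^ 2) p i *
          conj (axiGrad (fs p + f p / (2 * ‖p‖ ^ 2)) (fz p + f p * p 2 / ‖p‖ ^ 2) p j) +
          axiGrad (fs p + f p / (2 * ‖p‖ ^ 2)) (fz p + f p * p 2 / ‖p‖ ^ 2) p j *
          conj (axiGrad (fs p + f p / (2 * ‖p‖ ^ 2)) (fz p + f p * p 2 / ‖p‖ ^ 2) p i))) ∧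
      ErnstJet (rhoSq p) (p 2) (f p) (conj (f p)) (fs p) (fz p) fss fzz := by
  have hQ := norm_sq_pos_of_rhoSq_ne_zero hp
  have hp0 : p ≠ 0 := by rintro rfl; simp [rhoSq] at hp
  have hr : (‖p‖ : ℂ) ≠ 0 := by exact_mod_cast norm_ne_zero_iff.mpr hp0
  have hrr : ‖p‖ ≠ 0 := norm_ne_zero_iff.mpr hp0
  have hs0 : ∀ᶠ q in 𝓝 p, rhoSq q ≠ 0 :=
    (hasGrad_rhoSq p).differentiableAt.continuousAt.eventually_ne hp
  have hn0 : ∀ᶠ q in 𝓝 p, q ≠ 0 := continuousAt_id.eventually_ne hp0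
  have hg : weylMetric β =ᶠ[𝓝 p]
      axiMetric (fun q => β q - Real.log (rhoSq q + q 2 ^ 2)) β := by
    filter_upwards [hs0] with q hq using weylMetric_eq_axiMetric β hq
  have hm : ∀ᶠ q in 𝓝 p, HasGrad (fun q => β q - Real.log (rhoSq q + q 2 ^ 2))
      (axiGrad (bs q - 1 / (rhoSq q + q 2 ^ 2)) (bz q - 2 * q 2 / (rhoSq q + q 2 ^ 2)) q) q := by
    filter_upwards [hb, hs0] with q hq h2
    have := norm_sq_pos_of_rhoSq_ne_zero h2
    refine (hq.sub ((hasGrad_normSq q).log this.ne')).of_eq fun i => ?_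
    simp only [axiGrad, smul_eq_mul]
    field_simp
    ring
  have hms : HasGrad (fun q => bs q - 1 / (rhoSq q + q 2 ^ 2))
      (axiGrad (bss + 1 / ‖p‖ ^ 4) (bsz + 2 * p 2 / ‖p‖ ^ 4) p) p := by
    refine (hbs.sub ((hasGrad_const 1 p).div (hasGrad_normSq p) hQ.ne')).of_eq fun i => ?_
    rw [show ‖p‖ ^ 4 = (‖p‖ ^ 2) ^ 2 by ring, norm_sq_eq]
    simp only [axiGrad, smul_eq_mul]
    field_simp
    ring
  have hmz : HasGrad (fun q => bz q - 2 * q 2 / (rhoSq q + q 2 ^ 2))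
      (axiGrad (bsz + 2 * p 2 / ‖p‖ ^ 4) (bzz - 2 / ‖p‖ ^ 2 + 4 * p 2 ^ 2 / ‖p‖ ^ 4) p) p := by
    refine (hbz.sub (((hasGrad_const 2 p).mul (hasGrad_coord 2 p)).div
      (hasGrad_normSq p) hQ.ne')).of_eq fun i => ?_
    rw [show ‖p‖ ^ 4 = (‖p‖ ^ 2) ^ 2 by ring, norm_sq_eq]
    fin_cases i <;> simp [axiGrad, axisVec, rad] <;> field_simp <;> ring
  have hu : ∀ᶠ q in 𝓝 p, HasGrad (potential f) (axiGrad (‖q‖ * fs q + f q / (2 * ‖q‖))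
      (‖q‖ * fz q + f q * q 2 / ‖q‖) q) q := by
    filter_upwards [hf, hn0] with q h2 h3 using hasGrad_potential h3 h2
  have hR := (hasGrad_norm hp0).ofReal
  have h2r : ((2 : ℂ) * ‖p‖) ≠ 0 := by simp [hrr]
  have hus : HasGrad (fun q => ‖q‖ * fs q + f q / (2 * ‖q‖) : E3 → ℂ)
      (axiGrad (‖p‖ * fss + fs p / ‖p‖ - f p / (4 * ‖p‖ ^ 3))
        (‖p‖ * fsz + fs p * p 2 / ‖p‖ + fz p / (2 * ‖p‖) - f p * p 2 / (2 * ‖p‖ ^ 3)) p) p := by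
    refine ((hR.mul hfs).add (hf.self_of_nhds.div ((hasGrad_const 2 p).mul hR) h2r)).of_eq
      fun i => ?_
    simp [axiGrad]
    field_simp
    ring
  have huz : HasGrad (fun q => ‖q‖ * fz q + f q * q 2 / ‖q‖ : E3 → ℂ)
      (axiGrad (‖p‖ * fsz + fs p * p 2 / ‖p‖ + fz p / (2 * ‖p‖) - f p * p 2 / (2 * ‖p‖ ^ 3))
        (‖p‖ * fzz + 2 * fz p * p 2 / ‖p‖ + f p / ‖p‖ - f p * p 2 ^ 2 / ‖p‖ ^ 3) p) p := by
    refine ((hR.mul hfz).add ((hf.self_of_nhds.mul (hasGrad_coord 2 p).ofReal).div hR hr)).of_eq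
      fun i => ?_
    fin_cases i <;> simp [axiGrad, axisVec, rad] <;> field_simp <;> ring
  have hqq : (‖p‖ : ℂ) ^ 2 = rhoSq p + p 2 ^ 2 := by exact_mod_cast norm_sq_eq p
  have hqR := norm_sq_eq p
  have hφφ : potential f p * conj (potential f p) =
      ((rhoSq p : ℂ) + p 2 ^ 2) * f p * conj (f p) := by
    rw [← hqq]; simp [potential]; ring
  have hA : ((Real.exp (2 * (β p - Real.log (rhoSq p + p 2 ^ 2))) : ℝ) : ℂ) ≠ 0 := by
    exact_mod_cast (Real.exp_pos _).ne'
  rw [FieldEquationsAt, laplacian_axiMetric hp hg hm.self_of_nhds hb.self_of_nhds hu hus huz,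
    gradProd_axiMetric hp hg.eq_of_nhds hu.self_of_nhds hu.self_of_nhds, hφφ]
  refine and_congr (forall_congr' fun i => forall_congr' fun j => ?_) ?_
  · rw [ricci_axiMetric hp hg hm hb hms hmz hbs hbz, (hu.self_of_nhds).pd_eq,
      (hu.self_of_nhds).pd_eq, hu.self_of_nhds.conj.pd_eq, hu.self_of_nhds.conj.pd_eq, ← hqR]
    have h3 : ∀ i, axiGrad (‖p‖ * fs p + f p / (2 * ‖p‖)) (‖p‖ * fz p + f p * p 2 / ‖p‖) p i =
        ‖p‖ * axiGrad (fs p + f p / (2 * ‖p‖ ^ 2)) (fz p + f p * p 2 / ‖p‖ ^ 2) p i := by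
      intro i
      simp [axiGrad]
      field_simp
    rw [h3, h3]
    simp only [map_mul, Complex.conj_ofReal]
    refine Eq.congr_right ?_
    ring
  · rw [ErnstJet, mul_assoc, mul_left_comm _ (_⁻¹), mul_right_inj' (inv_ne_zero hA)]
    have h4 : (rhoSq p : ℂ) = ‖p‖ ^ 2 - p 2 ^ 2 := by rw [hqq]; ring
    push_cast
    rw [← hqq] at h1 ⊢
    simp only [potential, map_mul, Complex.conj_ofReal, ← Complex.ofReal_pow]
    push_cast
    generalize conj (f p) = g at *
    generalize f p = F at *
    generalize fs p = fs at *
    generalize fz p = fz at *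
    rw [h4]
    rw [div_mul_eq_mul_div, eq_div_iff h1]
    refine (sub_eq_zero.symm.trans ?_).trans sub_eq_zero
    refine Iff.trans (Eq.congr_left ?_) (mul_eq_zero_iff_left hr)
    field_simp
    ring

/-! ### The field equations in terms of jets -/

theorem weylRicci_iff {p : E3} (hp : rhoSq p ≠ 0) {D bs bz bss bsz bzz : ℝ} (K a b : ℂ) :
    (∀ i j, (axiRicci D (bs - 1 / ‖p‖ ^ 2) (bz - 2 * p 2 / ‖p‖ ^ 2)
        (bss + 1 / ‖p‖ ^ 4) (bsz + 2 * p 2 / ‖p‖ ^ 4)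
        (bzz - 2 / ‖p‖ ^ 2 + 4 * p 2 ^ 2 / ‖p‖ ^ 4) bs bz bss bsz bzz p i j : ℂ) =
        K * (axiGrad a b p i * conj (axiGrad a b p j) + axiGrad a b p j * conj (axiGrad a b p i))) ↔
      (-4 * rhoSq p * bss - bzz - 4 * rhoSq p * bs / ‖p‖ ^ 2 + 2 * p 2 * bz / ‖p‖ ^ 2 : ℂ) =
        8 * rhoSq p * K * (a * conj a) ∧
      (bz / rhoSq p - 4 * p 2 * bs / ‖p‖ ^ 2 - 2 * bz / ‖p‖ ^ 2 : ℂ) =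
        2 * K * (a * conj b + b * conj a) ∧
      (-4 * bs - 4 * rhoSq p * bss - bzz + 4 * rhoSq p * bs / ‖p‖ ^ 2 - 2 * p 2 * bz / ‖p‖ ^ 2 : ℂ)
        = 2 * K * (b * conj b) := by
  have hQ := norm_sq_pos_of_rhoSq_ne_zero hp
  rw [show ‖p‖ ^ 4 = (‖p‖ ^ 2) ^ 2 by ring,
    show (‖p‖ : ℂ) ^ 2 = ((‖p‖ ^ 2 : ℝ) : ℂ) by push_cast; rfl, norm_sq_eq]
  -- For the Weyl conformal factor the component along the orbits cancels identically, so only the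
  -- three components in the meridian plane remain.
  have key : ∀ i j, axiRicci D (bs - 1 / (rhoSq p + p 2 ^ 2)) (bz - 2 * p 2 / (rhoSq p + p 2 ^ 2))
      (bss + 1 / (rhoSq p + p 2 ^ 2) ^ 2) (bsz + 2 * p 2 / (rhoSq p + p 2 ^ 2) ^ 2)
      (bzz - 2 / (rhoSq p + p 2 ^ 2) + 4 * p 2 ^ 2 / (rhoSq p + p 2 ^ 2) ^ 2)
      bs bz bss bsz bzz p i j =
      (-4 * rhoSq p * bss - bzz - 4 * rhoSq p * bs / (rhoSq p + p 2 ^ 2)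
        + 2 * p 2 * bz / (rhoSq p + p 2 ^ 2)) * (rad p i * rad p j) / rhoSq p
      + (bz / rhoSq p - 4 * p 2 * bs / (rhoSq p + p 2 ^ 2) - 2 * bz / (rhoSq p + p 2 ^ 2)) *
        (rad p i * axisVec j + axisVec i * rad p j)
      + (-4 * bs - 4 * rhoSq p * bss - bzz + 4 * rhoSq p * bs / (rhoSq p + p 2 ^ 2)
        - 2 * p 2 * bz / (rhoSq p + p 2 ^ 2)) * (axisVec i * axisVec j) := by
    intro i j
    simp only [axiRicci]
    field_simp
    ring
  simp only [key]
  have hQc : ((rhoSq p : ℂ) + (p 2 : ℂ) ^ 2) ≠ 0 := by exact_mod_cast hQ.ne'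
  have hpc : (rhoSq p : ℂ) ≠ 0 := by exact_mod_cast hp
  have hs : ((rhoSq p : ℝ) : ℂ) = p 0 ^ 2 + p 1 ^ 2 := by simp [rhoSq]
  clear key
  push_cast
  generalize hC1 : (-4 * rhoSq p * bss - bzz - 4 * rhoSq p * bs / (rhoSq p + p 2 ^ 2)
        + 2 * p 2 * bz / (rhoSq p + p 2 ^ 2) : ℂ) = C1
  generalize hC2 : (bz / rhoSq p - 4 * p 2 * bs / (rhoSq p + p 2 ^ 2)
        - 2 * bz / (rhoSq p + p 2 ^ 2) : ℂ) = C2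
  generalize hC3 : (-4 * bs - 4 * rhoSq p * bss - bzz + 4 * rhoSq p * bs / (rhoSq p + p 2 ^ 2)
        - 2 * p 2 * bz / (rhoSq p + p 2 ^ 2) : ℂ) = C3
  clear hC1 hC2 hC3 hQc hQ hp
  have h2c : (starRingEnd ℂ) 2 = 2 := Complex.conj_ofNat 2
  constructor
  · intro h
    -- `rad` has squared length ρ̃², so contracting the component equations with it isolates the
    -- coefficients of the terms that contain it.
    have h00 := h 0 0
    have h01 := h 0 1
    have h11 := h 1 1
    have h02 := h 0 2
    have h12 := h 1 2
    have h22 := h 2 2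
    simp [rad, axisVec, axiGrad, h2c] at h00 h01 h11 h02 h12 h22
    refine ⟨?_, ?_, by linear_combination h22⟩
    · rw [← mul_right_inj' hpc]
      field_simp at h00 h01 h11
      rw [← mul_right_inj' hpc]
      linear_combination (p 0 : ℂ) ^ 2 * h00 + 2 * p 0 * p 1 * h01 + (p 1 : ℂ) ^ 2 * h11 +
        (-C1 + 8 * rhoSq p * K * a * conj a) * (-hs) * (rhoSq p + p 0 ^ 2 + p 1 ^ 2)
    · rw [← mul_right_inj' hpc]
      linear_combination (p 0 : ℂ) * h02 + p 1 * h12 +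
        (C2 - 2 * K * (a * conj b + b * conj a)) * hs
  · rintro ⟨h1, h2, h3⟩ i j
    rw [h1, h2, h3]
    simp [axiGrad, h2c]
    field_simp
    ring

/-- The numerator of `-2 ∂β/∂(ρ̃²)`. -/
def betaNumS {R : Type*} [CommRing R] (s z f g fs gs fz gz : R) : R :=
  (f + 2 * s * fs + z * fz) * (g + 2 * s * gs + z * gz) - s * ((fz - 2 * z * fs) * (gz - 2 * z * gs))

/-- The numerator of `-∂β/∂z̃`, divided by `ρ̃²`. -/
def betaNumZ {R : Type*} [CommRing R] (s z f g fs gs fz gz : R) : R :=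
  (f + 2 * s * fs + z * fz) * (gz - 2 * z * gs) + (fz - 2 * z * fs) * (g + 2 * s * gs + z * gz)

/-- The second derivatives enter the first and the third equation through the same combination. The
difference of these two equations and the second equation therefore form a linear system for the
first derivatives of β, whose determinant is −4/s up to sign. -/
theorem beta_of_ricci {s z q f g fs gs fz gz bs bz bss bzz N : ℂ} (hs : s ≠ 0) (hq : q ≠ 0)
    (hN : N ≠ 0) (hqs : q = s + z ^ 2)
    (h1 : -4 * s * bss - bzz - 4 * s * bs / q + 2 * z * bz / q =
        8 * s * (q / N ^ 2) * ((fs + f / (2 * q)) * (gs + g / (2 * q))))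
    (h2 : bz / s - 4 * z * bs / q - 2 * bz / q =
        2 * (q / N ^ 2) * ((fs + f / (2 * q)) * (gz + g * z / q) +
          (fz + f * z / q) * (gs + g / (2 * q))))
    (h3 : -4 * bs - 4 * s * bss - bzz + 4 * s * bs / q - 2 * z * bz / q =
        2 * (q / N ^ 2) * ((fz + f * z / q) * (gz + g * z / q))) :
    bs = -betaNumS s z f g fs gs fz gz / (2 * N ^ 2) ∧
      bz = -s * betaNumZ s z f g fs gs fz gz / N ^ 2 := by
  have e1 : bs = -(1 / (4 * q)) * ((z ^ 2 - s) * (2 * (q / N ^ 2) *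
      ((fz + f * z / q) * (gz + g * z / q)) -
        8 * s * (q / N ^ 2) * ((fs + f / (2 * q)) * (gs + g / (2 * q)))) +
      4 * s * z * (2 * (q / N ^ 2) * ((fs + f / (2 * q)) * (gz + g * z / q) +
          (fz + f * z / q) * (gs + g / (2 * q))))) := by
    rw [← h1, ← h2, ← h3]
    field_simp
    rw [hqs]
    ring
  have e2 : bz = (1 / q) * (-s * z * (2 * (q / N ^ 2) *
      ((fz + f * z / q) * (gz + g * z / q)) -
        8 * s * (q / N ^ 2) * ((fs + f / (2 * q)) * (gs + g / (2 * q)))) +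
      s * (z ^ 2 - s) * (2 * (q / N ^ 2) * ((fs + f / (2 * q)) * (gz + g * z / q) +
          (fz + f * z / q) * (gs + g / (2 * q))))) := by
    rw [← h1, ← h2, ← h3]
    field_simp
    rw [hqs]
    ring
  constructor
  · rw [e1, betaNumS]
    field_simp
    rw [hqs]
    ring
  · rw [e2, betaNumZ]
    field_simp
    rw [hqs]
    ring

/-- The mixed relation and the difference of the other two involve only first derivatives of β and
follow from the formulas for them. The remaining one contains second derivatives; there the Ernst
equation for f and for its conjugate is used to eliminate `fzz` and `gzz`. -/
theorem ricci_of_beta {s z q f g fs gs fz gz fss gss fsz gsz fzz gzz bs bz bss bzz N : ℂ}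
    (hs : s ≠ 0) (hq : q ≠ 0) (hN : N ≠ 0) (hqs : q = s + z ^ 2) (hNq : N = q * f * g - 1)
    (ef : ErnstJet s z f g fs fz fss fzz) (eg : ErnstJet s z g f gs gz gss gzz)
    (hbs : bs = -betaNumS s z f g fs gs fz gz / (2 * N ^ 2))
    (hbz : bz = -s * betaNumZ s z f g fs gs fz gz / N ^ 2)
    (hbss : bss = -((3 * fs + 2 * s * fss + z * fsz) * (g + 2 * s * gs + z * gz)
        + (f + 2 * s * fs + z * fz) * (3 * gs + 2 * s * gss + z * gsz)
        - (fz - 2 * z * fs) * (gz - 2 * z * gs)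
        - s * ((fsz - 2 * z * fss) * (gz - 2 * z * gs) + (fz - 2 * z * fs) * (gsz - 2 * z * gss)))
        / (2 * N ^ 2) + betaNumS s z f g fs gs fz gz * (f * g + q * (fs * g + f * gs)) / N ^ 3)
    (hbzz : bzz = -s * ((2 * fz + 2 * s * fsz + z * fzz) * (gz - 2 * z * gs)
        + (f + 2 * s * fs + z * fz) * (gzz - 2 * gs - 2 * z * gsz)
        + (fzz - 2 * fs - 2 * z * fsz) * (g + 2 * s * gs + z * gz)
        + (fz - 2 * z * fs) * (2 * gz + 2 * s * gsz + z * gzz)) / N ^ 2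
        + 2 * s * betaNumZ s z f g fs gs fz gz * (2 * z * f * g + q * (fz * g + f * gz)) / N ^ 3) :
    -4 * s * bss - bzz - 4 * s * bs / q + 2 * z * bz / q =
        8 * s * (q / N ^ 2) * ((fs + f / (2 * q)) * (gs + g / (2 * q))) ∧
    bz / s - 4 * z * bs / q - 2 * bz / q =
        2 * (q / N ^ 2) * ((fs + f / (2 * q)) * (gz + g * z / q) +
          (fz + f * z / q) * (gs + g / (2 * q))) ∧
    -4 * bs - 4 * s * bss - bzz + 4 * s * bs / q - 2 * z * bz / q =
        2 * (q / N ^ 2) * ((fz + f * z / q) * (gz + g * z / q)) := by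
  have h2 : bz / s - 4 * z * bs / q - 2 * bz / q =
        2 * (q / N ^ 2) * ((fs + f / (2 * q)) * (gz + g * z / q) +
          (fz + f * z / q) * (gs + g / (2 * q))) := by
    rw [hbs, hbz, betaNumS, betaNumZ]
    field_simp
    rw [hqs]
    ring
  have hd : -4 * bs + 8 * s * bs / q - 4 * z * bz / q = 2 * (q / N ^ 2) *
      ((fz + f * z / q) * (gz + g * z / q)) -
        8 * s * (q / N ^ 2) * ((fs + f / (2 * q)) * (gs + g / (2 * q))) := by
    rw [hbs, hbz, betaNumS, betaNumZ]
    field_simp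
    rw [hqs]
    ring
  have h1 : -4 * s * bss - bzz - 4 * s * bs / q + 2 * z * bz / q =
        8 * s * (q / N ^ 2) * ((fs + f / (2 * q)) * (gs + g / (2 * q))) := by
    rw [ErnstJet, ← hqs, ← hNq] at ef
    rw [ErnstJet, ← hqs, mul_right_comm, ← hNq] at eg
    have ef' : fzz = 2 * g * (f ^ 2 + 2 * f * (2 * s * fs + z * fz) +
        q * (4 * s * fs ^ 2 + fz ^ 2)) / N - 4 * fs - 4 * s * fss := by
      rw [← ef]; field_simp; ring
    have eg' : gzz = 2 * f * (g ^ 2 + 2 * g * (2 * s * gs + z * gz) +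
        q * (4 * s * gs ^ 2 + gz ^ 2)) / N - 4 * gs - 4 * s * gss := by
      rw [← eg]; field_simp; ring
    rw [hbs, hbz, hbss, hbzz, ef', eg', betaNumS, betaNumZ]
    clear hbs hbz hbss hbzz ef' eg' ef eg hd h2
    field_simp
    rw [hNq, hqs]
    ring
  exact ⟨h1, h2, by linear_combination h1 + hd⟩

/-- The integrability condition for β: the left side is the z̃-derivative of the formula for
∂β/∂ρ̃², the right side the ρ̃²-derivative of the formula for ∂β/∂z̃. They agree once the second
z̃-derivatives of f and of its conjugate are replaced by means of the Ernst equation. -/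
theorem beta_closed {s z q f g fs gs fz gz fss gss fsz gsz fzz gzz N : ℂ}
    (hN : N ≠ 0) (hqs : q = s + z ^ 2) (hNq : N = q * f * g - 1)
    (ef : ErnstJet s z f g fs fz fss fzz) (eg : ErnstJet s z g f gs gz gss gzz) :
    -((2 * fz + 2 * s * fsz + z * fzz) * (g + 2 * s * gs + z * gz)
        + (f + 2 * s * fs + z * fz) * (2 * gz + 2 * s * gsz + z * gzz)
        - s * ((fzz - 2 * fs - 2 * z * fsz) * (gz - 2 * z * gs)
          + (fz - 2 * z * fs) * (gzz - 2 * gs - 2 * z * gsz))) / (2 * N ^ 2)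
        + betaNumS s z f g fs gs fz gz * (2 * z * f * g + q * (fz * g + f * gz)) / N ^ 3 =
    -(betaNumZ s z f g fs gs fz gz + s * ((3 * fs + 2 * s * fss + z * fsz) * (gz - 2 * z * gs)
        + (f + 2 * s * fs + z * fz) * (gsz - 2 * z * gss)
        + (fsz - 2 * z * fss) * (g + 2 * s * gs + z * gz)
        + (fz - 2 * z * fs) * (3 * gs + 2 * s * gss + z * gsz))) / N ^ 2
        + 2 * s * betaNumZ s z f g fs gs fz gz * (f * g + q * (fs * g + f * gs)) / N ^ 3 := by
  rw [ErnstJet, ← hqs, ← hNq] at ef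
  rw [ErnstJet, ← hqs, mul_right_comm, ← hNq] at eg
  have ef' : fzz = 2 * g * (f ^ 2 + 2 * f * (2 * s * fs + z * fz) +
      q * (4 * s * fs ^ 2 + fz ^ 2)) / N - 4 * fs - 4 * s * fss := by
    rw [← ef]; field_simp; ring
  have eg' : gzz = 2 * f * (g ^ 2 + 2 * g * (2 * s * gs + z * gz) +
      q * (4 * s * gs ^ 2 + gz ^ 2)) / N - 4 * gs - 4 * s * gss := by
    rw [← eg]; field_simp; ring
  rw [ef', eg', betaNumS, betaNumZ]
  clear ef' eg' ef eg
  field_simp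
  rw [hNq, hqs]
  ring

/-! ### Convergent power series in two variables -/

open MvPowerSeries in
/-- The formal power series ring in two variables. -/
abbrev PS : Type := MvPowerSeries (Fin 2) ℂ

/-- The exponent `(j, k)`. -/
def ex (j k : ℕ) : Fin 2 →₀ ℕ := Finsupp.single 0 j + Finsupp.single 1 k

@[simp] theorem ex_zero (j k : ℕ) : ex j k 0 = j := by simp [ex]
@[simp] theorem ex_one (j k : ℕ) : ex j k 1 = k := by simp [ex]
theorem ex_eta (d : Fin 2 →₀ ℕ) : ex (d 0) (d 1) = d := by
  ext i; fin_cases i <;> simp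
/-- Exponents are pairs of natural numbers. -/
def exEquiv : ℕ × ℕ ≃ (Fin 2 →₀ ℕ) where
  toFun x := ex x.1 x.2
  invFun d := (d 0, d 1)
  left_inv x := by simp
  right_inv d := ex_eta d

/-- Total degree. -/
def deg (d : Fin 2 →₀ ℕ) : ℕ := d 0 + d 1

theorem deg_add (d e : Fin 2 →₀ ℕ) : deg (d + e) = deg d + deg e := by
  simp [deg]; ring

/-- Absolute convergence on the polydisc of radius `r`. -/
def ConvOn (r : ℝ) (a : PS) : Prop := Summable fun d => ‖a.coeff d‖ * r ^ deg d

/-- Convergence near the origin. -/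
def Conv (a : PS) : Prop := ∃ r : ℝ, 0 < r ∧ ConvOn r a

theorem ConvOn.mono {r r' : ℝ} {a : PS} (h : ConvOn r a) (h0 : 0 ≤ r') (hr : r' ≤ r) :
    ConvOn r' a :=
  Summable.of_nonneg_of_le (fun d => by positivity)
    (fun d => by gcongr) h

theorem Conv.exists_le {a : PS} (h : Conv a) {r : ℝ} (hr : 0 < r) :
    ∃ r' : ℝ, 0 < r' ∧ r' ≤ r ∧ ConvOn r' a := by
  obtain ⟨r1, h1, h2⟩ := h
  exact ⟨min r r1, lt_min hr h1, min_le_left _ _, h2.mono (lt_min hr h1).le (min_le_right _ _)⟩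

/-- The monomial function. -/
def monoF (d : Fin 2 →₀ ℕ) (w : ℂ × ℂ) : ℂ := w.1 ^ d 0 * w.2 ^ d 1

theorem monoF_add (d e : Fin 2 →₀ ℕ) (w : ℂ × ℂ) : monoF (d + e) w = monoF d w * monoF e w := by
  simp [monoF, pow_add]; ring

theorem norm_monoF_le (d : Fin 2 →₀ ℕ) {w : ℂ × ℂ} {r : ℝ} (hw : ‖w‖ ≤ r) :
    ‖monoF d w‖ ≤ r ^ deg d := by
  rw [monoF, norm_mul, norm_pow, norm_pow, deg, pow_add]
  have h1 := (norm_fst_le w).trans hw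
  have h2 := (norm_snd_le w).trans hw
  have h0 := (norm_nonneg w).trans hw
  gcongr

/-- The sum of a power series. -/
def S (a : PS) (w : ℂ × ℂ) : ℂ := ∑' d, a.coeff d * monoF d w

theorem ConvOn.summable_norm {r : ℝ} {a : PS} (h : ConvOn r a) {w : ℂ × ℂ} (hw : ‖w‖ ≤ r) :
    Summable fun d => ‖a.coeff d * monoF d w‖ := by
  refine Summable.of_nonneg_of_le (fun d => norm_nonneg _) (fun d => ?_) h
  rw [norm_mul]
  gcongr
  exact norm_monoF_le d hw

theorem ConvOn.add {r : ℝ} {a b : PS} (hr : 0 ≤ r) (ha : ConvOn r a) (hb : ConvOn r b) :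
    ConvOn r (a + b) := by
  refine Summable.of_nonneg_of_le (fun d => by positivity) (fun d => ?_) (Summable.add ha hb)
  rw [map_add, ← add_mul]
  gcongr
  exact norm_add_le _ _

theorem ConvOn.mul {r : ℝ} {a b : PS} (hr : 0 ≤ r) (ha : ConvOn r a) (hb : ConvOn r b) :
    ConvOn r (a * b) := by
  have h := summable_sum_mul_antidiagonal_of_summable_mul (Summable.mul_of_nonneg ha hb
    (fun d => by positivity) (fun d => by positivity))
  refine Summable.of_nonneg_of_le (fun d => by positivity) (fun d => ?_) h
  rw [MvPowerSeries.coeff_mul]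
  calc _ ≤ (∑ x ∈ Finset.HasAntidiagonal.antidiagonal d, ‖a.coeff x.1 * b.coeff x.2‖) * r ^ deg d := by
        gcongr; exact norm_sum_le _ _
    _ ≤ _ := by
        rw [Finset.sum_mul]
        refine Finset.sum_le_sum fun x hx => ?_
        rw [Finset.HasAntidiagonal.mem_antidiagonal] at hx
        rw [← hx, deg_add, pow_add, norm_mul]
        apply le_of_eq; ring

theorem Conv.add {a b : PS} (ha : Conv a) (hb : Conv b) : Conv (a + b) := by
  obtain ⟨r, h0, h1⟩ := ha
  obtain ⟨r', h2, h3, h4⟩ := hb.exists_le h0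
  exact ⟨r', h2, (h1.mono h2.le h3).add h2.le h4⟩

theorem Conv.mul {a b : PS} (ha : Conv a) (hb : Conv b) : Conv (a * b) := by
  obtain ⟨r, h0, h1⟩ := ha
  obtain ⟨r', h2, h3, h4⟩ := hb.exists_le h0
  exact ⟨r', h2, (h1.mono h2.le h3).mul h2.le h4⟩

theorem conv_of_finite {a : PS} (h : (Function.support fun d => a.coeff d).Finite) : Conv a := by
  refine ⟨1, one_pos, summable_of_hasFiniteSupport (h.subset fun d hd => ?_)⟩
  simp only [Function.mem_support] at hd ⊢
  contrapose! hd
  simp [hd]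

theorem conv_C (c : ℂ) : Conv (MvPowerSeries.C c) := by
  classical
  refine conv_of_finite ((Set.finite_singleton 0).subset fun d hd => ?_)
  simp only [Function.mem_support, MvPowerSeries.coeff_C] at hd
  by_contra h
  exact hd (if_neg h)

theorem conv_X (i : Fin 2) : Conv (MvPowerSeries.X i) := by
  classical
  refine conv_of_finite ((Set.finite_singleton (Finsupp.single i 1)).subset fun d hd => ?_)
  simp only [Function.mem_support, MvPowerSeries.coeff_X] at hd
  by_contra h
  exact hd (if_neg h)

theorem Conv.neg {a : PS} (ha : Conv a) : Conv (-a) := by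
  obtain ⟨r, h0, h1⟩ := ha
  exact ⟨r, h0, by simpa [ConvOn] using h1⟩

theorem Conv.sub {a b : PS} (ha : Conv a) (hb : Conv b) : Conv (a - b) := by
  rw [sub_eq_add_neg]; exact ha.add hb.neg

theorem Conv.of_le {a b : PS} (ha : Conv a) (h : ∀ d, ‖b.coeff d‖ ≤ ‖a.coeff d‖) : Conv b := by
  obtain ⟨r, h0, h1⟩ := ha
  exact ⟨r, h0, Summable.of_nonneg_of_le (fun d => by positivity) (fun d => by gcongr; exact h d) h1⟩

theorem Conv.pderiv {a : PS} (ha : Conv a) (i : Fin 2) : Conv (MvPowerSeries.pderiv ℂ i a) := by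
  obtain ⟨r, h0, h1⟩ := ha
  -- Halving the radius gains a power of 1/2 of exponent `deg d`, which absorbs the factor `d i + 1`
  -- produced by differentiation.
  refine ⟨r / 2, by positivity, ?_⟩
  have hinj : Function.Injective fun d : Fin 2 →₀ ℕ => d + Finsupp.single i 1 :=
    fun d e h => add_right_cancel h
  have h2 := (h1.comp_injective hinj).mul_left (1 / r)
  refine Summable.of_nonneg_of_le (fun d => by positivity) (fun d => ?_) h2
  have h3 : ((d i : ℝ) + 1) ≤ 2 ^ deg d := by
    have : d i + 1 ≤ 2 ^ deg d := by
      refine le_trans ?_ (Nat.lt_two_pow_self (n := deg d))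
      have : d i ≤ deg d := by fin_cases i <;> simp [deg]
      omega
    exact_mod_cast this
  have h4 : deg (d + Finsupp.single i 1) = deg d + 1 := by
    rw [deg_add]; congr 1; fin_cases i <;> simp [deg]
  simp only [Function.comp_apply, MvPowerSeries.coeff_pderiv, norm_mul, h4, div_pow, pow_succ]
  have h5 : ‖((d i : ℂ) + 1)‖ = (d i : ℝ) + 1 := by
    rw [show ((d i : ℂ) + 1) = ((d i + 1 : ℕ) : ℂ) by push_cast; rfl, Complex.norm_natCast]
    push_cast; rfl
  rw [h5]
  have h6 : (0 : ℝ) < 2 ^ deg d := by positivity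
  calc _ = ‖a.coeff (d + Finsupp.single i 1)‖ * r ^ deg d * (((d i : ℝ) + 1) / 2 ^ deg d) := by ring
    _ ≤ ‖a.coeff (d + Finsupp.single i 1)‖ * r ^ deg d * 1 := by
        gcongr; exact (div_le_one h6).mpr h3
    _ = _ := by field_simp

/-! ### The sum as a function -/

theorem eventually_norm_le {r : ℝ} (hr : 0 < r) : ∀ᶠ w : ℂ × ℂ in 𝓝 0, ‖w‖ ≤ r := by
  filter_upwards [Metric.closedBall_mem_nhds (0 : ℂ × ℂ) hr] with w hw
  simpa using hw

theorem S_add {a b : PS} (ha : Conv a) (hb : Conv b) : S (a + b) =ᶠ[𝓝 0] S a + S b := by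
  obtain ⟨r, h0, h1⟩ := ha
  obtain ⟨r', h2, h3, h4⟩ := hb.exists_le h0
  filter_upwards [eventually_norm_le h2] with w hw
  simp only [S, map_add, add_mul, Pi.add_apply]
  exact (h1.summable_norm (hw.trans h3)).of_norm.tsum_add (h4.summable_norm hw).of_norm

theorem S_neg (a : PS) : S (-a) = -S a := by
  funext w
  simp [S, tsum_neg]

theorem S_sub {a b : PS} (ha : Conv a) (hb : Conv b) : S (a - b) =ᶠ[𝓝 0] S a - S b := by
  rw [sub_eq_add_neg, sub_eq_add_neg, ← S_neg]
  exact S_add ha hb.neg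

theorem tsum_mul_tsum_antidiagonal {A : Type*} [AddCommMonoid A] [Finset.HasAntidiagonal A]
    {f g : A → ℂ} (hf : Summable fun d => ‖f d‖) (hg : Summable fun d => ‖g d‖) :
    (∑' d, f d) * ∑' d, g d =
      ∑' d, ∑ x ∈ Finset.HasAntidiagonal.antidiagonal d, f x.1 * g x.2 :=
  hf.of_norm.tsum_mul_tsum_eq_tsum_sum_antidiagonal hg.of_norm (summable_mul_of_summable_norm hf hg)

theorem ConvOn.S_mul {r : ℝ} {a b : PS} (ha : ConvOn r a) (hb : ConvOn r b) {w : ℂ × ℂ}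
    (hw : ‖w‖ ≤ r) : S (a * b) w = S a w * S b w := by
  rw [S, S, S, tsum_mul_tsum_antidiagonal (ha.summable_norm hw) (hb.summable_norm hw)]
  refine tsum_congr fun d => ?_
  rw [MvPowerSeries.coeff_mul, Finset.sum_mul]
  refine Finset.sum_congr rfl fun x hx => ?_
  rw [Finset.HasAntidiagonal.mem_antidiagonal] at hx
  rw [← hx, monoF_add]; ring

theorem S_mul {a b : PS} (ha : Conv a) (hb : Conv b) : S (a * b) =ᶠ[𝓝 0] S a * S b := by
  obtain ⟨r, h0, h1⟩ := ha
  obtain ⟨r', h2, h3, h4⟩ := hb.exists_le h0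
  filter_upwards [eventually_norm_le h2] with w hw using (h1.mono h2.le h3).S_mul h4 hw

theorem S_C (c : ℂ) : S (MvPowerSeries.C c) = fun _ => c := by
  classical
  funext w
  rw [S, tsum_eq_single 0]
  · simp [monoF]
  · intro d hd; simp [MvPowerSeries.coeff_C, hd]

theorem S_X_zero : S (MvPowerSeries.X 0) = fun w => w.1 := by
  classical
  funext w
  rw [S, tsum_eq_single (Finsupp.single 0 1)]
  · simp [monoF]
  · intro d hd; simp [MvPowerSeries.coeff_X, hd]

theorem S_X_one : S (MvPowerSeries.X 1) = fun w => w.2 := by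
  classical
  funext w
  rw [S, tsum_eq_single (Finsupp.single 1 1)]
  · simp [monoF]
  · intro d hd; simp [MvPowerSeries.coeff_X, hd]

theorem S_zero_eq (a : PS) : S a 0 = a.constantCoeff := by
  rw [S, tsum_eq_single 0]
  · simp [monoF]
  · intro d hd
    have : d 0 ≠ 0 ∨ d 1 ≠ 0 := by
      by_contra! h
      exact hd (by ext i; fin_cases i <;> simp [h])
    rcases this with h | h <;> simp [monoF, h]

/-- `G` has partial derivatives `a`, `b` at `w`. -/
def HasPart (G : ℂ × ℂ → ℂ) (a b : ℂ) (w : ℂ × ℂ) : Prop :=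
  HasFDerivAt G (a • ContinuousLinearMap.fst ℂ ℂ ℂ + b • ContinuousLinearMap.snd ℂ ℂ ℂ) w

/-- Termwise differentiation, dominated on a ball where both formal partial derivatives converge
absolutely. -/
theorem S_hasPart {a : PS} (ha : Conv a) : ∀ᶠ w in 𝓝 0,
    HasPart (S a) (S (MvPowerSeries.pderiv ℂ 0 a) w) (S (MvPowerSeries.pderiv ℂ 1 a) w) w := by
  obtain ⟨r0, h00, h01⟩ := ha.pderiv 0
  obtain ⟨r1, h10, h11, h12⟩ := (ha.pderiv 1).exists_le h00
  obtain ⟨r, hr0, hr1, hr⟩ := ha.exists_le h10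
  have k0 := h01.mono hr0.le (hr1.trans h11)
  have k1 := h12.mono hr0.le hr1
  have hmem : Metric.ball (0 : ℂ × ℂ) r ∈ 𝓝 (0 : ℂ × ℂ) := Metric.ball_mem_nhds _ hr0
  filter_upwards [hmem] with w hw
  have inj : ∀ i : Fin 2, Function.Injective fun d : Fin 2 →₀ ℕ => d + Finsupp.single i 1 :=
    fun i d e h => add_right_cancel h
  have hdeg : ∀ (i : Fin 2) (d : Fin 2 →₀ ℕ), d i ≠ 0 →
      ∃ d', d = d' + Finsupp.single i 1 := fun i d h => by
    refine ⟨d - Finsupp.single i 1, ?_⟩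
    rw [tsub_add_cancel_of_le]
    simpa [Nat.one_le_iff_ne_zero] using h
  -- termwise partial derivatives
  let A (i : Fin 2) (d : Fin 2 →₀ ℕ) (w : ℂ × ℂ) : ℂ :=
    a.coeff d * (d i * monoF (d - Finsupp.single i 1) w)
  have hA : ∀ i d w, A i (d + Finsupp.single i 1) w =
      (MvPowerSeries.pderiv ℂ i a).coeff d * monoF d w := by
    intro i d w
    simp only [A, MvPowerSeries.coeff_pderiv, add_tsub_cancel_right, Finsupp.add_apply,
      Finsupp.single_eq_same]
    push_cast; ring
  have hA0 : ∀ i d w, d ∉ Set.range (fun d : Fin 2 →₀ ℕ => d + Finsupp.single i 1) →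
      A i d w = 0 := by
    intro i d w hd
    have : d i = 0 := by
      by_contra h
      obtain ⟨d', e⟩ := hdeg i d h
      exact hd ⟨d', e.symm⟩
    simp [A, this]
  let u (i : Fin 2) (d : Fin 2 →₀ ℕ) : ℝ := ‖a.coeff d‖ * (d i * r ^ deg (d - Finsupp.single i 1))
  have hu : ∀ i, ConvOn r (MvPowerSeries.pderiv ℂ i a) → Summable (u i) := by
    intro i h
    rw [← (inj i).summable_iff]
    · refine (summable_congr fun d => ?_).mpr h
      simp only [u, Function.comp_apply, MvPowerSeries.coeff_pderiv, add_tsub_cancel_right,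
        Finsupp.add_apply, Finsupp.single_eq_same, norm_mul]
      rw [show ((d i : ℂ) + 1) = ((d i + 1 : ℕ) : ℂ) by push_cast; rfl, Complex.norm_natCast]
      push_cast; ring
    · intro d hd
      have : d i = 0 := by
        by_contra h
        obtain ⟨d', e⟩ := hdeg i d h
        exact hd ⟨d', e.symm⟩
      simp [u, this]
  have hAu : ∀ i d w, ‖w‖ ≤ r → ‖A i d w‖ ≤ u i d := by
    intro i d w hw
    simp only [A, u, norm_mul, Complex.norm_natCast]
    gcongr
    exact norm_monoF_le _ hw
  have hder : ∀ d w, HasFDerivAt (fun w => a.coeff d * monoF d w)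
      (A 0 d w • ContinuousLinearMap.fst ℂ ℂ ℂ + A 1 d w • ContinuousLinearMap.snd ℂ ℂ ℂ) w := by
    intro d w
    have h1 := (hasFDerivAt_fst (𝕜 := ℂ) (p := w)).pow (d 0)
    have h2 := (hasFDerivAt_snd (𝕜 := ℂ) (p := w)).pow (d 1)
    have h3 := (h1.mul h2).const_mul (a.coeff d)
    refine h3.congr_fderiv ?_
    ext <;> simp [A, monoF, -mul_eq_mul_left_iff] <;> ring
  have := hasFDerivAt_tsum_of_isPreconnected (𝕜 := ℂ) (u := fun d => u 0 d + u 1 d)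
    (f := fun d w => a.coeff d * monoF d w) (x₀ := 0) (x := w)
    ((hu 0 k0).add (hu 1 k1)) Metric.isOpen_ball (convex_ball (0 : ℂ × ℂ) r).isPreconnected
    (fun d w _ => hder d w) (fun d w hw => ?_) (Metric.mem_ball_self hr0)
    (hr.summable_norm (by simpa using hr0.le)).of_norm hw
  · refine this.congr_fderiv ?_
    have hw' : ‖w‖ ≤ r := by simpa using (Metric.mem_ball.mp hw).le
    have sA : ∀ i, Summable (u i) → Summable (fun d => A i d w) := fun i h =>
      Summable.of_norm_bounded h fun d => hAu i d w hw'
    have eA : ∀ i, ∑' d, A i d w = S (MvPowerSeries.pderiv ℂ i a) w := by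
      intro i
      rw [← (inj i).tsum_eq (f := fun d => A i d w)]
      · simp only [hA, S]
      · intro d hd
        by_contra h
        exact hd (hA0 i d w h)
    have s0 := sA 0 (hu 0 k0)
    have s1 := sA 1 (hu 1 k1)
    rw [(s0.smul_const _).tsum_add (s1.smul_const _), s0.tsum_smul_const, s1.tsum_smul_const,
      eA, eA]
  · have hw' : ‖w‖ ≤ r := by simpa using (Metric.mem_ball.mp hw).le
    refine (norm_add_le _ _).trans (add_le_add ?_ ?_)
    · rw [norm_smul]
      exact (mul_le_of_le_one_right (norm_nonneg _) (ContinuousLinearMap.norm_fst_le ℂ ℂ ℂ)).trans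
        (hAu 0 d w hw')
    · rw [norm_smul]
      exact (mul_le_of_le_one_right (norm_nonneg _) (ContinuousLinearMap.norm_snd_le ℂ ℂ ℂ)).trans
        (hAu 1 d w hw')

/-- Regrouping by total degree links sums over exponents with expansions whose n-th term is
homogeneous of degree n. -/
theorem hasSum_deg {F : (Fin 2 →₀ ℕ) → ℂ} (hF : Summable F) :
    HasSum (fun n => ∑ j ∈ Finset.range (n + 1), F (ex j (n - j))) (∑' d, F d) := by
  have h1 : HasSum (F ∘ exEquiv) (∑' d, F d) := (exEquiv.hasSum_iff).mpr hF.hasSum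
  have h2 := (Finset.HasAntidiagonal.sigmaAntidiagonalEquivProd (A := ℕ)).hasSum_iff.mpr h1
  refine h2.sigma fun n => ?_
  have h3 := hasSum_fintype (fun c : Finset.HasAntidiagonal.antidiagonal n =>
    ((F ∘ exEquiv) ∘ Finset.HasAntidiagonal.sigmaAntidiagonalEquivProd) ⟨n, c⟩)
  convert h3 using 1
  rw [← Finset.Nat.sum_antidiagonal_eq_sum_range_succ_mk (fun x => F (ex x.1 x.2)) n,
    ← Finset.sum_coe_sort]
  rfl

theorem summable_geom_deg : Summable fun d : Fin 2 →₀ ℕ => ((1 : ℝ) / 2) ^ deg d := by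
  rw [← exEquiv.summable_iff]
  have := Summable.mul_of_nonneg summable_geometric_two summable_geometric_two
    (fun n => by positivity) (fun n => by positivity)
  refine this.congr fun x => ?_
  simp [exEquiv, deg, pow_add]

theorem conv_of_bound {a : PS} {C A : ℝ} (hA : 0 ≤ A)
    (h : ∀ d, ‖a.coeff d‖ ≤ C * A ^ deg d) : Conv a := by
  refine ⟨1 / (2 * (A + 1)), by positivity, Summable.of_nonneg_of_le (fun d => by positivity)
    (fun d => ?_) (summable_geom_deg.mul_left C)⟩
  have hC : 0 ≤ C := by simpa [deg] using (norm_nonneg _).trans (h 0)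
  calc _ ≤ C * A ^ deg d * (1 / (2 * (A + 1))) ^ deg d := by gcongr; exact h d
    _ = C * (A / (2 * (A + 1))) ^ deg d := by rw [mul_assoc, ← mul_pow]; ring_nf
    _ ≤ _ := by
      refine mul_le_mul_of_nonneg_left (pow_le_pow_left₀ (by positivity) ?_ _) hC
      rw [div_le_div_iff₀ (by positivity) two_pos]; linarith

theorem Conv.exists_bound {a : PS} (ha : Conv a) :
    ∃ C A : ℝ, 0 < C ∧ 0 < A ∧ ∀ d, ‖a.coeff d‖ ≤ C * A ^ deg d := by
  obtain ⟨r, hr, h⟩ := ha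
  refine ⟨∑' d, ‖a.coeff d‖ * r ^ deg d + 1, 1 / r, ?_, by positivity, fun d => ?_⟩
  · have : 0 ≤ ∑' d, ‖a.coeff d‖ * r ^ deg d := tsum_nonneg fun d => by positivity
    linarith
  · have h1 := h.le_tsum d (fun e _ => by positivity)
    have h2 : 0 < r ^ deg d := by positivity
    rw [one_div, inv_pow, ← div_eq_mul_inv, le_div_iff₀ h2]
    linarith

theorem S_analyticAt {a : PS} (ha : Conv a) : AnalyticAt ℂ (S a) 0 := by
  obtain ⟨r, hr, h⟩ := ha
  lift r to NNReal using hr.le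
  -- The part of degree n as a multilinear map: a monomial of bidegree (j, n − j) takes the first
  -- component in the first j slots and the second component in the others. The map need not be
  -- symmetric; only its diagonal values and norm bounds are used.
  let p : FormalMultilinearSeries ℂ (ℂ × ℂ) ℂ := fun n =>
    ∑ j ∈ Finset.range (n + 1), a.coeff (ex j (n - j)) •
      (ContinuousMultilinearMap.mkPiAlgebra ℂ (Fin n) ℂ).compContinuousLinearMap
        (fun i => if (i : ℕ) < j then ContinuousLinearMap.fst ℂ ℂ ℂ
          else ContinuousLinearMap.snd ℂ ℂ ℂ)
  have hp : ∀ n (w : ℂ × ℂ), p n (fun _ => w) =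
      ∑ j ∈ Finset.range (n + 1), a.coeff (ex j (n - j)) * monoF (ex j (n - j)) w := by
    intro n w
    simp only [p, _root_.sum_apply, _root_.smul_apply,
      smul_eq_mul]
    refine Finset.sum_congr rfl fun j hj => ?_
    congr 1
    obtain ⟨k, rfl⟩ := Nat.exists_eq_add_of_le (Nat.lt_succ_iff.mp (Finset.mem_range.mp hj))
    simp only [ContinuousMultilinearMap.compContinuousLinearMap_apply,
      ContinuousMultilinearMap.mkPiAlgebra_apply, monoF, ex_zero, ex_one, add_tsub_cancel_left]
    rw [Fin.prod_univ_add]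
    simp
  have hn : ∀ n, ‖p n‖ ≤ ∑ j ∈ Finset.range (n + 1), ‖a.coeff (ex j (n - j))‖ := by
    intro n
    refine (norm_sum_le _ _).trans (Finset.sum_le_sum fun j _ => ?_)
    rw [norm_smul]
    refine mul_le_of_le_one_right (norm_nonneg _)
      ((ContinuousMultilinearMap.norm_compContinuousLinearMap_le _ _).trans ?_)
    rw [ContinuousMultilinearMap.norm_mkPiAlgebra, one_mul]
    refine Finset.prod_le_one (fun i _ => norm_nonneg _) fun i _ => ?_
    split_ifs
    · exact ContinuousLinearMap.norm_fst_le ℂ ℂ ℂ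
    · exact ContinuousLinearMap.norm_snd_le ℂ ℂ ℂ
  have hrad : (r : ENNReal) ≤ p.radius := by
    refine p.le_radius_of_bound (∑' d, ‖a.coeff d‖ * (r : ℝ) ^ deg d) fun n => ?_
    calc ‖p n‖ * (r : ℝ) ^ n ≤ ∑ j ∈ Finset.range (n + 1), ‖a.coeff (ex j (n - j))‖ *
          (r : ℝ) ^ deg (ex j (n - j)) := by
          refine (mul_le_mul_of_nonneg_right (hn n) (by positivity)).trans_eq ?_
          rw [Finset.sum_mul]
          refine Finset.sum_congr rfl fun j hj => ?_
          rw [deg, ex_zero, ex_one, Nat.add_sub_of_le (Nat.lt_succ_iff.mp (Finset.mem_range.mp hj))]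
      _ = ∑ d ∈ (Finset.range (n + 1)).image (fun j => ex j (n - j)),
          ‖a.coeff d‖ * (r : ℝ) ^ deg d := by
          rw [Finset.sum_image]
          intro j _ j' _ h
          simpa using DFunLike.congr_fun h 0
      _ ≤ _ := h.sum_le_tsum _ fun d _ => by positivity
  have key : ∀ y : ℂ × ℂ, ‖y‖ ≤ r → HasSum (fun n => p n fun _ => y) (S a y) := by
    intro y hy
    have h3 := hasSum_deg (h.summable_norm hy).of_norm
    refine HasSum.congr_fun ?_ (fun n => hp n y)
    exact h3
  clear_value p
  have hball : HasFPowerSeriesOnBall (S a) p 0 r := by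
    refine ⟨hrad, by exact_mod_cast hr, fun {y} hy => ?_⟩
    rw [zero_add]
    refine key y ?_
    rw [Metric.mem_eball, edist_zero_right, enorm_eq_nnnorm] at hy
    have : ‖y‖₊ < r := by exact_mod_cast hy
    exact_mod_cast this.le
  exact hball.analyticAt

/-- Expand the n-th multilinear term on x e0 + y e1: the coefficient of xʲyᵏ collects the choices of
the j slots that receive e0. The coefficients are complex even for 𝕜 = ℝ, so a real-analytic
function on a real plane acquires a holomorphic extension. -/
theorem exists_series_of_analyticAt {𝕜 E : Type*} [NontriviallyNormedField 𝕜] [NormedAlgebra 𝕜 ℂ]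
    [NormedAddCommGroup E] [NormedSpace 𝕜 E] {f : E → ℂ} (hf : AnalyticAt 𝕜 f 0) (e0 e1 : E) :
    ∃ c, Conv c ∧ ∀ᶠ x in 𝓝 (0 : 𝕜 × 𝕜), f (x.1 • e0 + x.2 • e1) =
      S c (algebraMap 𝕜 ℂ x.1, algebraMap 𝕜 ℂ x.2) := by
  classical
  obtain ⟨p, R, hp⟩ := hf
  obtain ⟨r, hr0, hrR⟩ := ENNReal.lt_iff_exists_nnreal_btwn.mp hp.r_pos
  obtain ⟨C, hC, hb⟩ := p.norm_mul_pow_le_of_lt_radius (hrR.trans_le hp.r_le)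
  have hr : (0 : ℝ) < r := by exact_mod_cast hr0
  set m : ℝ := max ‖e0‖ ‖e1‖ + 1 with hm
  have hm0 : 0 < m := by
    have := norm_nonneg e0; have := le_max_left ‖e0‖ ‖e1‖; linarith
  let c : PS := fun d => ∑ s ∈ Finset.powersetCard (d 0) (Finset.univ : Finset (Fin (deg d))),
    p (deg d) (s.piecewise (fun _ => e0) (fun _ => e1))
  have hc : ∀ d, c.coeff d = ∑ s ∈ Finset.powersetCard (d 0) (Finset.univ : Finset (Fin (deg d))),
    p (deg d) (s.piecewise (fun _ => e0) (fun _ => e1)) := fun d => rfl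
  have hpn : ∀ n, ‖p n‖ ≤ C * (1 / (r : ℝ)) ^ n := by
    intro n
    rw [one_div, inv_pow, ← div_eq_mul_inv, le_div_iff₀ (by positivity)]
    exact hb n
  have hbound : ∀ d, ‖c.coeff d‖ ≤ C * (2 * (1 / r) * m) ^ deg d := by
    intro d
    rw [hc]
    have h1 : ∀ s : Finset (Fin (deg d)), ‖p (deg d) (s.piecewise (fun _ => e0) (fun _ => e1))‖ ≤
        C * (1 / (r : ℝ)) ^ deg d * m ^ deg d := by
      intro s
      refine ((p (deg d)).le_opNorm _).trans ?_
      gcongr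
      · exact hpn _
      · refine (Finset.prod_le_prod (g := fun _ => m) (fun i _ => norm_nonneg _)
          fun i _ => ?_).trans (by simp)
        simp only [Finset.piecewise]
        split_ifs
        · exact (le_max_left _ _).trans (by linarith)
        · exact (le_max_right _ _).trans (by linarith)
    refine (norm_sum_le _ _).trans ((Finset.sum_le_sum fun s _ => h1 s).trans ?_)
    rw [Finset.sum_const, nsmul_eq_mul, Finset.card_powersetCard, Finset.card_univ, Fintype.card_fin]
    have h2 : ((deg d).choose (d 0) : ℝ) ≤ 2 ^ deg d := by
      exact_mod_cast Nat.choose_le_two_pow _ _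
    calc _ ≤ (2 : ℝ) ^ deg d * (C * (1 / (r : ℝ)) ^ deg d * m ^ deg d) := by gcongr
      _ = _ := by rw [mul_pow, mul_pow]; ring
  have hconv : Conv c := conv_of_bound (by positivity) hbound
  refine ⟨c, hconv, ?_⟩
  obtain ⟨ρ, hρ, hρc⟩ := hconv
  have hcont : Filter.Tendsto (fun x : 𝕜 × 𝕜 => x.1 • e0 + x.2 • e1) (𝓝 0) (𝓝 0) := by
    have : Continuous (fun x : 𝕜 × 𝕜 => x.1 • e0 + x.2 • e1) := by fun_prop
    simpa using this.tendsto 0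
  filter_upwards [hcont (Metric.eball_mem_nhds (0 : E) hp.r_pos),
    Metric.closedBall_mem_nhds (0 : 𝕜 × 𝕜) hρ] with x hx hx2
  have hsum := hp.hasSum hx
  rw [zero_add] at hsum
  have hw : ‖(algebraMap 𝕜 ℂ x.1, algebraMap 𝕜 ℂ x.2)‖ ≤ ρ := by
    have : ‖x‖ ≤ ρ := by simpa using hx2
    simpa [Prod.norm_def] using this
  have h3 := hasSum_deg (hρc.summable_norm hw).of_norm
  refine hsum.unique ?_
  refine HasSum.congr_fun h3 fun n => ?_
  have h4 := (p n).map_add_univ (fun _ => x.1 • e0) (fun _ => x.2 • e1)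
  change p n (fun _ => x.1 • e0 + x.2 • e1) = _ at h4
  rw [h4, ← Finset.powerset_univ, Finset.sum_powerset, Finset.card_univ, Fintype.card_fin]
  refine Finset.sum_congr rfl fun j hj => ?_
  obtain ⟨k, rfl⟩ := Nat.exists_eq_add_of_le (Nat.lt_succ_iff.mp (Finset.mem_range.mp hj))
  rw [add_tsub_cancel_left, hc]
  have hd : deg (ex j k) = j + k := by simp [deg]
  rw [Finset.sum_mul]
  have h5 : ∀ n (hn : n = j + k),
      ∑ s ∈ Finset.powersetCard j (Finset.univ : Finset (Fin (j + k))),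
        p (j + k) (s.piecewise (fun _ => x.1 • e0) (fun _ => x.2 • e1)) =
      ∑ s ∈ Finset.powersetCard j (Finset.univ : Finset (Fin n)),
        p n (s.piecewise (fun _ => e0) (fun _ => e1)) *
          monoF (ex j k) (algebraMap 𝕜 ℂ x.1, algebraMap 𝕜 ℂ x.2) := by
    rintro n rfl
    refine Finset.sum_congr rfl fun s hs => ?_
    have hs' := (Finset.mem_powersetCard.mp hs).2
    have h6 := (p (j + k)).map_smul_univ (fun i => if i ∈ s then x.1 else x.2)
      (s.piecewise (fun _ => e0) (fun _ => e1))
    have h7 : (fun i => (if i ∈ s then x.1 else x.2) •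
        (s.piecewise (fun _ => e0) (fun _ => e1) : Fin (j + k) → E) i) =
        s.piecewise (fun _ => x.1 • e0) (fun _ => x.2 • e1) := by
      funext i
      by_cases hi : i ∈ s <;> simp [Finset.piecewise, hi]
    rw [h7] at h6
    rw [h6, Finset.prod_ite, Finset.prod_const, Finset.prod_const]
    have h8 : (Finset.univ.filter fun i => i ∈ s).card = j := by
      rw [Finset.filter_mem_eq_inter, Finset.univ_inter, hs']
    have h9 : (Finset.univ.filter fun i => i ∉ s).card = k := by
      have := Finset.card_filter_add_card_filter_not (s := (Finset.univ : Finset (Fin (j + k))))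
        (fun i => i ∈ s)
      rw [h8, Finset.card_univ, Fintype.card_fin] at this
      omega
    rw [h8, h9, Algebra.smul_def, monoF, ex_zero, ex_one, map_mul, map_pow, map_pow]
    ring
  convert h5 _ hd using 2
  simp

theorem S_congr_pderiv {a : PS} (ha : Conv a) (h : S a =ᶠ[𝓝 0] 0) (i : Fin 2) :
    S (MvPowerSeries.pderiv ℂ i a) =ᶠ[𝓝 0] 0 := by
  filter_upwards [S_hasPart ha, h.eventually_nhds] with w h1 h2
  have h3 : HasFDerivAt (S a) (0 : ℂ × ℂ →L[ℂ] ℂ) w :=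
    (hasFDerivAt_const (0 : ℂ) w).congr_of_eventuallyEq h2
  have h4 := h1.unique h3
  have h5 := DFunLike.congr_fun h4 (if i = 0 then (1, 0) else (0, 1))
  fin_cases i <;> simpa using h5

/-- Vanishing near 0 is inherited by all formal derivatives, so induction on the total degree
reduces every coefficient to a constant term. -/
theorem eq_zero_of_S_eq_zero {a : PS} (ha : Conv a) (h : S a =ᶠ[𝓝 0] 0) : a = 0 := by
  have key : ∀ n (a : PS), Conv a → S a =ᶠ[𝓝 0] 0 → ∀ d, deg d = n → a.coeff d = 0 := by
    intro n
    induction n with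
    | zero =>
      intro a _ h d hd
      have : d = 0 := by
        simp only [deg, Nat.add_eq_zero_iff] at hd
        ext i; fin_cases i <;> simp [hd]
      subst this
      rw [MvPowerSeries.coeff_zero_eq_constantCoeff, ← S_zero_eq]
      exact h.self_of_nhds
    | succ n ih =>
      intro a ha h d hd
      have : d 0 ≠ 0 ∨ d 1 ≠ 0 := by
        by_contra! h
        simp [deg, h] at hd
      have main : ∀ i : Fin 2, d i ≠ 0 → a.coeff d = 0 := by
        intro i hi
        have hle : Finsupp.single i 1 ≤ d := by simpa [Nat.one_le_iff_ne_zero] using hi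
        have h1 := ih _ (ha.pderiv i) (S_congr_pderiv ha h i) (d - Finsupp.single i 1) (by
          have h2 : deg (d - Finsupp.single i 1) + deg (Finsupp.single i 1) = deg d := by
            rw [← deg_add, tsub_add_cancel_of_le hle]
          have h3 : deg (Finsupp.single i 1) = 1 := by fin_cases i <;> simp [deg]
          omega)
        rw [MvPowerSeries.coeff_pderiv, tsub_add_cancel_of_le hle, mul_eq_zero] at h1
        exact h1.resolve_right (Nat.cast_add_one_ne_zero _)
      exact this.elim (main 0) (main 1)
  ext d
  exact key _ a ha h d rfl

theorem eq_of_S_eq {a b : PS} (ha : Conv a) (hb : Conv b) (h : S a =ᶠ[𝓝 0] S b) : a = b := by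
  rw [← sub_eq_zero]
  refine eq_zero_of_S_eq_zero (ha.sub hb) ((S_sub ha hb).trans ?_)
  filter_upwards [h] with w hw
  simp [hw]

theorem exists_series {G : ℂ × ℂ → ℂ} (hG : AnalyticAt ℂ G 0) : ∃ c, Conv c ∧ G =ᶠ[𝓝 0] S c := by
  obtain ⟨c, hc, h⟩ := exists_series_of_analyticAt (𝕜 := ℂ) hG (1, 0) (0, 1)
  refine ⟨c, hc, ?_⟩
  filter_upwards [h] with w hw
  simpa using hw

/-- Complex conjugation of coefficients. -/
def cj (a : PS) : PS := MvPowerSeries.map (starRingEnd ℂ) a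

theorem coeff_cj (a : PS) (d) : (cj a).coeff d = conj (a.coeff d) := rfl

theorem Conv.cj {a : PS} (ha : Conv a) : Conv (cj a) :=
  ha.of_le fun d => by rw [coeff_cj, RCLike.norm_conj]

theorem S_cj (a : PS) (w : ℂ × ℂ) : S (cj a) w = conj (S a (conj w.1, conj w.2)) := by
  rw [S, S, Complex.conj_tsum]
  refine tsum_congr fun d => ?_
  rw [coeff_cj]
  simp [monoF]

theorem cj_cj (a : PS) : cj (cj a) = a := by ext d; simp [coeff_cj]

/-! ### Axisymmetric functions -/

/-- The invariants `(r², z̃)`. -/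
def inv (p : E3) : ℂ × ℂ := (((‖p‖ ^ 2 : ℝ) : ℂ), (p 2 : ℂ))

theorem continuous_inv : Continuous inv := by
  unfold inv
  fun_prop

theorem tendsto_inv : Filter.Tendsto inv (𝓝 0) (𝓝 0) := by
  have := continuous_inv.tendsto 0
  rwa [show inv 0 = 0 by simp [inv]] at this

theorem S_cj_inv (a : PS) (p : E3) : S (cj a) (inv p) = conj (S a (inv p)) := by
  rw [S_cj]
  simp [inv]

theorem analyticAt_coord (i : Fin 3) (p : E3) : AnalyticAt ℝ (fun q : E3 => q i) p :=
  (EuclideanSpace.proj i : E3 →L[ℝ] ℝ).analyticAt p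

theorem analyticAt_ofReal {E : Type*} [NormedAddCommGroup E] [NormedSpace ℝ E] {u : E → ℝ} {p : E}
    (hu : AnalyticAt ℝ u p) : AnalyticAt ℝ (fun q => (u q : ℂ)) p :=
  (Complex.ofRealCLM.analyticAt _).comp hu

theorem analyticAt_rhoSq (p : E3) : AnalyticAt ℝ rhoSq p :=
  ((analyticAt_coord 0 p).pow 2).add ((analyticAt_coord 1 p).pow 2)

theorem analyticAt_inv (p : E3) : AnalyticAt ℝ inv p := by
  refine AnalyticAt.prod (analyticAt_ofReal ?_) (analyticAt_ofReal (analyticAt_coord 2 p))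
  simp only [norm_sq_eq]
  exact (analyticAt_rhoSq p).add ((analyticAt_coord 2 p).pow 2)

theorem inv_zero : inv 0 = 0 := by simp [inv]

theorem analyticAt_comp_inv {G : ℂ × ℂ → ℂ} (hG : AnalyticAt ℂ G 0) :
    AnalyticAt ℝ (fun p => G (inv p)) 0 := by
  refine AnalyticAt.comp (g := G) ?_ (analyticAt_inv 0)
  rw [inv_zero]
  exact hG.restrictScalars

theorem HasPart.hasGrad {G : ℂ × ℂ → ℂ} {a b : ℂ} {p : E3} (h : HasPart G a b (inv p)) :
    HasGrad (fun q => G (inv q)) (axiGrad a (2 * p 2 * a + b) p) p := by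
  have h1 : HasFDerivAt inv ((gradForm fun i => ((axiGrad 1 (2 * p 2) p i : ℝ) : ℂ)).prod
      (gradForm fun i => ((if i = 2 then (1 : ℝ) else 0 : ℝ) : ℂ))) p := by
    have e1 : HasGrad (fun q : E3 => (((‖q‖ ^ 2 : ℝ)) : ℂ))
        (fun i => ((axiGrad 1 (2 * p 2) p i : ℝ) : ℂ)) p := by
      simpa only [norm_sq_eq] using (hasGrad_normSq p).ofReal
    have e2 := (hasGrad_coord 2 p).ofReal
    exact HasFDerivAt.prodMk e1 e2
  have h2 := (h.restrictScalars ℝ).comp p h1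
  refine HasGrad.of_eq (h2.congr_fderiv (clm_eq_gradForm _)) fun i => ?_
  fin_cases i <;> simp [gradForm_single, axiGrad, rad, axisVec] <;> ring

/-- The derivative with respect to `ρ̃²` of a power series in `(r², z̃)`. -/
def dS : Derivation ℂ PS PS := MvPowerSeries.pderiv ℂ 0
/-- The derivative with respect to `z̃` at fixed `r²`. -/
def d1 : Derivation ℂ PS PS := MvPowerSeries.pderiv ℂ 1
/-- The derivative with respect to `z̃` at fixed `ρ̃²`. -/
def dZ (a : PS) : PS := 2 * MvPowerSeries.X 1 * dS a + d1 a

theorem Conv.dS {a : PS} (ha : Conv a) : Conv (dS a) := ha.pderiv 0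
theorem Conv.d1 {a : PS} (ha : Conv a) : Conv (d1 a) := ha.pderiv 1
theorem C_two : (MvPowerSeries.C 2 : PS) = 2 := map_ofNat _ 2
theorem conv_two : Conv 2 := C_two ▸ conv_C 2
theorem Conv.dZ {a : PS} (ha : Conv a) : Conv (dZ a) :=
  ((conv_two.mul (conv_X 1)).mul ha.dS).add ha.d1

theorem S_two (w : ℂ × ℂ) : S 2 w = 2 := by
  rw [← C_two, S_C]

theorem S_dZ {a : PS} (ha : Conv a) :
    ∀ᶠ w in 𝓝 0, S (dZ a) w = 2 * w.2 * S (dS a) w + S (d1 a) w := by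
  filter_upwards [S_add ((conv_two.mul (conv_X 1)).mul ha.dS) ha.d1,
    S_mul (conv_two.mul (conv_X 1)) ha.dS, S_mul conv_two (conv_X 1)] with w h1 h2 h3
  rw [dZ, h1, Pi.add_apply, h2, Pi.mul_apply, h3, Pi.mul_apply, S_X_one, S_two]

theorem S_hasGrad {a : PS} (ha : Conv a) : ∀ᶠ p in 𝓝 (0 : E3),
    HasGrad (fun q => S a (inv q)) (axiGrad (S (dS a) (inv p)) (S (dZ a) (inv p)) p) p := by
  filter_upwards [tendsto_inv.eventually (S_hasPart ha), tendsto_inv.eventually (S_dZ ha)]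
    with p h1 h2
  refine h1.hasGrad.of_eq fun i => ?_
  rw [h2]
  rfl

/-- Keeping only the even powers of the first variable gives a series in its square. An axisymmetric
function restricted to a meridian plane is even in ρ̃, and this is how ρ̃² becomes the variable. -/
theorem exists_even_series {c : PS} (hc : Conv c) : ∃ a, Conv a ∧
    ∀ᶠ w in 𝓝 (0 : ℂ × ℂ), S a (w.1 ^ 2, w.2) = (S c w + S c (-w.1, w.2)) / 2 := by
  obtain ⟨r, hr, h⟩ := hc
  let a : PS := fun d => c.coeff (ex (2 * d 0) (d 1))
  have ha : ∀ d, a.coeff d = c.coeff (ex (2 * d 0) (d 1)) := fun d => rfl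
  have hinj : Function.Injective fun d : Fin 2 →₀ ℕ => ex (2 * d 0) (d 1) := by
    intro d e hde
    have h0 := DFunLike.congr_fun hde 0
    have h1 := DFunLike.congr_fun hde 1
    simp at h0 h1
    ext i; fin_cases i <;> simp [h0, h1]
  obtain ⟨C, A, hC, hA, hb⟩ := Conv.exists_bound ⟨r, hr, h⟩
  have hconv : Conv a := by
    refine conv_of_bound (C := C) (A := (A + 1) ^ 2) (by positivity) fun d => ?_
    rw [ha]
    refine (hb _).trans ?_
    gcongr
    rw [← pow_mul]
    calc A ^ deg (ex (2 * d 0) (d 1)) ≤ (A + 1) ^ deg (ex (2 * d 0) (d 1)) := by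
          gcongr; linarith
      _ ≤ _ := by
        apply pow_le_pow_right₀ (by linarith)
        simp [deg]; omega
  refine ⟨a, hconv, ?_⟩
  filter_upwards [eventually_norm_le hr] with w hw
  have hw' : ‖((-w.1, w.2) : ℂ × ℂ)‖ ≤ r := by simpa [Prod.norm_def] using hw
  have s1 := (h.summable_norm hw).of_norm
  have s2 := (h.summable_norm hw').of_norm
  rw [S, S, S, ← s1.tsum_add s2, ← tsum_div_const]
  rw [← hinj.tsum_eq (f := fun d => (c.coeff d * monoF d w + c.coeff d * monoF d (-w.1, w.2)) / 2)]
  · refine tsum_congr fun d => ?_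
    simp only [ha, monoF, ex_zero, ex_one, pow_mul, neg_sq]
    ring
  · intro d hd
    simp only [Function.mem_support] at hd
    rcases Nat.even_or_odd' (d 0) with ⟨j, hj | hj⟩
    · refine ⟨ex j (d 1), ?_⟩
      simp only [ex_zero, ex_one, ← hj, ex_eta]
    · exfalso
      apply hd
      simp only [monoF]
      rw [Odd.neg_pow ⟨j, hj⟩]
      ring

/-- An axisymmetric analytic function is a convergent power series in `r²` and `z̃`. -/
theorem exists_series_of_axisymmetric {u : E3 → ℂ} (hu : AnalyticAt ℝ u 0) (ha : Axisymmetric u) :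
    ∃ a, Conv a ∧ ∀ᶠ p in 𝓝 (0 : E3), u p = S a (inv p) := by
  obtain ⟨c, hc, h⟩ := exists_series_of_analyticAt (𝕜 := ℝ) hu (EuclideanSpace.single 0 1)
    (EuclideanSpace.single 2 1)
  obtain ⟨a, hconv, h2⟩ := exists_even_series hc
  -- Passage from the variables (ρ̃², z̃) to (r², z̃) by substituting ρ̃² = r² − z̃².
  have h3 : AnalyticAt ℂ (fun w : ℂ × ℂ => S a (w.1 - w.2 ^ 2, w.2)) 0 := by
    refine AnalyticAt.comp (g := S a) (f := fun w : ℂ × ℂ => (w.1 - w.2 ^ 2, w.2)) ?_ ?_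
    · have := S_analyticAt hconv
      rwa [show ((0 : ℂ × ℂ).1 - (0 : ℂ × ℂ).2 ^ 2, (0 : ℂ × ℂ).2) = 0 by simp]
    · exact (analyticAt_fst.sub (analyticAt_snd.pow 2)).prod analyticAt_snd
  obtain ⟨a', hconv', h4⟩ := exists_series h3
  refine ⟨a', hconv', ?_⟩
  have t1 : Filter.Tendsto (fun p : E3 => (√(rhoSq p), p 2)) (𝓝 0) (𝓝 0) := by
    have : Continuous (fun p : E3 => (√(rhoSq p), p 2)) := by unfold rhoSq; fun_prop
    have h := this.tendsto 0
    simp only [rhoSq, PiLp.zero_apply, ne_eq, OfNat.ofNat_ne_zero, not_false_eq_true, zero_pow,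
      add_zero, Real.sqrt_zero, neg_zero, Complex.ofReal_zero, Prod.mk_zero_zero] at h
    exact h
  have t1' : Filter.Tendsto (fun p : E3 => (-√(rhoSq p), p 2)) (𝓝 0) (𝓝 0) := by
    have : Continuous (fun p : E3 => (-√(rhoSq p), p 2)) := by unfold rhoSq; fun_prop
    have h := this.tendsto 0
    simp only [rhoSq, PiLp.zero_apply, ne_eq, OfNat.ofNat_ne_zero, not_false_eq_true, zero_pow,
      add_zero, Real.sqrt_zero, neg_zero, Complex.ofReal_zero, Prod.mk_zero_zero] at h
    exact h
  have t2 : Filter.Tendsto (fun p : E3 => ((√(rhoSq p) : ℂ), (p 2 : ℂ))) (𝓝 0) (𝓝 0) := by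
    have : Continuous (fun p : E3 => ((√(rhoSq p) : ℂ), (p 2 : ℂ))) := by unfold rhoSq; fun_prop
    have h := this.tendsto 0
    simp only [rhoSq, PiLp.zero_apply, ne_eq, OfNat.ofNat_ne_zero, not_false_eq_true, zero_pow,
      add_zero, Real.sqrt_zero, neg_zero, Complex.ofReal_zero, Prod.mk_zero_zero] at h
    exact h
  filter_upwards [t1.eventually h, t1'.eventually h, t2.eventually h2, tendsto_inv.eventually h4, ha]
    with p e1 e1' e2 e3 e4
  have hs : 0 ≤ rhoSq p := by unfold rhoSq; positivity
  have hsq : √(rhoSq p) ^ 2 = rhoSq p := Real.sq_sqrt hs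
  -- Axisymmetry identifies `u p` with the values at the two meridian points with first coordinate
  -- ±ρ̃, so the even part reproduces `u` exactly.
  have e5 := e4 (√(rhoSq p) • EuclideanSpace.single 0 1 + p 2 • EuclideanSpace.single 2 1)
    (by simpa [rhoSq] using hsq) (by simp)
  have e6 := e4 (-√(rhoSq p) • EuclideanSpace.single 0 1 + p 2 • EuclideanSpace.single 2 1)
    (by simpa [rhoSq] using hsq) (by simp)
  simp only [Complex.coe_algebraMap, Complex.ofReal_neg] at e1 e1'
  rw [← e3]
  have e7 : (((‖p‖ ^ 2 : ℝ) : ℂ) - (p 2 : ℂ) ^ 2) = ((√(rhoSq p) : ℝ) : ℂ) ^ 2 := by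
    have e8 : ((√(rhoSq p) : ℝ) : ℂ) ^ 2 = (rhoSq p : ℂ) := by
      rw [← Complex.ofReal_pow, Real.sq_sqrt hs]
    rw [norm_sq_eq, e8]; push_cast; ring
  simp only [inv, e7]
  rw [e2, ← e1, ← e1', e5, e6]
  ring

/-- The identity theorem for functions of `(r², z̃)`. -/
theorem eventually_eq_zero_of_comp_inv {H : ℂ × ℂ → ℂ} (hH : AnalyticAt ℂ H 0)
    (h : ∀ᶠ p in 𝓝 (0 : E3), rhoSq p ≠ 0 → H (inv p) = 0) : H =ᶠ[𝓝 0] 0 := by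
  -- In the coordinates (ρ̃, z̃) the real points with ρ̃ ≠ 0 come from points off the axis. They
  -- accumulate at 0 in each variable separately, so the one-variable identity theorem applies first
  -- in ρ̃ and then in z̃.
  let H' : ℂ × ℂ → ℂ := fun w => H (w.1 ^ 2 + w.2 ^ 2, w.2)
  have hH' : AnalyticAt ℂ H' 0 := by
    refine AnalyticAt.comp (g := H) (f := fun w : ℂ × ℂ => (w.1 ^ 2 + w.2 ^ 2, w.2)) ?_ ?_
    · rwa [show ((0 : ℂ × ℂ).1 ^ 2 + (0 : ℂ × ℂ).2 ^ 2, (0 : ℂ × ℂ).2) = 0 by simp]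
    · exact ((analyticAt_fst.pow 2).add (analyticAt_snd.pow 2)).prod analyticAt_snd
  obtain ⟨ε, hε, hε'⟩ := Metric.eventually_nhds_iff_ball.mp hH'.eventually_analyticAt
  have t : Filter.Tendsto (fun x : ℝ × ℝ =>
      x.1 • (EuclideanSpace.single 0 1 : E3) + x.2 • (EuclideanSpace.single 2 1 : E3))
      (𝓝 0) (𝓝 0) := by
    have : Continuous (fun x : ℝ × ℝ =>
      x.1 • (EuclideanSpace.single 0 1 : E3) + x.2 • (EuclideanSpace.single 2 1 : E3)) := by fun_prop
    simpa using this.tendsto 0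
  obtain ⟨δ, hδ, hδ'⟩ := Metric.eventually_nhds_iff_ball.mp (t.eventually h)
  have hmem : ∀ x z : ℂ, ‖x‖ < ε → ‖z‖ < ε → AnalyticAt ℂ H' (x, z) := by
    intro x z hx hz
    refine hε' (x, z) ?_
    simp [Prod.norm_def, hx, hz]
  have hfreq : ∀ {P : ℂ → Prop} {η : ℝ}, 0 < η → (∀ x : ℝ, x ≠ 0 → |x| < η → P x) →
      ∃ᶠ x in 𝓝[≠] (0 : ℂ), P x := by
    intro P η hη hP
    have hc : Filter.Tendsto (fun x : ℝ => (x : ℂ)) (𝓝[≠] 0) (𝓝[≠] 0) := by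
      refine tendsto_nhdsWithin_iff.mpr ⟨?_, ?_⟩
      · exact (by simpa using Complex.continuous_ofReal.tendsto 0 :
          Filter.Tendsto (fun x : ℝ => (x : ℂ)) (𝓝 0) (𝓝 0)).mono_left nhdsWithin_le_nhds
      · filter_upwards [self_mem_nhdsWithin] with x hx
        simpa using hx
    refine hc.frequently (Filter.Eventually.frequently ?_)
    filter_upwards [self_mem_nhdsWithin, mem_nhdsWithin_of_mem_nhds (Metric.ball_mem_nhds 0 hη)]
      with x hx hx'
    exact hP x hx (by simpa using hx')
  have step1 : ∀ z : ℝ, |z| < min ε δ → ∀ x : ℂ, ‖x‖ < ε → H' (x, z) = 0 := by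
    intro z hz x hx
    have han : AnalyticOnNhd ℂ (fun x => H' (x, (z : ℂ))) (Metric.ball 0 ε) := by
      intro y hy
      refine AnalyticAt.comp (g := H') (f := fun x : ℂ => (x, (z : ℂ)))
        (hmem _ _ (by simpa using hy) (by simpa using hz.trans_le (min_le_left _ _))) ?_
      exact analyticAt_id.prod analyticAt_const
    refine han.eqOn_zero_of_preconnected_of_frequently_eq_zero
      (convex_ball (0 : ℂ) ε).isPreconnected (Metric.mem_ball_self hε) ?_ (by simpa using hx)
    refine hfreq hδ fun x hx hx' => ?_
    have h1 := hδ' (x, z) (by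
      simpa [Prod.norm_def] using ⟨hx', hz.trans_le (min_le_right _ _)⟩)
    have h2 := h1 (by simpa [rhoSq] using hx)
    simp only [H']
    rw [← h2]
    congr 1
    simp [inv, norm_sq_eq, rhoSq]
  have step2 : ∀ x z : ℂ, ‖x‖ < ε → ‖z‖ < ε → H' (x, z) = 0 := by
    intro x z hx hz
    have han : AnalyticOnNhd ℂ (fun z => H' (x, z)) (Metric.ball 0 ε) := by
      intro y hy
      refine AnalyticAt.comp (g := H') (f := fun z : ℂ => (x, z))
        (hmem _ _ hx (by simpa using hy)) ?_
      exact analyticAt_const.prod analyticAt_id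
    refine han.eqOn_zero_of_preconnected_of_frequently_eq_zero
      (convex_ball (0 : ℂ) ε).isPreconnected (Metric.mem_ball_self hε) ?_ (by simpa using hz)
    exact hfreq (lt_min hε hδ) fun z _ hz' => step1 z hz' x hx
  have t3 : Filter.Tendsto (fun w : ℂ × ℂ => w.1 - w.2 ^ 2) (𝓝 0) (𝓝 0) := by
    have : Continuous (fun w : ℂ × ℂ => w.1 - w.2 ^ 2) := by fun_prop
    simpa using this.tendsto 0
  filter_upwards [t3.eventually (Metric.ball_mem_nhds 0 (by positivity : 0 < ε ^ 2)),
    Metric.ball_mem_nhds 0 hε] with w h1 h2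
  -- Every nearby value of (r², z̃) is reached from some complex ρ̃, a square root of r² − z̃².
  obtain ⟨x, hx⟩ := IsAlgClosed.exists_pow_nat_eq (w.1 - w.2 ^ 2) (n := 2) (by norm_num)
  have h4 : ‖x‖ < ε := by
    have : ‖x‖ ^ 2 < ε ^ 2 := by
      rw [← norm_pow x 2, hx]; simpa using h1
    exact lt_of_pow_lt_pow_left₀ 2 hε.le this
  have h5 := step2 x w.2 h4 ((norm_snd_le w).trans_lt (by simpa using h2))
  simp only [H', hx] at h5
  simpa using h5

/-! ### The Ernst equation for formal power series -/

theorem coeff_X_mul (i : Fin 2) (a : PS) (e : Fin 2 →₀ ℕ) :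
    (MvPowerSeries.X i * a).coeff e =
      if e i = 0 then 0 else a.coeff (e - Finsupp.single i 1) := by
  classical
  rw [MvPowerSeries.X_def, MvPowerSeries.coeff_monomial_mul]
  by_cases h : e i = 0
  · simp [h]
  · have : Finsupp.single i 1 ≤ e := by simpa [Nat.one_le_iff_ne_zero] using h
    simp [h, this]

theorem coeff_X_mul_pderiv (i : Fin 2) (a : PS) (e : Fin 2 →₀ ℕ) :
    (MvPowerSeries.X i * MvPowerSeries.pderiv ℂ i a).coeff e = e i * a.coeff e := by
  rw [coeff_X_mul]
  split_ifs with h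
  · simp [h]
  · have : Finsupp.single i 1 ≤ e := by simpa [Nat.one_le_iff_ne_zero] using h
    rw [MvPowerSeries.coeff_pderiv, tsub_add_cancel_of_le this, mul_comm]
    congr 1
    have h2 : (e - Finsupp.single i 1 : Fin 2 →₀ ℕ) i + 1 = e i := by
      simp only [Finsupp.coe_tsub, Pi.sub_apply, Finsupp.single_eq_same]; omega
    exact_mod_cast h2

/-- Weighted degree: `r²` has weight `2`. -/
def wd (e : Fin 2 →₀ ℕ) : ℕ := 2 * e 0 + e 1

/-- Exponents of `r²` and of `z²`. -/
def sq0 : Fin 2 →₀ ℕ := Finsupp.single 0 1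
def sq1 : Fin 2 →₀ ℕ := Finsupp.single 1 2

theorem wd_add (e e' : Fin 2 →₀ ℕ) : wd (e + e') = wd e + wd e' := by simp [wd]; ring
theorem wd_sq0 : wd sq0 = 2 := by simp [wd, sq0]
theorem wd_sq1 : wd sq1 = 2 := by simp [wd, sq1]

theorem C_nat (n : ℕ) [n.AtLeastTwo] : (MvPowerSeries.C (OfNat.ofNat n) : PS) = OfNat.ofNat n :=
  map_ofNat _ n

/-- The Euler operator `ρ̃ ∂_ρ̃ + z̃ ∂_z̃`. -/
def euler (a : PS) : PS := 2 * (MvPowerSeries.X 0 * dS a) + MvPowerSeries.X 1 * d1 a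

theorem coeff_euler (a : PS) (e) : (euler a).coeff e = wd e * a.coeff e := by
  rw [euler, map_add, ← C_two, MvPowerSeries.coeff_C_mul, dS, d1, coeff_X_mul_pderiv,
    coeff_X_mul_pderiv, wd]
  push_cast
  ring

/-- The flat Laplacian. -/
def lap (a : PS) : PS :=
  4 * dS a + 4 * (MvPowerSeries.X 0 - MvPowerSeries.X 1 ^ 2) * dS (dS a) + dZ (dZ a)

theorem d1_dS (a : PS) : d1 (dS a) = dS (d1 a) := by
  ext e
  simp only [d1, dS, MvPowerSeries.coeff_pderiv, add_right_comm e]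
  simp
  ring

theorem dS_X_one : dS (MvPowerSeries.X 1) = 0 := MvPowerSeries.pderiv_X_of_ne (by decide)
theorem dS_X_zero : dS (MvPowerSeries.X 0) = 1 := MvPowerSeries.pderiv_X_self
theorem d1_X_one : d1 (MvPowerSeries.X 1) = 1 := MvPowerSeries.pderiv_X_self
theorem d1_X_zero : d1 (MvPowerSeries.X 0) = 0 := MvPowerSeries.pderiv_X_of_ne (by decide)
theorem dS_two : dS 2 = 0 := by rw [← C_two]; exact MvPowerSeries.pderiv_C
theorem d1_two : d1 2 = 0 := by rw [← C_two]; exact MvPowerSeries.pderiv_C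

theorem lap_eq (a : PS) : lap a = 6 * dS a + 4 * (MvPowerSeries.X 0 * dS (dS a)) +
    4 * (MvPowerSeries.X 1 * d1 (dS a)) + d1 (d1 a) := by
  simp only [lap, dZ, map_add, Derivation.leibniz, smul_eq_mul, dS_X_one, d1_X_one, dS_two, d1_two,
    d1_dS]
  ring

/-- In the variables (r², z̃) the Laplacian lowers the weighted degree `wd` by two and joins only
two coefficients. The factor in front of the one with more powers of r² never vanishes, which is why
the null cone r² = 0 carries free data that determine everything else. -/
theorem coeff_lap (a : PS) (e) : (lap a).coeff e =
    2 * (e 0 + 1) * (2 * e 0 + 2 * e 1 + 3) * a.coeff (e + sq0) +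
      (e 1 + 2) * (e 1 + 1) * a.coeff (e + sq1) := by
  have h : e + Finsupp.single (1 : Fin 2) 1 + Finsupp.single 1 1 = e + sq1 := by
    rw [add_assoc, ← Finsupp.single_add]; rfl
  rw [lap_eq]
  simp only [map_add, ← C_nat, MvPowerSeries.coeff_C_mul]
  rw [dS, d1, coeff_X_mul_pderiv, coeff_X_mul_pderiv]
  simp only [MvPowerSeries.coeff_pderiv, h, sq0]
  simp
  ring

/-- The right-hand side of the Ernst equation, solved for the Laplacian. -/
def ernstRhs (a : PS) : PS :=
  3 * (a * cj a) * (MvPowerSeries.X 0 * lap a) - cj a * (MvPowerSeries.X 0 * lap (a * a)) -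
    2 * (cj a * (a * a)) - 2 * (cj a * euler (a * a))

/-- Trades the squared gradient for Laplacians of a and a². In `ernstRhs` every Laplacian then
carries a factor r², so the right-hand side does not lower weighted degrees. -/
theorem lap_mul_self (a : PS) : lap (a * a) = 2 * a * lap a +
    2 * (4 * (MvPowerSeries.X 0 - MvPowerSeries.X 1 ^ 2) * dS a ^ 2 + dZ a ^ 2) := by
  simp only [lap, dZ, map_add, Derivation.leibniz, smul_eq_mul, dS_X_one, d1_X_one, dS_two, d1_two,
    d1_dS]
  ring

theorem ernst_iff (a : PS) : lap a = ernstRhs a ↔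
    (MvPowerSeries.X 0 * a * cj a - 1) * lap a = 2 * cj a * (a ^ 2 +
      2 * a * (2 * (MvPowerSeries.X 0 - MvPowerSeries.X 1 ^ 2) * dS a + MvPowerSeries.X 1 * dZ a) +
      MvPowerSeries.X 0 *
        (4 * (MvPowerSeries.X 0 - MvPowerSeries.X 1 ^ 2) * dS a ^ 2 + dZ a ^ 2)) := by
  rw [ernstRhs, lap_mul_self]
  simp only [euler, dZ, Derivation.leibniz, smul_eq_mul]
  constructor
  · intro h; linear_combination -h
  · intro h; linear_combination -h

/-! ### Agreement up to a weighted degree -/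

/-- Agreement in weighted degrees below `n`. -/
def Agree (n : ℕ) (a b : PS) : Prop := ∀ e, wd e < n → a.coeff e = b.coeff e

theorem Agree.add {n a b a' b'} (h : Agree n a b) (h' : Agree n a' b') :
    Agree n (a + a') (b + b') := fun e he => by simp [h e he, h' e he]
theorem Agree.sub {n a b a' b'} (h : Agree n a b) (h' : Agree n a' b') :
    Agree n (a - a') (b - b') := fun e he => by simp [h e he, h' e he]
theorem Agree.refl {n a} : Agree n a a := fun _ _ => rfl
theorem Agree.mul {n a b a' b'} (h : Agree n a b) (h' : Agree n a' b') :
    Agree n (a * a') (b * b') := by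
  classical
  intro e he
  rw [MvPowerSeries.coeff_mul, MvPowerSeries.coeff_mul]
  refine Finset.sum_congr rfl fun x hx => ?_
  have h1 := congrArg wd (Finset.HasAntidiagonal.mem_antidiagonal.mp hx)
  rw [wd_add] at h1
  rw [h _ (by omega), h' _ (by omega)]
theorem Agree.cj {n a b} (h : Agree n a b) : Agree n (cj a) (cj b) := fun e he => by
  rw [coeff_cj, coeff_cj, h e he]
theorem Agree.euler {n a b} (h : Agree n a b) : Agree n (euler a) (euler b) := fun e he => by
  rw [coeff_euler, coeff_euler, h e he]

theorem sub_sq0_add {e : Fin 2 →₀ ℕ} (h : e 0 ≠ 0) : e - sq0 + sq0 = e :=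
  tsub_add_cancel_of_le (by simpa [sq0, Nat.one_le_iff_ne_zero] using h)

theorem wd_sub_sq0 {e : Fin 2 →₀ ℕ} (h : e 0 ≠ 0) : wd (e - sq0) + 2 = wd e := by
  conv_rhs => rw [← sub_sq0_add h, wd_add, wd_sq0]

/-- Multiplication by r² restores the two weighted degrees that the Laplacian takes away. -/
theorem Agree.X_mul_lap {n a b} (h : Agree n a b) :
    Agree n (MvPowerSeries.X 0 * lap a) (MvPowerSeries.X 0 * lap b) := fun e he => by
  rw [coeff_X_mul, coeff_X_mul]
  split_ifs with h0
  · rfl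
  · have h1 := wd_sub_sq0 h0
    change (lap a).coeff (e - sq0) = (lap b).coeff (e - sq0)
    rw [coeff_lap, coeff_lap, h _ (by rw [wd_add, wd_sq0]; omega),
      h _ (by rw [wd_add, wd_sq1]; omega)]

theorem Agree.ernstRhs {n a b} (h : Agree n a b) : Agree n (ernstRhs a) (ernstRhs b) :=
  ((((Agree.refl.mul (h.mul h.cj)).mul h.X_mul_lap).sub (h.cj.mul (h.mul h).X_mul_lap)).sub
    (Agree.refl.mul (h.cj.mul (h.mul h)))).sub (Agree.refl.mul (h.cj.mul (h.mul h).euler))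

theorem eq_of_agree {a b : PS} (h : ∀ n, Agree n a b) : a = b := by
  ext e; exact h _ e (Nat.lt_succ_self _)

/-! ### A right inverse of the Laplacian -/

/-- Coefficients of the solution of `lap u = b` without terms independent of `r²`. -/
def lapInvCoeff (b : PS) : ℕ → ℕ → ℂ
  | 0, _ => 0
  | j + 1, k => (b.coeff (ex j k) - (k + 2) * (k + 1) * lapInvCoeff b j (k + 2)) /
      (2 * (j + 1) * (2 * j + 2 * k + 3))

/-- The solution of `lap u = b` without terms independent of `r²`. -/
def lapInv (b : PS) : PS := fun d => lapInvCoeff b (d 0) (d 1)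

theorem coeff_lapInv (b : PS) (e) : (lapInv b).coeff e = lapInvCoeff b (e 0) (e 1) := rfl

theorem coeff_lapInv_of_zero (b : PS) {e : Fin 2 →₀ ℕ} (h : e 0 = 0) : (lapInv b).coeff e = 0 := by
  rw [coeff_lapInv, h, lapInvCoeff]

theorem coeff_lapInv_add_sq0 (b : PS) (e) : (lapInv b).coeff (e + sq0) =
    (b.coeff e - (e 1 + 2) * (e 1 + 1) * (lapInv b).coeff (e + sq1)) /
      (2 * (e 0 + 1) * (2 * e 0 + 2 * e 1 + 3)) := by
  rw [coeff_lapInv, coeff_lapInv]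
  simp [sq0, sq1, lapInvCoeff, ex_eta]

theorem lap_denom_ne_zero (j k : ℕ) : (2 * (j + 1) * (2 * j + 2 * k + 3) : ℂ) ≠ 0 := by
  norm_cast

theorem lap_lapInv (b : PS) : lap (lapInv b) = b := by
  ext e
  rw [coeff_lap, coeff_lapInv_add_sq0]
  have := lap_denom_ne_zero (e 0) (e 1)
  rw [mul_div_cancel₀ _ this]
  exact sub_add_cancel _ _

theorem lap_sub (a b : PS) : lap (a - b) = lap a - lap b := by
  ext e
  simp only [map_sub, coeff_lap]
  ring

theorem eq_zero_of_lap_eq_zero {a : PS} (h : lap a = 0) (h0 : ∀ e, e 0 = 0 → a.coeff e = 0) :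
    a = 0 := by
  have key : ∀ j e, e 0 = j → a.coeff e = 0 := by
    intro j
    induction j with
    | zero => exact h0
    | succ j ih =>
      intro e he
      have h1 := sub_sq0_add (e := e) (by omega)
      have h2 := congrArg (MvPowerSeries.coeff (e - sq0)) h
      rw [coeff_lap, h1, ih (e - sq0 + sq1) (by simp [sq0, sq1, he])] at h2
      rw [mul_zero, add_zero, show (0 : PS).coeff (e - sq0) = 0 from rfl] at h2
      exact (mul_eq_zero.mp h2).resolve_left (lap_denom_ne_zero _ _)
  ext e
  exact key _ e rfl

/-- The gain of two weighted degrees makes a ↦ b + `lapInv (ernstRhs a)` a contraction in the degree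
filtration. This yields both uniqueness and existence of the formal fixed point. -/
theorem Agree.lapInv {n a b} (h : Agree n a b) : Agree (n + 2) (lapInv a) (lapInv b) := by
  have key : ∀ j e, e 0 = j → wd e < n + 2 → (AxiErnst.lapInv a).coeff e =
      (AxiErnst.lapInv b).coeff e := by
    intro j
    induction j with
    | zero => intro e he _; rw [coeff_lapInv_of_zero _ he, coeff_lapInv_of_zero _ he]
    | succ j ih =>
      intro e he hw
      have h1 := sub_sq0_add (e := e) (by omega)
      have h2 := wd_sub_sq0 (e := e) (by omega)
      rw [← h1, coeff_lapInv_add_sq0, coeff_lapInv_add_sq0, h _ (by omega),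
        ih (e - sq0 + sq1) (by simp [sq0, sq1, he]) (by rw [wd_add, wd_sq1]; omega)]
  exact fun e => key _ e rfl

/-- The characteristic initial value problem as a fixed-point equation: the difference of the two
sides is harmonic without terms free of r², hence zero. -/
theorem eq_add_lapInv_of_ernst {a b : PS} (ha : lap a = ernstRhs a) (hb : lap b = 0)
    (h0 : ∀ e, e 0 = 0 → a.coeff e = b.coeff e) : a = b + lapInv (ernstRhs a) := by
  have : a - lapInv (ernstRhs a) - b = 0 := by
    refine eq_zero_of_lap_eq_zero ?_ fun e he => ?_
    · rw [lap_sub, lap_sub, lap_lapInv, hb, ha]; simp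
    · simp [coeff_lapInv_of_zero _ he, h0 e he]
  linear_combination this

theorem eq_of_fixed {a a' b : PS} (h : a = b + lapInv (ernstRhs a))
    (h' : a' = b + lapInv (ernstRhs a')) : a = a' := by
  refine eq_of_agree fun n => ?_
  induction n with
  | zero => intro e he; omega
  | succ n ih =>
    rw [h, h']
    exact Agree.refl.add fun e he => ih.ernstRhs.lapInv e (by omega)

theorem exists_fixed (b : PS) : ∃ a, a = b + lapInv (ernstRhs a) := by
  let F : ℕ → PS := fun n => (fun a => b + lapInv (ernstRhs a))^[n] 0
  have hF : ∀ n, F (n + 1) = b + lapInv (ernstRhs (F n)) := fun n =>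
    Function.iterate_succ_apply' _ n 0
  have hstep : ∀ n, Agree n (F n) (F (n + 1)) := by
    intro n
    induction n with
    | zero => intro e he; omega
    | succ n ih =>
      rw [hF, hF (n + 1)]
      exact Agree.refl.add fun e he => ih.ernstRhs.lapInv e (by omega)
  have hle : ∀ n k, Agree n (F n) (F (n + k)) := by
    intro n k
    induction k with
    | zero => exact Agree.refl
    | succ k ih => exact fun e he => (ih e he).trans (hstep (n + k) e (by omega))
  -- A coefficient of weighted degree d no longer changes after d + 1 iterations.
  let a : PS := fun e => (F (wd e + 1)).coeff e
  have ha : ∀ n, Agree n a (F n) := by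
    intro n e he
    obtain ⟨k, rfl⟩ := Nat.exists_eq_add_of_le (Nat.succ_le_of_lt he)
    exact hle (wd e + 1) k e (Nat.lt_succ_self _)
  refine ⟨a, eq_of_agree fun n e he => ?_⟩
  rw [ha (n + 1) e (by omega), hF]
  exact (Agree.refl.add fun e he => ((ha n).ernstRhs.lapInv e (by omega)).symm :
    Agree n (b + lapInv (ernstRhs (F n))) _) e he

/-! ### Data on the null cone and their harmonic extension -/

/-- The restriction to the null cone `r² = 0`. -/
def nullPart (a : PS) : PS := fun d => if d 0 = 0 then a.coeff d else 0

theorem coeff_nullPart (a : PS) (d) : (nullPart a).coeff d = if d 0 = 0 then a.coeff d else 0 := rfl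

/-- The flat harmonic extension from the null cone. -/
def harmonic (a : PS) : PS := nullPart a - lapInv (lap (nullPart a))

theorem lap_harmonic (a : PS) : lap (harmonic a) = 0 := by
  rw [harmonic, lap_sub, lap_lapInv, sub_self]

theorem coeff_harmonic (a : PS) {e : Fin 2 →₀ ℕ} (h : e 0 = 0) :
    (harmonic a).coeff e = a.coeff e := by
  simp [harmonic, coeff_nullPart, h, coeff_lapInv_of_zero]

theorem ernst_unique {a b : PS} (ha : lap a = ernstRhs a) (hb : lap b = ernstRhs b)
    (h : ∀ e, e 0 = 0 → a.coeff e = b.coeff e) : a = b :=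
  eq_of_fixed (b := harmonic b)
    (eq_add_lapInv_of_ernst ha (lap_harmonic _) fun e he => by rw [h e he, coeff_harmonic _ he])
    (eq_add_lapInv_of_ernst hb (lap_harmonic _) fun e he => by rw [coeff_harmonic _ he])

/-! ### Majorants -/

/-- The exponents of weighted degree below `n`. -/
def below (n : ℕ) : Finset (Fin 2 →₀ ℕ) :=
  ((Finset.range n ×ˢ Finset.range n).map exEquiv.toEmbedding).filter fun e => wd e < n

theorem mem_below {n : ℕ} {e : Fin 2 →₀ ℕ} : e ∈ below n ↔ wd e < n := by
  simp only [below, Finset.mem_filter, Finset.mem_map, Finset.mem_product, Finset.mem_range,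
    and_iff_right_iff_imp]
  intro h
  refine ⟨(e 0, e 1), ⟨?_, ?_⟩, ex_eta e⟩ <;> simp only [wd] at h <;> dsimp only <;> omega

/-- The weight of an exponent. -/
def wt (r : ℝ) (e : Fin 2 →₀ ℕ) : ℝ := r ^ wd e / ((e 0 + e 1 / 2).choose (e 0) : ℕ)

theorem wt_nonneg {r : ℝ} (hr : 0 ≤ r) (e) : 0 ≤ wt r e := by unfold wt; positivity

theorem choose_pos (e : Fin 2 →₀ ℕ) : 0 < (e 0 + e 1 / 2).choose (e 0) :=
  Nat.choose_pos (Nat.le_add_right _ _)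

/-- One term of Vandermonde's identity, combined with ⌊k/2⌋ + ⌊k′/2⌋ ≤ ⌊(k + k′)/2⌋. This
submultiplicativity makes the truncated norms compatible with products. -/
theorem wt_add_le {r : ℝ} (hr : 0 ≤ r) (e e') : wt r (e + e') ≤ wt r e * wt r e' := by
  have h : (e 0 + e 1 / 2).choose (e 0) * (e' 0 + e' 1 / 2).choose (e' 0) ≤
      ((e + e') 0 + (e + e') 1 / 2).choose ((e + e') 0) := by
    have h1 : (e 0 + e 1 / 2 + (e' 0 + e' 1 / 2)).choose (e 0 + e' 0) ≤
        ((e + e') 0 + (e + e') 1 / 2).choose ((e + e') 0) := by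
      refine Nat.choose_le_choose _ ?_
      simp only [Finsupp.add_apply]
      omega
    refine le_trans ?_ h1
    rw [Nat.add_choose_eq (e 0 + e 1 / 2)]
    exact Finset.single_le_sum (f := fun ij : ℕ × ℕ =>
      (e 0 + e 1 / 2).choose ij.1 * (e' 0 + e' 1 / 2).choose ij.2) (fun _ _ => Nat.zero_le _)
      (Finset.HasAntidiagonal.mem_antidiagonal.mpr (rfl : (e 0, e' 0).1 + (e 0, e' 0).2 = _))
  have h1 := choose_pos e
  have h2 := choose_pos e'
  rw [wt, wt, wt, wd_add, pow_add, div_mul_div_comm]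
  refine div_le_div_of_nonneg_left (by positivity) (by positivity) (by exact_mod_cast h)

/-- The binomial coefficient in `wt` is there for this rule and the next: the two exponents that
meet in `coeff_lap` receive weights in the ratio (j + 1) : (⌊k/2⌋ + 1), which compensates the growth
of (k + 2)(k + 1) in the recursion for `lapInv`. -/
theorem wt_add_sq0 (r : ℝ) (e) : wt r (e + sq0) =
    (e 0 + 1) * (r ^ 2 * wt r e / (e 0 + (e 1 / 2 : ℕ) + 1)) := by
  have h1 := choose_pos e
  have h2 : ((e 0 + e 1 / 2 + 1).choose (e 0 + 1) * (e 0 + 1) : ℕ) =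
      (e 0 + e 1 / 2 + 1) * (e 0 + e 1 / 2).choose (e 0) :=
    (Nat.add_one_mul_choose_eq _ _).symm
  have h3 : 0 < (e 0 + e 1 / 2 + 1).choose (e 0 + 1) := Nat.choose_pos (by omega)
  have h2' : (((e 0 + e 1 / 2 + 1).choose (e 0 + 1) : ℕ) * (e 0 + 1) : ℝ) =
      (e 0 + (e 1 / 2 : ℕ) + 1) * ((e 0 + e 1 / 2).choose (e 0) : ℕ) := by exact_mod_cast h2
  have h4 : (e + sq0) 0 + (e + sq0) 1 / 2 = e 0 + e 1 / 2 + 1 := by simp [sq0]; omega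
  have h5 : (e + sq0) 0 = e 0 + 1 := by simp [sq0]
  rw [wt, h4, h5, wd_add, wd_sq0, wt, pow_add]
  have h1' : (((e 0 + e 1 / 2).choose (e 0) : ℕ) : ℝ) ≠ 0 := by positivity
  have h3' : (((e 0 + e 1 / 2 + 1).choose (e 0 + 1) : ℕ) : ℝ) ≠ 0 := by positivity
  have h6 : ((e 0 : ℝ) + (e 1 / 2 : ℕ) + 1) ≠ 0 := by positivity
  field_simp
  linear_combination (-(r ^ 2 * r ^ wd e)) * h2'

theorem wt_add_sq1 (r : ℝ) (e) : wt r (e + sq1) =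
    ((e 1 / 2 : ℕ) + 1) * (r ^ 2 * wt r e / (e 0 + (e 1 / 2 : ℕ) + 1)) := by
  have h1 := choose_pos e
  have h2 := Nat.add_one_mul_choose_eq (e 0 + e 1 / 2) (e 1 / 2)
  rw [Nat.choose_symm_of_eq_add (show e 0 + e 1 / 2 = e 1 / 2 + e 0 by omega),
    Nat.choose_symm_of_eq_add (show e 0 + e 1 / 2 + 1 = (e 1 / 2 + 1) + e 0 by omega)] at h2
  have h3 : 0 < (e 0 + e 1 / 2 + 1).choose (e 0) := Nat.choose_pos (by omega)
  have h2' : (((e 0 + e 1 / 2 + 1).choose (e 0) : ℕ) * ((e 1 / 2 : ℕ) + 1) : ℝ) =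
      (e 0 + (e 1 / 2 : ℕ) + 1) * ((e 0 + e 1 / 2).choose (e 0) : ℕ) := by exact_mod_cast h2.symm
  have h4 : (e + sq1) 0 + (e + sq1) 1 / 2 = e 0 + e 1 / 2 + 1 := by simp [sq1]; omega
  have h5 : (e + sq1) 0 = e 0 := by simp [sq1]
  rw [wt, h4, h5, wd_add, wd_sq1, wt, pow_add]
  have h1' : (((e 0 + e 1 / 2).choose (e 0) : ℕ) : ℝ) ≠ 0 := by positivity
  have h3' : (((e 0 + e 1 / 2 + 1).choose (e 0) : ℕ) : ℝ) ≠ 0 := by positivity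
  have h6 : ((e 0 : ℝ) + (e 1 / 2 : ℕ) + 1) ≠ 0 := by positivity
  field_simp
  linear_combination (-(r ^ 2 * r ^ wd e)) * h2'

/-- A truncated weighted norm. -/
def tnorm (v : (Fin 2 →₀ ℕ) → ℝ) (n : ℕ) (a : PS) : ℝ := ∑ e ∈ below n, ‖a.coeff e‖ * v e

section
variable {v v' : (Fin 2 →₀ ℕ) → ℝ} (n : ℕ) (a b : PS)

theorem tnorm_nonneg (hv : ∀ e, 0 ≤ v e) : 0 ≤ tnorm v n a :=
  Finset.sum_nonneg fun e _ => mul_nonneg (norm_nonneg _) (hv e)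

theorem tnorm_mono_weight (h : ∀ e, v e ≤ v' e) : tnorm v n a ≤ tnorm v' n a :=
  Finset.sum_le_sum fun e _ => mul_le_mul_of_nonneg_left (h e) (norm_nonneg _)

theorem tnorm_add_le (hv : ∀ e, 0 ≤ v e) : tnorm v n (a + b) ≤ tnorm v n a + tnorm v n b := by
  rw [tnorm, tnorm, tnorm, ← Finset.sum_add_distrib]
  refine Finset.sum_le_sum fun e _ => ?_
  rw [← add_mul, map_add]
  exact mul_le_mul_of_nonneg_right (norm_add_le _ _) (hv e)

theorem tnorm_neg : tnorm v n (-a) = tnorm v n a := by simp [tnorm]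

theorem tnorm_sub_le (hv : ∀ e, 0 ≤ v e) : tnorm v n (a - b) ≤ tnorm v n a + tnorm v n b := by
  have := tnorm_add_le n a (-b) hv
  rwa [tnorm_neg, ← sub_eq_add_neg] at this

theorem tnorm_C_mul (k : ℂ) : tnorm v n (MvPowerSeries.C k * a) = ‖k‖ * tnorm v n a := by
  rw [tnorm, tnorm, Finset.mul_sum]
  refine Finset.sum_congr rfl fun e _ => ?_
  rw [MvPowerSeries.coeff_C_mul, norm_mul, mul_assoc]

theorem tnorm_cj : tnorm v n (cj a) = tnorm v n a :=
  Finset.sum_congr rfl fun e _ => by rw [coeff_cj, RCLike.norm_conj]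

/-- Weighted degree is additive, so both factors of a term below the truncation lie below it too; no
convergence is needed. -/
theorem tnorm_mul_le {v₁ v₂ : (Fin 2 →₀ ℕ) → ℝ} (h₁ : ∀ e, 0 ≤ v₁ e) (h₂ : ∀ e, 0 ≤ v₂ e)
    (hv : ∀ e, 0 ≤ v e) (h : ∀ e e', v (e + e') ≤ v₁ e * v₂ e') :
    tnorm v n (a * b) ≤ tnorm v₁ n a * tnorm v₂ n b := by
  classical
  let T : (Fin 2 →₀ ℕ) × (Fin 2 →₀ ℕ) → ℝ := fun x =>
    (‖a.coeff x.1‖ * v₁ x.1) * (‖b.coeff x.2‖ * v₂ x.2)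
  have hT : ∀ x, 0 ≤ T x := fun x =>
    mul_nonneg (mul_nonneg (norm_nonneg _) (h₁ _)) (mul_nonneg (norm_nonneg _) (h₂ _))
  calc tnorm v n (a * b)
      ≤ ∑ e ∈ below n, ∑ x ∈ Finset.HasAntidiagonal.antidiagonal e, T x := by
        refine Finset.sum_le_sum fun e _ => ?_
        rw [MvPowerSeries.coeff_mul]
        refine (mul_le_mul_of_nonneg_right (norm_sum_le _ _) (hv e)).trans ?_
        rw [Finset.sum_mul]
        refine Finset.sum_le_sum fun x hx => ?_
        rw [norm_mul, ← Finset.HasAntidiagonal.mem_antidiagonal.mp hx]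
        calc ‖a.coeff x.1‖ * ‖b.coeff x.2‖ * v (x.1 + x.2)
            ≤ ‖a.coeff x.1‖ * ‖b.coeff x.2‖ * (v₁ x.1 * v₂ x.2) := by
              gcongr; exact h _ _
          _ = T x := by simp only [T]; ring
    _ ≤ ∑ x ∈ below n ×ˢ below n, T x := by
        rw [← Finset.sum_biUnion]
        · refine Finset.sum_le_sum_of_subset_of_nonneg (fun x hx => ?_) fun x _ _ => hT x
          obtain ⟨e, he, hx⟩ := Finset.mem_biUnion.mp hx
          have h1 := congrArg wd (Finset.HasAntidiagonal.mem_antidiagonal.mp hx)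
          rw [wd_add] at h1
          rw [mem_below] at he
          rw [Finset.mem_product, mem_below, mem_below]
          omega
        · intro e _ e' _ hee
          refine Finset.disjoint_left.mpr fun x hx hx' => hee ?_
          rw [← Finset.HasAntidiagonal.mem_antidiagonal.mp hx,
            Finset.HasAntidiagonal.mem_antidiagonal.mp hx']
    _ = _ := by
        rw [tnorm, tnorm, Finset.sum_mul_sum, Finset.sum_product]

end

theorem sum_shift_le {s : Fin 2 →₀ ℕ} (hs : wd s = 2) (n : ℕ) {g : (Fin 2 →₀ ℕ) → ℝ}
    (hg : ∀ e, 0 ≤ g e) : ∑ e ∈ below (n - 2), g (e + s) ≤ ∑ e ∈ below n, g e := by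
  classical
  have : ∑ e ∈ below (n - 2), g (e + s) = ∑ e ∈ (below (n - 2)).map (addRightEmbedding s), g e := by
    rw [Finset.sum_map]; rfl
  rw [this]
  refine Finset.sum_le_sum_of_subset_of_nonneg (fun e he => ?_) fun e _ _ => hg e
  obtain ⟨e', he', rfl⟩ := Finset.mem_map.mp he
  rw [mem_below] at he' ⊢
  rw [addRightEmbedding_apply, wd_add, hs]
  omega

theorem sum_shift_sq0 (n : ℕ) {g : (Fin 2 →₀ ℕ) → ℝ} (hg : ∀ e, e 0 = 0 → g e = 0) :
    ∑ e ∈ below n, g e = ∑ e ∈ below (n - 2), g (e + sq0) := by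
  classical
  have : ∑ e ∈ below (n - 2), g (e + sq0) =
      ∑ e ∈ (below (n - 2)).map (addRightEmbedding sq0), g e := by
    rw [Finset.sum_map]; rfl
  rw [this]
  symm
  refine Finset.sum_subset (fun e he => ?_) fun e he he' => ?_
  · obtain ⟨e', he', rfl⟩ := Finset.mem_map.mp he
    rw [mem_below] at he' ⊢
    rw [addRightEmbedding_apply, wd_add, wd_sq0]
    omega
  · by_contra h
    have h0 : e 0 ≠ 0 := fun h0 => h (hg e h0)
    refine he' (Finset.mem_map.mpr ⟨e - sq0, ?_, sub_sq0_add h0⟩)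
    have := wd_sub_sq0 h0
    rw [mem_below] at he ⊢
    omega

theorem half_le (k : ℕ) : (k : ℝ) + 1 ≤ 2 * ((k / 2 : ℕ) + 1) := by
  have : k + 1 ≤ 2 * (k / 2 + 1) := by omega
  exact_mod_cast this

/-- The weight adapted to second derivatives. -/
def wt2 (r : ℝ) (e : Fin 2 →₀ ℕ) : ℝ := wt r e / (wd e + 1) ^ 2

section
variable {r : ℝ} (hr : 0 ≤ r) (n : ℕ)
include hr

theorem wt2_nonneg (e) : 0 ≤ wt2 r e := div_nonneg (wt_nonneg hr e) (by positivity)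

theorem wt2_le (e) : wt2 r e ≤ wt r e := by
  refine div_le_self (wt_nonneg hr e) ?_
  have : (0 : ℝ) ≤ wd e := by positivity
  nlinarith

/-- The factor (wd + 1)⁻² decreases with the degree, so in a product it may be charged to a single
factor, the one that contains the derivatives. -/
theorem wt2_add_le (e e') : wt2 r (e + e') ≤ wt r e * wt2 r e' := by
  rw [wt2, wt2, ← mul_div_assoc]
  refine div_le_div₀ (mul_nonneg (wt_nonneg hr _) (wt_nonneg hr _)) (wt_add_le hr e e')
    (by positivity) ?_
  rw [wd_add]
  push_cast
  have : (0 : ℝ) ≤ wd e := by positivity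
  have : (0 : ℝ) ≤ wd e' := by positivity
  gcongr
  linarith

theorem tnorm_mul (a b) : tnorm (wt r) n (a * b) ≤ tnorm (wt r) n a * tnorm (wt r) n b :=
  tnorm_mul_le n a b (wt_nonneg hr) (wt_nonneg hr) (wt_nonneg hr) (wt_add_le hr)

theorem tnorm_mul' (a b) : tnorm (wt2 r) n (a * b) ≤ tnorm (wt r) n a * tnorm (wt2 r) n b :=
  tnorm_mul_le n a b (wt_nonneg hr) (wt2_nonneg hr) (wt2_nonneg hr) (wt2_add_le hr)

theorem tnorm_euler_le (a) : tnorm (wt2 r) n (euler a) ≤ tnorm (wt r) n a := by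
  refine Finset.sum_le_sum fun e _ => ?_
  rw [coeff_euler, norm_mul, Complex.norm_natCast, wt2]
  have h : (0 : ℝ) ≤ wd e := by positivity
  have h2 : (wd e : ℝ) / (wd e + 1) ^ 2 ≤ 1 := by
    rw [div_le_one (by positivity)]; nlinarith
  calc _ = ‖a.coeff e‖ * wt r e * ((wd e : ℝ) / (wd e + 1) ^ 2) := by ring
    _ ≤ _ := mul_le_of_le_one_right (mul_nonneg (norm_nonneg _) (wt_nonneg hr e)) h2

theorem tnorm_X_mul_lap_le (a) :
    tnorm (wt2 r) n (MvPowerSeries.X 0 * lap a) ≤ 3 * tnorm (wt r) n a := by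
  have h0 : tnorm (wt2 r) n (MvPowerSeries.X 0 * lap a) =
      ∑ e ∈ below (n - 2), ‖(lap a).coeff e‖ * wt2 r (e + sq0) := by
    rw [tnorm, sum_shift_sq0]
    · refine Finset.sum_congr rfl fun e _ => ?_
      rw [coeff_X_mul, if_neg (by simp [sq0])]
      change ‖(lap a).coeff (e + sq0 - sq0)‖ * _ = _
      rw [add_tsub_cancel_right]
    · intro e he
      rw [coeff_X_mul, if_pos he]; simp
  -- The factor (wd + 1)⁻² in `wt2` pays for the two derivatives. The two coefficients in the
  -- Laplacian contribute 2 and 1, whence the constant 3.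
  have h1 : ∀ e, ‖(lap a).coeff e‖ * wt2 r (e + sq0) ≤
      2 * (‖a.coeff (e + sq0)‖ * wt r (e + sq0)) + ‖a.coeff (e + sq1)‖ * wt r (e + sq1) := by
    intro e
    have hW : 0 ≤ r ^ 2 * wt r e / (e 0 + (e 1 / 2 : ℕ) + 1) :=
      div_nonneg (mul_nonneg (by positivity) (wt_nonneg hr e)) (by positivity)
    rw [wt2, wt_add_sq0, wt_add_sq1, coeff_lap, wd_add, wd_sq0, wd]
    set W := r ^ 2 * wt r e / (e 0 + (e 1 / 2 : ℕ) + 1)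
    have hn : ‖2 * ((e 0 : ℂ) + 1) * (2 * e 0 + 2 * e 1 + 3) * a.coeff (e + sq0) +
        (e 1 + 2) * (e 1 + 1) * a.coeff (e + sq1)‖ ≤
        2 * ((e 0 : ℝ) + 1) * (2 * e 0 + 2 * e 1 + 3) * ‖a.coeff (e + sq0)‖ +
        (e 1 + 2) * (e 1 + 1) * ‖a.coeff (e + sq1)‖ := by
      refine (norm_add_le _ _).trans (le_of_eq ?_)
      rw [norm_mul _ (a.coeff (e + sq0)), norm_mul _ (a.coeff (e + sq1))]
      congr 2
      · rw [show (2 * ((e 0 : ℂ) + 1) * (2 * e 0 + 2 * e 1 + 3)) =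
          ((2 * (e 0 + 1) * (2 * e 0 + 2 * e 1 + 3) : ℕ) : ℂ) by push_cast; ring,
          Complex.norm_natCast]
        push_cast; ring
      · rw [show (((e 1 : ℂ) + 2) * (e 1 + 1)) = (((e 1 + 2) * (e 1 + 1) : ℕ) : ℂ) by
          push_cast; ring, Complex.norm_natCast]
        push_cast; ring
    have hj : (0 : ℝ) ≤ e 0 := by positivity
    have hk : (0 : ℝ) ≤ e 1 := by positivity
    have hl : (0 : ℝ) ≤ (e 1 / 2 : ℕ) := by positivity
    have hl2 := half_le (e 1)
    set j : ℝ := ((e 0 : ℕ) : ℝ)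
    set k : ℝ := ((e 1 : ℕ) : ℝ)
    set l : ℝ := ((e 1 / 2 : ℕ) : ℝ)
    set x := ‖a.coeff (e + sq0)‖
    set y := ‖a.coeff (e + sq1)‖
    have hx : 0 ≤ x := norm_nonneg _
    have hy : 0 ≤ y := norm_nonneg _
    push_cast
    rw [← mul_div_assoc, div_le_iff₀ (by positivity)]
    refine (mul_le_mul_of_nonneg_right hn (by positivity)).trans ?_
    have e1 : 2 * (j + 1) * (2 * j + 2 * k + 3) ≤ 2 * (2 * j + k + 2 + 1) ^ 2 := by nlinarith
    have e2 : (k + 2) * (k + 1) * (j + 1) ≤ (l + 1) * (2 * j + k + 2 + 1) ^ 2 := by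
      have : (k + 1) * ((k + 2) * (j + 1)) ≤ 2 * (l + 1) * ((k + 2) * (j + 1)) := by gcongr
      have : (k + 2) * (2 * (j + 1)) ≤ (2 * j + k + 2 + 1) ^ 2 := by nlinarith
      nlinarith
    have e3 := mul_le_mul_of_nonneg_right e1 (show 0 ≤ x * ((j + 1) * W) by positivity)
    have e4 := mul_le_mul_of_nonneg_right e2 (show 0 ≤ y * W by positivity)
    nlinarith
  rw [h0]
  refine (Finset.sum_le_sum fun e _ => h1 e).trans ?_
  rw [Finset.sum_add_distrib, ← Finset.mul_sum]
  have g := fun e => mul_nonneg (norm_nonneg (a.coeff e)) (wt_nonneg hr e)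
  have h2 := sum_shift_le wd_sq0 n g
  have h3 := sum_shift_le wd_sq1 n g
  change _ ≤ 3 * ∑ e ∈ below n, ‖a.coeff e‖ * wt r e
  linarith

/-- The recursion bounds the norm N of the solution by r² times that of the right-hand side plus
(2/3) N, since after weighting the second term of the recursion has a coefficient at most 2/3.
Absorbing it gives the factor 3; truncation keeps N finite, so the absorption is legitimate. -/
theorem tnorm_lapInv_le (b) :
    tnorm (wt r) n (lapInv b) ≤ 3 * r ^ 2 * tnorm (wt2 r) (n - 2) b := by
  have h0 : tnorm (wt r) n (lapInv b) =
      ∑ e ∈ below (n - 2), ‖(lapInv b).coeff (e + sq0)‖ * wt r (e + sq0) := by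
    rw [tnorm, sum_shift_sq0]
    intro e he
    rw [coeff_lapInv_of_zero _ he]; simp
  have h1 : ∀ e, ‖(lapInv b).coeff (e + sq0)‖ * wt r (e + sq0) ≤
      r ^ 2 * (‖b.coeff e‖ * wt2 r e) +
        2 / 3 * (‖(lapInv b).coeff (e + sq1)‖ * wt r (e + sq1)) := by
    intro e
    have hw := wt_nonneg hr e
    rw [wt2, wt_add_sq0, wt_add_sq1, coeff_lapInv_add_sq0, norm_div, wd]
    have hn : ‖b.coeff e - ((e 1 : ℂ) + 2) * (e 1 + 1) * (lapInv b).coeff (e + sq1)‖ ≤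
        ‖b.coeff e‖ + ((e 1 : ℝ) + 2) * (e 1 + 1) * ‖(lapInv b).coeff (e + sq1)‖ := by
      refine (norm_sub_le _ _).trans (le_of_eq ?_)
      rw [norm_mul _ ((lapInv b).coeff (e + sq1)),
        show (((e 1 : ℂ) + 2) * (e 1 + 1)) = (((e 1 + 2) * (e 1 + 1) : ℕ) : ℂ) by
          push_cast; ring, Complex.norm_natCast]
      push_cast; ring
    have hd : ‖2 * ((e 0 : ℂ) + 1) * (2 * e 0 + 2 * e 1 + 3)‖ =
        2 * ((e 0 : ℝ) + 1) * (2 * e 0 + 2 * e 1 + 3) := by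
      rw [show (2 * ((e 0 : ℂ) + 1) * (2 * e 0 + 2 * e 1 + 3)) =
          ((2 * (e 0 + 1) * (2 * e 0 + 2 * e 1 + 3) : ℕ) : ℂ) by push_cast; ring,
          Complex.norm_natCast]
      push_cast; ring
    rw [hd]
    have hj : (0 : ℝ) ≤ e 0 := by positivity
    have hk : (0 : ℝ) ≤ e 1 := by positivity
    have hl : (0 : ℝ) ≤ (e 1 / 2 : ℕ) := by positivity
    have hl2 := half_le (e 1)
    push_cast
    set j : ℝ := ((e 0 : ℕ) : ℝ)
    set k : ℝ := ((e 1 : ℕ) : ℝ)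
    set l : ℝ := ((e 1 / 2 : ℕ) : ℝ)
    set x := ‖b.coeff e‖
    set y := ‖(lapInv b).coeff (e + sq1)‖
    have hx : 0 ≤ x := norm_nonneg _
    have hy : 0 ≤ y := norm_nonneg _
    set w := wt r e
    have hW : 0 ≤ r ^ 2 * w / (j + l + 1) := by positivity
    calc _ ≤ (x + (k + 2) * (k + 1) * y) / (2 * (j + 1) * (2 * j + 2 * k + 3)) *
          ((j + 1) * (r ^ 2 * w / (j + l + 1))) := by gcongr
      _ = r ^ 2 * (x * w) * (1 / (2 * (j + l + 1) * (2 * j + 2 * k + 3))) +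
          (k + 2) * (k + 1) / (2 * (2 * j + 2 * k + 3) * (l + 1)) *
            (y * ((l + 1) * (r ^ 2 * w / (j + l + 1)))) := by
        field_simp
      _ ≤ r ^ 2 * (x * w) * (1 / (2 * j + k + 1) ^ 2) +
          2 / 3 * (y * ((l + 1) * (r ^ 2 * w / (j + l + 1)))) := by
        gcongr ?_ + ?_
        · refine mul_le_mul_of_nonneg_left ?_ (by positivity)
          refine one_div_le_one_div_of_le (by positivity) ?_
          nlinarith
        · refine mul_le_mul_of_nonneg_right ?_ (by positivity)
          rw [div_le_div_iff₀ (by positivity) (by norm_num)]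
          have e1 : (k + 1) * (3 * (k + 2)) ≤ 2 * (l + 1) * (3 * (k + 2)) := by gcongr
          have e2 : (l + 1) * (3 * (k + 2)) ≤ (l + 1) * (2 * (2 * j + 2 * k + 3)) :=
            mul_le_mul_of_nonneg_left (by linarith) (by positivity)
          nlinarith
      _ = _ := by ring
  have h2 := sum_shift_le wd_sq1 n
    fun e => mul_nonneg (norm_nonneg ((lapInv b).coeff e)) (wt_nonneg hr e)
  have h3 := Finset.sum_le_sum fun e (_ : e ∈ below (n - 2)) => h1 e
  rw [Finset.sum_add_distrib, ← Finset.mul_sum, ← Finset.mul_sum, ← h0] at h3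
  change _ ≤ tnorm (wt r) n (lapInv b) at h2
  change _ ≤ r ^ 2 * tnorm (wt2 r) (n - 2) b + _ at h3
  linarith

/-- All four terms are cubic and conjugation preserves the norm; they contribute 9, 3, 2 and 2. -/
theorem tnorm_ernstRhs_le (a) :
    tnorm (wt2 r) n (ernstRhs a) ≤ 16 * tnorm (wt r) n a ^ 3 := by
  have p2 := wt2_nonneg hr
  set N := tnorm (wt r) n a with hN
  have hN0 : 0 ≤ N := tnorm_nonneg n a (wt_nonneg hr)
  have haa : tnorm (wt r) n (a * a) ≤ N ^ 2 := by
    rw [sq]; exact tnorm_mul hr n a a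
  have hac : tnorm (wt r) n (a * cj a) ≤ N ^ 2 := by
    have := tnorm_mul hr n a (cj a)
    rwa [tnorm_cj, ← sq] at this
  have h3 : tnorm (wt2 r) n (3 * (a * cj a) * (MvPowerSeries.X 0 * lap a)) ≤ 9 * N ^ 3 := by
    rw [mul_assoc, ← C_nat, tnorm_C_mul]
    have h1 := tnorm_mul' hr n (a * cj a) (MvPowerSeries.X 0 * lap a)
    have h2 := tnorm_X_mul_lap_le hr n a
    have h4 : tnorm (wt r) n (a * cj a) * tnorm (wt2 r) n (MvPowerSeries.X 0 * lap a) ≤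
        N ^ 2 * (3 * N) := mul_le_mul hac h2 (tnorm_nonneg n _ p2) (by positivity)
    norm_num
    nlinarith
  have h4 : tnorm (wt2 r) n (cj a * (MvPowerSeries.X 0 * lap (a * a))) ≤ 3 * N ^ 3 := by
    have h1 := tnorm_mul' hr n (cj a) (MvPowerSeries.X 0 * lap (a * a))
    have h2 := tnorm_X_mul_lap_le hr n (a * a)
    rw [tnorm_cj] at h1
    have h4 : N * tnorm (wt2 r) n (MvPowerSeries.X 0 * lap (a * a)) ≤ N * (3 * N ^ 2) := by
      gcongr; linarith
    nlinarith
  have h5 : tnorm (wt2 r) n (2 * (cj a * (a * a))) ≤ 2 * N ^ 3 := by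
    rw [← C_nat, tnorm_C_mul]
    have h1 := tnorm_mul' hr n (cj a) (a * a)
    have h2 := tnorm_mono_weight n (a * a) (wt2_le hr)
    rw [tnorm_cj] at h1
    have h4 : N * tnorm (wt2 r) n (a * a) ≤ N * N ^ 2 := by gcongr; linarith
    norm_num
    nlinarith
  have h6 : tnorm (wt2 r) n (2 * (cj a * euler (a * a))) ≤ 2 * N ^ 3 := by
    rw [← C_nat, tnorm_C_mul]
    have h1 := tnorm_mul' hr n (cj a) (euler (a * a))
    have h2 := tnorm_euler_le hr n (a * a)
    rw [tnorm_cj] at h1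
    have h4 : N * tnorm (wt2 r) n (euler (a * a)) ≤ N * N ^ 2 := by gcongr; linarith
    norm_num
    nlinarith
  have k1 := tnorm_sub_le n (3 * (a * cj a) * (MvPowerSeries.X 0 * lap a) -
    cj a * (MvPowerSeries.X 0 * lap (a * a)) - 2 * (cj a * (a * a)))
    (2 * (cj a * euler (a * a))) p2
  have k2 := tnorm_sub_le n (3 * (a * cj a) * (MvPowerSeries.X 0 * lap a) -
    cj a * (MvPowerSeries.X 0 * lap (a * a))) (2 * (cj a * (a * a))) p2
  have k3 := tnorm_sub_le n (3 * (a * cj a) * (MvPowerSeries.X 0 * lap a))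
    (cj a * (MvPowerSeries.X 0 * lap (a * a))) p2
  rw [ernstRhs]
  linarith

theorem tnorm_harmonic_le (a) :
    tnorm (wt r) n (harmonic a) ≤ 7 * tnorm (wt r) n (nullPart a) := by
  have h1 := tnorm_sub_le n (nullPart a) (lapInv (lap (nullPart a))) (wt_nonneg hr)
  have h2 := tnorm_lapInv_le hr n (lap (nullPart a))
  -- Only exponents without r² contribute, and there (k + 2)(k + 1) ≤ 2 (k + 1)². With the factor 3
  -- from `tnorm_lapInv_le` the final constant is 7 = 1 + 3 · 2.
  have h3 : r ^ 2 * tnorm (wt2 r) (n - 2) (lap (nullPart a)) ≤ 2 * tnorm (wt r) n (nullPart a) := by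
    have h4 : ∀ e, r ^ 2 * (‖(lap (nullPart a)).coeff e‖ * wt2 r e) ≤
        2 * (‖(nullPart a).coeff (e + sq1)‖ * wt r (e + sq1)) := by
      intro e
      have hw := wt_nonneg hr
      rw [coeff_lap, coeff_nullPart, if_neg (by simp [sq0]), mul_zero, zero_add]
      by_cases he : e 0 = 0
      · rw [wt2, wt_add_sq1, wd, he, norm_mul,
          show (((e 1 : ℂ) + 2) * (e 1 + 1)) = (((e 1 + 2) * (e 1 + 1) : ℕ) : ℂ) by
            push_cast; ring, Complex.norm_natCast]
        have hl : (0 : ℝ) ≤ (e 1 / 2 : ℕ) := by positivity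
        have hk : (0 : ℝ) ≤ e 1 := by positivity
        push_cast
        set k : ℝ := ((e 1 : ℕ) : ℝ)
        set l : ℝ := ((e 1 / 2 : ℕ) : ℝ)
        set x := ‖(nullPart a).coeff (e + sq1)‖
        have hx : 0 ≤ x := norm_nonneg _
        have hwe := hw e
        have e1 : (k + 2) * (k + 1) / (2 * 0 + k + 1) ^ 2 ≤ 2 := by
          rw [div_le_iff₀ (by positivity)]; nlinarith
        calc _ = (k + 2) * (k + 1) / (2 * 0 + k + 1) ^ 2 * (x * (r ^ 2 * wt r e)) := by ring
          _ ≤ 2 * (x * (r ^ 2 * wt r e)) := by gcongr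
          _ = _ := by field_simp; ring
      · rw [coeff_nullPart, if_neg (by simp [sq1, he])]
        simp
    have h5 := Finset.sum_le_sum fun e (_ : e ∈ below (n - 2)) => h4 e
    rw [← Finset.mul_sum, ← Finset.mul_sum] at h5
    have h6 := sum_shift_le wd_sq1 n
      fun e => mul_nonneg (norm_nonneg ((nullPart a).coeff e)) (wt_nonneg hr e)
    change r ^ 2 * tnorm (wt2 r) (n - 2) (lap (nullPart a)) ≤ _ at h5
    change _ ≤ tnorm (wt r) n (nullPart a) at h6
    linarith
  rw [harmonic]
  linarith

end

/-- The weights are bounded below by a geometric sequence: the binomial coefficient is at most 2 to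
the power `deg`, and r ≤ 1 turns `wd ≤ 2 * deg` into a lower bound for the power of r. -/
theorem conv_of_tnorm {a : PS} {r M : ℝ} (hr : 0 < r) (hr1 : r ≤ 1)
    (h : ∀ n, tnorm (wt r) n a ≤ M) : Conv a := by
  refine conv_of_bound (C := M) (A := 2 / r ^ 2) (by positivity) fun e => ?_
  have h1 : ‖a.coeff e‖ * wt r e ≤ M :=
    (Finset.single_le_sum (f := fun e => ‖a.coeff e‖ * wt r e)
      (fun e _ => mul_nonneg (norm_nonneg _) (wt_nonneg hr.le e))
      (mem_below.mpr (Nat.lt_succ_self (wd e)))).trans (h _)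
  have hc := choose_pos e
  have h2 : (((e 0 + e 1 / 2).choose (e 0) : ℕ) : ℝ) ≤ 2 ^ deg e := by
    have h3 : (e 0 + e 1 / 2).choose (e 0) ≤ 2 ^ deg e :=
      (Nat.choose_le_two_pow _ _).trans (Nat.pow_le_pow_right (by norm_num) (by unfold deg; omega))
    exact_mod_cast h3
  have hM : 0 ≤ M := le_trans (mul_nonneg (norm_nonneg _) (wt_nonneg hr.le e)) h1
  have h3 : (r ^ 2) ^ deg e ≤ r ^ wd e := by
    rw [← pow_mul]
    exact pow_le_pow_of_le_one hr.le hr1 (by unfold wd deg; omega)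
  rw [wt, ← mul_div_assoc, div_le_iff₀ (by positivity)] at h1
  rw [div_pow, ← mul_div_assoc, le_div_iff₀ (by positivity)]
  calc ‖a.coeff e‖ * (r ^ 2) ^ deg e ≤ ‖a.coeff e‖ * r ^ wd e := by gcongr
    _ ≤ _ := h1
    _ ≤ _ := by gcongr

theorem wt_mono {r r' : ℝ} (hr : 0 ≤ r) (h : r ≤ r') (e) : wt r e ≤ wt r' e := by
  unfold wt; gcongr

/-- Bootstrap in the truncation order: `lapInv` looks only at orders below n − 2, so the bound 2K
there enters the cubic estimate and returns the bound 2K below n, provided that the radius is small.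
-/
theorem conv_of_fixed {a b : PS} {r M : ℝ} (hr : 0 < r) (hb : ∀ n, tnorm (wt r) n b ≤ M)
    (h : a = b + lapInv (ernstRhs a)) : Conv a := by
  set K := max M 1
  have hK : 1 ≤ K := le_max_right _ _
  -- With r′ ≤ 1/(20K) the nonlinear term is at most 3 r′² · 16 (2K)³ ≤ (384/400) K.
  set r' := min r (min 1 (1 / (20 * K)))
  have hr' : 0 < r' := lt_min hr (lt_min one_pos (by positivity))
  have hr1 : r' ≤ 1 := (min_le_right _ _).trans (min_le_left _ _)
  have hrK : r' * (20 * K) ≤ 1 := by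
    rw [← le_div_iff₀ (by positivity)]
    exact (min_le_right _ _).trans (min_le_right _ _)
  refine conv_of_tnorm (M := 2 * K) hr' hr1 fun n => ?_
  induction n using Nat.strong_induction_on with
  | _ n ih =>
    rcases Nat.eq_zero_or_pos n with rfl | hn
    · have : below 0 = ∅ := by ext e; simp [mem_below]
      rw [tnorm, this, Finset.sum_empty]
      positivity
    · have h1 := tnorm_add_le n b (lapInv (ernstRhs a)) (wt_nonneg hr'.le)
      rw [← h] at h1
      have h2 := tnorm_lapInv_le hr'.le n (ernstRhs a)
      have h3 := tnorm_ernstRhs_le hr'.le (n - 2) a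
      have h4 := ih (n - 2) (by omega)
      have h5 : tnorm (wt r') n b ≤ K :=
        (tnorm_mono_weight n b (wt_mono hr'.le (min_le_left _ _))).trans
          ((hb n).trans (le_max_left _ _))
      have h6 := tnorm_nonneg (n - 2) a (wt_nonneg hr'.le)
      have h7 : tnorm (wt r') (n - 2) a ^ 3 ≤ (2 * K) ^ 3 := by gcongr
      have h8 : (r' * (20 * K)) ^ 2 ≤ 1 := by
        have : 0 ≤ r' * (20 * K) := by positivity
        nlinarith
      have h9 : 3 * r' ^ 2 * tnorm (wt2 r') (n - 2) (ernstRhs a) ≤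
          3 * r' ^ 2 * (16 * (2 * K) ^ 3) := by gcongr; linarith
      have h10 : 3 * r' ^ 2 * (16 * (2 * K) ^ 3) = 384 / 400 * K * (r' * (20 * K)) ^ 2 := by ring
      nlinarith

/-- Analytic solutions of the Ernst equation exist for all analytic data on the null cone. -/
theorem ernst_exists {b : PS} (hb : Conv b) :
    ∃ a, Conv a ∧ lap a = ernstRhs a ∧ ∀ e, e 0 = 0 → a.coeff e = b.coeff e := by
  obtain ⟨a, ha⟩ := exists_fixed (harmonic b)
  have hn : Conv (nullPart b) := hb.of_le fun d => by
    rw [coeff_nullPart]; split_ifs <;> simp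
  obtain ⟨r, hr, hr'⟩ := hn
  refine ⟨a, conv_of_fixed (M := 7 * ∑' e, ‖(nullPart b).coeff e‖ * r ^ deg e) hr
    (fun n => ?_) ha, ?_, fun e he => ?_⟩
  · refine (tnorm_harmonic_le hr.le n b).trans ?_
    gcongr
    refine le_trans (Finset.sum_le_sum fun e _ => ?_)
      (Summable.sum_le_tsum (below n) (fun e _ => by positivity) hr')
    -- On exponents without r² the binomial coefficient is 1 and the weighted degree equals the
    -- degree, so convergence of the data bounds all truncated norms.
    by_cases he : e 0 = 0
    · rw [wt, wd, deg, he]; simp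
    · rw [coeff_nullPart, if_neg he]; simp
  · have h1 : a - lapInv (ernstRhs a) = harmonic b := by linear_combination ha
    have h2 := congrArg lap h1
    rw [lap_sub, lap_lapInv, lap_harmonic, sub_eq_zero] at h2
    exact h2
  · rw [ha, map_add, coeff_harmonic _ he, coeff_lapInv_of_zero _ he, add_zero]

/-! ### Restriction to the null cone -/

/-- Restriction of a power series in `(r², z̃)` to `r² = 0`. -/
def null : PS →+* PowerSeries ℂ where
  toFun a := PowerSeries.mk fun n => a.coeff (Finsupp.single 1 n)
  map_one' := by
    classical
    ext n
    rw [PowerSeries.coeff_mk, MvPowerSeries.coeff_one, PowerSeries.coeff_one]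
    simp
  map_mul' a b := by
    classical
    ext n
    rw [PowerSeries.coeff_mk, MvPowerSeries.coeff_mul, PowerSeries.coeff_mul,
      Finsupp.antidiagonal_single, Finset.sum_map]
    simp
  map_zero' := by ext n; simp
  map_add' a b := by ext n; simp

theorem coeff_null (a : PS) (n : ℕ) : (null a).coeff n = a.coeff (Finsupp.single 1 n) :=
  PowerSeries.coeff_mk n fun n => a.coeff (Finsupp.single 1 n)

theorem null_X_zero : null (MvPowerSeries.X 0) = 0 := by
  classical
  ext n
  rw [coeff_null, MvPowerSeries.coeff_X, if_neg]
  · simp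
  · intro h
    simpa using DFunLike.congr_fun h 0

theorem null_X_one : null (MvPowerSeries.X 1) = PowerSeries.X := by
  classical
  ext n
  rw [coeff_null, MvPowerSeries.coeff_X, PowerSeries.coeff_X]
  congr 1
  rw [eq_iff_iff]
  exact (Finsupp.single_injective 1).eq_iff

theorem null_d1 (a : PS) : null (d1 a) = PowerSeries.derivative ℂ (null a) := by
  ext n
  rw [coeff_null, PowerSeries.coeff_derivative, coeff_null, d1, MvPowerSeries.coeff_pderiv,
    ← Finsupp.single_add]
  simp

theorem null_dZ (a : PS) :
    null (dZ a) = 2 * PowerSeries.X * null (dS a) + PowerSeries.derivative ℂ (null a) := by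
  rw [dZ, map_add, map_mul, map_mul, null_X_one, null_d1, map_ofNat]

theorem coeff_eq_null (a : PS) {e : Fin 2 →₀ ℕ} (h : e 0 = 0) :
    a.coeff e = (null a).coeff (e 1) := by
  rw [coeff_null]
  congr 2
  ext i
  fin_cases i <;> simp [h]

/-! ### Taylor series -/

/-- Up to the factor n + 1, the coefficient of order n + 1 is the n-th coefficient of the
derivative, which the Leibniz rule expresses through products; so induction on the order works. The
abstract form serves Taylor series in one variable and Taylor series along a complex direction
alike. -/
theorem taylor_mul_of_leibniz {F : Type*} [CommRing F] {T : F → PowerSeries ℂ} {G : F → Prop}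
    {D : F → F} (hD : ∀ u, G u → G (D u)) (hmul : ∀ u v, G u → G v → G (u * v))
    (hT : ∀ u, G u → T (D u) = PowerSeries.derivative ℂ (T u))
    (hadd : ∀ u v, G u → G v → T (u + v) = T u + T v)
    (hcoeff : ∀ u v, G u → G v → (T (u * v)).coeff 0 = (T u).coeff 0 * (T v).coeff 0)
    (hleib : ∀ u v, G u → G v → T (D (u * v)) = T (D u * v + u * D v)) {u v : F} (hu : G u)
    (hv : G v) : T (u * v) = T u * T v := by
  ext n
  induction n generalizing u v with
  | zero => rw [hcoeff u v hu hv]; simp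
  | succ n ih =>
    have h1 : (PowerSeries.derivative ℂ (T (u * v))).coeff n =
        (PowerSeries.derivative ℂ (T u * T v)).coeff n := by
      rw [← hT _ (hmul _ _ hu hv), hleib _ _ hu hv,
        hadd _ _ (hmul _ _ (hD _ hu) hv) (hmul _ _ hu (hD _ hv)), map_add, ih (hD _ hu) hv,
        ih hu (hD _ hv), hT _ hu, hT _ hv, Derivation.leibniz, map_add, smul_eq_mul, smul_eq_mul]
      rw [mul_comm (T v), add_comm]
    rw [PowerSeries.coeff_derivative, PowerSeries.coeff_derivative] at h1
    exact mul_right_cancel₀ (Nat.cast_add_one_ne_zero n) h1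

/-- The Taylor series at `0` of a function of one variable. -/
def taylor (u : ℂ → ℂ) : PowerSeries ℂ := PowerSeries.mk fun n => iteratedDeriv n u 0 / n.factorial

theorem coeff_taylor (u : ℂ → ℂ) (n) : (taylor u).coeff n = iteratedDeriv n u 0 / n.factorial :=
  PowerSeries.coeff_mk _ _

theorem coeff_zero_taylor (u : ℂ → ℂ) : (taylor u).coeff 0 = u 0 := by simp [coeff_taylor]

theorem constantCoeff_taylor (u : ℂ → ℂ) : PowerSeries.constantCoeff (taylor u) = u 0 := by
  rw [← PowerSeries.coeff_zero_eq_constantCoeff_apply, coeff_zero_taylor]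

theorem taylor_congr {u v : ℂ → ℂ} (h : u =ᶠ[𝓝 0] v) : taylor u = taylor v := by
  ext n; rw [coeff_taylor, coeff_taylor, h.iteratedDeriv_eq]

theorem taylor_deriv (u : ℂ → ℂ) : taylor (deriv u) = PowerSeries.derivative ℂ (taylor u) := by
  ext n
  rw [PowerSeries.coeff_derivative, coeff_taylor, coeff_taylor, ← iteratedDeriv_succ',
    Nat.factorial_succ]
  have := Nat.cast_add_one_ne_zero (R := ℂ) n
  have : (n.factorial : ℂ) ≠ 0 := by exact_mod_cast n.factorial_ne_zero
  push_cast
  field_simp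

theorem taylor_add {u v : ℂ → ℂ} (hu : AnalyticAt ℂ u 0) (hv : AnalyticAt ℂ v 0) :
    taylor (u + v) = taylor u + taylor v := by
  ext n
  rw [map_add, coeff_taylor, coeff_taylor, coeff_taylor,
    iteratedDeriv_add hu.contDiffAt hv.contDiffAt, add_div]

theorem taylor_mul {u v : ℂ → ℂ} (hu : AnalyticAt ℂ u 0) (hv : AnalyticAt ℂ v 0) :
    taylor (u * v) = taylor u * taylor v := by
  refine taylor_mul_of_leibniz (T := taylor) (G := fun u => AnalyticAt ℂ u 0) (D := deriv)
    (fun u h => h.deriv) (fun u v h h' => h.mul h') (fun u _ => taylor_deriv u)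
    (fun u v h h' => taylor_add h h') (fun u v _ _ => by simp [coeff_zero_taylor])
    (fun u v h h' => taylor_congr ?_) hu hv
  filter_upwards [h.eventually_analyticAt, h'.eventually_analyticAt] with t h1 h2
  rw [deriv_mul h1.differentiableAt h2.differentiableAt]
  rfl

theorem taylor_const (c : ℂ) : taylor (fun _ => c) = PowerSeries.C c := by
  ext n
  rw [coeff_taylor, iteratedDeriv_const, PowerSeries.coeff_C]
  split_ifs with h <;> simp [h]

theorem taylor_id : taylor (fun t => t) = PowerSeries.X := by
  ext n
  rcases n with _ | n
  · simp [coeff_zero_taylor]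
  · rw [coeff_taylor, iteratedDeriv_succ']
    have : deriv (fun t : ℂ => t) = fun _ => 1 := by funext; simp
    rw [this, iteratedDeriv_const, PowerSeries.coeff_X]
    split_ifs with h h' <;> simp_all

theorem eventually_eq_of_taylor_eq {u v : ℂ → ℂ} (hu : AnalyticAt ℂ u 0) (hv : AnalyticAt ℂ v 0)
    (h : taylor u = taylor v) : u =ᶠ[𝓝 0] v := by
  have h1 := hu.hasFPowerSeriesAt
  have h2 := hv.hasFPowerSeriesAt
  have h3 : (fun n => iteratedDeriv n u 0 / (n.factorial : ℂ)) =
      fun n => iteratedDeriv n v 0 / (n.factorial : ℂ) := by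
    funext n; rw [← coeff_taylor, h, coeff_taylor]
  rw [h3] at h1
  filter_upwards [h1.eventually_hasSum_sub, h2.eventually_hasSum_sub] with t e1 e2 using e1.unique e2

theorem analyticAt_S_null {a : PS} (ha : Conv a) : AnalyticAt ℂ (fun t => S a (0, t)) 0 := by
  refine AnalyticAt.comp (g := S a) (f := fun t : ℂ => ((0 : ℂ), t)) ?_
    (analyticAt_const.prod analyticAt_id)
  exact S_analyticAt ha

theorem tendsto_prodMk_zero : Filter.Tendsto (fun t : ℂ => ((0 : ℂ), t)) (𝓝 0) (𝓝 0) :=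
  Continuous.tendsto (by fun_prop) 0

theorem taylor_S {a : PS} (ha : Conv a) : taylor (fun t => S a (0, t)) = null a := by
  ext n
  induction n generalizing a with
  | zero =>
    rw [coeff_zero_taylor, coeff_null]
    have := S_zero_eq a
    rw [Finsupp.single_zero, MvPowerSeries.coeff_zero_eq_constantCoeff]
    exact this
  | succ n ih =>
    have h1 : deriv (fun t => S a (0, t)) =ᶠ[𝓝 0] fun t => S (d1 a) (0, t) := by
      filter_upwards [tendsto_prodMk_zero.eventually (S_hasPart ha)] with t ht
      have h2 : HasFDerivAt (fun t : ℂ => ((0 : ℂ), t)) (ContinuousLinearMap.inr ℂ ℂ ℂ) t :=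
        (ContinuousLinearMap.inr ℂ ℂ ℂ).hasFDerivAt
      have h3 := (HasFDerivAt.comp t ht h2).hasDerivAt
      refine h3.deriv.trans ?_
      simp [d1]
    have h2 := ih ha.d1
    rw [← taylor_congr h1, taylor_deriv, null_d1, PowerSeries.coeff_derivative,
      PowerSeries.coeff_derivative] at h2
    exact mul_right_cancel₀ (Nat.cast_add_one_ne_zero n) h2

theorem exists_null {u : ℂ → ℂ} (hu : AnalyticAt ℂ u 0) :
    ∃ a, Conv a ∧ null a = taylor u := by
  have : AnalyticAt ℂ (fun w : ℂ × ℂ => u w.2) 0 :=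
    AnalyticAt.comp (g := u) (f := fun w : ℂ × ℂ => w.2) hu analyticAt_snd
  obtain ⟨a, ha, h⟩ := exists_series this
  refine ⟨a, ha, ?_⟩
  rw [← taylor_S ha]
  refine taylor_congr ?_
  filter_upwards [tendsto_prodMk_zero.eventually h] with t ht using ht.symm

/-! ### Functions represented by power series -/

/-- `G` is the sum of the convergent power series `a` near `0`. -/
def Rep (a : PS) (G : ℂ × ℂ → ℂ) : Prop := Conv a ∧ S a =ᶠ[𝓝 0] G

theorem Conv.rep {a : PS} (ha : Conv a) : Rep a (S a) := ⟨ha, Filter.EventuallyEq.rfl⟩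
theorem Rep.add {a b G H} (h : Rep a G) (h' : Rep b H) : Rep (a + b) fun w => G w + H w :=
  ⟨h.1.add h'.1, (S_add h.1 h'.1).trans (h.2.add h'.2)⟩
theorem Rep.sub {a b G H} (h : Rep a G) (h' : Rep b H) : Rep (a - b) fun w => G w - H w :=
  ⟨h.1.sub h'.1, (S_sub h.1 h'.1).trans (h.2.sub h'.2)⟩
theorem Rep.mul {a b G H} (h : Rep a G) (h' : Rep b H) : Rep (a * b) fun w => G w * H w :=
  ⟨h.1.mul h'.1, (S_mul h.1 h'.1).trans (h.2.mul h'.2)⟩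
theorem Rep.sq {a G} (h : Rep a G) : Rep (a ^ 2) fun w => G w ^ 2 := by
  simpa only [pow_two] using h.mul h
theorem rep_C (c : ℂ) : Rep (MvPowerSeries.C c) fun _ => c := ⟨conv_C c, by rw [S_C]⟩
theorem rep_one : Rep 1 fun _ => 1 := by simpa using rep_C 1
theorem rep_ofNat (n : ℕ) [n.AtLeastTwo] : Rep (OfNat.ofNat n) fun _ => OfNat.ofNat n := by
  rw [← C_nat]; exact rep_C _
theorem rep_q : Rep (MvPowerSeries.X 0) fun w => w.1 := ⟨conv_X 0, by rw [S_X_zero]⟩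
theorem rep_z : Rep (MvPowerSeries.X 1) fun w => w.2 := ⟨conv_X 1, by rw [S_X_one]⟩

/-- Lets identities between functions at real points off the axis be read as identities of formal
power series. -/
theorem Rep.eq_zero {a G} (h : Rep a G) (h0 : ∀ᶠ p in 𝓝 (0 : E3), rhoSq p ≠ 0 → G (inv p) = 0) :
    a = 0 := by
  refine eq_zero_of_S_eq_zero h.1 (eventually_eq_zero_of_comp_inv (S_analyticAt h.1) ?_)
  filter_upwards [tendsto_inv.eventually h.2, h0] with p h1 h2 h3
  rw [h1, h2 h3]

theorem Rep.eval_eq_zero {a G} (h : Rep a G) (h0 : a = 0) : ∀ᶠ w in 𝓝 0, G w = 0 := by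
  filter_upwards [h.2] with w hw
  rw [← hw, h0]
  simp [S]

/-! ### The field equations for convergent power series -/

theorem cj_add (a b : PS) : cj (a + b) = cj a + cj b := map_add _ a b
theorem cj_sub (a b : PS) : cj (a - b) = cj a - cj b := map_sub _ a b
theorem cj_mul (a b : PS) : cj (a * b) = cj a * cj b := map_mul _ a b
theorem cj_one : cj 1 = 1 := map_one _
theorem cj_ofNat (n : ℕ) [n.AtLeastTwo] : cj (OfNat.ofNat n) = OfNat.ofNat n := map_ofNat _ n
theorem cj_X (i : Fin 2) : cj (MvPowerSeries.X i) = MvPowerSeries.X i := MvPowerSeries.map_X _ i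

theorem cj_dS (a : PS) : cj (dS a) = dS (cj a) := by
  ext e; simp [coeff_cj, dS, MvPowerSeries.coeff_pderiv]
theorem cj_d1 (a : PS) : cj (d1 a) = d1 (cj a) := by
  ext e; simp [coeff_cj, d1, MvPowerSeries.coeff_pderiv]
theorem cj_dZ (a : PS) : cj (dZ a) = dZ (cj a) := by
  rw [dZ, dZ, cj_add, cj_mul, cj_mul, cj_X, cj_ofNat, cj_dS, cj_d1]

theorem dZ_dS (a : PS) : dZ (dS a) = dS (dZ a) := by
  simp only [dZ, map_add, Derivation.leibniz, smul_eq_mul, dS_X_one, dS_two, d1_dS]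
  ring

theorem HasGrad.re {u : E3 → ℂ} {d : Fin 3 → ℂ} {p : E3} (h : HasGrad u d p) :
    HasGrad (fun q => (u q).re) (fun i => (d i).re) p := by
  have := (Complex.reCLM.hasFDerivAt (x := u p)).comp p h
  refine HasGrad.of_eq (this.congr_fderiv (clm_eq_gradForm _)) fun i => ?_
  simp [gradForm_single]

theorem re_axiGrad (a b : ℂ) (p : E3) (i : Fin 3) :
    (axiGrad a b p i).re = axiGrad a.re b.re p i := by
  simp [axiGrad]

theorem S_re_hasGrad {a : PS} (ha : Conv a) : ∀ᶠ p in 𝓝 (0 : E3),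
    HasGrad (fun q => (S a (inv q)).re)
      (axiGrad (S (dS a) (inv p)).re (S (dZ a) (inv p)).re p) p := by
  filter_upwards [S_hasGrad ha] with p hp
  exact hp.re.of_eq fun i => re_axiGrad _ _ _ _

theorem ofReal_re_S {a : PS} (ha : cj a = a) (p : E3) :
    (((S a (inv p)).re : ℝ) : ℂ) = S a (inv p) := by
  rw [← Complex.conj_eq_iff_re, ← S_cj_inv, ha]

theorem inv_fst (p : E3) : (inv p).1 = rhoSq p + (p 2 : ℂ) ^ 2 := by
  simp only [inv, norm_sq_eq]; push_cast; ring

theorem inv_snd (p : E3) : (inv p).2 = p 2 := rfl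

/-- The power series of the denominator of the Ernst equation. -/
def den (a : PS) : PS := MvPowerSeries.X 0 * a * cj a - 1

/-- The power series of `ρ̃²`. -/
def rhoPS : PS := MvPowerSeries.X 0 - MvPowerSeries.X 1 ^ 2

theorem rep_den {a : PS} (ha : Conv a) : Rep (den a) fun w => w.1 * S a w * S (cj a) w - 1 :=
  ((rep_q.mul ha.rep).mul ha.cj.rep).sub rep_one

theorem rep_rhoPS : Rep rhoPS fun w => w.1 - w.2 ^ 2 := rep_q.sub rep_z.sq

theorem ernst_iff_eventually {a : PS} (ha : Conv a) : lap a = ernstRhs a ↔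
    ∀ᶠ p in 𝓝 (0 : E3), rhoSq p ≠ 0 → ErnstJet (rhoSq p) (p 2) (S a (inv p)) (S (cj a) (inv p))
      (S (dS a) (inv p)) (S (dZ a) (inv p)) (S (dS (dS a)) (inv p)) (S (dZ (dZ a)) (inv p)) := by
  have hr := (((rep_den ha).mul ((((rep_ofNat 4).mul ha.dS.rep).add (((rep_ofNat 4).mul rep_rhoPS).mul
    ha.dS.dS.rep)).add ha.dZ.dZ.rep)).sub (((rep_ofNat 2).mul ha.cj.rep).mul ((ha.rep.sq.add
      (((rep_ofNat 2).mul ha.rep).mul ((((rep_ofNat 2).mul rep_rhoPS).mul ha.dS.rep).add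
        (rep_z.mul ha.dZ.rep)))).add (rep_q.mul ((((rep_ofNat 4).mul rep_rhoPS).mul ha.dS.rep.sq).add
          ha.dZ.rep.sq)))))
  have hj : ∀ p, ErnstJet (rhoSq p) (p 2) (S a (inv p)) (S (cj a) (inv p))
      (S (dS a) (inv p)) (S (dZ a) (inv p)) (S (dS (dS a)) (inv p)) (S (dZ (dZ a)) (inv p)) ↔ _ :=
    fun p => sub_eq_zero.symm
  rw [ernst_iff, ← sub_eq_zero]
  simp only [hj]
  constructor
  · intro h
    filter_upwards [tendsto_inv.eventually (hr.eval_eq_zero h)] with p hp _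
    rw [← hp, inv_fst, inv_snd]
    ring
  · intro h
    refine hr.eq_zero ?_
    filter_upwards [h] with p hp h1
    rw [← hp h1, inv_fst, inv_snd]
    ring

theorem tendsto_den {a : PS} (ha : Conv a) :
    ∀ᶠ p in 𝓝 (0 : E3), ((rhoSq p : ℂ) + p 2 ^ 2) * S a (inv p) * S (cj a) (inv p) - 1 ≠ 0 := by
  have h : ContinuousAt (fun w : ℂ × ℂ => w.1 * S a w * S (cj a) w - 1) 0 :=
    ((continuousAt_fst.mul (S_analyticAt ha).continuousAt).mul
      (S_analyticAt ha.cj).continuousAt).sub continuousAt_const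
  have h0 : ((0 : ℂ × ℂ).1 * S a 0 * S (cj a) 0 - 1 : ℂ) ≠ 0 := by simp
  filter_upwards [tendsto_inv.eventually (h.eventually_ne h0)] with p hp
  rwa [inv_fst] at hp

/-- The jets are introduced as arbitrary complex numbers with defining equations, so that the purely
algebraic `beta_of_ricci` and `ricci_of_beta` apply directly. Since r² and z̃ are real at points of
space, the conjugate of a value of `a` is the value of `cj a`. -/
theorem fieldEquations_series_iff {a b : PS} (ha : Conv a) (hb : Conv b) (hbr : cj b = b)
    {f : E3 → ℂ} {β : E3 → ℝ} (hf : ∀ᶠ p in 𝓝 (0 : E3), f p = S a (inv p))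
    (hβ : ∀ᶠ p in 𝓝 (0 : E3), β p = (S b (inv p)).re) :
    ∀ᶠ p in 𝓝 (0 : E3), ∀ s z q f' g fs gs fz gz bs bz bss bzz N : ℂ, rhoSq p ≠ 0 →
      s = rhoSq p → z = p 2 → q = s + z ^ 2 → f' = S a (inv p) → g = S (cj a) (inv p) →
      fs = S (dS a) (inv p) → gs = S (dS (cj a)) (inv p) →
      fz = S (dZ a) (inv p) → gz = S (dZ (cj a)) (inv p) → bs = S (dS b) (inv p) →
      bz = S (dZ b) (inv p) → bss = S (dS (dS b)) (inv p) → bzz = S (dZ (dZ b)) (inv p) →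
      N = q * f' * g - 1 →
      (FieldEquationsAt (weylMetric β) (potential f) p ↔
      (-4 * s * bss - bzz - 4 * s * bs / q + 2 * z * bz / q =
        8 * s * (q / N ^ 2) * ((fs + f' / (2 * q)) * (gs + g / (2 * q))) ∧
      bz / s - 4 * z * bs / q - 2 * bz / q =
        2 * (q / N ^ 2) * ((fs + f' / (2 * q)) * (gz + g * z / q) +
          (fz + f' * z / q) * (gs + g / (2 * q))) ∧
      -4 * bs - 4 * s * bss - bzz + 4 * s * bs / q - 2 * z * bz / q =
        2 * (q / N ^ 2) * ((fz + f' * z / q) * (gz + g * z / q))) ∧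
      ErnstJet s z f' g fs fz (S (dS (dS a)) (inv p)) (S (dZ (dZ a)) (inv p))) := by
  filter_upwards [hf.eventually_nhds, hβ.eventually_nhds, (S_hasGrad ha).eventually_nhds,
    S_hasGrad ha.dS, S_hasGrad ha.dZ, (S_re_hasGrad hb).eventually_nhds, S_re_hasGrad hb.dS,
    S_re_hasGrad hb.dZ, tendsto_den ha] with p h1 h2 h3 h4 h5 h6 h7 h8 h9
  intro s z q f' g fs gs fz gz bs bz bss bzz N hp hs hz hq hf' hg hfs hgs hfz hgz hbs hbz hbss hbzz hN
  have k1 : ∀ᶠ q in 𝓝 p, HasGrad f (axiGrad (S (dS a) (inv q)) (S (dZ a) (inv q)) q) q := by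
    filter_upwards [h1.eventually_nhds, h3] with q e1 e2 using e2.congr e1
  have k2 : ∀ᶠ q in 𝓝 p, HasGrad β (axiGrad (S (dS b) (inv q)).re (S (dZ b) (inv q)).re q) q := by
    filter_upwards [h2.eventually_nhds, h6] with q e1 e2 using e2.congr e1
  have e1 := h1.self_of_nhds
  rw [dZ_dS] at h4 h7
  have e2 : conj (S a (inv p)) = S (cj a) (inv p) := (S_cj_inv _ _).symm
  have h2c : (starRingEnd ℂ) 2 = 2 := Complex.conj_ofNat 2
  have hqn : (‖p‖ ^ 2 : ℂ) = q := by
    rw [hq, hs, hz, ← Complex.ofReal_pow, norm_sq_eq]; push_cast; rfl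
  have e3 : conj (S (dS a) (inv p) + S a (inv p) / (2 * ‖p‖ ^ 2)) = gs + g / (2 * q) := by
    rw [hgs, hg, ← hqn]
    simp only [map_add, map_div₀, map_mul, map_pow, Complex.conj_ofReal, h2c, e2, ← S_cj_inv, cj_dS]
  have e4 : conj (S (dZ a) (inv p) + S a (inv p) * p 2 / ‖p‖ ^ 2) = gz + g * z / q := by
    rw [hgz, hg, ← hqn, hz]
    simp only [map_add, map_div₀, map_mul, map_pow, Complex.conj_ofReal, e2, ← S_cj_inv, cj_dZ]
  rw [fieldEquationsAt_iff hp k2 h7 h8 k1 h4 h5 (by rwa [e1, e2]), weylRicci_iff hp, e1]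
  rw [e3, e4, ofReal_re_S (a := dS b) (by rw [cj_dS, hbr]),
    ofReal_re_S (a := dZ b) (by rw [cj_dZ, hbr]),
    ofReal_re_S (a := dS (dS b)) (by rw [cj_dS, cj_dS, hbr]),
    ofReal_re_S (a := dZ (dZ b)) (by rw [cj_dZ, cj_dZ, hbr]), e2, ← hs, ← hz, ← hq, hqn, ← hf', ← hg, ← hN, ← hfs, ← hfz, ← hbs, ← hbz, ← hbss, ← hbzz]

/-- The power series data of a solution. -/
structure IsSeriesSolution (a b : PS) : Prop where
  conv_a : Conv a
  conv_b : Conv b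
  real_b : cj b = b
  ernst : lap a = ernstRhs a
  beta_s : 2 * den a ^ 2 * dS b =
    -betaNumS rhoPS (MvPowerSeries.X 1) a (cj a) (dS a) (dS (cj a)) (dZ a) (dZ (cj a))
  beta_z : den a ^ 2 * dZ b =
    -rhoPS * betaNumZ rhoPS (MvPowerSeries.X 1) a (cj a) (dS a) (dS (cj a)) (dZ a) (dZ (cj a))

theorem rep_betaNumS {a : PS} (ha : Conv a) :
    Rep (betaNumS rhoPS (MvPowerSeries.X 1) a (cj a) (dS a) (dS (cj a)) (dZ a) (dZ (cj a)))
      fun w => betaNumS (w.1 - w.2 ^ 2) w.2 (S a w) (S (cj a) w) (S (dS a) w) (S (dS (cj a)) w)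
        (S (dZ a) w) (S (dZ (cj a)) w) := by
  have t2 := rep_ofNat 2
  exact (((ha.rep.add ((t2.mul rep_rhoPS).mul ha.dS.rep)).add (rep_z.mul ha.dZ.rep)).mul
    ((ha.cj.rep.add ((t2.mul rep_rhoPS).mul ha.cj.dS.rep)).add (rep_z.mul ha.cj.dZ.rep))).sub
    (rep_rhoPS.mul ((ha.dZ.rep.sub ((t2.mul rep_z).mul ha.dS.rep)).mul
      (ha.cj.dZ.rep.sub ((t2.mul rep_z).mul ha.cj.dS.rep))))

theorem rep_betaNumZ {a : PS} (ha : Conv a) :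
    Rep (betaNumZ rhoPS (MvPowerSeries.X 1) a (cj a) (dS a) (dS (cj a)) (dZ a) (dZ (cj a)))
      fun w => betaNumZ (w.1 - w.2 ^ 2) w.2 (S a w) (S (cj a) w) (S (dS a) w) (S (dS (cj a)) w)
        (S (dZ a) w) (S (dZ (cj a)) w) := by
  have t2 := rep_ofNat 2
  exact (((ha.rep.add ((t2.mul rep_rhoPS).mul ha.dS.rep)).add (rep_z.mul ha.dZ.rep)).mul
      (ha.cj.dZ.rep.sub ((t2.mul rep_z).mul ha.cj.dS.rep))).add
    ((ha.dZ.rep.sub ((t2.mul rep_z).mul ha.dS.rep)).mul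
    ((ha.cj.rep.add ((t2.mul rep_rhoPS).mul ha.cj.dS.rep)).add (rep_z.mul ha.cj.dZ.rep)))

theorem cj_eq_self_of_real {b : PS} (hb : Conv b) {β : E3 → ℝ}
    (h : ∀ᶠ p in 𝓝 (0 : E3), (β p : ℂ) = S b (inv p)) : cj b = b := by
  have hr := hb.cj.rep.sub hb.rep
  refine sub_eq_zero.mp (hr.eq_zero ?_)
  filter_upwards [h] with p hp _
  rw [S_cj_inv, ← hp, Complex.conj_ofReal, sub_self]

theorem norm_sq_ne {p : E3} (hp : rhoSq p ≠ 0) : ((rhoSq p : ℂ) + p 2 ^ 2) ≠ 0 := by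
  exact_mod_cast (norm_sq_pos_of_rhoSq_ne_zero hp).ne'

/-- The field equations off the axis determine the power series. -/
theorem isSeriesSolution_of_fieldEquations {a b : PS} (ha : Conv a) (hb : Conv b) {f : E3 → ℂ}
    {β : E3 → ℝ} (hf : ∀ᶠ p in 𝓝 (0 : E3), f p = S a (inv p))
    (hβ : ∀ᶠ p in 𝓝 (0 : E3), (β p : ℂ) = S b (inv p))
    (h : ∀ᶠ p in 𝓝 (0 : E3), rhoSq p ≠ 0 → FieldEquationsAt (weylMetric β) (potential f) p) :
    IsSeriesSolution a b := by
  have hr := cj_eq_self_of_real hb hβ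
  have hβ' : ∀ᶠ p in 𝓝 (0 : E3), β p = (S b (inv p)).re := by
    filter_upwards [hβ] with p hp
    rw [← hp, Complex.ofReal_re]
  have key := fieldEquations_series_iff ha hb hr hf hβ'
  have t2 := rep_ofNat 2
  have e1 := ((t2.mul (rep_den ha).sq).mul hb.dS.rep).add (rep_betaNumS ha)
  have e2 := ((rep_den ha).sq.mul hb.dZ.rep).add (rep_rhoPS.mul (rep_betaNumZ ha))
  have h12 : ∀ᶠ p in 𝓝 (0 : E3), rhoSq p ≠ 0 →
      S (dS b) (inv p) = -betaNumS (rhoSq p : ℂ) (p 2) (S a (inv p)) (S (cj a) (inv p))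
        (S (dS a) (inv p)) (S (dS (cj a)) (inv p)) (S (dZ a) (inv p)) (S (dZ (cj a)) (inv p)) /
        (2 * (((rhoSq p : ℂ) + p 2 ^ 2) * S a (inv p) * S (cj a) (inv p) - 1) ^ 2) ∧
      S (dZ b) (inv p) = -rhoSq p * betaNumZ (rhoSq p : ℂ) (p 2) (S a (inv p)) (S (cj a) (inv p))
        (S (dS a) (inv p)) (S (dS (cj a)) (inv p)) (S (dZ a) (inv p)) (S (dZ (cj a)) (inv p)) /
        (((rhoSq p : ℂ) + p 2 ^ 2) * S a (inv p) * S (cj a) (inv p) - 1) ^ 2 := by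
    filter_upwards [key, h, tendsto_den ha] with p h1 h2 h3 h4
    obtain ⟨⟨c1, c2, c3⟩, -⟩ := (h1 _ _ _ _ _ _ _ _ _ _ _ _ _ _ h4 rfl rfl rfl rfl rfl rfl rfl rfl
      rfl rfl rfl rfl rfl rfl).mp (h2 h4)
    exact beta_of_ricci (by exact_mod_cast h4) (norm_sq_ne h4) h3 rfl c1 c2 c3
  refine ⟨ha, hb, hr, (ernst_iff_eventually ha).mpr ?_, eq_neg_of_add_eq_zero_left (e1.eq_zero ?_),
    ?_⟩
  · filter_upwards [key, h] with p h1 h2 h4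
    exact ((h1 _ _ _ _ _ _ _ _ _ _ _ _ _ _ h4 rfl rfl rfl rfl rfl rfl rfl rfl
      rfl rfl rfl rfl rfl rfl).mp (h2 h4)).2
  · filter_upwards [h12, tendsto_den ha] with p h1 h2 h4
    rw [inv_fst, inv_snd, add_sub_cancel_right, (h1 h4).1]
    field_simp
    ring
  · rw [neg_mul]
    refine eq_neg_of_add_eq_zero_left (e2.eq_zero ?_)
    filter_upwards [h12, tendsto_den ha] with p h1 h2 h4
    rw [inv_fst, inv_snd, add_sub_cancel_right, (h1 h4).2]
    field_simp
    ring

/-! ### Construction of `β` -/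

section
variable {R : Type*} [CommRing R] (s z f g fs gs fz gz fss gss fsz gsz fzz gzz : R)

/-- The derivatives of `betaNumS` and `betaNumZ`. -/
def betaNumSs : R :=
  (3 * fs + 2 * s * fss + z * fsz) * (g + 2 * s * gs + z * gz)
    + (f + 2 * s * fs + z * fz) * (3 * gs + 2 * s * gss + z * gsz)
    - (fz - 2 * z * fs) * (gz - 2 * z * gs)
    - s * ((fsz - 2 * z * fss) * (gz - 2 * z * gs) + (fz - 2 * z * fs) * (gsz - 2 * z * gss))
def betaNumSz : R :=
  (2 * fz + 2 * s * fsz + z * fzz) * (g + 2 * s * gs + z * gz)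
    + (f + 2 * s * fs + z * fz) * (2 * gz + 2 * s * gsz + z * gzz)
    - s * ((fzz - 2 * fs - 2 * z * fsz) * (gz - 2 * z * gs)
      + (fz - 2 * z * fs) * (gzz - 2 * gs - 2 * z * gsz))
def betaNumZs : R :=
  (3 * fs + 2 * s * fss + z * fsz) * (gz - 2 * z * gs)
    + (f + 2 * s * fs + z * fz) * (gsz - 2 * z * gss)
    + (fsz - 2 * z * fss) * (g + 2 * s * gs + z * gz)
    + (fz - 2 * z * fs) * (3 * gs + 2 * s * gss + z * gsz)
def betaNumZz : R :=
  (2 * fz + 2 * s * fsz + z * fzz) * (gz - 2 * z * gs)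
    + (f + 2 * s * fs + z * fz) * (gzz - 2 * gs - 2 * z * gsz)
    + (fzz - 2 * fs - 2 * z * fsz) * (g + 2 * s * gs + z * gz)
    + (fz - 2 * z * fs) * (2 * gz + 2 * s * gsz + z * gzz)
end

theorem cj_two : cj 2 = 2 := map_ofNat _ 2
theorem cj_three : cj 3 = 3 := map_ofNat _ 3
theorem cj_four : cj 4 = 4 := map_ofNat _ 4

theorem dS_mul (a b : PS) : dS (a * b) = a * dS b + b * dS a := Derivation.leibniz _ _ _
theorem dZ_mul (a b : PS) : dZ (a * b) = a * dZ b + b * dZ a := by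
  simp only [dZ, Derivation.leibniz, smul_eq_mul]; ring
theorem dZ_add (a b : PS) : dZ (a + b) = dZ a + dZ b := by simp only [dZ, map_add]; ring
theorem dZ_sub (a b : PS) : dZ (a - b) = dZ a - dZ b := by simp only [dZ, map_sub]; ring
theorem dZ_X_zero : dZ (MvPowerSeries.X 0) = 2 * MvPowerSeries.X 1 := by
  rw [dZ, dS_X_zero, d1_X_zero]; ring
theorem dZ_X_one : dZ (MvPowerSeries.X 1) = 1 := by rw [dZ, dS_X_one, d1_X_one]; ring
theorem dZ_two : dZ 2 = 0 := by rw [dZ, dS_two, d1_two]; ring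
theorem dS_one : dS 1 = 0 := dS.map_one_eq_zero
theorem dZ_one : dZ 1 = 0 := by rw [dZ, dS_one, d1.map_one_eq_zero]; ring
theorem dS_rhoPS : dS rhoPS = 1 := by
  rw [rhoPS, map_sub, sq, dS_mul, dS_X_zero, dS_X_one]; ring
theorem dZ_rhoPS : dZ rhoPS = 0 := by
  rw [rhoPS, dZ_sub, sq, dZ_mul, dZ_X_zero, dZ_X_one]; ring

section
variable (a : PS)

theorem dS_den : dS (den a) = a * cj a + MvPowerSeries.X 0 * (dS a * cj a + a * dS (cj a)) := by
  rw [den, map_sub, dS_mul, dS_mul, dS_X_zero, dS_one]; ring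
theorem dZ_den : dZ (den a) =
    2 * MvPowerSeries.X 1 * a * cj a + MvPowerSeries.X 0 * (dZ a * cj a + a * dZ (cj a)) := by
  rw [den, dZ_sub, dZ_mul, dZ_mul, dZ_X_zero, dZ_one]; ring

/-- `betaNumS` and `betaNumZ` as power series. -/
def betaS : PS := betaNumS rhoPS (MvPowerSeries.X 1) a (cj a) (dS a) (dS (cj a)) (dZ a) (dZ (cj a))
def betaZ : PS := betaNumZ rhoPS (MvPowerSeries.X 1) a (cj a) (dS a) (dS (cj a)) (dZ a) (dZ (cj a))

theorem dS_betaS : dS (betaS a) = betaNumSs rhoPS (MvPowerSeries.X 1) a (cj a) (dS a) (dS (cj a))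
    (dZ a) (dZ (cj a)) (dS (dS a)) (dS (dS (cj a))) (dS (dZ a)) (dS (dZ (cj a))) := by
  simp only [betaS, betaNumS, betaNumSs, map_add, map_sub, dS_mul, dS_rhoPS, dS_X_one, dS_two]
  ring
theorem dZ_betaS : dZ (betaS a) = betaNumSz rhoPS (MvPowerSeries.X 1) a (cj a) (dS a) (dS (cj a))
    (dZ a) (dZ (cj a)) (dS (dZ a)) (dS (dZ (cj a))) (dZ (dZ a)) (dZ (dZ (cj a))) := by
  simp only [betaS, betaNumS, betaNumSz, dZ_add, dZ_sub, dZ_mul, dZ_rhoPS, dZ_X_one, dZ_two, dZ_dS]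
  ring
theorem dS_betaZ : dS (betaZ a) = betaNumZs rhoPS (MvPowerSeries.X 1) a (cj a) (dS a) (dS (cj a))
    (dZ a) (dZ (cj a)) (dS (dS a)) (dS (dS (cj a))) (dS (dZ a)) (dS (dZ (cj a))) := by
  simp only [betaZ, betaNumZ, betaNumZs, map_add, map_sub, dS_mul, dS_rhoPS, dS_X_one, dS_two]
  ring
theorem dZ_betaZ : dZ (betaZ a) = betaNumZz rhoPS (MvPowerSeries.X 1) a (cj a) (dS a) (dS (cj a))
    (dZ a) (dZ (cj a)) (dS (dZ a)) (dS (dZ (cj a))) (dZ (dZ a)) (dZ (dZ (cj a))) := by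
  simp only [betaZ, betaNumZ, betaNumZz, dZ_add, dZ_sub, dZ_mul, dZ_rhoPS, dZ_X_one, dZ_two, dZ_dS]
  ring

variable {a}

theorem repA (ha : Conv a) : Rep (a + 2 * rhoPS * dS a + MvPowerSeries.X 1 * dZ a)
    fun w => S a w + 2 * (w.1 - w.2 ^ 2) * S (dS a) w + w.2 * S (dZ a) w :=
  (ha.rep.add (((rep_ofNat 2).mul rep_rhoPS).mul ha.dS.rep)).add (rep_z.mul ha.dZ.rep)
theorem repC (ha : Conv a) : Rep (dZ a - 2 * MvPowerSeries.X 1 * dS a)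
    fun w => S (dZ a) w - 2 * w.2 * S (dS a) w :=
  ha.dZ.rep.sub (((rep_ofNat 2).mul rep_z).mul ha.dS.rep)
theorem repAs (ha : Conv a) :
    Rep (3 * dS a + 2 * rhoPS * dS (dS a) + MvPowerSeries.X 1 * dS (dZ a)) fun w =>
      3 * S (dS a) w + 2 * (w.1 - w.2 ^ 2) * S (dS (dS a)) w + w.2 * S (dS (dZ a)) w :=
  (((rep_ofNat 3).mul ha.dS.rep).add (((rep_ofNat 2).mul rep_rhoPS).mul ha.dS.dS.rep)).add
    (rep_z.mul ha.dZ.dS.rep)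
theorem repCs (ha : Conv a) : Rep (dS (dZ a) - 2 * MvPowerSeries.X 1 * dS (dS a))
    fun w => S (dS (dZ a)) w - 2 * w.2 * S (dS (dS a)) w :=
  ha.dZ.dS.rep.sub (((rep_ofNat 2).mul rep_z).mul ha.dS.dS.rep)
theorem repAz (ha : Conv a) :
    Rep (2 * dZ a + 2 * rhoPS * dS (dZ a) + MvPowerSeries.X 1 * dZ (dZ a)) fun w =>
      2 * S (dZ a) w + 2 * (w.1 - w.2 ^ 2) * S (dS (dZ a)) w + w.2 * S (dZ (dZ a)) w :=
  (((rep_ofNat 2).mul ha.dZ.rep).add (((rep_ofNat 2).mul rep_rhoPS).mul ha.dZ.dS.rep)).add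
    (rep_z.mul ha.dZ.dZ.rep)
theorem repCz (ha : Conv a) :
    Rep (dZ (dZ a) - 2 * dS a - 2 * MvPowerSeries.X 1 * dS (dZ a))
    fun w => S (dZ (dZ a)) w - 2 * S (dS a) w - 2 * w.2 * S (dS (dZ a)) w :=
  (ha.dZ.dZ.rep.sub ((rep_ofNat 2).mul ha.dS.rep)).sub
    (((rep_ofNat 2).mul rep_z).mul ha.dZ.dS.rep)

theorem rep_dS_betaS (ha : Conv a) : Rep (dS (betaS a)) fun w =>
    betaNumSs (w.1 - w.2 ^ 2) w.2 (S a w) (S (cj a) w) (S (dS a) w) (S (dS (cj a)) w)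
      (S (dZ a) w) (S (dZ (cj a)) w) (S (dS (dS a)) w) (S (dS (dS (cj a))) w)
      (S (dS (dZ a)) w) (S (dS (dZ (cj a))) w) := by
  rw [dS_betaS]
  have c := ha.cj
  exact ((((repAs ha).mul (repA c)).add ((repA ha).mul (repAs c))).sub ((repC ha).mul (repC c))).sub
    (rep_rhoPS.mul (((repCs ha).mul (repC c)).add ((repC ha).mul (repCs c))))

theorem rep_dS_betaZ (ha : Conv a) : Rep (dS (betaZ a)) fun w =>
    betaNumZs (w.1 - w.2 ^ 2) w.2 (S a w) (S (cj a) w) (S (dS a) w) (S (dS (cj a)) w)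
      (S (dZ a) w) (S (dZ (cj a)) w) (S (dS (dS a)) w) (S (dS (dS (cj a))) w)
      (S (dS (dZ a)) w) (S (dS (dZ (cj a))) w) := by
  rw [dS_betaZ]
  have c := ha.cj
  exact ((((repAs ha).mul (repC c)).add ((repA ha).mul (repCs c))).add ((repCs ha).mul (repA c))).add
    ((repC ha).mul (repAs c))

theorem rep_dZ_betaS (ha : Conv a) : Rep (dZ (betaS a)) fun w =>
    betaNumSz (w.1 - w.2 ^ 2) w.2 (S a w) (S (cj a) w) (S (dS a) w) (S (dS (cj a)) w)
      (S (dZ a) w) (S (dZ (cj a)) w) (S (dS (dZ a)) w) (S (dS (dZ (cj a))) w)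
      (S (dZ (dZ a)) w) (S (dZ (dZ (cj a))) w) := by
  rw [dZ_betaS]
  have c := ha.cj
  exact (((repAz ha).mul (repA c)).add ((repA ha).mul (repAz c))).sub
    (rep_rhoPS.mul (((repCz ha).mul (repC c)).add ((repC ha).mul (repCz c))))

theorem rep_dZ_betaZ (ha : Conv a) : Rep (dZ (betaZ a)) fun w =>
    betaNumZz (w.1 - w.2 ^ 2) w.2 (S a w) (S (cj a) w) (S (dS a) w) (S (dS (cj a)) w)
      (S (dZ a) w) (S (dZ (cj a)) w) (S (dS (dZ a)) w) (S (dS (dZ (cj a))) w)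
      (S (dZ (dZ a)) w) (S (dZ (dZ (cj a))) w) := by
  rw [dZ_betaZ]
  have c := ha.cj
  exact ((((repAz ha).mul (repC c)).add ((repA ha).mul (repCz c))).add ((repCz ha).mul (repA c))).add
    ((repC ha).mul (repAz c))

theorem rep_dS_den (ha : Conv a) : Rep (dS (den a)) fun w =>
    S a w * S (cj a) w + w.1 * (S (dS a) w * S (cj a) w + S a w * S (dS (cj a)) w) := by
  rw [dS_den]
  exact (ha.rep.mul ha.cj.rep).add
    (rep_q.mul ((ha.dS.rep.mul ha.cj.rep).add (ha.rep.mul ha.cj.dS.rep)))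

theorem rep_dZ_den (ha : Conv a) : Rep (dZ (den a)) fun w =>
    2 * w.2 * S a w * S (cj a) w +
      w.1 * (S (dZ a) w * S (cj a) w + S a w * S (dZ (cj a)) w) := by
  rw [dZ_den]
  exact ((((rep_ofNat 2).mul rep_z).mul ha.rep).mul ha.cj.rep).add
    (rep_q.mul ((ha.dZ.rep.mul ha.cj.rep).add (ha.rep.mul ha.cj.dZ.rep)))

end

theorem eventually_den_ne {a : PS} (ha : Conv a) :
    ∀ᶠ w : ℂ × ℂ in 𝓝 0, w.1 * S a w * S (cj a) w - 1 ≠ 0 := by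
  have h : ContinuousAt (fun w : ℂ × ℂ => w.1 * S a w * S (cj a) w - 1) 0 :=
    ((continuousAt_fst.mul (S_analyticAt ha).continuousAt).mul
      (S_analyticAt ha.cj).continuousAt).sub continuousAt_const
  have h0 : ((0 : ℂ × ℂ).1 * S a 0 * S (cj a) 0 - 1 : ℂ) ≠ 0 := by simp
  exact h.eventually_ne h0

theorem den_ne_zero (a : PS) : den a ≠ 0 := by
  intro h
  have := congrArg MvPowerSeries.constantCoeff h
  simp [den] at this

theorem ernst_conj {a : PS} (h : lap a = ernstRhs a) : lap (cj a) = ernstRhs (cj a) := by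
  have h1 := congrArg cj h
  have hl : ∀ u, cj (lap u) = lap (cj u) := fun u => by
    simp only [lap, cj_add, cj_sub, cj_mul, cj_four, cj_X, cj_dS, cj_dZ, sq]
  have he : ∀ u, cj (euler u) = euler (cj u) := fun u => by
    simp only [euler, cj_add, cj_mul, cj_two, cj_X, cj_dS, cj_d1]
  rw [hl] at h1
  rw [h1]
  simp only [ernstRhs, cj_sub, cj_mul, cj_two, cj_three, cj_X, hl, he]

/-! #### Integration with respect to `ρ̃²` -/

theorem exists_dS_eq {h : PS} (hh : Conv h) : ∃ b, Conv b ∧ dS b = h := by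
  obtain ⟨C, A, hC, hA, hb⟩ := hh.exists_bound
  -- For `d 0 = 0` the division by zero returns 0, so this primitive has no terms free of the first
  -- variable.
  let b : PS := fun d => h.coeff (d - Finsupp.single 0 1) / d 0
  have hbc : ∀ d, b.coeff d = h.coeff (d - Finsupp.single 0 1) / d 0 := fun d => rfl
  refine ⟨b, conv_of_bound (C := C) (A := A + 1) (by positivity) fun d => ?_, ?_⟩
  · rw [hbc, norm_div, Complex.norm_natCast]
    rcases Nat.eq_zero_or_pos (d 0) with h0 | h0
    · rw [h0]; simp; positivity
    · refine (div_le_self (norm_nonneg _) (by exact_mod_cast h0)).trans ((hb _).trans ?_)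
      gcongr
      refine (pow_le_pow_left₀ hA.le (by linarith) _).trans
        (pow_le_pow_right₀ (by linarith : (1 : ℝ) ≤ A + 1) ?_)
      simp [deg]
  · ext d
    rw [dS, MvPowerSeries.coeff_pderiv, hbc, add_tsub_cancel_right]
    have := Nat.cast_add_one_ne_zero (R := ℂ) (d 0)
    simp
    field_simp

theorem S_eq_of_dS_eq_zero {u : PS} (h : dS u = 0) (x y z : ℂ) : S u (x, z) = S u (y, z) := by
  rw [S, S]
  refine tsum_congr fun d => ?_
  by_cases h0 : d 0 = 0
  · simp [monoF, h0]
  · have h1 : Finsupp.single 0 1 ≤ d := by simpa [Nat.one_le_iff_ne_zero] using h0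
    have h2 := congrArg (MvPowerSeries.coeff (d - Finsupp.single 0 1)) h
    rw [dS, MvPowerSeries.coeff_pderiv, tsub_add_cancel_of_le h1,
      show (0 : PS).coeff (d - Finsupp.single 0 1) = 0 from rfl, mul_eq_zero] at h2
    rw [h2.resolve_right (Nat.cast_add_one_ne_zero _)]
    simp

theorem tendsto_axis : Filter.Tendsto (fun z : ℂ => ((z ^ 2, z) : ℂ × ℂ)) (𝓝 0) (𝓝 0) := by
  have : Continuous fun z : ℂ => ((z ^ 2, z) : ℂ × ℂ) := by fun_prop
  have h := this.tendsto 0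
  rwa [show ((0 : ℂ) ^ 2, (0 : ℂ)) = (0 : ℂ × ℂ) by simp] at h

theorem tendsto_snd_zero : Filter.Tendsto (fun w : ℂ × ℂ => w.2) (𝓝 0) (𝓝 0) :=
  continuous_snd.tendsto (0 : ℂ × ℂ)

/-- Such a series does not depend on its first argument, and the axis ρ̃ = 0, which is r² = z̃²,
meets every small value of z̃. -/
theorem eq_zero_of_dS_eq_zero {u : PS} (hu : Conv u) (h : dS u = 0)
    (h0 : ∀ᶠ z : ℂ in 𝓝 0, S u (z ^ 2, z) = 0) : u = 0 := by
  refine eq_zero_of_S_eq_zero hu ?_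
  filter_upwards [tendsto_snd_zero.eventually h0] with w hw
  rw [show w = (w.1, w.2) from rfl, S_eq_of_dS_eq_zero h w.1 (w.2 ^ 2), hw]
  rfl

/-- From any primitive one subtracts its restriction to the axis, which is a function of z̃ alone.
This normalisation will make β vanish on the axis. -/
theorem exists_primitive {h : PS} (hh : Conv h) :
    ∃ b, Conv b ∧ dS b = h ∧ ∀ᶠ z : ℂ in 𝓝 0, S b (z ^ 2, z) = 0 := by
  obtain ⟨b, hb, hbh⟩ := exists_dS_eq hh
  have hG : AnalyticAt ℂ (fun w : ℂ × ℂ => S b (w.2 ^ 2, w.2)) 0 := by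
    refine AnalyticAt.comp (g := S b) (f := fun w : ℂ × ℂ => (w.2 ^ 2, w.2)) ?_
      ((analyticAt_snd.pow 2).prod analyticAt_snd)
    rw [show (((0 : ℂ × ℂ).2 ^ 2, (0 : ℂ × ℂ).2) : ℂ × ℂ) = 0 by simp]
    exact S_analyticAt hb
  obtain ⟨g, hg, hGg⟩ := exists_series hG
  have hd : dS g = 0 := by
    refine eq_zero_of_S_eq_zero hg.dS ?_
    filter_upwards [S_hasPart hg, hGg.eventually_nhds] with w h1 h2
    have hl : HasFDerivAt (fun t : ℂ => (t, w.2)) (ContinuousLinearMap.inl ℂ ℂ ℂ) w.1 :=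
      hasFDerivAt_prodMk_left w.1 w.2
    have h3 := (HasFDerivAt.comp w.1 (f := fun t : ℂ => (t, w.2)) h1 hl).hasDerivAt
    have hc : ContinuousAt (fun t : ℂ => (t, w.2)) w.1 := by fun_prop
    have h4 : (S g ∘ fun t : ℂ => (t, w.2)) =ᶠ[𝓝 w.1] fun _ => S b (w.2 ^ 2, w.2) := by
      filter_upwards [hc.tendsto.eventually h2] with t ht
      exact ht.symm
    have h5 := h3.unique ((hasDerivAt_const w.1 _).congr_of_eventuallyEq h4)
    simpa [dS] using h5
  refine ⟨b - g, hb.sub hg, by rw [map_sub, hd, hbh, sub_zero], ?_⟩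
  filter_upwards [tendsto_axis.eventually (S_sub hb hg), tendsto_axis.eventually hGg] with z h1 h2
  rw [h1, Pi.sub_apply, ← h2, sub_self]

/-- `dZ` differentiates at fixed ρ̃², hence is tangent to the axis. -/
theorem axis_dZ {b : PS} (hb : Conv b) (h : ∀ᶠ z : ℂ in 𝓝 0, S b (z ^ 2, z) = 0) :
    ∀ᶠ z : ℂ in 𝓝 0, S (dZ b) (z ^ 2, z) = 0 := by
  filter_upwards [h.eventually_nhds, tendsto_axis.eventually (S_hasPart hb),
    tendsto_axis.eventually (S_dZ hb)] with z h1 h2 h3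
  have hl : HasDerivAt (fun t : ℂ => ((t ^ 2, t) : ℂ × ℂ)) (2 * z, 1) z := by
    simpa using (hasDerivAt_pow 2 z).prodMk (hasDerivAt_id z)
  have h4 := HasFDerivAt.comp_hasDerivAt z (f := fun t : ℂ => ((t ^ 2, t) : ℂ × ℂ)) h2 hl
  have h5 := h4.unique ((hasDerivAt_const z (0 : ℂ)).congr_of_eventuallyEq h1)
  rw [h3, ← h5]
  simp [dS, d1]
  ring

theorem constantCoeff_den (a : PS) : MvPowerSeries.constantCoeff (den a) = -1 := by simp [den]

/-- The division is done on the analytic sums and transported back, which gives convergence of the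
quotient at once. -/
theorem exists_mul_eq {n d : PS} (hn : Conv n) (hd : Conv d)
    (h0 : MvPowerSeries.constantCoeff d ≠ 0) : ∃ h, Conv h ∧ d * h = n := by
  have h1 : S d 0 ≠ 0 := by rwa [S_zero_eq]
  have h2 : AnalyticAt ℂ (fun w => S n w / S d w) 0 := (S_analyticAt hn).div (S_analyticAt hd) h1
  obtain ⟨h, hh, he⟩ := exists_series h2
  refine ⟨h, hh, eq_of_S_eq (hd.mul hh) hn ?_⟩
  filter_upwards [S_mul hd hh, he, (S_analyticAt hd).continuousAt.eventually_ne h1] with w e1 e2 e3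
  rw [e1, Pi.mul_apply, ← e2]
  field_simp

theorem rep_betaS {a : PS} (ha : Conv a) : Rep (betaS a) fun w =>
    betaNumS (w.1 - w.2 ^ 2) w.2 (S a w) (S (cj a) w) (S (dS a) w) (S (dS (cj a)) w)
      (S (dZ a) w) (S (dZ (cj a)) w) := rep_betaNumS ha
theorem rep_betaZ {a : PS} (ha : Conv a) : Rep (betaZ a) fun w =>
    betaNumZ (w.1 - w.2 ^ 2) w.2 (S a w) (S (cj a) w) (S (dS a) w) (S (dS (cj a)) w)
      (S (dZ a) w) (S (dZ (cj a)) w) := rep_betaNumZ ha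

/-- The equations for the first derivatives of `β`, differentiated once. -/
theorem eval_beta {a h k : PS} (ha : Conv a) (hh : Conv h) (hk : Conv k)
    (e1 : 2 * den a ^ 2 * h = -betaS a) (e2 : den a ^ 2 * k = -rhoPS * betaZ a) :
    ∀ᶠ w : ℂ × ℂ in 𝓝 0, ∀ s z f g fs gs fz gz fss gss fsz gsz fzz gzz N Ns Nz : ℂ,
      s = w.1 - w.2 ^ 2 → z = w.2 → f = S a w → g = S (cj a) w → fs = S (dS a) w →
      gs = S (dS (cj a)) w → fz = S (dZ a) w → gz = S (dZ (cj a)) w → fss = S (dS (dS a)) w →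
      gss = S (dS (dS (cj a))) w → fsz = S (dS (dZ a)) w → gsz = S (dS (dZ (cj a))) w →
      fzz = S (dZ (dZ a)) w → gzz = S (dZ (dZ (cj a))) w → N = w.1 * f * g - 1 →
      Ns = f * g + w.1 * (fs * g + f * gs) → Nz = 2 * z * f * g + w.1 * (fz * g + f * gz) →
      2 * N ^ 2 * S h w = -betaNumS s z f g fs gs fz gz ∧
      N ^ 2 * S k w = -s * betaNumZ s z f g fs gs fz gz ∧
      2 * N ^ 2 * S (dS h) w + 4 * N * Ns * S h w =
        -betaNumSs s z f g fs gs fz gz fss gss fsz gsz ∧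
      2 * N ^ 2 * S (dZ h) w + 4 * N * Nz * S h w =
        -betaNumSz s z f g fs gs fz gz fsz gsz fzz gzz ∧
      N ^ 2 * S (dS k) w + 2 * N * Ns * S k w =
        -betaNumZ s z f g fs gs fz gz - s * betaNumZs s z f g fs gs fz gz fss gss fsz gsz ∧
      N ^ 2 * S (dZ k) w + 2 * N * Nz * S k w =
        -s * betaNumZz s z f g fs gs fz gz fsz gsz fzz gzz := by
  have t2 := rep_ofNat 2
  have t4 := rep_ofNat 4
  have N := rep_den ha
  have Ns := rep_dS_den ha
  have Nz := rep_dZ_den ha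
  have f1 : 2 * den a ^ 2 * h + betaS a = 0 := by rw [e1]; ring
  have f2 : den a ^ 2 * k + rhoPS * betaZ a = 0 := by rw [e2]; ring
  have f3 : 2 * den a ^ 2 * dS h + 4 * den a * dS (den a) * h + dS (betaS a) = 0 := by
    have := congrArg dS f1
    simp only [map_add, dS_mul, sq, dS_two, map_zero] at this
    linear_combination this
  have f4 : 2 * den a ^ 2 * dZ h + 4 * den a * dZ (den a) * h + dZ (betaS a) = 0 := by
    have := congrArg dZ f1
    simp only [dZ_add, dZ_mul, sq, dZ_two, show dZ 0 = 0 by simp [dZ]] at this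
    linear_combination this
  have f5 : den a ^ 2 * dS k + 2 * den a * dS (den a) * k + (betaZ a + rhoPS * dS (betaZ a)) = 0 := by
    have := congrArg dS f2
    simp only [map_add, dS_mul, sq, dS_rhoPS, map_zero] at this
    linear_combination this
  have f6 : den a ^ 2 * dZ k + 2 * den a * dZ (den a) * k + rhoPS * dZ (betaZ a) = 0 := by
    have := congrArg dZ f2
    simp only [dZ_add, dZ_mul, sq, dZ_rhoPS, show dZ 0 = 0 by simp [dZ]] at this
    linear_combination this
  have g1 := (((t2.mul N.sq).mul hh.rep).add (rep_betaS ha)).eval_eq_zero f1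
  have g2 := ((N.sq.mul hk.rep).add (rep_rhoPS.mul (rep_betaZ ha))).eval_eq_zero f2
  have g3 := ((((t2.mul N.sq).mul hh.dS.rep).add (((t4.mul N).mul Ns).mul hh.rep)).add
    (rep_dS_betaS ha)).eval_eq_zero f3
  have g4 := ((((t2.mul N.sq).mul hh.dZ.rep).add (((t4.mul N).mul Nz).mul hh.rep)).add
    (rep_dZ_betaS ha)).eval_eq_zero f4
  have g5 := (((N.sq.mul hk.dS.rep).add (((t2.mul N).mul Ns).mul hk.rep)).add
    ((rep_betaZ ha).add (rep_rhoPS.mul (rep_dS_betaZ ha)))).eval_eq_zero f5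
  have g6 := (((N.sq.mul hk.dZ.rep).add (((t2.mul N).mul Nz).mul hk.rep)).add
    (rep_rhoPS.mul (rep_dZ_betaZ ha))).eval_eq_zero f6
  filter_upwards [g1, g2, g3, g4, g5, g6] with w g1 g2 g3 g4 g5 g6
  rintro s z f g fs gs fz gz fss gss fsz gsz fzz gzz N Ns Nz rfl rfl rfl rfl rfl rfl rfl rfl rfl rfl
    rfl rfl rfl rfl rfl rfl rfl
  exact ⟨by linear_combination g1, by linear_combination g2, by linear_combination g3,
    by linear_combination g4, by linear_combination g5, by linear_combination g6⟩

theorem eq_of_closed {N Ns Nz s h k hz ks A B A' B' : ℂ} (hN : N ≠ 0) (q1 : 2 * N ^ 2 * h = -A)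
    (q2 : N ^ 2 * k = -s * B) (q4 : 2 * N ^ 2 * hz + 4 * N * Nz * h = -A')
    (q5 : N ^ 2 * ks + 2 * N * Ns * k = -B - s * B')
    (key : -A' / (2 * N ^ 2) + A * Nz / N ^ 3 = -(B + s * B') / N ^ 2 + 2 * s * B * Ns / N ^ 3) :
    hz = ks := by
  field_simp at key
  refine mul_left_cancel₀ (pow_ne_zero 3 hN) ?_
  linear_combination (1 / 2) * key - Nz * q1 + N * q4 / 2 - N * q5 + 2 * Ns * q2

theorem ernstJet_conj {a : PS} (ha : Conv a) (h : lap a = ernstRhs a) :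
    ∀ᶠ p in 𝓝 (0 : E3), rhoSq p ≠ 0 → ErnstJet (rhoSq p) (p 2) (S (cj a) (inv p)) (S a (inv p))
      (S (dS (cj a)) (inv p)) (S (dZ (cj a)) (inv p)) (S (dS (dS (cj a))) (inv p))
      (S (dZ (dZ (cj a))) (inv p)) := by
  have := (ernst_iff_eventually ha.cj).mp (ernst_conj h)
  rwa [cj_cj] at this

/-- The function `β` belonging to a solution of the Ernst equation. -/
theorem exists_beta {a : PS} (ha : Conv a) (h : lap a = ernstRhs a) :
    ∃ b, IsSeriesSolution a b ∧ ∀ᶠ z : ℂ in 𝓝 0, S b (z ^ 2, z) = 0 := by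
  have hN := (rep_den ha).1
  have hS := (rep_betaS ha).1
  have hZ := (rep_betaZ ha).1
  obtain ⟨h', hh, e1⟩ := exists_mul_eq hS.neg ((conv_two.mul (rep_den ha).sq.1))
    (by rw [map_mul, map_pow, constantCoeff_den, ← C_two]; simp)
  obtain ⟨k, hk, e2⟩ := exists_mul_eq (rep_rhoPS.1.neg.mul hZ) (rep_den ha).sq.1
    (by rw [map_pow, constantCoeff_den]; simp)
  -- β is obtained by integrating its ρ̃²-derivative from the axis; its z̃-derivative is identified
  -- afterwards by closedness.
  obtain ⟨b, hb, hbh, hb0⟩ := exists_primitive hh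
  have hreal : cj h' = h' := by
    have c1 : cj (den a) = den a := by
      simp only [den, cj_sub, cj_mul, cj_X, cj_one, cj_cj]; ring
    have c2 : cj (betaS a) = betaS a := by
      simp only [betaS, betaNumS, cj_sub, cj_add, cj_mul, cj_X, cj_two, cj_cj, cj_dS, cj_dZ, rhoPS, sq]
      ring
    have c3 := congrArg cj e1
    rw [cj_mul, cj_mul, cj_two, sq, cj_mul, c1, show cj (-betaS a) = -cj (betaS a) from map_neg _ _,
      c2, ← e1, sq] at c3
    refine mul_left_cancel₀ (mul_ne_zero ?_ (mul_ne_zero (den_ne_zero a) (den_ne_zero a))) c3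
    rw [← C_two]
    exact fun h => two_ne_zero (α := ℂ) (by simpa using congrArg MvPowerSeries.constantCoeff h)
  have hclosed : dZ h' = dS k := by
    refine sub_eq_zero.mp ((hh.dZ.rep.sub hk.dS.rep).eq_zero ?_)
    filter_upwards [tendsto_inv.eventually (eval_beta ha hh hk e1 e2), tendsto_den ha,
      (ernst_iff_eventually ha).mp h, ernstJet_conj ha h] with p k1 k2 k3 k4 k5
    obtain ⟨q1, q2, -, q4, q5, -⟩ := k1 _ _ _ _ _ _ _ _ _ _ _ _ _ _ _ _ _ rfl rfl rfl rfl rfl rfl rfl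
      rfl rfl rfl rfl rfl rfl rfl rfl rfl rfl
    have key := beta_closed (fss := S (dS (dS a)) (inv p)) (gss := S (dS (dS (cj a))) (inv p))
      (fsz := S (dS (dZ a)) (inv p)) (gsz := S (dS (dZ (cj a))) (inv p)) k2 rfl rfl (k3 k5) (k4 k5)
    rw [inv_fst, inv_snd, add_sub_cancel_right] at q1 q2 q4 q5
    generalize ((rhoSq p : ℂ) + p 2 ^ 2) * S a (inv p) * S (cj a) (inv p) - 1 = N at *
    exact sub_eq_zero.mpr (eq_of_closed k2 q1 q2 q4 q5 key)
  -- Both sides have the same ρ̃²-derivative by closedness, and both vanish on the axis: the left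
  -- because b does, the right because of the factor ρ̃² in the equation defining k.
  have hbz : dZ b = k := by
    refine sub_eq_zero.mp (eq_zero_of_dS_eq_zero (hb.dZ.sub hk) ?_ ?_)
    · rw [map_sub, ← dZ_dS, hbh, hclosed, sub_self]
    · filter_upwards [axis_dZ hb hb0, tendsto_axis.eventually (S_sub hb.dZ hk),
        tendsto_axis.eventually (eval_beta ha hh hk e1 e2),
        tendsto_axis.eventually (eventually_den_ne ha)] with z h1 h2 h3 h4
      obtain ⟨-, q2, -⟩ := h3 _ _ _ _ _ _ _ _ _ _ _ _ _ _ _ _ _ rfl rfl rfl rfl rfl rfl rfl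
        rfl rfl rfl rfl rfl rfl rfl rfl rfl rfl
      rw [sub_self, neg_zero, zero_mul] at q2
      rw [h2, Pi.sub_apply, h1, (mul_eq_zero.mp q2).resolve_left (pow_ne_zero 2 h4), sub_self]
  have hbr : cj b = b := by
    refine sub_eq_zero.mp (eq_zero_of_dS_eq_zero (hb.cj.sub hb) ?_ ?_)
    · rw [map_sub, ← cj_dS, hbh, hreal, sub_self]
    · have hc : Filter.Tendsto (fun z : ℂ => conj z) (𝓝 0) (𝓝 0) := by
        simpa using Complex.continuous_conj.tendsto 0
      filter_upwards [tendsto_axis.eventually (S_sub hb.cj hb), hb0, hc.eventually hb0] with z h1 h2 h3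
      rw [h1, Pi.sub_apply, h2, S_cj, map_pow, h3]
      simp
  exact ⟨b, ⟨ha, hb, hbr, h, by rw [hbh]; exact e1, by rw [hbz]; exact e2⟩, hb0⟩

theorem fieldEquations_of_isSeriesSolution {a b : PS} (h : IsSeriesSolution a b) {f : E3 → ℂ}
    {β : E3 → ℝ} (hf : ∀ᶠ p in 𝓝 (0 : E3), f p = S a (inv p))
    (hβ : ∀ᶠ p in 𝓝 (0 : E3), β p = (S b (inv p)).re) :
    ∀ᶠ p in 𝓝 (0 : E3), rhoSq p ≠ 0 → FieldEquationsAt (weylMetric β) (potential f) p := by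
  have ha := h.conv_a
  filter_upwards [fieldEquations_series_iff ha h.conv_b h.real_b hf hβ,
    tendsto_inv.eventually (eval_beta ha h.conv_b.dS h.conv_b.dZ h.beta_s h.beta_z), tendsto_den ha,
    (ernst_iff_eventually ha).mp h.ernst, ernstJet_conj ha h.ernst] with p k0 k1 k2 k3 k4 k5
  obtain ⟨q1, q2, q3, -, -, q6⟩ := k1 _ _ _ _ _ _ _ _ _ _ _ _ _ _ _ _ _ rfl rfl rfl rfl rfl rfl rfl
    rfl rfl rfl rfl rfl rfl rfl rfl rfl rfl
  rw [inv_fst, inv_snd, add_sub_cancel_right] at q1 q2 q3 q6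
  refine (k0 _ _ _ _ _ _ _ _ _ _ _ _ _ _ k5 rfl rfl rfl rfl rfl rfl rfl rfl
      rfl rfl rfl rfl rfl rfl).mpr ⟨?_, k3 k5⟩
  have hN : ∃ N, N = ((rhoSq p : ℂ) + p 2 ^ 2) * S a (inv p) * S (cj a) (inv p) - 1 := ⟨_, rfl⟩
  obtain ⟨N, hN⟩ := hN
  rw [← hN] at q1 q2 q3 q6 k2 ⊢
  have q1' := (eq_div_iff (b := 2 * N ^ 2) (by simpa using k2)).mpr ((mul_comm _ _).trans q1)
  have q2' := (eq_div_iff (b := N ^ 2) (by simpa using k2)).mpr ((mul_comm _ _).trans q2)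
  refine ricci_of_beta (fss := S (dS (dS a)) (inv p)) (gss := S (dS (dS (cj a))) (inv p))
    (fsz := S (dS (dZ a)) (inv p)) (gsz := S (dS (dZ (cj a))) (inv p)) (by exact_mod_cast k5)
    (norm_sq_ne k5) k2 rfl hN (k3 k5) (k4 k5) q1' q2' ?_ ?_
  · rw [q1'] at q3
    simp only [betaNumSs] at q3
    clear q1 q2 q6 q1' q2' k0 k1
    field_simp at q3 ⊢
    linear_combination q3 / 2
  · rw [q2'] at q6
    simp only [betaNumZz] at q6
    clear q1 q2 q3 q1' q2' k0 k1
    field_simp at q6 ⊢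
    linear_combination q6

/-! ### Analyticity of curvature -/

section
variable {F : Type*} [NormedAddCommGroup F] [NormedSpace ℝ F] [CompleteSpace F] {p : E3}

theorem analyticAt_pd {u : E3 → F} (i : Fin 3) (hu : AnalyticAt ℝ u p) : AnalyticAt ℝ (pd i u) p :=
  ((ContinuousLinearMap.apply ℝ F (EuclideanSpace.single i 1 : E3)).analyticAt _).comp hu.fderiv

theorem analyticAt_det {n : Type*} [Fintype n] [DecidableEq n] {g : E3 → Matrix n n ℝ}
    (hg : ∀ i j, AnalyticAt ℝ (fun q => g q i j) p) : AnalyticAt ℝ (fun q => (g q).det) p := by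
  simp only [Matrix.det_apply, zsmul_eq_mul, Units.smul_def]
  exact Finset.analyticAt_fun_sum _ fun σ _ =>
    analyticAt_const.mul (Finset.analyticAt_fun_prod _ fun i _ => hg _ _)

theorem analyticAt_matrix_inv {n : Type*} [Fintype n] [DecidableEq n] {g : E3 → Matrix n n ℝ}
    (hg : ∀ i j, AnalyticAt ℝ (fun q => g q i j) p) (h0 : (g p).det ≠ 0) (i j : n) :
    AnalyticAt ℝ (fun q => (g q)⁻¹ i j) p := by
  have h1 : AnalyticAt ℝ (fun q => (g q).adjugate i j) p := by
    simp only [Matrix.adjugate_apply]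
    refine analyticAt_det fun k l => ?_
    by_cases hk : k = j
    · simp only [hk, Matrix.updateRow_self]; exact analyticAt_const
    · simp only [ne_eq, hk, not_false_eq_true, Matrix.updateRow_ne]; exact hg k l
  have h2 : (fun q => (g q)⁻¹ i j) = fun q => ((g q).det)⁻¹ * (g q).adjugate i j := by
    funext q
    rw [Matrix.inv_def, Ring.inverse_eq_inv', Matrix.smul_apply, smul_eq_mul]
  rw [h2]
  exact ((analyticAt_det hg).inv h0).mul h1

variable {g : MetricField}

theorem analyticAt_christoffel (hg : ∀ i j, AnalyticAt ℝ (fun q => g q i j) p)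
    (h0 : (g p).det ≠ 0) (k i j : Fin 3) : AnalyticAt ℝ (christoffel g k i j) p := by
  refine analyticAt_const.mul (Finset.analyticAt_fun_sum _ fun l _ => ?_)
  exact (analyticAt_matrix_inv hg h0 k l).mul
    (((analyticAt_pd i (hg j l)).add (analyticAt_pd j (hg i l))).sub (analyticAt_pd l (hg i j)))

theorem analyticAt_ricci (hg : ∀ i j, AnalyticAt ℝ (fun q => g q i j) p)
    (h0 : (g p).det ≠ 0) (i j : Fin 3) : AnalyticAt ℝ (ricci g i j) p := by
  have h := analyticAt_christoffel hg h0
  refine (Finset.analyticAt_fun_sum _ fun k _ => ?_).add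
    (Finset.analyticAt_fun_sum _ fun k _ => Finset.analyticAt_fun_sum _ fun l _ => ?_)
  · exact (analyticAt_pd k (h _ _ _)).sub (analyticAt_pd j (h _ _ _))
  · exact ((h _ _ _).mul (h _ _ _)).sub ((h _ _ _).mul (h _ _ _))

theorem analyticAt_laplacian (hg : ∀ i j, AnalyticAt ℝ (fun q => g q i j) p)
    (h0 : (g p).det ≠ 0) {u : E3 → ℂ} (hu : AnalyticAt ℝ u p) :
    AnalyticAt ℝ (laplacian g u) p := by
  refine Finset.analyticAt_fun_sum _ fun i _ => Finset.analyticAt_fun_sum _ fun j _ => ?_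
  refine (analyticAt_ofReal (analyticAt_matrix_inv hg h0 i j)).mul
    ((analyticAt_pd i (analyticAt_pd j hu)).sub (Finset.analyticAt_fun_sum _ fun k _ => ?_))
  exact (analyticAt_ofReal (analyticAt_christoffel hg h0 k i j)).mul (analyticAt_pd k hu)

theorem analyticAt_gradProd (hg : ∀ i j, AnalyticAt ℝ (fun q => g q i j) p)
    (h0 : (g p).det ≠ 0) {u v : E3 → ℂ} (hu : AnalyticAt ℝ u p) (hv : AnalyticAt ℝ v p) :
    AnalyticAt ℝ (gradProd g u v) p :=
  Finset.analyticAt_fun_sum _ fun i _ => Finset.analyticAt_fun_sum _ fun j _ =>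
    (analyticAt_ofReal (analyticAt_matrix_inv hg h0 i j)).mul
      ((analyticAt_pd i hu).mul (analyticAt_pd j hv))

theorem analyticAt_conj {u : E3 → ℂ} (hu : AnalyticAt ℝ u p) :
    AnalyticAt ℝ (fun q => conj (u q)) p :=
  (Complex.conjCLE.toContinuousLinearMap.analyticAt _).comp hu
end

theorem frequently_rhoSq_ne_zero (p : E3) : ∃ᶠ q in 𝓝 p, rhoSq q ≠ 0 := by
  by_cases hp : rhoSq p = 0
  · have h0 : p 0 = 0 := by
      unfold rhoSq at hp
      nlinarith [sq_nonneg (p 0), sq_nonneg (p 1)]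
    have h : Filter.Tendsto (fun t : ℝ => p + t • (EuclideanSpace.single 0 1 : E3)) (𝓝[≠] 0)
        (𝓝 p) := by
      have : Continuous fun t : ℝ => p + t • (EuclideanSpace.single 0 1 : E3) := by fun_prop
      have h := (this.tendsto 0).mono_left (nhdsWithin_le_nhds (s := {0}ᶜ))
      rwa [zero_smul, add_zero] at h
    refine h.frequently (Filter.Eventually.frequently ?_)
    filter_upwards [self_mem_nhdsWithin] with t ht
    have : t ≠ 0 := ht
    simp only [rhoSq, PiLp.add_apply, PiLp.smul_apply, h0]
    simp
    positivity
  · exact ((analyticAt_rhoSq p).continuousAt.eventually_ne hp).frequently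

/-- The axis has empty interior, so continuity carries the identity onto it. -/
theorem eq_of_eventually_off_axis {u v : E3 → ℂ} {p : E3} (hu : AnalyticAt ℝ u p)
    (hv : AnalyticAt ℝ v p) (huv : ∀ᶠ q in 𝓝 p, rhoSq q ≠ 0 → u q = v q) : u p = v p := by
  by_contra hne
  have := (hu.continuousAt.sub hv.continuousAt).eventually_ne (sub_ne_zero.mpr hne)
  obtain ⟨q, hq, h1, h2⟩ := ((frequently_rhoSq_ne_zero p).and_eventually (huv.and this)).exists
  exact h2 (sub_eq_zero.mpr (h1 hq))

theorem eventuallyEq_of_off_axis {u v : E3 → ℂ} {p : E3} (hu : AnalyticAt ℝ u p)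
    (hv : AnalyticAt ℝ v p) (huv : ∀ᶠ q in 𝓝 p, rhoSq q ≠ 0 → u q = v q) : u =ᶠ[𝓝 p] v := by
  filter_upwards [hu.eventually_analyticAt, hv.eventually_analyticAt, huv.eventually_nhds]
    with q h1 h2 h3 using eq_of_eventually_off_axis h1 h2 h3

/-- The field equations hold at `p` if they hold at the nearby points off the axis. -/
theorem fieldEquationsAt_of_eventually {h : MetricField} {φ : E3 → ℂ} {p : E3}
    (hh : ∀ i j, AnalyticAt ℝ (fun q => h q i j) p) (h0 : (h p).det ≠ 0) (hφ : AnalyticAt ℝ φ p)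
    (hN : φ p * conj (φ p) - 1 ≠ 0)
    (he : ∀ᶠ q in 𝓝 p, rhoSq q ≠ 0 → FieldEquationsAt h φ q) : FieldEquationsAt h φ p := by
  have ext := fun u v => eq_of_eventually_off_axis (u := u) (v := v) (p := p)
  have hc := analyticAt_conj hφ
  have hd : AnalyticAt ℝ (fun q => φ q * conj (φ q) - 1) p := (hφ.mul hc).sub analyticAt_const
  refine ⟨fun a b => ?_, ?_⟩
  · refine ext _ _ (analyticAt_ofReal (analyticAt_ricci hh h0 a b))
      ((analyticAt_const.div (hd.pow 2) (pow_ne_zero 2 hN)).mul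
        ((((analyticAt_pd a hφ).mul (analyticAt_pd b hc)).add
          ((analyticAt_pd b hφ).mul (analyticAt_pd a hc))).div analyticAt_const two_ne_zero)) ?_
    filter_upwards [he] with q hq h using (hq h).1 a b
  · refine ext _ _ (analyticAt_laplacian hh h0 hφ)
      (((analyticAt_const.mul hc).div hd hN).mul (analyticAt_gradProd hh h0 hφ hφ)) ?_
    filter_upwards [he] with q hq h using (hq h).2

/-! ### Division by `ρ̃²` -/

/-- In the variables (ρ̃², z̃) vanishing on the axis is divisibility by the first variable. The
shift of the first variable by z̃² is carried out on the sums of the series and undone after the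
division. -/
theorem exists_rhoPS_mul {u : PS} (hu : Conv u) (h : ∀ᶠ z : ℂ in 𝓝 0, S u (z ^ 2, z) = 0) :
    ∃ k, Conv k ∧ u = rhoPS * k := by
  have hm : AnalyticAt ℂ (fun w : ℂ × ℂ => (w.1 + w.2 ^ 2, w.2)) 0 :=
    (analyticAt_fst.add (analyticAt_snd.pow 2)).prod analyticAt_snd
  have hG : AnalyticAt ℂ (fun w : ℂ × ℂ => S u (w.1 + w.2 ^ 2, w.2)) 0 := by
    refine AnalyticAt.comp (g := S u) ?_ hm
    simpa [← Prod.zero_eq_mk] using S_analyticAt hu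
  obtain ⟨c, hc, hcS⟩ := exists_series hG
  have h0 : null c = 0 := by
    rw [← taylor_S hc, ← map_zero PowerSeries.C, ← taylor_const]
    refine taylor_congr ?_
    filter_upwards [h, tendsto_prodMk_zero.eventually hcS] with z h1 h2
    rw [← h2, zero_add, h1]
  obtain ⟨c', rfl⟩ : (MvPowerSeries.X 0 : PS) ∣ c := by
    rw [MvPowerSeries.X_dvd_iff]
    intro e he
    rw [coeff_eq_null c he, h0, map_zero]
  have hc' : Conv c' := by
    obtain ⟨C, A, hC, hA, hb⟩ := hc.exists_bound
    refine conv_of_bound (C := C * A) hA.le fun d => ?_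
    have := hb (Finsupp.single 0 1 + d)
    rw [MvPowerSeries.X, MvPowerSeries.coeff_add_monomial_mul, one_mul] at this
    refine this.trans_eq ?_
    rw [mul_assoc, ← pow_succ']
    congr 2
    simp [deg]; ring
  have hm' : AnalyticAt ℂ (fun w : ℂ × ℂ => (w.1 - w.2 ^ 2, w.2)) 0 :=
    (analyticAt_fst.sub (analyticAt_snd.pow 2)).prod analyticAt_snd
  have hG' : AnalyticAt ℂ (fun w : ℂ × ℂ => S c' (w.1 - w.2 ^ 2, w.2)) 0 := by
    refine AnalyticAt.comp (g := S c') ?_ hm'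
    simpa [← Prod.zero_eq_mk] using S_analyticAt hc'
  obtain ⟨k, hk, hkS⟩ := exists_series hG'
  refine ⟨k, hk, eq_of_S_eq hu (rep_rhoPS.1.mul hk) ?_⟩
  have ht : Filter.Tendsto (fun w : ℂ × ℂ => (w.1 - w.2 ^ 2, w.2)) (𝓝 0) (𝓝 0) := by
    simpa [← Prod.zero_eq_mk] using hm'.continuousAt.tendsto
  filter_upwards [ht.eventually hcS, ht.eventually (rep_q.mul hc'.rep).2, hkS,
    (rep_rhoPS.mul hk.rep).2] with w e1 e2 e3 e4
  rw [e4, ← e3]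
  rw [e2] at e1
  simpa using e1

/-! ### Regularity -/

theorem analyticAt_rot (i : Fin 3) (p : E3) : AnalyticAt ℝ (fun q => rot q i) p := by
  fin_cases i
  · exact (analyticAt_coord 1 p).neg
  · exact analyticAt_coord 0 p
  · exact analyticAt_const

theorem hatMetric_apply {β : E3 → ℝ} {K : ℝ} {p : E3}
    (h : Real.exp (-2 * β p) - 1 = rhoSq p * K) (i j : Fin 3) :
    hatMetric β p i j = kron i j + K * (rot p i * rot p j) := by
  have h1 : Real.exp (-2 * β p) = 1 + rhoSq p * K := by linarith
  have h2 : hatMetric β p i j = (Real.exp (-2 * β p) - 1) * angularForm p i j + kron i j := by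
    simp only [hatMetric, Matrix.add_apply, Matrix.smul_apply, Matrix.sub_apply, smul_eq_mul,
      Matrix.one_apply, kron]
    ring
  have h3 : angularForm p i j = rot p i * rot p j / rhoSq p := rfl
  rw [h2, h3, h1]
  -- On the axis the quotient in `angularForm` is 0 by convention, in agreement with the vanishing
  -- of `rot` there.
  by_cases hs : rhoSq p = 0
  · have h0 : p 0 = 0 := by
      unfold rhoSq at hs; nlinarith [sq_nonneg (p 0), sq_nonneg (p 1)]
    have h0' : p 1 = 0 := by
      unfold rhoSq at hs; nlinarith [sq_nonneg (p 0), sq_nonneg (p 1)]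
    have hr : rot p i = 0 := by fin_cases i <;> simp [rot, h0, h0']
    rw [hr]; ring
  · field_simp; ring

theorem analyticAt_hatMetric {β K : E3 → ℝ} {p : E3} (hK : AnalyticAt ℝ K p)
    (h : ∀ᶠ q in 𝓝 p, Real.exp (-2 * β q) - 1 = rhoSq q * K q) (i j : Fin 3) :
    AnalyticAt ℝ (fun q => hatMetric β q i j) p := by
  refine ((analyticAt_const (v := kron i j)).add
    (hK.mul ((analyticAt_rot i p).mul (analyticAt_rot j p)))).congr ?_
  filter_upwards [h] with q hq using (hatMetric_apply hq i j).symm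

theorem det_hatMetric {β : E3 → ℝ} {K : ℝ} {p : E3}
    (h : Real.exp (-2 * β p) - 1 = rhoSq p * K) : (hatMetric β p).det = Real.exp (-2 * β p) := by
  rw [Matrix.det_fin_three]
  simp only [hatMetric_apply h]
  rw [eq_add_of_sub_eq h]
  simp [rot, kron, rhoSq]
  ring

theorem weylMetric_eq_smul_hatMetric (β : E3 → ℝ) (p : E3) :
    weylMetric β p = ((‖p‖ ^ 4)⁻¹ * Real.exp (2 * β p)) • hatMetric β p := by
  have : Real.exp (2 * β p) * Real.exp (-2 * β p) = 1 := by rw [← Real.exp_add]; simp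
  rw [weylMetric, hatMetric, mul_smul, smul_add (Real.exp (2 * β p)),
    smul_smul (Real.exp (2 * β p)), this, one_smul]

/-- Since β vanishes on the axis, so does e^{−2β} − 1, which is therefore divisible by ρ̃². This
quotient is what makes the rescaled metric analytic across the axis. -/
theorem exists_exp_sub_one {b : PS} (hb : Conv b) (h0 : ∀ᶠ z : ℂ in 𝓝 0, S b (z ^ 2, z) = 0)
    {β : E3 → ℝ} (hβ : ∀ᶠ p in 𝓝 (0 : E3), (β p : ℂ) = S b (inv p)) :
    ∃ k, Conv k ∧
      ∀ᶠ p in 𝓝 (0 : E3), Real.exp (-2 * β p) - 1 = rhoSq p * (S k (inv p)).re := by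
  have hE : AnalyticAt ℂ (fun w => Complex.exp (-2 * S b w) - 1) 0 :=
    ((analyticAt_const.mul (S_analyticAt hb)).cexp).sub analyticAt_const
  obtain ⟨u, hu, hue⟩ := exists_series hE
  obtain ⟨k, hk, rfl⟩ := exists_rhoPS_mul hu (by
    filter_upwards [h0, tendsto_axis.eventually hue] with z h1 h2
    rw [← h2, h1]; simp)
  refine ⟨k, hk, ?_⟩
  filter_upwards [tendsto_inv.eventually hue, tendsto_inv.eventually (rep_rhoPS.mul hk.rep).2, hβ]
    with p h1 h2 h3
  rw [h2, inv_fst, inv_snd, add_sub_cancel_right, ← h3] at h1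
  have := congrArg Complex.re h1
  rw [Complex.re_ofReal_mul] at this
  rw [← this, show (-2 * (β p : ℂ)) = ((-2 * β p : ℝ) : ℂ) by push_cast; ring,
    ← Complex.ofReal_exp, Complex.sub_re, Complex.ofReal_re, Complex.one_re]

/-- A solution of the Ernst equation determines an axisymmetric vacuum solution. -/
theorem exists_isAxisymmetricVacuum {a : PS} (ha : Conv a) (h : lap a = ernstRhs a) :
    ∃ β : E3 → ℝ, IsAxisymmetricVacuum (fun p => S a (inv p)) β := by
  obtain ⟨b, hb, h0⟩ := exists_beta ha h
  have hbc := hb.conv_b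
  have hSb := S_analyticAt hbc
  let β : E3 → ℝ := fun p => (S b (inv p)).re
  obtain ⟨k, hk, hβK⟩ := exists_exp_sub_one (β := β) hbc h0
    (Filter.Eventually.of_forall fun p => ofReal_re_S hb.real_b p)
  let K : E3 → ℝ := fun p => (S k (inv p)).re
  have hre : ∀ {G : ℂ × ℂ → ℂ}, AnalyticAt ℂ G 0 → AnalyticAt ℝ (fun p => (G (inv p)).re) 0 :=
    fun hG => (Complex.reCLM.analyticAt _).comp (analyticAt_comp_inv hG)
  have hβ : AnalyticAt ℝ β 0 := hre hSb
  have hK : AnalyticAt ℝ K 0 := hre (S_analyticAt hk)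
  have hf : AnalyticAt ℝ (fun p => S a (inv p)) 0 := analyticAt_comp_inv (S_analyticAt ha)
  have hhat := fun i j => analyticAt_hatMetric hK hβK i j
  have hinv : ∀ {p q : E3}, q 0 ^ 2 + q 1 ^ 2 = p 0 ^ 2 + p 1 ^ 2 → q 2 = p 2 → inv q = inv p := by
    intro p q h1 h2
    simp only [inv, norm_sq_eq, rhoSq, h1, h2]
  refine ⟨β, hf, Filter.Eventually.of_forall fun p q h1 h2 => by simp only; rw [hinv h1 h2], hβ,
    Filter.Eventually.of_forall fun p q h1 h2 => by simp only [β]; rw [hinv h1 h2], hhat, ?_⟩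
  have hoff := fieldEquations_of_isSeriesSolution (f := fun p => S a (inv p)) (β := β) hb
    (Filter.Eventually.of_forall fun p => rfl) (Filter.Eventually.of_forall fun p => rfl)
  have hpot : ∀ᶠ p in 𝓝 (0 : E3), potential (fun p => S a (inv p)) p *
      conj (potential (fun p => S a (inv p)) p) - 1 ≠ 0 := by
    filter_upwards [tendsto_inv.eventually (eventually_den_ne ha)] with p hp
    rw [S_cj_inv] at hp
    refine fun h => hp ?_
    rw [← h]
    simp only [potential, map_mul, Complex.conj_ofReal, inv]
    push_cast
    ring
  rw [eventually_nhdsWithin_iff]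
  filter_upwards [hoff.eventually_nhds, hpot, hf.eventually_analyticAt, hβ.eventually_analyticAt,
    Filter.eventually_all.mpr fun i => Filter.eventually_all.mpr fun j =>
      (hhat i j).eventually_analyticAt, hβK] with p h1 h2 h3 h4 h5 h6 hp
  have hp0 : p ≠ 0 := hp
  have hn : AnalyticAt ℝ (fun q : E3 => ‖q‖) p := (contDiffAt_norm ℝ hp0).analyticAt
  have hfac : AnalyticAt ℝ (fun q => (‖q‖ ^ 4)⁻¹ * Real.exp (2 * β q)) p :=
    ((hn.pow 4).inv (pow_ne_zero 4 (norm_ne_zero_iff.mpr hp0))).mul (analyticAt_const.mul h4).rexp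
  -- At points of the axis other than Λ the equations follow by continuity from nearby points off
  -- the axis.
  refine fieldEquationsAt_of_eventually (fun i j => ?_) ?_ ((analyticAt_ofReal hn).mul h3) h2 h1
  · simp only [weylMetric_eq_smul_hatMetric, Matrix.smul_apply, smul_eq_mul]
    exact hfac.mul (h5 i j)
  · rw [weylMetric_eq_smul_hatMetric, Matrix.det_smul, det_hatMetric h6]
    have := norm_pos_iff.mpr hp0
    positivity

/-! ### The power series of a solution -/

/-- Power series describing an axisymmetric vacuum solution; the third one describes
`(e^{-2β} - 1) / ρ̃²`. -/
structure IsSolutionData (f : E3 → ℂ) (β : E3 → ℝ) (a b k : PS) : Prop where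
  sol : IsSeriesSolution a b
  f_eq : ∀ᶠ p in 𝓝 (0 : E3), f p = S a (inv p)
  β_eq : ∀ᶠ p in 𝓝 (0 : E3), (β p : ℂ) = S b (inv p)
  axis : ∀ᶠ z : ℂ in 𝓝 0, S b (z ^ 2, z) = 0
  conv_k : Conv k
  exp_eq : ∀ᶠ p in 𝓝 (0 : E3), Real.exp (-2 * β p) - 1 = rhoSq p * (S k (inv p)).re

theorem trace_hatMetric (β : E3 → ℝ) (p : E3) : ∑ i, hatMetric β p i i =
    if rhoSq p = 0 then 3 else 2 + Real.exp (-2 * β p) := by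
  have h : ∀ i, hatMetric β p i i =
      1 + (Real.exp (-2 * β p) - 1) * (rot p i * rot p i / rhoSq p) := by
    intro i
    simp only [hatMetric, angularForm, Matrix.add_apply, Matrix.smul_apply, Matrix.sub_apply,
      smul_eq_mul, Matrix.one_apply_eq, Matrix.of_apply, rot, rhoSq]
    ring
  simp only [h, Fin.sum_univ_three]
  split_ifs with hs
  · simp [hs]; norm_num
  · field_simp
    simp only [rot, rhoSq, Matrix.cons_val_zero, Matrix.cons_val_one, Matrix.cons_val]
    ring

/-- The trace of the rescaled metric is 3 on the axis and 2 + e^{−2β} off it, so analyticity of the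
metric coefficients forces e^{−2β} = 1 on the axis. -/
theorem eq_zero_of_rhoSq_eq_zero {f : E3 → ℂ} {β : E3 → ℝ} (h : IsAxisymmetricVacuum f β) :
    ∀ᶠ p in 𝓝 (0 : E3), rhoSq p = 0 → β p = 0 := by
  have htr : AnalyticAt ℝ (fun p => ∑ i, hatMetric β p i i) 0 :=
    Finset.analyticAt_fun_sum _ fun i _ => h.analytic_metric i i
  filter_upwards [htr.eventually_analyticAt, h.analytic_β.eventually_analyticAt] with p h1 h2 hp
  have h3 : ContinuousAt (fun q => (∑ i, hatMetric β q i i) - (2 + Real.exp (-2 * β q))) p :=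
    h1.continuousAt.sub (continuousAt_const.add (continuousAt_const.mul h2.continuousAt).rexp)
  have h4 : (∑ i, hatMetric β p i i) - (2 + Real.exp (-2 * β p)) = 0 := by
    by_contra hne
    obtain ⟨q, hq, h5⟩ := ((frequently_rhoSq_ne_zero p).and_eventually (h3.eventually_ne hne)).exists
    rw [trace_hatMetric, if_neg hq, sub_self] at h5
    exact h5 rfl
  rw [trace_hatMetric, if_pos hp] at h4
  have h5 : Real.exp (-2 * β p) = 1 := by linarith
  rw [Real.exp_eq_one_iff] at h5
  linarith

theorem exists_isSolutionData {f : E3 → ℂ} {β : E3 → ℝ} (h : IsAxisymmetricVacuum f β) :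
    ∃ a b k, IsSolutionData f β a b k := by
  obtain ⟨a, ha, hf⟩ := exists_series_of_axisymmetric h.analytic_f h.axisymmetric_f
  obtain ⟨b, hb, hβ⟩ := exists_series_of_axisymmetric (analyticAt_ofReal h.analytic_β) (by
    filter_upwards [h.axisymmetric_β] with p hp q h1 h2
    rw [hp q h1 h2])
  have hfe := eventually_nhdsWithin_iff.mp h.fieldEquations
  have hsol := isSeriesSolution_of_fieldEquations ha hb hf hβ (by
    filter_upwards [hfe] with p hp h0
    refine hp fun h => h0 ?_
    rw [Set.mem_singleton_iff.mp h]; simp [rhoSq])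
  have haxis : ∀ᶠ z : ℂ in 𝓝 0, S b (z ^ 2, z) = 0 := by
    have han : AnalyticAt ℂ (fun z : ℂ => S b (z ^ 2, z)) 0 := by
      refine AnalyticAt.comp (g := S b) (f := fun z : ℂ => (z ^ 2, z)) ?_
        ((analyticAt_id.pow 2).prod analyticAt_id)
      simpa [← Prod.zero_eq_mk] using S_analyticAt hb
    -- β vanishes at the real points of the axis, which accumulate at Λ; the identity theorem
    -- extends this to complex z̃.
    refine han.eventually_eq_zero_or_eventually_ne_zero.resolve_right fun hne => ?_
    have hl : Filter.Tendsto (fun t : ℝ => t • (EuclideanSpace.single 2 1 : E3)) (𝓝[≠] 0) (𝓝 0) := by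
      have : Continuous fun t : ℝ => t • (EuclideanSpace.single 2 1 : E3) := by fun_prop
      have h := (this.tendsto 0).mono_left (nhdsWithin_le_nhds (s := {0}ᶜ))
      rwa [zero_smul] at h
    have hr : Filter.Tendsto (fun t : ℝ => (t : ℂ)) (𝓝[≠] 0) (𝓝[≠] 0) := by
      refine tendsto_nhdsWithin_of_tendsto_nhds_of_eventually_within _
        ((Complex.continuous_ofReal.tendsto 0).mono_left nhdsWithin_le_nhds) ?_
      filter_upwards [self_mem_nhdsWithin] with t ht
      simpa using ht
    obtain ⟨t, h1, h2, h3⟩ := ((hr.eventually hne).and ((hl.eventually hβ).and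
      (hl.eventually (eq_zero_of_rhoSq_eq_zero h)))).exists
    rw [h3 (by simp [rhoSq])] at h2
    refine h1 ?_
    rw [← Complex.ofReal_zero, h2]
    congr 1
    simp [inv, norm_smul]
  obtain ⟨k, hk, hke⟩ := exists_exp_sub_one hb haxis hβ
  exact ⟨a, b, k, hsol, hf, hβ, haxis, hk, hke⟩

theorem constantCoeff_null (a : PS) : PowerSeries.constantCoeff (null a) = S a 0 := by
  rw [← PowerSeries.coeff_zero_eq_constantCoeff_apply, coeff_null, S_zero_eq, Finsupp.single_zero]
  rfl

theorem constantCoeff_null_beta {b : PS} (h : ∀ᶠ z : ℂ in 𝓝 0, S b (z ^ 2, z) = 0) :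
    PowerSeries.constantCoeff (null b) = 0 := by
  rw [constantCoeff_null, ← h.self_of_nhds]
  congr 1; ext <;> simp

/-- The function `β` on the null cone. -/
theorem derivative_null_beta {a b : PS} (h : IsSeriesSolution a b) :
    PowerSeries.derivative ℂ (null b) = PowerSeries.X *
      (null a + 2 * PowerSeries.X * PowerSeries.derivative ℂ (null a)) *
      (null (cj a) + 2 * PowerSeries.X * PowerSeries.derivative ℂ (null (cj a))) := by
  have h1 := congrArg null h.beta_s
  have h2 := congrArg null h.beta_z
  have hd : null (den a) = -1 := by simp [den, null_X_zero]
  have hr : null rhoPS = -PowerSeries.X ^ 2 := by simp [rhoPS, null_X_zero, null_X_one]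
  simp only [betaNumS, betaNumZ, map_neg, map_add, map_sub, map_mul, map_pow, map_ofNat, hd, hr, null_dZ,
    null_X_one] at h1 h2
  -- By `null_dZ`, the derivative of β along the null cone is its z̃-derivative minus 2t times its
  -- ρ̃²-derivative; on the cone ρ̃² = −t² and the denominator `den a` is −1.
  linear_combination h2 - PowerSeries.X * h1

/-! ### Derivatives along a complex direction at `Λ` -/

/-- Differentiation in the complex direction `η`. -/
def dirD (η : Fin 3 → ℂ) (u : E3 → ℂ) (p : E3) : ℂ := ∑ i, η i * pd i u p

theorem pd_congr {F : Type*} [NormedAddCommGroup F] [NormedSpace ℝ F] {u v : E3 → F} {p : E3}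
    (h : u =ᶠ[𝓝 p] v) (i : Fin 3) : pd i u =ᶠ[𝓝 p] pd i v := by
  filter_upwards [h.eventually_nhds] with q hq
  rw [pd, pd, Filter.EventuallyEq.fderiv_eq hq]

theorem dirD_congr {η : Fin 3 → ℂ} {u v : E3 → ℂ} {p : E3} (h : u =ᶠ[𝓝 p] v) :
    dirD η u =ᶠ[𝓝 p] dirD η v := by
  filter_upwards [Filter.eventually_all.mpr (pd_congr h)] with q hq
  simp only [dirD, hq]

theorem analyticAt_dirD {η : Fin 3 → ℂ} {u : E3 → ℂ} {p : E3} (h : AnalyticAt ℝ u p) :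
    AnalyticAt ℝ (dirD η u) p :=
  Finset.analyticAt_fun_sum _ fun i _ => analyticAt_const.mul (analyticAt_pd i h)

theorem HasGrad.dirD_eq {η : Fin 3 → ℂ} {u : E3 → ℂ} {d : Fin 3 → ℂ} {p : E3} (h : HasGrad u d p) :
    dirD η u p = ∑ i, η i * d i := by simp only [dirD, h.pd_eq]

/-- The Taylor series of `u` at the origin in the complex direction `η`. -/
def dirTaylor (η : Fin 3 → ℂ) (u : E3 → ℂ) : PowerSeries ℂ :=
  PowerSeries.mk fun n => (dirD η)^[n] u 0 / n.factorial

section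
variable {η : Fin 3 → ℂ}

theorem coeff_dirTaylor (u : E3 → ℂ) (n : ℕ) :
    (dirTaylor η u).coeff n = (dirD η)^[n] u 0 / n.factorial := PowerSeries.coeff_mk _ _

theorem coeff_zero_dirTaylor (u : E3 → ℂ) : (dirTaylor η u).coeff 0 = u 0 := by
  simp [coeff_dirTaylor]

theorem dirTaylor_congr {u v : E3 → ℂ} (h : u =ᶠ[𝓝 0] v) : dirTaylor η u = dirTaylor η v := by
  have : ∀ n, (dirD η)^[n] u =ᶠ[𝓝 0] (dirD η)^[n] v := by
    intro n
    induction n with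
    | zero => exact h
    | succ n ih =>
      rw [Function.iterate_succ_apply', Function.iterate_succ_apply']
      exact dirD_congr ih
  ext n
  rw [coeff_dirTaylor, coeff_dirTaylor, (this n).eq_of_nhds]

theorem dirTaylor_dirD (u : E3 → ℂ) :
    dirTaylor η (dirD η u) = PowerSeries.derivative ℂ (dirTaylor η u) := by
  ext n
  rw [PowerSeries.coeff_derivative, coeff_dirTaylor, coeff_dirTaylor, ← Function.iterate_succ_apply,
    Nat.factorial_succ]
  have := Nat.cast_add_one_ne_zero (R := ℂ) n
  have : (n.factorial : ℂ) ≠ 0 := by exact_mod_cast n.factorial_ne_zero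
  push_cast
  field_simp

theorem dirTaylor_add {u v : E3 → ℂ} (hu : AnalyticAt ℝ u 0) (hv : AnalyticAt ℝ v 0) :
    dirTaylor η (u + v) = dirTaylor η u + dirTaylor η v := by
  have key : ∀ n (u v : E3 → ℂ), AnalyticAt ℝ u 0 → AnalyticAt ℝ v 0 →
      (dirD η)^[n] (u + v) 0 = (dirD η)^[n] u 0 + (dirD η)^[n] v 0 := by
    intro n
    induction n with
    | zero => intro u v _ _; rfl
    | succ n ih =>
      intro u v hu hv
      simp only [Function.iterate_succ_apply]
      rw [← ih _ _ (analyticAt_dirD hu) (analyticAt_dirD hv)]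
      have h : dirD η (u + v) =ᶠ[𝓝 0] dirD η u + dirD η v := by
        filter_upwards [hu.eventually_analyticAt, hv.eventually_analyticAt] with p h1 h2
        have := ((hasGrad_of_differentiableAt h1.differentiableAt).add
          (hasGrad_of_differentiableAt h2.differentiableAt)).dirD_eq (η := η)
        simpa only [dirD, Pi.add_apply, mul_add, Finset.sum_add_distrib] using! this
      have := congrArg (fun A : PowerSeries ℂ => PowerSeries.coeff n A * (n.factorial : ℂ)) (dirTaylor_congr (η := η) h)
      have h0 : (n.factorial : ℂ) ≠ 0 := by exact_mod_cast n.factorial_ne_zero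
      simpa only [coeff_dirTaylor, div_mul_cancel₀ _ h0] using this
  ext n
  rw [map_add, coeff_dirTaylor, coeff_dirTaylor, coeff_dirTaylor, key n u v hu hv, add_div]

theorem dirTaylor_mul {u v : E3 → ℂ} (hu : AnalyticAt ℝ u 0) (hv : AnalyticAt ℝ v 0) :
    dirTaylor η (u * v) = dirTaylor η u * dirTaylor η v := by
  refine taylor_mul_of_leibniz (T := dirTaylor η) (G := fun u => AnalyticAt ℝ u 0) (D := dirD η)
    (fun u h => analyticAt_dirD h) (fun u v h h' => h.mul h') (fun u _ => dirTaylor_dirD u)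
    (fun u v h h' => dirTaylor_add h h') (fun u v _ _ => by simp [coeff_zero_dirTaylor])
    (fun u v h h' => dirTaylor_congr ?_) hu hv
  filter_upwards [h.eventually_analyticAt, h'.eventually_analyticAt] with p h1 h2
  have := ((hasGrad_of_differentiableAt h1.differentiableAt).mul
    (hasGrad_of_differentiableAt h2.differentiableAt)).dirD_eq (η := η)
  refine Eq.trans this ?_
  simp only [Pi.add_apply, Pi.mul_apply, dirD, Finset.sum_mul, Finset.mul_sum,
    ← Finset.sum_add_distrib]
  exact Finset.sum_congr rfl fun i _ => by ring

theorem dirTaylor_const (c : ℂ) : dirTaylor η (fun _ => c) = PowerSeries.C c := by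
  have h : dirD η (fun _ => c) = fun _ => 0 := by
    funext p; rw [(hasGrad_const c p).dirD_eq]; simp
  have h0 : dirD η (fun _ => 0) = fun _ => 0 := by
    funext p; rw [(hasGrad_const 0 p).dirD_eq]; simp
  have hn : ∀ n, (dirD η)^[n] (fun _ => (0 : ℂ)) = fun _ => 0 := fun n => Function.iterate_fixed h0 n
  ext n
  rw [coeff_dirTaylor, PowerSeries.coeff_C]
  rcases n with _ | n
  · simp
  · rw [Function.iterate_succ_apply, h, hn]; simp

/-- `u` is analytic at the origin with Taylor series `A` in the direction `η`. -/
def HasDirTaylor (η : Fin 3 → ℂ) (u : E3 → ℂ) (A : PowerSeries ℂ) : Prop :=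
  AnalyticAt ℝ u 0 ∧ dirTaylor η u = A

theorem hasDirTaylor {u : E3 → ℂ} (hu : AnalyticAt ℝ u 0) : HasDirTaylor η u (dirTaylor η u) :=
  ⟨hu, rfl⟩

namespace HasDirTaylor
variable {u v : E3 → ℂ} {A B : PowerSeries ℂ}

theorem congr (h : HasDirTaylor η u A) (e : v =ᶠ[𝓝 0] u) : HasDirTaylor η v A :=
  ⟨h.1.congr e.symm, (dirTaylor_congr e).trans h.2⟩

theorem unique (h : HasDirTaylor η u A) (h' : HasDirTaylor η v B) (e : u =ᶠ[𝓝 0] v) : A = B := by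
  rw [← h.2, ← h'.2, dirTaylor_congr e]

theorem add (h : HasDirTaylor η u A) (h' : HasDirTaylor η v B) :
    HasDirTaylor η (fun p => u p + v p) (A + B) :=
  ⟨h.1.add h'.1, by rw [← h.2, ← h'.2]; exact dirTaylor_add h.1 h'.1⟩

theorem mul (h : HasDirTaylor η u A) (h' : HasDirTaylor η v B) :
    HasDirTaylor η (fun p => u p * v p) (A * B) :=
  ⟨h.1.mul h'.1, by rw [← h.2, ← h'.2]; exact dirTaylor_mul h.1 h'.1⟩

theorem const (c : ℂ) : HasDirTaylor η (fun _ => c) (PowerSeries.C c) :=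
  ⟨analyticAt_const, dirTaylor_const c⟩

theorem one : HasDirTaylor η (fun _ => 1) 1 := by simpa using const (η := η) 1

theorem ofNat (n : ℕ) [n.AtLeastTwo] : HasDirTaylor η (fun _ => OfNat.ofNat n) (OfNat.ofNat n) := by
  have := const (η := η) (OfNat.ofNat n)
  rwa [map_ofNat] at this

theorem neg (h : HasDirTaylor η u A) : HasDirTaylor η (fun p => -u p) (-A) := by
  have := (const (η := η) (-1)).mul h
  simpa using this

theorem sub (h : HasDirTaylor η u A) (h' : HasDirTaylor η v B) :
    HasDirTaylor η (fun p => u p - v p) (A - B) := by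
  simpa only [sub_eq_add_neg] using h.add h'.neg

theorem sq (h : HasDirTaylor η u A) : HasDirTaylor η (fun p => u p ^ 2) (A ^ 2) := by
  simpa only [pow_two] using h.mul h

theorem deriv (h : HasDirTaylor η u A) :
    HasDirTaylor η (dirD η u) (PowerSeries.derivative ℂ A) :=
  ⟨analyticAt_dirD h.1, by rw [dirTaylor_dirD, h.2]⟩

theorem sum {ι : Type*} (s : Finset ι) {u : ι → E3 → ℂ} {A : ι → PowerSeries ℂ}
    (h : ∀ i ∈ s, HasDirTaylor η (u i) (A i)) :
    HasDirTaylor η (fun p => ∑ i ∈ s, u i p) (∑ i ∈ s, A i) := by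
  classical
  induction s using Finset.induction_on with
  | empty => simpa using const (η := η) 0
  | insert i s hi ih =>
    simp only [Finset.sum_insert hi]
    exact (h i (by simp)).add (ih fun j hj => h j (by simp [hj]))

theorem prod {ι : Type*} (s : Finset ι) {u : ι → E3 → ℂ} {A : ι → PowerSeries ℂ}
    (h : ∀ i ∈ s, HasDirTaylor η (u i) (A i)) :
    HasDirTaylor η (fun p => ∏ i ∈ s, u i p) (∏ i ∈ s, A i) := by
  classical
  induction s using Finset.induction_on with
  | empty => simpa using one (η := η)
  | insert i s hi ih =>
    simp only [Finset.prod_insert hi]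
    exact (h i (by simp)).mul (ih fun j hj => h j (by simp [hj]))

theorem constantCoeff (h : HasDirTaylor η u A) : PowerSeries.constantCoeff A = u 0 := by
  rw [← PowerSeries.coeff_zero_eq_constantCoeff_apply, ← h.2, coeff_zero_dirTaylor]

theorem coord (i : Fin 3) :
    HasDirTaylor η (fun p => ((p i : ℝ) : ℂ)) (PowerSeries.C (η i) * PowerSeries.X) := by
  refine ⟨analyticAt_ofReal (analyticAt_coord i 0), ?_⟩
  have h : dirD η (fun p => ((p i : ℝ) : ℂ)) = fun _ => η i := by
    funext p
    have : HasGrad (fun p : E3 => ((p i : ℝ) : ℂ)) (fun j => if j = i then 1 else 0) p := by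
      have := (Complex.ofRealCLM.comp (EuclideanSpace.proj i : E3 →L[ℝ] ℝ)).hasFDerivAt (x := p)
      refine HasGrad.of_eq (this.congr_fderiv (clm_eq_gradForm _)) fun j => ?_
      by_cases hj : i = j <;> simp [hj, eq_comm]
    rw [this.dirD_eq]
    simp
  ext n
  rcases n with _ | n
  · rw [coeff_zero_dirTaylor]; simp
  · have h2 := congrArg (PowerSeries.coeff n) (dirTaylor_dirD (η := η) fun p => ((p i : ℝ) : ℂ))
    rw [h, dirTaylor_const, PowerSeries.coeff_derivative, PowerSeries.coeff_C] at h2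
    rw [PowerSeries.coeff_C_mul, PowerSeries.coeff_X]
    have h3 : (n : ℂ) + 1 ≠ 0 := Nat.cast_add_one_ne_zero n
    refine mul_right_cancel₀ h3 (h2.symm.trans ?_)
    by_cases hn : n = 0 <;> simp [hn]

theorem exp (h : HasDirTaylor η u A) : ∃ E, HasDirTaylor η (fun p => Complex.exp (u p)) E ∧
    PowerSeries.derivative ℂ E = PowerSeries.derivative ℂ A * E := by
  have h1 : AnalyticAt ℝ (fun p => Complex.exp (u p)) 0 :=
    ((analyticAt_cexp (z := u 0)).restrictScalars (𝕜 := ℝ)).comp h.1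
  refine ⟨_, hasDirTaylor h1, ?_⟩
  refine (hasDirTaylor h1).deriv.unique (h.deriv.mul (hasDirTaylor h1)) ?_
  filter_upwards [h.1.eventually_analyticAt] with p hp
  have h2 : HasGrad (fun p => Complex.exp (u p)) (fun i => Complex.exp (u p) * pd i u p) p := by
    have := (hasGrad_of_differentiableAt hp.differentiableAt)
    have h3 := HasFDerivAt.cexp this
    rw [clm_eq_gradForm (_ • gradForm _)] at h3
    exact HasGrad.of_eq h3 fun i => by simp [gradForm_single]
  rw [h2.dirD_eq, dirD, Finset.sum_mul]
  exact Finset.sum_congr rfl fun i _ => by ring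

end HasDirTaylor

/-- The null directions with `z̃`-component `1`. -/
structure IsNullDir (η : Fin 3 → ℂ) : Prop where
  two : η 2 = 1
  sq : η 0 ^ 2 + η 1 ^ 2 = -1

/-- The gradient of r² contracts with η to twice the linear form Σ ηᵢ pᵢ, whose Taylor series along
a null direction vanishes. Only the z̃-derivative at fixed r² survives, so the Taylor series along η
is that of the restriction to the null cone. -/
theorem HasDirTaylor.series (hη : IsNullDir η) {a : PS} (ha : Conv a) :
    HasDirTaylor η (fun p => S a (inv p)) (null a) := by
  refine ⟨analyticAt_comp_inv (S_analyticAt ha), ?_⟩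
  have hl : HasDirTaylor η (fun p => ∑ i, η i * ((p i : ℝ) : ℂ)) 0 := by
    have := HasDirTaylor.sum Finset.univ fun i _ =>
      (HasDirTaylor.const (η := η) (η i)).mul (HasDirTaylor.coord i)
    rwa [Fin.sum_univ_three, hη.two, ← mul_assoc, ← mul_assoc, ← mul_assoc, ← map_mul, ← map_mul, ← map_mul,
      ← add_mul, ← add_mul, ← map_add, ← map_add,
      show η 0 * η 0 + η 1 * η 1 + 1 * 1 = 0 by linear_combination hη.sq, map_zero, zero_mul] at this
  ext n
  induction n generalizing a with
  | zero =>
    rw [coeff_zero_dirTaylor, inv_zero, PowerSeries.coeff_zero_eq_constantCoeff_apply,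
      constantCoeff_null]
  | succ n ih =>
    have h1 : dirTaylor η (dirD η fun p => S a (inv p)) = dirTaylor η fun p => S (d1 a) (inv p) := by
      have h2 := ((HasDirTaylor.ofNat (η := η) 2).mul (hl.mul
        (hasDirTaylor (analyticAt_comp_inv (S_analyticAt ha.dS))))).add
        (hasDirTaylor (analyticAt_comp_inv (S_analyticAt ha.d1)))
      rw [zero_mul, mul_zero, zero_add] at h2
      refine ((h2.congr ?_).2)
      filter_upwards [S_hasGrad ha, tendsto_inv.eventually (S_dZ ha)] with p e1 e2
      rw [e1.dirD_eq, e2, Fin.sum_univ_three, Fin.sum_univ_three, inv_snd, hη.two]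
      simp [axiGrad, rad, axisVec]
      ring
    have h3 := congrArg (PowerSeries.coeff n) ((dirTaylor_dirD _).symm.trans h1)
    rw [ih ha.d1, null_d1, PowerSeries.coeff_derivative, PowerSeries.coeff_derivative] at h3
    exact mul_right_cancel₀ (Nat.cast_add_one_ne_zero n) h3
end

/-! ### Contraction of tensors with a vector -/

/-- The contraction `T_{a_1 … a_n} ξ^{a_1} ⋯ ξ^{a_n}`. -/
def contract (ξ : Fin 3 → ℂ) {n : ℕ} (T : Tensor n) : ℂ := ∑ J, T J * ∏ s, ξ (J s)

theorem contract_zero (ξ : Fin 3 → ℂ) (T : Tensor 0) : contract ξ T = T Fin.elim0 := by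
  rw [contract, Fintype.sum_unique, Finset.univ_eq_empty, Finset.prod_empty, mul_one]
  congr 1

theorem contract_add (ξ : Fin 3 → ℂ) {n : ℕ} (T T' : Tensor n) :
    contract ξ (T + T') = contract ξ T + contract ξ T' := by
  simp only [contract, Pi.add_apply, add_mul, Finset.sum_add_distrib]

theorem contract_sub (ξ : Fin 3 → ℂ) {n : ℕ} (T T' : Tensor n) :
    contract ξ (T - T') = contract ξ T - contract ξ T' := by
  simp only [contract, Pi.sub_apply, sub_mul, Finset.sum_sub_distrib]

theorem contract_smul (ξ : Fin 3 → ℂ) {n : ℕ} (c : ℂ) (T : Tensor n) :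
    contract ξ (c • T) = c * contract ξ T := by
  simp only [contract, Pi.smul_apply, smul_eq_mul, Finset.mul_sum, mul_assoc]

theorem contract_symmetrize (ξ : Fin 3 → ℂ) {n : ℕ} (T : Tensor n) :
    contract ξ (symmetrize T) = contract ξ T := by
  have h : ∀ σ : Equiv.Perm (Fin n), ∑ J : Fin n → Fin 3, T (J ∘ σ) * ∏ s, ξ (J s) =
      contract ξ T := by
    intro σ
    refine Fintype.sum_equiv (Equiv.arrowCongr σ.symm (Equiv.refl (Fin 3))) _ _ fun J => ?_
    have : (Equiv.arrowCongr σ.symm (Equiv.refl (Fin 3))) J = J ∘ σ := by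
      ext s; simp [Equiv.arrowCongr]
    rw [this]
    congr 1
    exact (Equiv.prod_comp σ fun s => ξ (J s)).symm
  simp only [contract, symmetrize, mul_assoc, Finset.sum_mul]
  rw [← Finset.mul_sum, Finset.sum_comm, Finset.sum_congr rfl fun σ _ => h σ, Finset.sum_const,
    Finset.card_univ, Fintype.card_perm, Fintype.card_fin, nsmul_eq_mul, ← mul_assoc,
    inv_mul_cancel₀ (by exact_mod_cast n.factorial_ne_zero), one_mul]
  rfl

theorem sum_cons {M : Type*} [AddCommMonoid M] {n : ℕ} (F : (Fin (n + 1) → Fin 3) → M) :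
    ∑ J, F J = ∑ i, ∑ J : Fin n → Fin 3, F (Fin.cons i J) := by
  rw [← Fintype.sum_prod_type']
  exact (Fintype.sum_equiv (Fin.consEquiv fun _ => Fin 3) _ _ fun x => rfl).symm

theorem contract_matMul (ξ : Fin 3 → ℂ) {n : ℕ} (M : Fin 3 → Fin 3 → ℝ) (Q : Tensor n) :
    contract ξ (matMul M Q) = (∑ i, ∑ j, (M i j : ℂ) * (ξ i * ξ j)) * contract ξ Q := by
  rw [contract, sum_cons, Finset.sum_mul]
  refine Finset.sum_congr rfl fun i _ => ?_
  rw [sum_cons, Finset.sum_mul]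
  refine Finset.sum_congr rfl fun j _ => ?_
  rw [contract, Finset.mul_sum]
  refine Finset.sum_congr rfl fun J _ => ?_
  rw [Fin.prod_univ_succ, Fin.prod_univ_succ]
  simp only [matMul, Fin.cons_zero, Fin.cons_succ, Fin.cons_one]
  ring

/-- The trace part contracts to g(ξ, ξ) times a contraction of `Q`, which is zero, and
symmetrization is invisible to contractions with a single vector. -/
theorem contract_eq_of_isSymmTraceFreePart {g : Matrix (Fin 3) (Fin 3) ℝ} {ξ : Fin 3 → ℂ}
    (hξ : ∑ i, ∑ j, (g i j : ℂ) * (ξ i * ξ j) = 0) :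
    ∀ {n : ℕ} {T S : Tensor n}, IsSymmTraceFreePart g T S → contract ξ S = contract ξ T
  | 0, _, _, h => congrArg _ h
  | 1, _, _, h => congrArg _ h
  | n + 2, T, S, ⟨_, _, Q, h⟩ => by
    have := congrArg (contract ξ) h
    rw [contract_symmetrize, contract_add, contract_symmetrize] at this
    have h0 : contract ξ (matMul g Q) = 0 :=
      (contract_matMul ξ (fun i j => g i j) Q).trans (by rw [hξ, zero_mul])
    exact ((this.trans (congrArg _ h0)).trans (add_zero _)).symm

/-- Reindexing of a contraction in which one index is replaced. -/
theorem sum_update {n : ℕ} (s : Fin n) (T : Tensor n) (A : Fin 3 → Fin 3 → ℂ) (ξ : Fin 3 → ℂ) :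
    ∑ J : Fin n → Fin 3, (∑ k, A k (J s) * T (Function.update J s k)) * ∏ r, ξ (J r) =
      ∑ J : Fin n → Fin 3, (∑ j, A (J s) j * ξ j) * (∏ r ∈ Finset.univ.erase s, ξ (J r)) * T J := by
  simp only [Finset.sum_mul]
  rw [← Fintype.sum_prod_type', ← Fintype.sum_prod_type']
  have hinv : Function.Involutive fun x : (Fin n → Fin 3) × Fin 3 =>
      (Function.update x.1 s x.2, x.1 s) := by
    rintro ⟨J, k⟩
    simp
  refine Fintype.sum_equiv hinv.toPerm _ _ ?_
  rintro ⟨J, k⟩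
  rw [Function.Involutive.coe_toPerm]
  simp only [Function.update_self]
  rw [← Finset.mul_prod_erase _ _ (Finset.mem_univ s)]
  have : ∏ r ∈ Finset.univ.erase s, ξ (Function.update J s k r) =
      ∏ r ∈ Finset.univ.erase s, ξ (J r) :=
    Finset.prod_congr rfl fun r hr => by rw [Function.update_of_ne (Finset.ne_of_mem_erase hr)]
  rw [this]
  ring

/-- ξ is constant, so the partial derivatives combine to a derivative along ξ. `sum_update` regroups
the Christoffel terms so that both lower indices of each symbol are contracted with ξ. -/
theorem contract_covDeriv {g : MetricField} {n : ℕ} {T : E3 → Tensor n} {p : E3} (ξ : Fin 3 → ℂ)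
    (hT : ∀ J, DifferentiableAt ℝ (fun q => T q J) p) :
    contract ξ (covDeriv g T p) = dirD ξ (fun q => contract ξ (T q)) p -
      ∑ J, ∑ s, (∑ i, ∑ j, (christoffel g (J s) i j p : ℂ) * (ξ i * ξ j)) *
        (∏ r ∈ Finset.univ.erase s, ξ (J r)) * T p J := by
  have h1 : dirD ξ (fun q => contract ξ (T q)) p =
      ∑ i, ∑ J, ξ i * (pd i (fun q => T q J) p * ∏ s, ξ (J s)) := by
    have := HasGrad.sum Finset.univ fun J _ => (hasGrad_of_differentiableAt (hT J)).mul
      (hasGrad_const (∏ s, ξ (J s)) p)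
    refine (HasGrad.dirD_eq (u := fun q => contract ξ (T q)) this).trans ?_
    refine Finset.sum_congr rfl fun i _ => ?_
    rw [Finset.mul_sum]
    exact Finset.sum_congr rfl fun J _ => by ring
  have h2 : ∑ J : Fin n → Fin 3, ∑ s, (∑ i, ∑ j, (christoffel g (J s) i j p : ℂ) * (ξ i * ξ j)) *
        (∏ r ∈ Finset.univ.erase s, ξ (J r)) * T p J =
      ∑ i, ∑ J : Fin n → Fin 3, ξ i * ((∑ s, ∑ k, (christoffel g k i (J s) p : ℂ) *
        T p (Function.update J s k)) * ∏ s, ξ (J s)) := by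
    have e : ∀ (J : Fin n → Fin 3) s,
        (∑ i, ∑ j, (christoffel g (J s) i j p : ℂ) * (ξ i * ξ j)) *
        (∏ r ∈ Finset.univ.erase s, ξ (J r)) * T p J =
        ∑ i, ξ i * ((∑ j, (christoffel g (J s) i j p : ℂ) * ξ j) *
        (∏ r ∈ Finset.univ.erase s, ξ (J r)) * T p J) := by
      intro J s
      simp only [Finset.mul_sum, Finset.sum_mul]
      exact Finset.sum_congr rfl fun i _ => Finset.sum_congr rfl fun j _ => by ring
    simp only [e]
    rw [Finset.sum_congr rfl fun J _ => Finset.sum_comm, Finset.sum_comm]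
    refine Finset.sum_congr rfl fun i _ => ?_
    simp only [← Finset.mul_sum]
    congr 1
    refine Finset.sum_comm.trans (Eq.trans ?_
      (Finset.sum_congr rfl fun J _ => (Finset.sum_mul _ _ _).symm))
    refine Eq.trans ?_ Finset.sum_comm
    exact Finset.sum_congr rfl fun s _ => (sum_update s (T p) (fun k j => christoffel g k i j p) ξ).symm
  rw [h1, h2, contract, sum_cons, ← Finset.sum_sub_distrib]
  refine Finset.sum_congr rfl fun i _ => ?_
  rw [← Finset.sum_sub_distrib]
  refine Finset.sum_congr rfl fun J _ => ?_
  rw [Fin.prod_univ_succ]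
  simp only [covDeriv, Fin.cons_zero, Fin.cons_succ, Fin.tail_cons]
  ring

section
variable {η : Fin 3 → ℂ}

theorem HasDirTaylor.contract {n : ℕ} {T : E3 → Tensor n} {ξ : Fin 3 → E3 → ℂ}
    (hξ : ∀ i, HasDirTaylor η (ξ i) (PowerSeries.C (η i)))
    (hT : ∀ J, AnalyticAt ℝ (fun p => T p J) 0) :
    HasDirTaylor η (fun p => contract (fun i => ξ i p) (T p))
      (∑ J, dirTaylor η (fun p => T p J) * ∏ s, PowerSeries.C (η (J s))) :=
  HasDirTaylor.sum _ fun J _ => (hasDirTaylor (hT J)).mul (HasDirTaylor.prod _ fun s _ => hξ (J s))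

/-- A metric with a null vector field whose Taylor series in the direction `η` is constant. -/
def HasNullField (g : MetricField) (η : Fin 3 → ℂ) : Prop :=
  ∃ ξ : Fin 3 → E3 → ℂ, (∀ i, HasDirTaylor η (ξ i) (PowerSeries.C (η i))) ∧
    ∀ᶠ p in 𝓝 (0 : E3), ∑ i, ∑ j, (g p i j : ℂ) * (ξ i p * ξ j p) = 0

/-- The exact null field ξ and the constant vector η have the same Taylor series along η.
Contraction with ξ, which is blind to traces, may thus be replaced by contraction with η. -/
theorem dirTaylor_contract_traceFree {g : MetricField} (hg : HasNullField g η) {n : ℕ}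
    {T S : E3 → Tensor n} (hT : ∀ J, AnalyticAt ℝ (fun p => T p J) 0)
    (hS : ∀ J, AnalyticAt ℝ (fun p => S p J) 0)
    (h : ∀ᶠ p in 𝓝 0, IsSymmTraceFreePart (g p) (T p) (S p)) :
    dirTaylor η (fun p => contract η (S p)) = dirTaylor η (fun p => contract η (T p)) := by
  obtain ⟨ξ, hξ, h0⟩ := hg
  have hc : ∀ i, HasDirTaylor η (fun _ => η i) (PowerSeries.C (η i)) := fun i =>
    HasDirTaylor.const (η i)
  rw [(HasDirTaylor.contract hc hS).2, (HasDirTaylor.contract hc hT).2]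
  refine (HasDirTaylor.contract hξ hS).unique (HasDirTaylor.contract hξ hT) ?_
  filter_upwards [h0, h] with p h1 h2 using contract_eq_of_isSymmTraceFreePart h1 h2

/-- The hypothesis says that, to all orders along η, the constant field η is geodesic up to
parametrization. Each of the n slots then contributes the same multiple of the contraction. -/
theorem dirTaylor_contract_covDeriv {g : MetricField} {n : ℕ} {T : E3 → Tensor n}
    {k : PowerSeries ℂ}
    (hg : ∀ k', HasDirTaylor η (fun p => ∑ i, ∑ j, (christoffel g k' i j p : ℂ) * (η i * η j))
      (2 * k * PowerSeries.C (η k')))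
    (hT : ∀ J, AnalyticAt ℝ (fun p => T p J) 0) :
    dirTaylor η (fun p => contract η (covDeriv g T p)) =
      PowerSeries.derivative ℂ (dirTaylor η fun p => contract η (T p)) -
        2 * n * k * dirTaylor η fun p => contract η (T p) := by
  have hc : ∀ i, HasDirTaylor η (fun _ => η i) (PowerSeries.C (η i)) := fun i =>
    HasDirTaylor.const (η i)
  have h1 := HasDirTaylor.contract hc hT
  have h2 := HasDirTaylor.sum Finset.univ fun (J : Fin n → Fin 3) _ =>
    HasDirTaylor.sum Finset.univ fun (s : Fin n) _ =>
      ((hg (J s)).mul (HasDirTaylor.prod (Finset.univ.erase s) fun r _ => hc (J r))).mul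
        (hasDirTaylor (hT J))
  have h3 := (((h1.deriv.sub h2).congr (v := fun p => contract η (covDeriv g T p)) ?_)).2
  · rw [h3, h1.2]
    congr 1
    rw [Finset.mul_sum]
    refine Finset.sum_congr rfl fun J _ => ?_
    have : ∀ s, 2 * k * PowerSeries.C (η (J s)) *
        ∏ r ∈ Finset.univ.erase s, PowerSeries.C (η (J r)) =
        2 * k * ∏ r, PowerSeries.C (η (J r)) := by
      intro s
      rw [mul_assoc, Finset.mul_prod_erase _ (fun r => PowerSeries.C (η (J r))) (Finset.mem_univ s)]
    simp only [this, Finset.sum_const, Finset.card_univ, Fintype.card_fin, nsmul_eq_mul]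
    ring
  · filter_upwards [Filter.eventually_all.mpr fun J => (hT J).eventually_analyticAt] with p hp
    exact contract_covDeriv η fun J => (hp J).differentiableAt
end

/-! ### The rescaled metric along null directions -/

/-- Power series describing an axisymmetric vacuum solution and a conformal factor. -/
structure IsGaugeData (f : E3 → ℂ) (β κ : E3 → ℝ) (a b k c : PS) : Prop
    extends IsSolutionData f β a b k where
  conv_c : Conv c
  real_c : cj c = c
  κ_eq : ∀ᶠ p in 𝓝 (0 : E3), (κ p : ℂ) = S c (inv p)

theorem exists_isGaugeData {f : E3 → ℂ} {β κ : E3 → ℝ} {a b k : PS} {c₀ : ℝ}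
    (h : IsSolutionData f β a b k) (hκ : IsConformalGauge c₀ κ) :
    ∃ c, IsGaugeData f β κ a b k c := by
  obtain ⟨c, hc, he⟩ := exists_series_of_axisymmetric (analyticAt_ofReal hκ.analytic) (by
    filter_upwards [hκ.axisymmetric] with p hp q h1 h2
    rw [hp q h1 h2])
  exact ⟨c, h, hc, cj_eq_self_of_real hc he, he⟩

theorem analyticAt_re_series {a : PS} (ha : Conv a) : AnalyticAt ℝ (fun p => (S a (inv p)).re) 0 :=
  (Complex.reCLM.analyticAt _).comp (analyticAt_comp_inv (S_analyticAt ha))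

section
variable {f : E3 → ℂ} {β κ : E3 → ℝ} {a b k c : PS}

namespace IsGaugeData

theorem conv_b (h : IsGaugeData f β κ a b k c) : Conv b := h.sol.conv_b

theorem β_eq_re (h : IsGaugeData f β κ a b k c) : ∀ᶠ p in 𝓝 (0 : E3), β p = (S b (inv p)).re := by
  filter_upwards [h.β_eq] with p hp
  rw [← hp, Complex.ofReal_re]

theorem κ_eq_re (h : IsGaugeData f β κ a b k c) : ∀ᶠ p in 𝓝 (0 : E3), κ p = (S c (inv p)).re := by
  filter_upwards [h.κ_eq] with p hp
  rw [← hp, Complex.ofReal_re]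

theorem analyticAt_β (h : IsGaugeData f β κ a b k c) : AnalyticAt ℝ β 0 :=
  (analyticAt_re_series h.conv_b).congr (h.β_eq_re.mono fun _ hp => hp.symm)

theorem analyticAt_κ (h : IsGaugeData f β κ a b k c) : AnalyticAt ℝ κ 0 :=
  (analyticAt_re_series h.conv_c).congr (h.κ_eq_re.mono fun _ hp => hp.symm)

theorem analyticAt_tildeMetric (h : IsGaugeData f β κ a b k c) (i j : Fin 3) :
    AnalyticAt ℝ (fun p => tildeMetric β κ p i j) 0 :=
  (analyticAt_const.mul h.analyticAt_κ).rexp.mul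
    (analyticAt_hatMetric (analyticAt_re_series h.conv_k) h.exp_eq i j)

theorem det_tildeMetric_ne_zero (h : IsGaugeData f β κ a b k c) : (tildeMetric β κ 0).det ≠ 0 := by
  rw [tildeMetric, Matrix.det_smul, det_hatMetric h.exp_eq.self_of_nhds]
  positivity

theorem analyticAt_christoffel (h : IsGaugeData f β κ a b k c) (l i j : Fin 3) :
    AnalyticAt ℝ (christoffel (tildeMetric β κ) l i j) 0 :=
  AxiErnst.analyticAt_christoffel h.analyticAt_tildeMetric h.det_tildeMetric_ne_zero l i j

theorem analyticAt_ricci (h : IsGaugeData f β κ a b k c) (i j : Fin 3) :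
    AnalyticAt ℝ (ricci (tildeMetric β κ) i j) 0 :=
  AxiErnst.analyticAt_ricci h.analyticAt_tildeMetric h.det_tildeMetric_ne_zero i j

end IsGaugeData

variable {η : Fin 3 → ℂ}

/-- The component of `rot` along `η`. -/
def rotDir (η : Fin 3 → ℂ) (p : E3) : ℂ := p 0 * η 1 - p 1 * η 0

/-- The component of `rad` along `η`. -/
def radDir (η : Fin 3 → ℂ) (p : E3) : ℂ := p 0 * η 0 + p 1 * η 1

theorem HasDirTaylor.rotDir : HasDirTaylor η (rotDir η) 0 := by
  have := ((HasDirTaylor.coord (η := η) 0).mul (HasDirTaylor.const (η 1))).sub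
    ((HasDirTaylor.coord (η := η) 1).mul (HasDirTaylor.const (η 0)))
  rwa [show PowerSeries.C (η 0) * PowerSeries.X * PowerSeries.C (η 1) -
    PowerSeries.C (η 1) * PowerSeries.X * PowerSeries.C (η 0) = 0 by ring] at this

theorem IsNullDir.C_sq (hη : IsNullDir η) : (PowerSeries.C (η 0) : PowerSeries ℂ) ^ 2 +
    PowerSeries.C (η 1) ^ 2 = -1 := by
  rw [← map_pow, ← map_pow, ← map_add, hη.sq, map_neg, map_one]

theorem HasDirTaylor.radDir (hη : IsNullDir η) : HasDirTaylor η (radDir η) (-PowerSeries.X) := by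
  have := ((HasDirTaylor.coord (η := η) 0).mul (HasDirTaylor.const (η 0))).add
    ((HasDirTaylor.coord (η := η) 1).mul (HasDirTaylor.const (η 1)))
  rwa [show (PowerSeries.C (η 0) * PowerSeries.X * PowerSeries.C (η 0) +
    PowerSeries.C (η 1) * PowerSeries.X * PowerSeries.C (η 1) : PowerSeries ℂ) = -PowerSeries.X by
      linear_combination PowerSeries.X * hη.C_sq] at this

theorem HasDirTaylor.rhoSq (hη : IsNullDir η) :
    HasDirTaylor η (fun p => (rhoSq p : ℂ)) (-PowerSeries.X ^ 2) := by
  have := (HasDirTaylor.coord (η := η) 0).sq.add (HasDirTaylor.coord (η := η) 1).sq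
  rw [show ((PowerSeries.C (η 0) * PowerSeries.X) ^ 2 +
    (PowerSeries.C (η 1) * PowerSeries.X) ^ 2 : PowerSeries ℂ) = -PowerSeries.X ^ 2 by
      linear_combination PowerSeries.X ^ 2 * hη.C_sq] at this
  exact this.congr (Filter.Eventually.of_forall fun p => by simp [AxiErnst.rhoSq])

theorem exists_hasDirTaylor_sqrt {u : E3 → ℂ} (hu : HasDirTaylor η u 1) :
    ∃ w : E3 → ℂ, HasDirTaylor η w 1 ∧ ∀ᶠ p in 𝓝 (0 : E3), w p ^ 2 = u p := by
  have h0 : u 0 = 1 := by rw [← hu.constantCoeff]; simp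
  have han : AnalyticAt ℝ (fun p => Complex.exp (Complex.log (u p) / 2)) 0 := by
    have h1 : AnalyticAt ℝ (fun p => Complex.log (u p)) 0 :=
      ((analyticAt_clog (z := u 0) (by rw [h0]; exact Complex.one_mem_slitPlane)).restrictScalars
        (𝕜 := ℝ)).comp hu.1
    exact AnalyticAt.comp (g := Complex.exp) (f := fun p => Complex.log (u p) / 2)
      (analyticAt_cexp.restrictScalars (𝕜 := ℝ)) (h1.div analyticAt_const two_ne_zero)
  have hsq : ∀ᶠ p in 𝓝 (0 : E3), Complex.exp (Complex.log (u p) / 2) ^ 2 = u p := by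
    filter_upwards [hu.1.continuousAt.eventually_ne (show u 0 ≠ 0 by rw [h0]; exact one_ne_zero)]
      with p hp
    rw [← Complex.exp_nat_mul, Nat.cast_ofNat, mul_div_cancel₀ _ two_ne_zero, Complex.exp_log hp]
  have hT := hasDirTaylor (η := η) han
  refine ⟨_, ⟨han, ?_⟩, hsq⟩
  set A := dirTaylor η fun p => Complex.exp (Complex.log (u p) / 2)
  have h1 : A ^ 2 = 1 := hT.sq.unique hu hsq
  have h2 : (A - 1) * (A + 1) = 0 := by linear_combination h1
  refine sub_eq_zero.mp ((mul_eq_zero.mp h2).resolve_right fun h3 => ?_)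
  have h4 := congrArg PowerSeries.constantCoeff h3
  rw [map_add, hT.constantCoeff, h0] at h4
  norm_num at h4

/-- The metric is conformal to the identity plus K times the square of `rot`, so replacing the
z̃-component of η by a root of 1 − K (rot · η)² makes it exactly null. Taylor series along η do not
see the change, because rot · η has series 0. -/
theorem IsGaugeData.hasNullField (h : IsGaugeData f β κ a b k c) (hη : IsNullDir η) :
    HasNullField (tildeMetric β κ) η := by
  have h1 := (HasDirTaylor.one (η := η)).sub
    ((hasDirTaylor (analyticAt_ofReal (analyticAt_re_series h.conv_k))).mul
      (HasDirTaylor.rotDir (η := η)).sq)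
  rw [show ∀ A : PowerSeries ℂ, 1 - A * 0 ^ 2 = 1 by intro A; ring] at h1
  obtain ⟨w, hw, hsq⟩ := exists_hasDirTaylor_sqrt h1
  refine ⟨![fun _ => η 0, fun _ => η 1, w], fun i => ?_, ?_⟩
  · fin_cases i
    · exact HasDirTaylor.const _
    · exact HasDirTaylor.const _
    · simpa [hη.two] using hw
  · filter_upwards [hsq, h.exp_eq] with p h2 h3
    simp only [tildeMetric, Matrix.smul_apply, hatMetric_apply h3, Fin.sum_univ_three,
      smul_eq_mul, Complex.ofReal_mul, Complex.ofReal_add]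
    generalize (Real.exp (2 * κ p) : ℂ) = E
    generalize (S k (inv p)).re = K at *
    simp [kron, AxiErnst.rot]
    simp only [AxiErnst.rotDir] at h2
    linear_combination E * h2 + E * hη.sq

/-- Here e is the series of e^{(β − κ)/2} on the null cone, described by its differential equation
and initial value. -/
theorem HasDirTaylor.tildePotential (h : IsGaugeData f β κ a b k c) (hη : IsNullDir η)
    (h0 : β 0 = 0) (h0' : κ 0 = 0) :
    ∃ e, HasDirTaylor η (tildePotential f β κ) (e * null a) ∧
      2 * PowerSeries.derivative ℂ e =
        (PowerSeries.derivative ℂ (null b) - PowerSeries.derivative ℂ (null c)) * e ∧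
      PowerSeries.constantCoeff e = 1 := by
  have h1 : HasDirTaylor η (fun p => (1 / 2 : ℂ) * (S b (inv p) - S c (inv p)))
      (PowerSeries.C (1 / 2) * (null b - null c)) :=
    (HasDirTaylor.const _).mul ((HasDirTaylor.series hη h.conv_b).sub
      (HasDirTaylor.series hη h.conv_c))
  obtain ⟨e, he, hd⟩ := h1.exp
  refine ⟨e, (he.mul (HasDirTaylor.series hη h.sol.conv_a)).congr ?_, ?_, ?_⟩
  · filter_upwards [h.f_eq, h.β_eq, h.κ_eq] with p e1 e2 e3
    rw [AxiErnst.tildePotential, e1, ← e2, ← e3, Complex.ofReal_exp]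
    push_cast
    ring_nf
  · rw [hd, Derivation.leibniz]
    have : (2 : PowerSeries ℂ) * PowerSeries.C (1 / 2) = 1 := by
      rw [← map_ofNat PowerSeries.C 2, ← map_mul]; norm_num
    simp only [smul_eq_mul, map_sub, PowerSeries.derivative_C, mul_zero, add_zero]
    linear_combination ((PowerSeries.derivative ℂ (null b) - PowerSeries.derivative ℂ (null c)) * e) * this
  · rw [he.constantCoeff, ← h.β_eq.self_of_nhds, ← h.κ_eq.self_of_nhds, h0, h0']
    simp
end

/-- After multiplication by ρ̃², everything but the first term contains the factor `rotDir`, whose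
Taylor series along η is 0. -/
theorem contract_axiChristoffel {K s : ℝ} {μ β : Fin 3 → ℝ} {η : Fin 3 → ℂ} {p : E3}
    (hη : IsNullDir η) (hs : s ≠ 0) (l : Fin 3) :
    (s : ℂ) * ∑ i, ∑ j, (axiChristoffel (1 + s * K) s (rot p) (rad p) μ β l i j : ℂ) * (η i * η j) =
      2 * s * η l * (∑ i, η i * (μ i : ℂ)) + rotDir η p *
      (-2 * (∑ i, (β i : ℂ) * η i) * rot p l - 2 * K * radDir η p * rot p l
        + (β l * (1 + s * K) + K * rad p l) * rotDir η p
        + 2 * s * K * (∑ i, (rotD i l : ℂ) * η i) - s * K * rotDir η p * μ l) := by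
  have hs' : (s : ℂ) ≠ 0 := by exact_mod_cast hs
  have h2 := hη.two
  have h3 := hη.sq
  fin_cases l <;> simp [Fin.sum_univ_three, axiChristoffel, kron, rot, rad, rotD, rotDir, radDir, h2] <;>
    field_simp
  · linear_combination (-(s : ℂ) * (μ 0 : ℂ)) * h3
  · linear_combination (-(s : ℂ) * (μ 1 : ℂ)) * h3
  · linear_combination (-(s : ℂ) * (μ 2 : ℂ)) * h3

/-- The contraction of the Ricci tensor of `axiMetric` with a null vector whose `rad`-component
is `e`, multiplied by `s = ρ̃²`. -/
def nullRicci {R : Type*} [CommRing R] (s ms mz mss msz mzz bs bz bss bsz bzz e : R) : R :=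
  let Z := 4 * ms + 4 * s * mss + mzz - 4 * s * bs * ms - bz * mz + 4 * s * ms ^ 2 + mz ^ 2
  (6 * bs - 4 * s * bs ^ 2 + 4 * s * bss - (2 * ms + 4 * s * mss) + 4 * s * ms ^ 2 - Z) * e ^ 2
    + 2 * (bz + s * (-2 * bs * bz + 2 * bsz - 2 * msz + 2 * ms * mz)) * e
    + s * (bzz - bz ^ 2 - mzz + mz ^ 2 - Z)

/-- The component of the Ricci tensor of `axiMetric` along the orbits. -/
def orbitRicci {R : Type*} [CommRing R] (s ms mz mss mzz bs bz bss bzz : R) : R :=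
  6 * bs - 4 * s * bs ^ 2 + 4 * s * bss - bz ^ 2 + bzz - (2 * ms - 4 * s * bs * ms - bz * mz)
    - (4 * ms + 4 * s * mss + mzz - 4 * s * bs * ms - bz * mz + 4 * s * ms ^ 2 + mz ^ 2)

theorem contract_axiRicci {D ms mz mss msz mzz bs bz bss bsz bzz : ℝ} {η : Fin 3 → ℂ} {p : E3}
    (hη : IsNullDir η) (hp : rhoSq p ≠ 0) :
    (rhoSq p : ℂ) * ∑ i, ∑ j,
      (axiRicci D ms mz mss msz mzz bs bz bss bsz bzz p i j : ℂ) * (η i * η j) =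
      nullRicci (rhoSq p : ℂ) ms mz mss msz mzz bs bz bss bsz bzz (radDir η p) +
      orbitRicci (rhoSq p : ℂ) ms mz mss mzz bs bz bss bzz * D * rotDir η p ^ 2 := by
  have hs' : (rhoSq p : ℂ) ≠ 0 := by exact_mod_cast hp
  have h2 := hη.two
  simp only [axiRicci, nullRicci, orbitRicci]
  generalize rhoSq p = s at *
  simp [Fin.sum_univ_three, rot, rad, rotDir, radDir, axisVec, h2]
  field_simp
  ring

section
variable {f : E3 → ℂ} {β κ : E3 → ℝ} {a b k c : PS} {η : Fin 3 → ℂ}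

theorem hasDirTaylor_pd {u : E3 → ℝ} (hu : AnalyticAt ℝ u 0) {A : PowerSeries ℂ}
    (h : HasDirTaylor η (fun p => (u p : ℂ)) A) :
    HasDirTaylor η (fun p => ∑ i, η i * ((pd i u p : ℝ) : ℂ)) (PowerSeries.derivative ℂ A) := by
  refine h.deriv.congr ?_
  filter_upwards [hu.eventually_analyticAt] with p hp
  have := (hasGrad_of_differentiableAt hp.differentiableAt)
  have h3 : HasGrad (fun q => (u q : ℂ)) (fun i => ((pd i u p : ℝ) : ℂ)) p := by
    have h4 := Complex.ofRealCLM.hasFDerivAt.comp p this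
    rw [clm_eq_gradForm (_ ∘SL gradForm _)] at h4
    exact HasGrad.of_eq h4 fun i => by simp [gradForm_single]
  exact h3.dirD_eq.symm

/-- The series of ρ̃² along η is −X², which can be cancelled. Formulas with ρ̃² in the denominator,
valid only off the axis, therefore still determine Taylor series. -/
theorem hasDirTaylor_of_mul_rhoSq (hη : IsNullDir η) {u : E3 → ℂ} (hu : AnalyticAt ℝ u 0)
    {w : E3 → ℂ} {A : PowerSeries ℂ} (hw : HasDirTaylor η w (PowerSeries.X ^ 2 * A))
    (h : ∀ᶠ p in 𝓝 (0 : E3), rhoSq p ≠ 0 → rhoSq p * u p = -w p) : HasDirTaylor η u A := by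
  have h1 := (HasDirTaylor.rhoSq hη).mul (hasDirTaylor (η := η) hu)
  have h2 := h1.unique hw.neg (eventuallyEq_of_off_axis h1.1 hw.neg.1 h)
  refine ⟨hu, mul_left_cancel₀ (pow_ne_zero 2 PowerSeries.X_ne_zero) ?_⟩
  linear_combination -h2

/-- Only the conformal exponent κ acts: the contribution of ĥ disappears along the null cone, where
η is geodesic up to the factor 2κ′. -/
theorem IsGaugeData.hasDirTaylor_christoffel (h : IsGaugeData f β κ a b k c) (hη : IsNullDir η)
    (l : Fin 3) :
    HasDirTaylor η (fun p => ∑ i, ∑ j, (christoffel (tildeMetric β κ) l i j p : ℂ) * (η i * η j))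
      (2 * PowerSeries.derivative ℂ (null c) * PowerSeries.C (η l)) := by
  have hc := fun x : ℂ => HasDirTaylor.const (η := η) x
  have an := fun {u : E3 → ℝ} (hu : AnalyticAt ℝ u 0) => hasDirTaylor (η := η) (analyticAt_ofReal hu)
  have hK := an (analyticAt_re_series h.conv_k)
  have hs := HasDirTaylor.rhoSq hη
  have hv := an (analyticAt_rot l 0)
  have hr := HasDirTaylor.rotDir (η := η)
  have he := HasDirTaylor.radDir hη
  have hb := fun i => an (analyticAt_pd i h.analyticAt_β)
  have hm := an (analyticAt_pd l h.analyticAt_κ)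
  have hrad : AnalyticAt ℝ (fun p => rad p l) 0 := by
    fin_cases l
    · exact analyticAt_coord 0 0
    · exact analyticAt_coord 1 0
    · exact analyticAt_const
  have t2 : HasDirTaylor η (fun _ => (2 : ℂ)) 2 := HasDirTaylor.ofNat 2
  have hk : HasDirTaylor η (fun p => (κ p : ℂ)) (null c) :=
    (HasDirTaylor.series hη h.conv_c).congr h.κ_eq
  have hX := hasDirTaylor_pd h.analyticAt_κ hk
  have hJ := ((((((hc (-2)).mul (HasDirTaylor.sum Finset.univ fun i _ => (hb i).mul (hc (η i)))).mul
    hv).sub (((t2.mul hK).mul he).mul hv)).add ((((hb l).mul (HasDirTaylor.one.add (hs.mul hK))).add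
    (hK.mul (an hrad))).mul hr)).add (((t2.mul hs).mul hK).mul (HasDirTaylor.sum Finset.univ
    fun i _ => (hc (rotD i l)).mul (hc (η i))))).sub (((hs.mul hK).mul hr).mul hm)
  have hw := ((((t2.mul hs).mul (hc (η l))).mul hX).add (hr.mul hJ)).neg
  rw [zero_mul, add_zero, show -(2 * -PowerSeries.X ^ 2 * PowerSeries.C (η l) *
    PowerSeries.derivative ℂ (null c)) = PowerSeries.X ^ 2 * (2 * PowerSeries.derivative ℂ (null c) *
      PowerSeries.C (η l)) by ring] at hw
  refine hasDirTaylor_of_mul_rhoSq hη ?_ hw ?_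
  · exact Finset.analyticAt_fun_sum _ fun i _ => Finset.analyticAt_fun_sum _ fun j _ =>
      (analyticAt_ofReal (h.analyticAt_christoffel l i j)).mul analyticAt_const
  · filter_upwards [h.exp_eq, h.β_eq_re.eventually_nhds, h.κ_eq_re.eventually_nhds,
      S_re_hasGrad h.conv_b, S_re_hasGrad h.conv_c] with p e1 e2 e3 e4 e5 hp
    have e4' := e4.congr e2
    have e5' := e5.congr e3
    rw [neg_neg, ← contract_axiChristoffel hη hp l]
    congr 1
    refine Finset.sum_congr rfl fun i _ => Finset.sum_congr rfl fun j _ => ?_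
    congr 2
    rw [christoffel_axiMetric hp (Filter.EventuallyEq.of_eq (tildeMetric_eq_axiMetric β κ)) e5' e4',
      eq_add_of_sub_eq e1, add_comm _ (1 : ℝ), funext e5'.pd_eq, funext e4'.pd_eq]

/-- The orbit component carries `rotDir` squared and drops out. With `radDir` = −t and ρ̃² = −t² the
remaining terms combine into derivatives along the cone. The relation is multiplied by X because it
contains 2β′/t. -/
theorem IsGaugeData.hasDirTaylor_ricci (h : IsGaugeData f β κ a b k c) (hη : IsNullDir η) :
    ∃ R, HasDirTaylor η (fun p => ∑ i, ∑ j, (ricci (tildeMetric β κ) i j p : ℂ) * (η i * η j)) R ∧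
      PowerSeries.X * R =
        -PowerSeries.X * PowerSeries.derivative ℂ (null b) ^ 2
        + PowerSeries.X * PowerSeries.derivative ℂ (PowerSeries.derivative ℂ (null b))
        + 2 * PowerSeries.derivative ℂ (null b)
        - PowerSeries.X * PowerSeries.derivative ℂ (PowerSeries.derivative ℂ (null c))
        + PowerSeries.X * PowerSeries.derivative ℂ (null c) ^ 2 := by
  have hu : AnalyticAt ℝ
      (fun p => ∑ i, ∑ j, (ricci (tildeMetric β κ) i j p : ℂ) * (η i * η j)) 0 :=
    Finset.analyticAt_fun_sum _ fun i _ => Finset.analyticAt_fun_sum _ fun j _ =>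
      (analyticAt_ofReal (h.analyticAt_ricci i j)).mul analyticAt_const
  refine ⟨_, hasDirTaylor hu, ?_⟩
  have ser := fun {a : PS} (ha : Conv a) => HasDirTaylor.series hη ha
  have hb := h.conv_b
  have hc := h.conv_c
  have s := HasDirTaylor.rhoSq hη
  have e := HasDirTaylor.radDir hη
  have v := HasDirTaylor.rotDir (η := η)
  have D := hasDirTaylor (η := η) (analyticAt_ofReal (analyticAt_const.mul h.analyticAt_β).rexp :
    AnalyticAt ℝ (fun p => ((Real.exp (-2 * β p) : ℝ) : ℂ)) 0)
  have ms := ser hc.dS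
  have mz := ser hc.dZ
  have mss := ser hc.dS.dS
  have msz := ser hc.dZ.dS
  have mzz := ser hc.dZ.dZ
  have bs := ser hb.dS
  have bz := ser hb.dZ
  have bss := ser hb.dS.dS
  have bsz := ser hb.dZ.dS
  have bzz := ser hb.dZ.dZ
  have t2 : HasDirTaylor η (fun _ => (2 : ℂ)) 2 := HasDirTaylor.ofNat 2
  have t4 : HasDirTaylor η (fun _ => (4 : ℂ)) 4 := HasDirTaylor.ofNat 4
  have t6 : HasDirTaylor η (fun _ => (6 : ℂ)) 6 := HasDirTaylor.ofNat 6
  have n2 := t2.neg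
  have Z := ((((((t4.mul ms).add ((t4.mul s).mul mss)).add mzz).sub (((t4.mul s).mul bs).mul ms)).sub
    (bz.mul mz)).add ((t4.mul s).mul ms.sq)).add mz.sq
  have hO := (((((((t6.mul bs).sub ((t4.mul s).mul bs.sq)).add ((t4.mul s).mul bss)).sub bz.sq).add
    bzz).sub (((t2.mul ms).sub (((t4.mul s).mul bs).mul ms)).sub (bz.mul mz))).sub Z)
  have hN := ((((((((t6.mul bs).sub ((t4.mul s).mul bs.sq)).add ((t4.mul s).mul bss)).sub
    ((t2.mul ms).add ((t4.mul s).mul mss))).add ((t4.mul s).mul ms.sq)).sub Z).mul e.sq).add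
    ((t2.mul (bz.add (s.mul ((((((n2.mul bs).mul bz).add (t2.mul bsz)).sub (t2.mul msz)).add
      ((t2.mul ms).mul mz)))))).mul e)).add
    (s.mul ((((bzz.sub bz.sq).sub mzz).add mz.sq).sub Z))
  have hR := s.mul (hasDirTaylor (η := η) hu)
  have hw := hN.add ((hO.mul D).mul v.sq)
  have key := hR.unique hw (eventuallyEq_of_off_axis hR.1 hw.1 ?_)
  · rw [show ∀ A : PowerSeries ℂ, A * 0 ^ 2 = 0 by intro A; ring, add_zero] at key
    refine mul_left_cancel₀ PowerSeries.X_ne_zero ?_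
    simp only [null_dZ, ← dZ_dS, map_add, Derivation.leibniz, PowerSeries.derivative_X,
      smul_eq_mul] at key
    have d2 : PowerSeries.derivative ℂ (2 : PowerSeries ℂ) = 0 := by
      have := (PowerSeries.derivative ℂ).map_natCast 2
      simpa using this
    rw [d2] at key
    linear_combination -key
  · filter_upwards [h.β_eq_re.eventually_nhds, h.κ_eq_re.eventually_nhds,
      (S_re_hasGrad hb).eventually_nhds, (S_re_hasGrad hc).eventually_nhds, S_re_hasGrad hb.dS,
      S_re_hasGrad hb.dZ, S_re_hasGrad hc.dS, S_re_hasGrad hc.dZ] with p e2 e3 e4 e5 e6 e7 e8 e9 hp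
    have e4' : ∀ᶠ q in 𝓝 p, HasGrad β (axiGrad (S (dS b) (inv q)).re (S (dZ b) (inv q)).re q) q := by
      filter_upwards [e4, e2.eventually_nhds] with q h1 h2 using h1.congr h2
    have e5' : ∀ᶠ q in 𝓝 p, HasGrad κ (axiGrad (S (dS c) (inv q)).re (S (dZ c) (inv q)).re q) q := by
      filter_upwards [e5, e3.eventually_nhds] with q h1 h2 using h1.congr h2
    rw [dZ_dS] at e6 e8
    have hre := fun {a : PS} (ha : cj a = a) => ofReal_re_S ha p
    have hcb := h.sol.real_b
    have hcc := h.real_c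
    simp only [ricci_axiMetric hp (Filter.EventuallyEq.of_eq (tildeMetric_eq_axiMetric β κ)) e5' e4' e8 e9 e6 e7]
    rw [contract_axiRicci hη hp]
    rw [hre (a := dS b) (by rw [cj_dS, hcb]), hre (a := dZ b) (by rw [cj_dZ, hcb]),
      hre (a := dS (dS b)) (by rw [cj_dS, cj_dS, hcb]), hre (a := dZ (dZ b)) (by rw [cj_dZ, cj_dZ, hcb]),
      hre (a := dS (dZ b)) (by rw [cj_dS, cj_dZ, hcb]),
      hre (a := dS c) (by rw [cj_dS, hcc]), hre (a := dZ c) (by rw [cj_dZ, hcc]),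
      hre (a := dS (dS c)) (by rw [cj_dS, cj_dS, hcc]), hre (a := dZ (dZ c)) (by rw [cj_dZ, cj_dZ, hcc]),
      hre (a := dS (dZ c)) (by rw [cj_dS, cj_dZ, hcc])]
    rfl
end

/-! ### Independence of the conformal gauge -/

section
open Polynomial Differential
variable {A : Type*} [CommRing A] [Differential A]

/-- Polynomials describing the moments in terms of the derivative `h` of the conformal factor. -/
def gaugePoly (Y : A) : ℕ → A[X]
  | 0 => C Y
  | 1 => C Y′ - X * C Y
  | n + 2 => Differential.mapCoeffs (gaugePoly Y (n + 1)) - (4 * (n : A[X]) + 5) * X * gaugePoly Y (n + 1)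
      - 2 * (((n : A[X]) + 1) * (2 * (n : A[X]) + 1)) * X ^ 2 * gaugePoly Y n

theorem derivative_mapCoeffs (p : A[X]) :
    derivative (Differential.mapCoeffs p) = Differential.mapCoeffs (derivative p) := by
  ext i
  simp only [coeff_derivative, coeff_mapCoeffs]
  rw [Derivation.leibniz]
  have : ((i : A) + 1)′ = 0 := by
    rw [map_add, Derivation.map_natCast, Derivation.map_one_eq_zero, add_zero]
  rw [this]
  simp [mul_comm]

/-- Induction through the recursion. In `map_gauge` the chain rule produces exactly this multiple of
h′, and it cancels the h′ that stands in the recursion for G. -/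
theorem derivative_gaugePoly (Y : A) (n : ℕ) :
    derivative (gaugePoly Y (n + 1)) = -(((n : A[X]) + 1) * (2 * (n : A[X]) + 1)) * gaugePoly Y n := by
  induction n using Nat.strong_induction_on with
  | _ n ih =>
    rcases n with _ | n
    · simp [gaugePoly]
    · have h1 := ih n (Nat.lt_succ_self n)
      have hc : derivative (4 * (n : A[X]) + 5) = 0 := by
        have := derivative_natCast (R := A) (n := 4 * n + 5)
        simpa only [Nat.cast_add, Nat.cast_mul, Nat.cast_ofNat] using this
      have hc' : derivative (2 * (((n : A[X]) + 1) * (2 * (n : A[X]) + 1))) = 0 := by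
        have := derivative_natCast (R := A) (n := 2 * ((n + 1) * (2 * n + 1)))
        rwa [show ((2 * ((n + 1) * (2 * n + 1)) : ℕ) : A[X]) =
          2 * (((n : A[X]) + 1) * (2 * (n : A[X]) + 1)) by push_cast; ring] at this
      have hm : Differential.mapCoeffs (-(((n : A[X]) + 1) * (2 * (n : A[X]) + 1)) * gaugePoly Y n) =
          -(((n : A[X]) + 1) * (2 * (n : A[X]) + 1)) * Differential.mapCoeffs (gaugePoly Y n) := by
        have := (Differential.mapCoeffs (A := A)).map_natCast ((n + 1) * (2 * n + 1))
        push_cast at this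
        rw [Derivation.leibniz, map_neg, this]
        simp
      rw [gaugePoly, derivative_sub, derivative_sub, derivative_mapCoeffs, h1, hm, derivative_mul,
        derivative_mul, derivative_mul, derivative_mul, hc, hc', h1, derivative_X, derivative_X_pow]
      rcases n with _ | n
      · simp [gaugePoly]
        rw [show (C 2 : A[X]) = 2 from map_ofNat C 2]
        ring
      · rw [ih n (by omega)]
        conv_rhs => rw [gaugePoly]
        rw [gaugePoly]
        push_cast
        simp
        rw [show (C 2 : A[X]) = 2 from map_ofNat C 2]
        ring

theorem deriv_eval (x : A) (p : A[X]) :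
    (eval x p)′ = eval x (Differential.mapCoeffs p) + eval x (derivative p) * x′ := by
  have := deriv_aeval_eq (A := A) (R := A) x p
  simpa only [coe_aeval_eq_eval] using this

/-- As the terms with h′ cancel, G n is e times a polynomial in h whose coefficients contain no
derivative of h. The homomorphism ε kills h and leaves the constant coefficient, the n-th derivative
of Y. So the result does not see h, although only ε h is assumed to vanish and not ε of its
derivatives. -/
theorem map_gauge {k : Type*} [CommRing k] (ε : A →+* k) {e h Y : A} (he : e′ = -h * e)
    (hε : ε h = 0) {G : ℕ → A} (h0 : G 0 = e * Y) (h1 : G 1 = (G 0)′)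
    (h2 : ∀ n, G (n + 2) = (G (n + 1))′ - 4 * (n + 1) * h * G (n + 1) -
      (n + 1) * (2 * n + 1) * (2 * h ^ 2 - h′) * G n) (n : ℕ) :
    ε (G n) = ε e * ε ((Differential.deriv : Derivation ℤ A A)^[n] Y) := by
  have key : ∀ n, G n = e * eval h (gaugePoly Y n) ∧
      G (n + 1) = e * eval h (gaugePoly Y (n + 1)) := by
    intro n
    induction n with
    | zero =>
      refine ⟨by simp [gaugePoly, h0], ?_⟩
      rw [zero_add, h1, h0, Derivation.leibniz, he]
      simp [gaugePoly]
      ring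
    | succ n ih =>
      refine ⟨ih.2, ?_⟩
      rw [h2, ih.1, ih.2, Derivation.leibniz, deriv_eval, derivative_gaugePoly, he, gaugePoly]
      simp
      ring
  rw [(key n).1, map_mul]
  congr 1
  have h3 : ∀ p : A[X], ε (eval h p) = ε (p.coeff 0) := by
    intro p
    rw [← eval₂_at_apply, hε, eval₂_at_zero]
  have h4 : ∀ n, (gaugePoly Y n).coeff 0 = (Differential.deriv : Derivation ℤ A A)^[n] Y := by
    intro n
    induction n with
    | zero => simp [gaugePoly]
    | succ n ih =>
      rw [Function.iterate_succ_apply', ← ih]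
      rcases n with _ | n
      · simp [gaugePoly]
      · rw [gaugePoly]
        simp [mul_assoc, mul_coeff_zero]
  rw [h3, h4]
end

/-- The differential structure is supplied locally, because the derivation used later depends on ω.
-/
theorem map_gauge_of_derivation {A k : Type*} [CommRing A] [CommRing k] (ε : A →+* k)
    (d : A →+ A) (hd : ∀ u v, d (u * v) = u * d v + v * d u) {e h Y : A} (he : d e = -h * e)
    (hε : ε h = 0) {G : ℕ → A} (h0 : G 0 = e * Y) (h1 : G 1 = d (G 0))
    (h2 : ∀ n, G (n + 2) = d (G (n + 1)) - 4 * (n + 1) * h * G (n + 1) -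
      (n + 1) * (2 * n + 1) * (2 * h ^ 2 - d h) * G n) (n : ℕ) :
    ε (G n) = ε e * ε (d^[n] Y) := by
  let _ : Differential A := ⟨Derivation.mk' d.toIntLinearMap hd⟩
  exact map_gauge ε he hε h0 h1 h2 n

/-! ### Moments on the null cone -/

section
variable {f : E3 → ℂ} {β κ : E3 → ℝ} {a b k c : PS} {η : Fin 3 → ℂ}

theorem analyticAt_covDeriv {g : MetricField} (hg : ∀ l i j, AnalyticAt ℝ (christoffel g l i j) 0)
    {n : ℕ} {T : E3 → Tensor n} (hT : ∀ J, AnalyticAt ℝ (fun p => T p J) 0) (J : Fin (n + 1) → Fin 3) :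
    AnalyticAt ℝ (fun p => covDeriv g T p J) 0 :=
  (analyticAt_pd _ (hT _)).sub (Finset.analyticAt_fun_sum _ fun _ _ =>
    Finset.analyticAt_fun_sum _ fun _ _ => (analyticAt_ofReal (hg _ _ _)).mul (hT _))

theorem analyticAt_matMul {M : Fin 3 → Fin 3 → E3 → ℝ} (hM : ∀ i j, AnalyticAt ℝ (M i j) 0)
    {n : ℕ} {T : E3 → Tensor n} (hT : ∀ J, AnalyticAt ℝ (fun p => T p J) 0) (J : Fin (n + 2) → Fin 3) :
    AnalyticAt ℝ (fun p => matMul (fun i j => M i j p) (T p) J) 0 :=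
  (analyticAt_ofReal (hM _ _)).mul (hT _)

/-- The recursion satisfied by the restriction of the moment tensors to the null cone. -/
theorem IsGaugeData.moment_recursion (h : IsGaugeData f β κ a b k c) (hη : IsNullDir η)
    {P : (n : ℕ) → E3 → Tensor n}
    (hP : IsMomentSequence (tildeMetric β κ) (tildePotential f β κ) P) {R : PowerSeries ℂ}
    (hR : HasDirTaylor η
      (fun p => ∑ i, ∑ j, (ricci (tildeMetric β κ) i j p : ℂ) * (η i * η j)) R)
    {F : ℕ → PowerSeries ℂ} (hF : ∀ n, F n = dirTaylor η fun p => contract η (P n p)) :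
    F 0 = dirTaylor η (tildePotential f β κ) ∧ F 1 = PowerSeries.derivative ℂ (F 0) ∧
    ∀ n : ℕ, F (n + 2) = PowerSeries.derivative ℂ (F (n + 1)) -
      2 * (n + 1) * PowerSeries.derivative ℂ (null c) * F (n + 1) -
      PowerSeries.C (((n : ℂ) + 1) * (2 * (n : ℂ) + 1) / 2) * (R * F n) := by
  have hg := h.hasNullField hη
  have hchr := h.analyticAt_christoffel
  have hcov := fun n => dirTaylor_contract_covDeriv (h.hasDirTaylor_christoffel hη) (hP.analytic n)
  refine ⟨?_, ?_, fun n => ?_⟩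
  · rw [hF]
    refine dirTaylor_congr ?_
    filter_upwards [hP.zero] with p hp
    rw [contract_zero, hp]
  · rw [hF, hF, dirTaylor_contract_traceFree hg (analyticAt_covDeriv hchr (hP.analytic 0))
      (hP.analytic 1) hP.one, hcov]
    simp
  · have hcd := analyticAt_covDeriv hchr (hP.analytic (n + 1))
    have hmm := analyticAt_matMul h.analyticAt_ricci (hP.analytic n)
    have hT : ∀ J, AnalyticAt ℝ (fun p => (covDeriv (tildeMetric β κ) (P (n + 1)) p -
        (((n : ℂ) + 1) * (2 * (n : ℂ) + 1) / 2) •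
          matMul (fun i j => ricci (tildeMetric β κ) i j p) (P n p)) J) 0 := fun J =>
      (hcd J).sub (analyticAt_const.mul (hmm J))
    have hc : ∀ i, HasDirTaylor η (fun _ => η i) (PowerSeries.C (η i)) := fun i =>
      HasDirTaylor.const (η i)
    rw [hF, hF, hF, dirTaylor_contract_traceFree hg hT (hP.analytic (n + 2)) (hP.add_two n)]
    have h1 : HasDirTaylor η _ _ := hasDirTaylor (HasDirTaylor.contract hc hcd).1
    have h2 : HasDirTaylor η _ _ := hasDirTaylor (HasDirTaylor.contract hc (hP.analytic n)).1
    have h3 := h1.sub ((HasDirTaylor.const (((n : ℂ) + 1) * (2 * (n : ℂ) + 1) / 2)).mul (hR.mul h2))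
    have h4 := (h3.congr (v := fun p => contract η (covDeriv (tildeMetric β κ) (P (n + 1)) p -
        (((n : ℂ) + 1) * (2 * (n : ℂ) + 1) / 2) •
          matMul (fun i j => ricci (tildeMetric β κ) i j p) (P n p)))
      (Filter.Eventually.of_forall fun p => by
        simp only [contract_sub, contract_smul, contract_matMul])).2
    rw [h4]
    have h5 := hcov (n + 1)
    push_cast at h5
    congr 1

/-! ### The adapted radius on the null cone and the formula for the moments -/

/-- The derivation `d/dρ` on power series in `t`, where `dρ/dt = 1/ω`. -/
def nullDer (ω : PowerSeries ℂ) : Derivation ℂ (PowerSeries ℂ) (PowerSeries ℂ) :=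
  ω • PowerSeries.derivative ℂ

theorem nullDer_apply (ω u : PowerSeries ℂ) : nullDer ω u = ω * PowerSeries.derivative ℂ u := rfl

/-- `r` is the square root of a conformal radius along the null cone, for the derivative `B` of `β`
along the null cone and the translation `c`. -/
structure IsNullGauge (B : PowerSeries ℂ) (c : ℂ) (r E ω : PowerSeries ℂ) : Prop where
  coeff_zero : PowerSeries.constantCoeff r = 1
  coeff_one : 2 * PowerSeries.constantCoeff (PowerSeries.derivative ℂ r) = -c
  eq : E = r ^ 2 - 2 * PowerSeries.X * r * PowerSeries.derivative ℂ r
  deriv : PowerSeries.derivative ℂ E = 2 * B * E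
  mul_eq : ω * E = r ^ 4

namespace IsNullGauge
variable {B r E ω : PowerSeries ℂ} {c : ℂ}

theorem constantCoeff_E (h : IsNullGauge B c r E ω) : PowerSeries.constantCoeff E = 1 := by
  rw [h.eq]; simp [h.coeff_zero]

theorem constantCoeff_ω (h : IsNullGauge B c r E ω) : PowerSeries.constantCoeff ω = 1 := by
  have := congrArg PowerSeries.constantCoeff h.mul_eq
  rwa [map_mul, map_pow, h.coeff_zero, h.constantCoeff_E, one_pow, mul_one] at this

end IsNullGauge

theorem constantCoeff_derivative_beta (h : IsSeriesSolution a b) :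
    PowerSeries.constantCoeff (PowerSeries.derivative ℂ (null b)) = 0 := by
  rw [derivative_null_beta h]; simp

/-- The moments in terms of the restriction of the solution to the null cone. -/
theorem IsGaugeData.contract_moment (h : IsGaugeData f β κ a b k c) (hη : IsNullDir η)
    (h0 : β 0 = 0) (h0' : κ 0 = 0) {P : (n : ℕ) → E3 → Tensor n}
    (hP : IsMomentSequence (tildeMetric β κ) (tildePotential f β κ) P) {r E ω : PowerSeries ℂ} {c₀ : ℂ}
    (hG : IsNullGauge (PowerSeries.derivative ℂ (null b)) c₀ r E ω)
    (hc : PowerSeries.constantCoeff (PowerSeries.derivative ℂ (null c)) = c₀) (n : ℕ) :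
    contract η (P n 0) = PowerSeries.constantCoeff ((nullDer ω)^[n] (r * null a)) := by
  have hE1 := hG.constantCoeff_E
  have hω1 := hG.constantCoeff_ω
  obtain ⟨hr, hr1, hE, hE', hω⟩ := hG
  obtain ⟨R, hR, hXR⟩ := h.hasDirTaylor_ricci hη
  obtain ⟨e₀, he₀, hde₀, hce₀⟩ := HasDirTaylor.tildePotential h hη h0 h0'
  obtain ⟨F, hF⟩ : ∃ F : ℕ → PowerSeries ℂ, ∀ n, F n = dirTaylor η fun p => contract η (P n p) :=
    ⟨_, fun _ => rfl⟩
  obtain ⟨hF0, hF1, hF2⟩ := h.moment_recursion hη hP hR hF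
  rw [he₀.2] at hF0
  have hri : r * r⁻¹ = 1 := PowerSeries.mul_inv_cancel r (by rw [hr]; exact one_ne_zero)
  have hE0 : E ≠ 0 := fun h => by rw [h] at hE1; simp at hE1
  have hri1 : PowerSeries.constantCoeff r⁻¹ = 1 := by
    have := congrArg PowerSeries.constantCoeff hri
    rwa [map_mul, hr, one_mul, map_one] at this
  have hB0 := constantCoeff_derivative_beta h.sol
  have half : (2 : PowerSeries ℂ) * PowerSeries.C (1 / 2) = 1 := by
    rw [← map_ofNat PowerSeries.C 2, ← map_mul]; norm_num
  have d2 : PowerSeries.derivative ℂ (2 : PowerSeries ℂ) = 0 := by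
    have := (PowerSeries.derivative ℂ).map_natCast 2
    simpa using this
  have dh : PowerSeries.derivative ℂ (PowerSeries.C (1 / 2 : ℂ)) = 0 := PowerSeries.derivative_C
  set D := PowerSeries.derivative ℂ
  set B := D (null b)
  set q := D (null c)
  set r' := D r with hr'
  have hdri : D r⁻¹ = -(r⁻¹ * r⁻¹ * r') := by
    have h1 := congrArg D hri
    rw [Derivation.leibniz, Derivation.map_one_eq_zero, smul_eq_mul, smul_eq_mul] at h1
    linear_combination r⁻¹ * h1 - D r⁻¹ * hri
  -- The equation defining E, differentiated once and divided by r²: a second-order equation for r.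
  have hk0 : PowerSeries.X * (2 * (r' * r⁻¹) ^ 2 + 2 * (D r' * r⁻¹) - 4 * (r' * r⁻¹) * B) =
      -(2 * B) := by
    have h1 : D E = -2 * PowerSeries.X * (r' ^ 2 + r * D r') := by
      rw [hE, sq, map_sub]
      simp only [Derivation.leibniz, smul_eq_mul, d2, D, PowerSeries.derivative_X]
      ring
    rw [hE', hE] at h1
    linear_combination r⁻¹ ^ 2 * h1 - (2 * PowerSeries.X * (D r' * r⁻¹) -
      4 * PowerSeries.X * B * (r' * r⁻¹) + 2 * B * (r * r⁻¹ + 1)) * hri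
  have hW : D ω = ω * (4 * (r' * r⁻¹) - 2 * B) := by
    refine mul_left_cancel₀ hE0 ?_
    have h1 := congrArg D hω
    rw [Derivation.leibniz, Derivation.leibniz_pow, hE'] at h1
    simp only [smul_eq_mul, nsmul_eq_mul, Nat.cast_ofNat] at h1
    norm_num at h1
    linear_combination h1 - (4 * (r' * r⁻¹)) * hω - 4 * r ^ 3 * r' * hri
  -- The logarithmic derivative of e^κ relative to e^β r⁻². The function h of `map_gauge` is ω g /
  -- 2.
  set g := q + 2 * (r' * r⁻¹) - B with hg
  have hDg : D g = D q + 2 * (D r' * r⁻¹ - (r' * r⁻¹) ^ 2) - D B := by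
    rw [hg, map_sub, map_add, Derivation.leibniz, Derivation.leibniz, hdri, d2]
    simp only [smul_eq_mul]
    ring
  -- The curvature becomes a Riccati expression in g, and this brings the recursion into the form
  -- required by `map_gauge`.
  have hk1 : PowerSeries.X * (g ^ 2 - (4 * (r' * r⁻¹) - 2 * B) * g - D g) = PowerSeries.X * R := by
    rw [hDg, hg]
    linear_combination -hk0 - hXR
  have hk2 := mul_left_cancel₀ PowerSeries.X_ne_zero hk1
  set h₂ := PowerSeries.C (1 / 2 : ℂ) with hh₂
  have hDh : D (h₂ * ω * g) = h₂ * (ω * (4 * (r' * r⁻¹) - 2 * B) * g + ω * D g) := by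
    rw [Derivation.leibniz, Derivation.leibniz, hW, dh]
    simp only [smul_eq_mul]
    ring
  have hderiv : ∀ u : PowerSeries ℂ, (nullDer ω).toLinearMap.toAddMonoidHom u = ω * D u :=
    fun u => rfl
  -- The derivation is d/dρ, the homomorphism is evaluation at Λ, and the factor ωⁿ converts n
  -- derivatives in t into derivatives in ρ.
  have key := map_gauge_of_derivation PowerSeries.constantCoeff
    (nullDer ω).toLinearMap.toAddMonoidHom (nullDer ω).leibniz (e := e₀ * r⁻¹)
    (h := h₂ * ω * g) (Y := r * null a) (G := fun n => ω ^ n * F n) ?_ ?_ ?_ ?_ ?_ n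
  · rw [map_mul, map_mul, map_pow, hω1, hce₀, hri1, one_pow, one_mul, one_mul, one_mul] at key
    have h1 : PowerSeries.constantCoeff (F n) = contract η (P n 0) := by
      rw [← PowerSeries.coeff_zero_eq_constantCoeff_apply, hF, coeff_zero_dirTaylor]
    rw [← h1, key]
    rfl
  · rw [hderiv, Derivation.leibniz, hdri]
    simp only [smul_eq_mul]
    linear_combination (ω * r⁻¹ * h₂) * hde₀ +
      (-ω * r⁻¹ * D e₀ + ω * e₀ * r⁻¹ * r⁻¹ * r') * half
  -- h vanishes at Λ: κ′ contributes c, the term 2r′/r contributes −c, and β′ contributes 0.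
  · simp only [hg, map_mul, map_add, map_sub, map_ofNat, hri1, hB0, hω1]
    linear_combination (PowerSeries.constantCoeff h₂) * (hc + hr1)
  · simp only [pow_zero, one_mul]
    rw [hF0]
    linear_combination -(e₀ * null a) * hri
  · simp only [pow_zero, one_mul, pow_one]
    rw [hderiv, hF1]
  · intro n
    simp only [hderiv]
    rw [hF2, hDh, Derivation.leibniz, Derivation.leibniz_pow, hW]
    have hC : PowerSeries.C (((n : ℂ) + 1) * (2 * (n : ℂ) + 1) / 2) =
        ((n : PowerSeries ℂ) + 1) * (2 * n + 1) * h₂ := by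
      rw [hh₂, div_eq_mul_one_div]
      simp only [map_mul, map_add, map_natCast, map_one, map_ofNat]
    rw [hC, ← hk2]
    simp only [smul_eq_mul, nsmul_eq_mul, Nat.add_sub_cancel]
    push_cast
    linear_combination (2 * ((n : PowerSeries ℂ) + 1) * ω ^ (n + 2) * g * F (n + 1) +
      (n + 1) * (2 * n + 1) * ω ^ (n + 2) * h₂ * g ^ 2 * F n) * half +
      2 * ((n : PowerSeries ℂ) + 1) * ω ^ (n + 2) * F (n + 1) * hg
end

/-! ### The moments determine the solution -/

section
open PowerSeries

theorem X_pow_dvd_of_derivative {n : ℕ} {u : PowerSeries ℂ} (h : X ^ n ∣ derivative ℂ u)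
    (h0 : constantCoeff u = 0) : X ^ (n + 1) ∣ u := by
  rw [X_pow_dvd_iff] at h ⊢
  intro m hm
  rcases m with _ | m
  · rwa [coeff_zero_eq_constantCoeff_apply]
  · have h1 := h m (by omega)
    rw [coeff_derivative] at h1
    exact (mul_eq_zero.mp h1).resolve_right (Nat.cast_add_one_ne_zero m)

theorem X_pow_dvd_X_mul_derivative {n : ℕ} {u : PowerSeries ℂ} (h : X ^ n ∣ u) :
    X ^ n ∣ X * derivative ℂ u := by
  rw [X_pow_dvd_iff] at h ⊢
  intro m hm
  rcases m with _ | m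
  · simp
  · rw [coeff_succ_X_mul, coeff_derivative, h _ hm, zero_mul]

/-- E is the exponential of an integral of 2B, so it agrees to one order more than B. The equation E
= r² − X (r²)′ multiplies the m-th coefficient of r² by 1 − m, so it determines r² except at m = 1,
where the prescribed derivative at 0 takes over. -/
theorem IsNullGauge.congr {B r E ω B' r' E' ω' : PowerSeries ℂ} {c : ℂ}
    (h : IsNullGauge B c r E ω) (h' : IsNullGauge B' c r' E' ω') {n : ℕ} (hB : X ^ n ∣ B - B') :
    X ^ (n + 1) ∣ r - r' ∧ X ^ (n + 1) ∣ ω - ω' := by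
  have hi : E' * E'⁻¹ = 1 := PowerSeries.mul_inv_cancel E' (by rw [h'.constantCoeff_E]; exact one_ne_zero)
  have hE1 : constantCoeff E'⁻¹ = 1 := by
    have := congrArg constantCoeff hi
    rwa [map_mul, h'.constantCoeff_E, one_mul, map_one] at this
  have hdi : derivative ℂ E'⁻¹ = -(2 * B' * E'⁻¹) := by
    have h1 := congrArg (derivative ℂ) hi
    rw [Derivation.leibniz, Derivation.map_one_eq_zero, h'.deriv] at h1
    simp only [smul_eq_mul] at h1
    linear_combination E'⁻¹ * h1 - (derivative ℂ E'⁻¹ + E'⁻¹ * 2 * B') * hi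
  have hE : X ^ (n + 1) ∣ E - E' := by
    have h1 : X ^ (n + 1) ∣ E * E'⁻¹ - 1 := by
      refine X_pow_dvd_of_derivative ?_ (by simp [h.constantCoeff_E, hE1])
      rw [map_sub, Derivation.map_one_eq_zero, Derivation.leibniz, hdi, h.deriv]
      simp only [smul_eq_mul]
      exact hB.trans ⟨2 * E * E'⁻¹, by ring⟩
    exact h1.trans ⟨E', by linear_combination E * (-hi)⟩
  have hv : X ^ (n + 1) ∣ r ^ 2 - r' ^ 2 := by
    have h1 : E - E' = (r ^ 2 - r' ^ 2) - X * derivative ℂ (r ^ 2 - r' ^ 2) := by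
      rw [h.eq, h'.eq, map_sub, Derivation.leibniz_pow, Derivation.leibniz_pow]
      simp only [smul_eq_mul, nsmul_eq_mul, Nat.cast_ofNat]
      ring
    rw [X_pow_dvd_iff] at hE ⊢
    intro m hm
    have h2 := hE m hm
    rw [h1] at h2
    rcases m with _ | _ | m
    · rw [coeff_zero_eq_constantCoeff_apply]
      simp [h.coeff_zero, h'.coeff_zero]
    · have h3 : coeff 1 (r ^ 2 - r' ^ 2) = constantCoeff (derivative ℂ (r ^ 2 - r' ^ 2)) := by
        rw [← coeff_zero_eq_constantCoeff_apply, coeff_derivative]; simp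
      rw [zero_add, h3, map_sub, Derivation.leibniz_pow, Derivation.leibniz_pow]
      simp only [smul_eq_mul, nsmul_eq_mul, Nat.cast_ofNat, map_sub, map_mul, map_ofNat, map_pow,
        h.coeff_zero, h'.coeff_zero]
      linear_combination h.coeff_one - h'.coeff_one
    · rw [map_sub, coeff_succ_X_mul, coeff_derivative] at h2
      have h3 : coeff (m + 1 + 1) (r ^ 2 - r' ^ 2) * ((m : ℂ) + 1) = 0 := by
        push_cast at h2
        linear_combination -h2
      exact (mul_eq_zero.mp h3).resolve_right (Nat.cast_add_one_ne_zero m)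
  have hr : X ^ (n + 1) ∣ r - r' := by
    have hu : IsUnit (r + r') := by
      rw [PowerSeries.isUnit_iff_constantCoeff, map_add, h.coeff_zero, h'.coeff_zero]
      norm_num
    rw [← hu.dvd_mul_right]
    exact hv.trans ⟨1, by ring⟩
  refine ⟨hr, ?_⟩
  have hu : IsUnit E := by
    rw [PowerSeries.isUnit_iff_constantCoeff, h.constantCoeff_E]; exact isUnit_one
  rw [← hu.dvd_mul_right, show (ω - ω') * E = (r - r') * ((r + r') * (r ^ 2 + r' ^ 2)) -
    (E - E') * ω' by linear_combination h.mul_eq - h'.mul_eq]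
  exact dvd_sub (hr.mul_right _) (hE.mul_right _)

/-- Each application of the derivation lowers the order of the difference by one and multiplies its
leading coefficient by the current exponent, which accumulates to n!. The difference of ω and ω′
contributes only to higher order. -/
theorem constantCoeff_nullDer_iterate_sub {ω ω' : PowerSeries ℂ} (h0 : constantCoeff ω = 1) (n : ℕ)
    {Y Y' : PowerSeries ℂ} (hω : X ^ n ∣ ω - ω') (hY : X ^ n ∣ Y - Y') :
    constantCoeff ((nullDer ω)^[n] Y) - constantCoeff ((nullDer ω')^[n] Y') =
      n.factorial * coeff n (Y - Y') := by
  induction n generalizing Y Y' with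
  | zero => simp
  | succ n ih =>
    obtain ⟨U, hU⟩ := hω
    obtain ⟨Z, hZ⟩ := hY
    have hDZ : derivative ℂ Y - derivative ℂ Y' = ((n : PowerSeries ℂ) + 1) * X ^ n * Z + X ^ (n + 1) * derivative ℂ Z := by
      rw [← map_sub, hZ, Derivation.leibniz, Derivation.leibniz_pow, derivative_X]
      simp only [smul_eq_mul, nsmul_eq_mul, Nat.add_sub_cancel]
      push_cast
      ring
    have h1 : nullDer ω Y - nullDer ω' Y' = X ^ n * (((n : PowerSeries ℂ) + 1) * ω * Z +
        X * (ω * derivative ℂ Z + U * derivative ℂ Y')) := by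
      rw [nullDer_apply, nullDer_apply]
      linear_combination ω * hDZ + derivative ℂ Y' * hU
    rw [Function.iterate_succ_apply, Function.iterate_succ_apply,
      ih ((pow_dvd_pow X n.le_succ).trans ⟨U, hU⟩) ⟨_, h1⟩, h1, hZ]
    have h2 : ∀ (k : ℕ) (W : PowerSeries ℂ), coeff k (X ^ k * W) = constantCoeff W := fun k W => by
      rw [← coeff_zero_eq_constantCoeff_apply, coeff_X_pow_mul' W k k, if_pos le_rfl, Nat.sub_self]
    rw [h2, h2, Nat.factorial_succ]
    simp [h0]
    ring

/-- Coefficient by coefficient: agreement of the null restrictions modulo Xⁿ gives the same for β′,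
hence agreement of r and ω modulo Xⁿ⁺¹. The n-th moments then differ by n! times the difference of
the n-th coefficients of the restrictions, which must vanish. -/
theorem null_eq_of_moments {a b a' b' : PS} (h : IsSeriesSolution a b) (h' : IsSeriesSolution a' b')
    {c : ℂ} {r E ω r' E' ω' : PowerSeries ℂ} (hG : IsNullGauge (derivative ℂ (null b)) c r E ω)
    (hG' : IsNullGauge (derivative ℂ (null b')) c r' E' ω')
    (hm : ∀ n, constantCoeff ((nullDer ω)^[n] (r * null a)) =
      constantCoeff ((nullDer ω')^[n] (r' * null a'))) : null a = null a' := by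
  have key : ∀ n, X ^ n ∣ null a - null a' := by
    intro n
    induction n with
    | zero => simp
    | succ n ih =>
      have hcj : X ^ n ∣ null (cj a) - null (cj a') := by
        rw [X_pow_dvd_iff] at ih ⊢
        intro m hm
        have := congrArg conj (ih m hm)
        rw [map_sub, coeff_null, coeff_null] at this ⊢
        rw [coeff_cj, coeff_cj, ← map_sub, this, map_zero]
      -- A derivative costs one order, but in the formula for β′ it always comes with a factor X.
      have hA := X_pow_dvd_X_mul_derivative ih
      have hA' := X_pow_dvd_X_mul_derivative hcj
      rw [map_sub] at hA hA'
      have hB : X ^ n ∣ derivative ℂ (null b) - derivative ℂ (null b') := by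
        rw [derivative_null_beta h, derivative_null_beta h']
        have h1 := (ih.add (hA.mul_left 2)).mul_left
          (X * (null (cj a) + 2 * X * derivative ℂ (null (cj a))))
        have h2 := (hcj.add (hA'.mul_left 2)).mul_left
          (X * (null a' + 2 * X * derivative ℂ (null a')))
        refine (h1.add h2).trans ⟨1, ?_⟩
        ring
      obtain ⟨hr, hω⟩ := hG.congr hG' hB
      have h1 : r * null a - r' * null a' = r * (null a - null a') + (r - r') * null a' := by ring
      have hY : X ^ n ∣ r * null a - r' * null a' := by
        rw [h1]
        exact (ih.mul_left _).add (((pow_dvd_pow X n.le_succ).trans hr).mul_right _)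
      have h2 := constantCoeff_nullDer_iterate_sub hG.constantCoeff_ω n
        ((pow_dvd_pow X n.le_succ).trans hω) hY
      rw [hm, sub_self, eq_comm, mul_eq_zero] at h2
      have h3 := h2.resolve_left (by exact_mod_cast n.factorial_ne_zero)
      rw [h1, map_add, X_pow_dvd_iff.mp (hr.mul_right (null a')) n n.lt_succ_self, add_zero] at h3
      obtain ⟨Z, hZ⟩ := ih
      rw [hZ, mul_left_comm, coeff_X_pow_mul' _ n n, if_pos le_rfl, Nat.sub_self,
        coeff_zero_eq_constantCoeff_apply, map_mul, hG.coeff_zero, one_mul] at h3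
      obtain ⟨W, hW⟩ := X_dvd_iff.mpr h3
      exact ⟨W, by rw [hZ, hW]; ring⟩
  ext n
  have := X_pow_dvd_iff.mp (key (n + 1)) n n.lt_succ_self
  rwa [map_sub, sub_eq_zero] at this

theorem eq_of_moments {a b a' b' : PS} (h : IsSeriesSolution a b) (h' : IsSeriesSolution a' b')
    {c : ℂ} {r E ω r' E' ω' : PowerSeries ℂ} (hG : IsNullGauge (derivative ℂ (null b)) c r E ω)
    (hG' : IsNullGauge (derivative ℂ (null b')) c r' E' ω')
    (hm : ∀ n, constantCoeff ((nullDer ω)^[n] (r * null a)) =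
      constantCoeff ((nullDer ω')^[n] (r' * null a'))) : a = a' :=
  ernst_unique h.ernst h'.ernst fun e he => by
    rw [coeff_eq_null a he, coeff_eq_null a' he, null_eq_of_moments h h' hG hG' hm]

end

/-! ### Analytic functions of one variable -/

/-- `u` is analytic at the origin with Taylor series `A`. -/
def HasTaylor (u : ℂ → ℂ) (A : PowerSeries ℂ) : Prop := AnalyticAt ℂ u 0 ∧ taylor u = A

theorem hasTaylor {u : ℂ → ℂ} (h : AnalyticAt ℂ u 0) : HasTaylor u (taylor u) := ⟨h, rfl⟩

namespace HasTaylor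
variable {u v : ℂ → ℂ} {A B : PowerSeries ℂ}

theorem congr (h : HasTaylor u A) (he : v =ᶠ[𝓝 0] u) : HasTaylor v A :=
  ⟨h.1.congr he.symm, (taylor_congr he).trans h.2⟩

theorem unique (h : HasTaylor u A) (h' : HasTaylor u B) : A = B := h.2.symm.trans h'.2

theorem eventuallyEq (h : HasTaylor u A) (h' : HasTaylor v A) : u =ᶠ[𝓝 0] v :=
  eventually_eq_of_taylor_eq h.1 h'.1 (h.2.trans h'.2.symm)

theorem constantCoeff (h : HasTaylor u A) : PowerSeries.constantCoeff A = u 0 := by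
  rw [← h.2, constantCoeff_taylor]

theorem add (h : HasTaylor u A) (h' : HasTaylor v B) : HasTaylor (fun t => u t + v t) (A + B) :=
  ⟨h.1.add h'.1, by rw [← h.2, ← h'.2]; exact taylor_add h.1 h'.1⟩

theorem mul (h : HasTaylor u A) (h' : HasTaylor v B) : HasTaylor (fun t => u t * v t) (A * B) :=
  ⟨h.1.mul h'.1, by rw [← h.2, ← h'.2]; exact taylor_mul h.1 h'.1⟩

theorem const (c : ℂ) : HasTaylor (fun _ => c) (PowerSeries.C c) :=
  ⟨analyticAt_const, taylor_const c⟩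

theorem one : HasTaylor (fun _ => 1) 1 := by simpa using HasTaylor.const 1

theorem two : HasTaylor (fun _ => 2) 2 := by
  have := HasTaylor.const 2
  rwa [map_ofNat] at this

theorem id : HasTaylor (fun t => t) PowerSeries.X := ⟨analyticAt_id, taylor_id⟩

theorem neg (h : HasTaylor u A) : HasTaylor (fun t => -u t) (-A) := by
  have := (HasTaylor.const (-1)).mul h
  simpa using this

theorem sub (h : HasTaylor u A) (h' : HasTaylor v B) : HasTaylor (fun t => u t - v t) (A - B) := by
  simpa only [sub_eq_add_neg] using h.add h'.neg

theorem sq (h : HasTaylor u A) : HasTaylor (fun t => u t ^ 2) (A ^ 2) := by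
  simpa only [_root_.sq] using h.mul h

theorem deriv (h : HasTaylor u A) : HasTaylor (deriv u) (PowerSeries.derivative ℂ A) :=
  ⟨h.1.deriv, by rw [taylor_deriv, h.2]⟩

end HasTaylor

theorem exists_deriv_eq {K : ℂ → ℂ} (hK : AnalyticAt ℂ K 0) (a : ℂ) :
    ∃ G, AnalyticAt ℂ G 0 ∧ G 0 = a ∧ deriv G =ᶠ[𝓝 0] K := by
  obtain ⟨r, hr, h⟩ := Metric.eventually_nhds_iff_ball.mp hK.eventually_analyticAt
  have hd : DifferentiableOn ℂ K (Metric.ball 0 r) := fun t ht =>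
    (h t ht).differentiableAt.differentiableWithinAt
  obtain ⟨G, h0, hG⟩ := hd.isExactOn_ball.with_val_at 0 a
  have hn := Metric.ball_mem_nhds (0 : ℂ) hr
  refine ⟨G, ?_, h0, ?_⟩
  · exact DifferentiableOn.analyticAt (s := Metric.ball 0 r)
      (fun t ht => (hG t ht).differentiableAt.differentiableWithinAt) hn
  · filter_upwards [hn] with t ht using (hG t ht).deriv

theorem exists_deriv_deriv_eq {K : ℂ → ℂ} {A : PowerSeries ℂ} (hK : HasTaylor K A) (a b : ℂ) :
    ∃ G B, HasTaylor G B ∧ G 0 = a ∧ deriv G 0 = b ∧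
      PowerSeries.derivative ℂ (PowerSeries.derivative ℂ B) = A := by
  obtain ⟨G', hG', h0', hd'⟩ := exists_deriv_eq hK.1 b
  obtain ⟨G, hG, h0, hd⟩ := exists_deriv_eq hG' a
  refine ⟨G, taylor G, hasTaylor hG, h0, hd.self_of_nhds.trans h0', ?_⟩
  exact ((hasTaylor hG).deriv.deriv.congr hd.deriv.symm).unique (hK.congr hd')

theorem exists_inv_sqrt {u : ℂ → ℂ} (hu : AnalyticAt ℂ u 0) (h0 : u 0 = 1) :
    AnalyticAt ℂ (fun t => Complex.exp (-(Complex.log (u t) / 2))) 0 ∧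
      ∀ᶠ t in 𝓝 0, Complex.exp (-(Complex.log (u t) / 2)) ^ 2 * u t = 1 := by
  constructor
  · have h1 : AnalyticAt ℂ (fun t => Complex.log (u t)) 0 :=
      hu.clog (by rw [h0]; exact Complex.one_mem_slitPlane)
    exact (h1.div analyticAt_const two_ne_zero).neg.cexp
  · filter_upwards [hu.continuousAt.eventually_ne (show u 0 ≠ 0 by rw [h0]; exact one_ne_zero)]
      with t ht
    rw [← Complex.exp_nat_mul, Nat.cast_ofNat, mul_neg, mul_div_cancel₀ _ two_ne_zero,
      Complex.exp_neg, Complex.exp_log ht, inv_mul_cancel₀ ht]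

theorem taylor_conj (u : ℂ → ℂ) :
    taylor (fun t => conj (u (conj t))) = PowerSeries.map (starRingEnd ℂ) (taylor u) := by
  have h : ∀ n, iteratedDeriv n (fun t => conj (u (conj t))) =
      fun t => conj (iteratedDeriv n u (conj t)) := by
    intro n
    induction n with
    | zero => simp
    | succ n ih =>
      funext t
      rw [iteratedDeriv_succ, iteratedDeriv_succ, ih]
      exact congrFun (deriv_conj_conj (f := iteratedDeriv n u)) t
  ext n
  simp [coeff_taylor, h]

theorem HasTaylor.conj {u : ℂ → ℂ} {A : PowerSeries ℂ} (h : HasTaylor u A) :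
    HasTaylor (fun t => conj (u (conj t))) (PowerSeries.map (starRingEnd ℂ) A) := by
  refine ⟨?_, by rw [taylor_conj, h.2]⟩
  have h1 : ∀ᶠ t : ℂ in 𝓝 0, DifferentiableAt ℂ u (conj t) := by
    have hc : Filter.Tendsto (fun t : ℂ => (starRingEnd ℂ) t) (𝓝 0) (𝓝 0) := by
      have := Complex.continuous_conj.tendsto 0
      rwa [map_zero] at this
    exact hc.eventually (h.1.eventually_analyticAt.mono fun t ht => ht.differentiableAt)
  refine Complex.analyticAt_iff_eventually_differentiableAt.mpr (h1.mono fun t ht => ?_)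
  have := DifferentiableAt.conj_conj ht
  rwa [Complex.conj_conj] at this

/-- An analytic local inverse. -/
theorem exists_localInverse {u : ℂ → ℂ} (hu : AnalyticAt ℂ u 0) (h0 : u 0 = 0)
    (h1 : deriv u 0 ≠ 0) : ∃ w : ℂ → ℂ, AnalyticAt ℂ w 0 ∧ w 0 = 0 ∧
      (∀ᶠ t in 𝓝 0, w (u t) = t) ∧ ∀ᶠ t in 𝓝 0, u (w t) = t := by
  have ha := hu.analyticAt_localInverse h1
  have hl := hu.hasStrictDerivAt.eventually_left_inverse h1
  have hr := hu.hasStrictDerivAt.eventually_right_inverse h1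
  rw [h0] at ha hr
  refine ⟨_, ha, ?_, hl, hr⟩
  have := hl.self_of_nhds
  rwa [h0] at this

/-- τ inverts ρ, so d/dρ is W d/dt with W = 1/ρ′; iterating the chain rule turns derivatives in ρ
into iterates of `nullDer`. -/
theorem iteratedDeriv_comp {ρ τ W u : ℂ → ℂ} {n : ℕ} (hρ : AnalyticAt ℂ ρ 0) (hτ : AnalyticAt ℂ τ 0)
    (h0 : τ 0 = 0) (h : ∀ᶠ t in 𝓝 0, ρ (τ t) = t) (hW : AnalyticAt ℂ W 0)
    (hWρ : ∀ᶠ t in 𝓝 0, W t * deriv ρ t = 1) (hu : AnalyticAt ℂ u 0) :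
    iteratedDeriv n (fun t => u (τ t)) 0 =
      PowerSeries.constantCoeff ((nullDer (taylor W))^[n] (taylor u)) := by
  have hτ0 : Filter.Tendsto τ (𝓝 0) (𝓝 0) := by
    have := hτ.continuousAt.tendsto
    rwa [h0] at this
  induction n generalizing u with
  | zero => simp [h0, constantCoeff_taylor]
  | succ n ih =>
    have h1 : deriv (fun t => u (τ t)) =ᶠ[𝓝 0] fun t => W (τ t) * deriv u (τ t) := by
      filter_upwards [h.eventually_nhds, hτ0.eventually hWρ, hτ.eventually_analyticAt,
        hτ0.eventually hρ.eventually_analyticAt, hτ0.eventually hu.eventually_analyticAt]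
        with t e1 e2 e3 e4 e5
      have h2 := (e4.differentiableAt.hasDerivAt.comp t e3.differentiableAt.hasDerivAt).unique
        ((hasDerivAt_id t).congr_of_eventuallyEq e1)
      have h3 := (e5.differentiableAt.hasDerivAt.comp t e3.differentiableAt.hasDerivAt).deriv
      refine Eq.trans h3 ?_
      linear_combination (-deriv u (τ t) * deriv τ t) * e2 + W (τ t) * deriv u (τ t) * h2
    have h2 := hasTaylor (hW.mul hu.deriv)
    have h3 := ((hasTaylor hW).mul (hasTaylor hu).deriv).unique h2
    rw [iteratedDeriv_succ', h1.iteratedDeriv_eq, Function.iterate_succ_apply, nullDer_apply, h3]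
    exact ih (hW.mul hu.deriv)

theorem hasPositiveRadius_iff {m : ℕ → ℂ} :
    HasPositiveRadius m ↔ ∃ y : ℂ → ℂ, AnalyticAt ℂ y 0 ∧ ∀ n, iteratedDeriv n y 0 = m n := by
  constructor
  · intro h
    have h1 := (FormalMultilinearSeries.hasFPowerSeriesOnBall _ h).hasFPowerSeriesAt
    refine ⟨_, h1.analyticAt, fun n => ?_⟩
    have h2 := h1.analyticAt.hasFPowerSeriesAt.eq_formalMultilinearSeries h1
    have h3 := congrFun (FormalMultilinearSeries.ofScalars_series_injective ℂ ℂ h2) n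
    have h4 : (n.factorial : ℂ) ≠ 0 := by exact_mod_cast n.factorial_ne_zero
    exact (div_left_inj' h4).mp h3
  · rintro ⟨y, hy, hm⟩
    have h1 := hy.hasFPowerSeriesAt
    simp only [hm] at h1
    obtain ⟨r, hr⟩ := h1
    exact hr.r_pos.trans_le hr.r_le

/-! ### The conformal radius of a solution along the null cone -/

theorem HasTaylor.exp {u : ℂ → ℂ} {A : PowerSeries ℂ} (h : HasTaylor u A) :
    ∃ e, HasTaylor (fun t => Complex.exp (u t)) e ∧
      PowerSeries.derivative ℂ e = PowerSeries.derivative ℂ A * e := by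
  refine ⟨_, hasTaylor h.1.cexp, ?_⟩
  refine (hasTaylor h.1.cexp).deriv.unique ((h.deriv.mul (hasTaylor h.1.cexp)).congr ?_)
  filter_upwards [h.1.eventually_analyticAt] with t ht
  exact ht.differentiableAt.hasDerivAt.cexp.deriv.trans (mul_comm _ _)

theorem hasTaylor_null {a : PS} (ha : Conv a) : HasTaylor (fun t => S a (0, t)) (null a) :=
  ⟨analyticAt_S_null ha, taylor_S ha⟩

theorem derivative_two : PowerSeries.derivative ℂ (2 : PowerSeries ℂ) = 0 := by
  have := (PowerSeries.derivative ℂ).map_natCast 2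
  simpa using this

theorem powerSeries_ext {A B : PowerSeries ℂ}
    (h : PowerSeries.derivative ℂ A = PowerSeries.derivative ℂ B)
    (h0 : PowerSeries.constantCoeff A = PowerSeries.constantCoeff B) : A = B :=
  PowerSeries.derivative.ext h h0

/-- For v = r² the equation v − t v′ = e^{2β} is singular at t = 0. Its derivative −t v″ = 2β′
e^{2β} can be divided by t, because β′ has the factor t, and v″ = −2(f + 2t f′)(f̄ + 2t f̄′) e^{2β}
is solved by two integrations with v(0) = 1, v′(0) = −c. -/
theorem exists_isNullGauge {a b : PS} (h : IsSeriesSolution a b)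
    (h0 : PowerSeries.constantCoeff (null b) = 0) (c : ℂ) :
    ∃ (R W : ℂ → ℂ) (r E ω : PowerSeries ℂ), HasTaylor R r ∧ HasTaylor W ω ∧
      IsNullGauge (PowerSeries.derivative ℂ (null b)) c r E ω := by
  have hb := hasTaylor_null h.conv_b
  obtain ⟨E, hE, hdE⟩ := (HasTaylor.two.mul hb).exp
  rw [Derivation.leibniz, derivative_two, smul_zero, add_zero, smul_eq_mul] at hdE
  have hE1 : PowerSeries.constantCoeff E = 1 := by
    rw [hE.constantCoeff, ← hb.constantCoeff, h0, mul_zero, Complex.exp_zero]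
  have hf := hasTaylor_null h.conv_a
  have hg := hasTaylor_null h.conv_a.cj
  have hΦ := (hf.add ((HasTaylor.two.mul HasTaylor.id).mul hf.deriv)).mul
    (hg.add ((HasTaylor.two.mul HasTaylor.id).mul hg.deriv))
  obtain ⟨v, V, hv, hv0, hv1, hV⟩ := exists_deriv_deriv_eq ((HasTaylor.two.mul hΦ).mul hE).neg 1 (-c)
  have hVE : V - PowerSeries.X * PowerSeries.derivative ℂ V = E := by
    refine powerSeries_ext ?_ (by simp [hE1, hv.constantCoeff, hv0])
    rw [map_sub, Derivation.leibniz, hV, hdE, derivative_null_beta h, PowerSeries.derivative_X]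
    simp only [smul_eq_mul]
    ring
  -- The square root of v is taken in the form v · v^{−1/2}.
  obtain ⟨hR₀, hsq⟩ := exists_inv_sqrt hv.1 hv0
  have hR := (hasTaylor hR₀).mul hv
  obtain ⟨r, hr⟩ : ∃ r, HasTaylor (fun t => Complex.exp (-(Complex.log (v t) / 2)) * v t) r := ⟨_, hR⟩
  have hr2 : r ^ 2 = V := hr.sq.unique (hv.congr (by
    filter_upwards [hsq] with t ht
    linear_combination v t * ht))
  have hr0 : PowerSeries.constantCoeff r = 1 := by
    rw [hr.constantCoeff, hv0]; simp
  have hdV : PowerSeries.derivative ℂ V = 2 * r * PowerSeries.derivative ℂ r := by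
    rw [← hr2, Derivation.leibniz_pow]
    simp only [smul_eq_mul, nsmul_eq_mul, Nat.cast_ofNat]
    ring
  have hW : AnalyticAt ℂ (fun t => (Complex.exp (-(Complex.log (v t) / 2)) * v t) ^ 4 /
      Complex.exp (2 * S b (0, t))) 0 := (hr.1.pow _).div hE.1 (Complex.exp_ne_zero _)
  refine ⟨_, _, r, E, _, hr, hasTaylor hW, hr0, ?_, ?_, ?_, ?_⟩
  · have h1 := congrArg PowerSeries.constantCoeff hdV
    rw [hv.deriv.constantCoeff, hv1, map_mul, map_mul, hr0, map_ofNat] at h1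
    linear_combination -h1
  · rw [← hVE, hdV, ← hr2]; ring
  · rw [hdE]
  · refine ((hasTaylor hW).mul hE).unique ?_
    rw [show r ^ 4 = (r ^ 2) ^ 2 by ring]
    refine hr.sq.sq.congr (Filter.Eventually.of_forall fun t => ?_)
    have := Complex.exp_ne_zero (2 * S b (0, t))
    field_simp

/-- The variable of y is ρ = t/r². Its derivative is E/r⁴ = 1/ω, nonzero at 0, so ρ has an analytic
inverse τ, and (r f) ∘ τ has the required derivatives. -/
theorem exists_iteratedDeriv_eq {a : PS} (ha : Conv a) {R W : ℂ → ℂ} {B r E ω : PowerSeries ℂ} {c : ℂ}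
    (hR : HasTaylor R r) (hW : HasTaylor W ω) (hG : IsNullGauge B c r E ω) :
    ∃ y : ℂ → ℂ, AnalyticAt ℂ y 0 ∧ ∀ n, iteratedDeriv n y 0 =
      PowerSeries.constantCoeff ((nullDer ω)^[n] (r * null a)) := by
  have hR0 : R 0 = 1 := by rw [← hR.constantCoeff, hG.coeff_zero]
  have hρ : AnalyticAt ℂ (fun t => t / R t ^ 2) 0 :=
    analyticAt_id.div (hR.1.pow 2) (by rw [hR0]; norm_num)
  obtain ⟨P, hP⟩ : ∃ P, HasTaylor (fun t => t / R t ^ 2) P := ⟨_, hasTaylor hρ⟩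
  have hPX : P * r ^ 2 = PowerSeries.X := (hP.mul hR.sq).unique (HasTaylor.id.congr (by
    filter_upwards [hR.1.continuousAt.eventually_ne (show R 0 ≠ 0 by rw [hR0]; exact one_ne_zero)]
      with t ht
    field_simp))
  have hE0 : E ≠ 0 := fun h0 => by
    have := hG.constantCoeff_E
    rw [h0] at this; simp at this
  have hPω : ω * PowerSeries.derivative ℂ P = 1 := by
    have h1 := congrArg (PowerSeries.derivative ℂ) hPX
    rw [Derivation.leibniz, Derivation.leibniz_pow, PowerSeries.derivative_X] at h1
    simp only [smul_eq_mul, nsmul_eq_mul, Nat.cast_ofNat, Nat.add_one_sub_one, pow_one] at h1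
    refine mul_left_cancel₀ hE0 ?_
    linear_combination PowerSeries.derivative ℂ P * hG.mul_eq + r ^ 2 * h1 - hG.eq -
      2 * r * PowerSeries.derivative ℂ r * hPX
  have hWρ := (hW.mul hP.deriv).eventuallyEq (hPω ▸ HasTaylor.one)
  have h1 : deriv (fun t => t / R t ^ 2) 0 ≠ 0 := fun h0 => by
    have := hWρ.self_of_nhds
    simp only [h0, mul_zero] at this
    exact zero_ne_one this
  obtain ⟨τ, hτ, hτ0, -, hinv⟩ := exists_localInverse hρ (by simp) h1
  have hY := hR.mul (hasTaylor_null ha)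
  refine ⟨fun t => R (τ t) * S a (0, τ t), ?_, fun n => ?_⟩
  · exact AnalyticAt.comp (g := fun t => R t * S a (0, t)) (f := τ) (by rw [hτ0]; exact hY.1) hτ
  · have := iteratedDeriv_comp (n := n) hρ hτ hτ0 hinv hW.1 hWρ hY.1
    rw [this, hW.2, hY.2]

/-! ### Construction of the values on the null cone -/

/-- The letters stand for functions of t after the substitution ρ = σ(t): P is ρ itself, K is dρ/dt,
V and Y are v and y, Z is the conjugate of y, an index 1 marks a derivative in ρ, H is v − ρ v′ and
ω is H r⁴. The datum on the null cone is y v r = y/r; the verification that r is its null gauge is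
purely algebraic. -/
theorem isNullGauge_of_relations {P V V₁ Θ Y Y₁ Z Z₁ H r K : PowerSeries ℂ} {c : ℂ}
    (hP : PowerSeries.X * V = P) (hr : r ^ 2 * V = 1) (hr1 : PowerSeries.constantCoeff r = 1)
    (hdV : PowerSeries.derivative ℂ V = V₁ * K) (hdY : PowerSeries.derivative ℂ Y = Y₁ * K)
    (hdZ : PowerSeries.derivative ℂ Z = Z₁ * K)
    (hdH : PowerSeries.derivative ℂ H = -(2 * P * Θ * K)) (hK : K * H = V ^ 2)
    (hH : H = V - P * V₁) (hΘ : Θ = (Y + 2 * P * Y₁) * (Z + 2 * P * Z₁))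
    (hc : PowerSeries.constantCoeff (V₁ * K) = c) :
    IsNullGauge (PowerSeries.X *
      (Y * V * r + 2 * PowerSeries.X * PowerSeries.derivative ℂ (Y * V * r)) *
      (Z * V * r + 2 * PowerSeries.X * PowerSeries.derivative ℂ (Z * V * r)))
      c r (r ^ 2 - 2 * PowerSeries.X * r * PowerSeries.derivative ℂ r) (H * r ^ 4) ∧
    H * r ^ 4 * K = 1 := by
  have hV1 : PowerSeries.constantCoeff V = 1 := by
    have := congrArg PowerSeries.constantCoeff hr
    rwa [map_mul, map_pow, hr1, one_pow, one_mul, map_one] at this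
  have hdr : 2 * PowerSeries.derivative ℂ r = -(V₁ * r ^ 3 * K) := by
    have h1 := congrArg (PowerSeries.derivative ℂ) hr
    rw [Derivation.leibniz, Derivation.leibniz_pow, Derivation.map_one_eq_zero, hdV] at h1
    simp only [smul_eq_mul, nsmul_eq_mul, Nat.cast_ofNat, Nat.add_one_sub_one, pow_one] at h1
    linear_combination r * h1 - 2 * PowerSeries.derivative ℂ r * hr
  obtain ⟨E, hE⟩ : ∃ E, E = r ^ 2 - 2 * PowerSeries.X * r * PowerSeries.derivative ℂ r := ⟨_, rfl⟩
  have hE' : E = r ^ 2 + PowerSeries.X * r ^ 4 * V₁ * K := by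
    rw [hE]; linear_combination -PowerSeries.X * r * hdr
  -- In terms of ρ this says e^{2β} = 1/(v − ρ v′).
  have hEH : E * H = 1 := by
    rw [hE']
    linear_combination PowerSeries.X * r ^ 4 * V₁ * hK + r ^ 2 * hH + r ^ 2 * V₁ * hP +
      (1 - PowerSeries.X * V₁ + PowerSeries.X * V₁ * (r ^ 2 * V + 1)) * hr
  have hKE : K = V ^ 2 * E := by linear_combination E * hK - K * hEH
  have hEV : E * V ^ 2 = V + PowerSeries.X * V₁ * K := by
    rw [hE']
    linear_combination (V + PowerSeries.X * V₁ * K * (r ^ 2 * V + 1)) * hr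
  have hdE : PowerSeries.derivative ℂ E = 2 * P * Θ * K * E ^ 2 := by
    have h1 := congrArg (PowerSeries.derivative ℂ) hEH
    rw [Derivation.leibniz, Derivation.map_one_eq_zero, hdH] at h1
    simp only [smul_eq_mul] at h1
    linear_combination E * h1 - PowerSeries.derivative ℂ E * hEH
  have hA : ∀ Y Y₁ : PowerSeries ℂ, PowerSeries.derivative ℂ Y = Y₁ * K →
      Y * V * r + 2 * PowerSeries.X * PowerSeries.derivative ℂ (Y * V * r) =
        r * V ^ 2 * E * (Y + 2 * P * Y₁) := by
    intro Y Y₁ h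
    rw [Derivation.leibniz, Derivation.leibniz, h, hdV]
    simp only [smul_eq_mul]
    linear_combination PowerSeries.X * Y * V * hdr - PowerSeries.X * Y * V₁ * r * K * hr -
      r * Y * hEV + 2 * r * Y₁ * P * hKE + 2 * r * Y₁ * K * hP
  rw [hA Y Y₁ hdY, hA Z Z₁ hdZ, ← hE]
  refine ⟨⟨hr1, ?_, hE, ?_, ?_⟩, ?_⟩
  · have h1 := congrArg PowerSeries.constantCoeff hdr
    rw [map_mul, map_ofNat] at h1
    rw [h1, show V₁ * r ^ 3 * K = V₁ * K * r ^ 3 by ring, map_neg, map_mul, map_pow, hr1, hc]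
    ring
  · rw [hdE, hΘ]
    linear_combination (2 * P * (Y + 2 * P * Y₁) * (Z + 2 * P * Z₁) * E ^ 2) * hKE -
      2 * E ^ 3 * V ^ 2 * (Y + 2 * P * Y₁) * (Z + 2 * P * Z₁) *
        (PowerSeries.X * V * hr + hP)
  · linear_combination r ^ 4 * hEH
  · linear_combination r ^ 4 * hK + (r ^ 2 * V + 1) * hr

theorem derivative_map_conj (A : PowerSeries ℂ) :
    PowerSeries.derivative ℂ (PowerSeries.map (starRingEnd ℂ) A) =
      PowerSeries.map (starRingEnd ℂ) (PowerSeries.derivative ℂ A) := by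
  ext n; simp [PowerSeries.coeff_derivative]

theorem null_cj (a : PS) : null (cj a) = PowerSeries.map (starRingEnd ℂ) (null a) := by
  ext n; rw [coeff_null, PowerSeries.coeff_map, coeff_null, coeff_cj]

theorem derivative_taylor_comp {u σ : ℂ → ℂ} (hu : AnalyticAt ℂ u 0) (hσ : AnalyticAt ℂ σ 0)
    (h0 : σ 0 = 0) : PowerSeries.derivative ℂ (taylor fun t => u (σ t)) =
      taylor (fun t => deriv u (σ t)) * taylor (deriv σ) := by
  have h1 : AnalyticAt ℂ (fun t => u (σ t)) 0 :=
    AnalyticAt.comp (g := u) (f := σ) (by rwa [h0]) hσ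
  have h2 : AnalyticAt ℂ (fun t => deriv u (σ t)) 0 :=
    AnalyticAt.comp (g := deriv u) (f := σ) (by rw [h0]; exact hu.deriv) hσ
  refine (hasTaylor h1).deriv.unique (((hasTaylor h2).mul (hasTaylor hσ.deriv)).congr ?_)
  have hσ0 : Filter.Tendsto σ (𝓝 0) (𝓝 0) := by
    have := hσ.continuousAt.tendsto
    rwa [h0] at this
  filter_upwards [hσ.eventually_analyticAt, hσ0.eventually hu.eventually_analyticAt] with t e1 e2
  exact (e2.differentiableAt.hasDerivAt.comp t e1.differentiableAt.hasDerivAt).deriv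

/-- The inverse of the passage from f to y, with ρ as the independent variable: v = 1/r² satisfies
v″ = 2(y + 2ρ y′)(ȳ + 2ρ ȳ′), v(0) = 1, v′(0) = c, again two integrations. Then t = ρ/v, and f = y
√v is the datum on the null cone that `ernst_exists` extends. -/
theorem exists_series_of_potential {y : ℂ → ℂ} (hy : AnalyticAt ℂ y 0) (c : ℝ) :
    ∃ a, Conv a ∧ lap a = ernstRhs a ∧ ∃ r E ω : PowerSeries ℂ,
      IsNullGauge (PowerSeries.X * (null a + 2 * PowerSeries.X * PowerSeries.derivative ℂ (null a)) *
        (null (cj a) + 2 * PowerSeries.X * PowerSeries.derivative ℂ (null (cj a)))) c r E ω ∧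
      ∀ n, PowerSeries.constantCoeff ((nullDer ω)^[n] (r * null a)) = iteratedDeriv n y 0 := by
  have hY := hasTaylor hy
  have hZ := hY.conj
  have hΘ := (hY.add ((HasTaylor.two.mul HasTaylor.id).mul hY.deriv)).mul
    (hZ.add ((HasTaylor.two.mul HasTaylor.id).mul hZ.deriv))
  set z : ℂ → ℂ := fun t => conj (y (conj t)) with hz
  obtain ⟨Θ, hΘd⟩ : ∃ Θ : ℂ → ℂ, Θ = fun t => (y t + 2 * t * deriv y t) * (z t + 2 * t * deriv z t) :=
    ⟨_, rfl⟩
  rw [← hΘd] at hΘ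
  obtain ⟨v, V, hv, hv0, hv1, hV⟩ := exists_deriv_deriv_eq (HasTaylor.two.mul hΘ) 1 c
  -- v, and with it s and σ below, commutes with conjugation because c is real. Hence the conjugate
  -- datum on the null cone arises by conjugating y alone.
  have hconj : PowerSeries.map (starRingEnd ℂ) V = V := by
    have h1 : ∀ A : PowerSeries ℂ, PowerSeries.map (starRingEnd ℂ)
        (PowerSeries.map (starRingEnd ℂ) A) = A := fun A => by ext n; simp
    have h2 : PowerSeries.map (starRingEnd ℂ) (PowerSeries.derivative ℂ V) =
        PowerSeries.derivative ℂ V := by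
      refine powerSeries_ext ?_ ?_
      · rw [derivative_map_conj, hV]
        simp only [map_mul, map_add, map_ofNat, PowerSeries.map_X, derivative_map_conj, h1]
        ring
      · rw [← PowerSeries.coeff_zero_eq_constantCoeff_apply, PowerSeries.coeff_map,
          PowerSeries.coeff_zero_eq_constantCoeff_apply, hv.deriv.constantCoeff, hv1,
          Complex.conj_ofReal]
    refine powerSeries_ext (by rw [derivative_map_conj, h2]) ?_
    rw [← PowerSeries.coeff_zero_eq_constantCoeff_apply, PowerSeries.coeff_map,
      PowerSeries.coeff_zero_eq_constantCoeff_apply, hv.constantCoeff, hv0, map_one]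
  have hvc := hv.conj.eventuallyEq (hconj.symm ▸ hv)
  obtain ⟨hs, hsv⟩ := exists_inv_sqrt hv.1 hv0
  obtain ⟨s, hsd⟩ : ∃ s : ℂ → ℂ, s = fun t => Complex.exp (-(Complex.log (v t) / 2)) := ⟨_, rfl⟩
  have hs0 : s 0 = 1 := by rw [hsd]; simp [hv0]
  rw [← hsd] at hs
  replace hsv : ∀ᶠ t in 𝓝 0, s t ^ 2 * v t = 1 := by rw [hsd]; exact hsv
  have hsc : (fun t => conj (s (conj t))) =ᶠ[𝓝 0] s := by
    have h1 := hasTaylor hs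
    have h2 : taylor s ^ 2 * V = 1 := (h1.sq.mul hv).unique (HasTaylor.one.congr hsv)
    have h3 := congrArg (PowerSeries.map (starRingEnd ℂ)) h2
    rw [map_mul, map_pow, hconj, map_one] at h3
    have h4 : (PowerSeries.map (starRingEnd ℂ) (taylor s) - taylor s) *
        (PowerSeries.map (starRingEnd ℂ) (taylor s) + taylor s) = 0 := by
      linear_combination (PowerSeries.map (starRingEnd ℂ) (taylor s)) ^ 2 * (-h2) +
        taylor s ^ 2 * h3
    have h5 := (mul_eq_zero.mp h4).resolve_right fun h6 => by
      have := congrArg PowerSeries.constantCoeff h6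
      rw [map_add, h1.constantCoeff, h1.conj.constantCoeff, map_zero, map_zero, hs0, map_one] at this
      norm_num at this
    rw [sub_eq_zero] at h5
    exact h1.conj.eventuallyEq (h5.symm ▸ h1)
  have hv0' : ∀ᶠ t in 𝓝 0, v t ≠ 0 := hv.1.continuousAt.eventually_ne (by rw [hv0]; exact one_ne_zero)
  -- This is t = ρ/v as a function of ρ; its local inverse σ expresses ρ through t.
  have hT : AnalyticAt ℂ (fun t => t / v t) 0 := analyticAt_id.div hv.1 (by rw [hv0]; exact one_ne_zero)
  have hdT : ∀ᶠ t in 𝓝 0, deriv (fun t => t / v t) t * v t ^ 2 = v t - t * deriv v t := by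
    filter_upwards [hv.1.eventually_analyticAt, hv0'] with t e1 e2
    have h1 : deriv (fun t => t / v t) t = _ :=
      ((hasDerivAt_id t).div e1.differentiableAt.hasDerivAt e2).deriv
    rw [h1]
    simp only [id]
    field_simp
  have hdT0 : deriv (fun t => t / v t) 0 ≠ 0 := fun h => by
    have := hdT.self_of_nhds
    rw [h, hv0] at this; norm_num at this
  obtain ⟨σ, hσ, hσ0, hl, hr⟩ := exists_localInverse hT (by simp) hdT0
  have hσ0' : Filter.Tendsto σ (𝓝 0) (𝓝 0) := by
    have := hσ.continuousAt.tendsto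
    rwa [hσ0] at this
  have hcj : Filter.Tendsto (fun t : ℂ => (starRingEnd ℂ) t) (𝓝 0) (𝓝 0) := by
    have := Complex.continuous_conj.tendsto 0
    rwa [map_zero] at this
  have hσc : (fun t => conj (σ (conj t))) =ᶠ[𝓝 0] σ := by
    have hx : Filter.Tendsto (fun t => conj (σ (conj t))) (𝓝 0) (𝓝 0) := hcj.comp (hσ0'.comp hcj)
    filter_upwards [hx.eventually hl, hcj.eventually hr, hx.eventually hvc] with t e1 e2 e3
    have h1 : conj (σ (conj t)) / v (conj (σ (conj t))) = t := by
      have := congrArg conj e2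
      rw [map_div₀, Complex.conj_conj] at this
      rwa [← e3, Complex.conj_conj]
    rw [h1] at e1
    exact e1.symm
  have hcomp : ∀ {u : ℂ → ℂ}, AnalyticAt ℂ u 0 → HasTaylor (fun t => u (σ t)) (taylor fun t => u (σ t)) :=
    fun {u} hu => hasTaylor (AnalyticAt.comp (g := u) (f := σ) (by rwa [hσ0]) hσ)
  have hσσ := hasTaylor hσ
  have hσd := hasTaylor hσ.deriv
  have hH : HasTaylor (fun t => v t - t * deriv v t) _ := hv.sub (HasTaylor.id.mul hv.deriv)
  have hdd : deriv (deriv v) =ᶠ[𝓝 0] fun t => 2 * Θ t :=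
    hv.deriv.deriv.eventuallyEq (hV ▸ HasTaylor.two.mul hΘ)
  have hdH : deriv (fun t => v t - t * deriv v t) =ᶠ[𝓝 0] fun t => -(2 * t * Θ t) := by
    filter_upwards [hv.1.eventually_analyticAt, hv.deriv.1.eventually_analyticAt, hdd] with t e1 e2 e3
    have := (e1.differentiableAt.hasDerivAt.sub
      ((hasDerivAt_id t).mul e2.differentiableAt.hasDerivAt)).deriv
    refine Eq.trans this ?_
    rw [e3]; simp only [id]; ring
  have hKH : taylor (deriv σ) * taylor (fun t => v (σ t) - σ t * deriv v (σ t)) =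
      taylor (fun t => v (σ t)) ^ 2 := by
    refine (hσd.mul (hcomp hH.1)).unique ((hcomp hv.1).sq.congr ?_)
    filter_upwards [hr.eventually_nhds, hσ.eventually_analyticAt,
      hσ0'.eventually hT.eventually_analyticAt, hσ0'.eventually hdT] with t e1 e2 e3 e4
    have h2 := (e3.differentiableAt.hasDerivAt.comp t e2.differentiableAt.hasDerivAt).unique
        ((hasDerivAt_id t).congr_of_eventuallyEq e1)
    linear_combination (-deriv σ t) * e4 + v (σ t) ^ 2 * h2
  have hGK := isNullGauge_of_relations (P := taylor σ) (V := taylor fun t => v (σ t))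
    (V₁ := taylor fun t => deriv v (σ t)) (Θ := taylor fun t => Θ (σ t)) (Y := taylor fun t => y (σ t))
    (Y₁ := taylor fun t => deriv y (σ t)) (Z := taylor fun t => z (σ t))
    (Z₁ := taylor fun t => deriv z (σ t)) (H := taylor fun t => v (σ t) - σ t * deriv v (σ t))
    (r := taylor fun t => s (σ t)) (K := taylor (deriv σ)) (c := (c : ℂ))
    ?_ ?_ ?_ (derivative_taylor_comp hv.1 hσ hσ0) (derivative_taylor_comp hy hσ hσ0)
    (derivative_taylor_comp hZ.1 hσ hσ0) ?_ ?_ ?_ ?_ ?_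
  · obtain ⟨hG, hωK⟩ := hGK
    have hf := ((hcomp hy).mul (hcomp hv.1)).mul (hcomp hs)
    obtain ⟨a₀, ha₀, hn₀⟩ := exists_null hf.1
    obtain ⟨a, ha, hae, han⟩ := ernst_exists ha₀
    have hna : null a = (taylor fun t => y (σ t)) * (taylor fun t => v (σ t)) *
        taylor fun t => s (σ t) := by
      rw [← hf.2, ← hn₀]
      ext n
      rw [coeff_null, coeff_null, han _ (by simp)]
    have hnc : null (cj a) = (taylor fun t => z (σ t)) * (taylor fun t => v (σ t)) *
        taylor fun t => s (σ t) := by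
      rw [null_cj, hna]
      refine hf.conj.unique ((((hcomp hZ.1).mul (hcomp hv.1)).mul (hcomp hs)).congr ?_)
      filter_upwards [hσc, hσ0'.eventually hvc, hσ0'.eventually hsc] with t e1 e2 e3
      have h1 : σ (conj t) = conj (σ t) := by rw [← e1, Complex.conj_conj]
      rw [map_mul, map_mul, h1, e2, e3]
    refine ⟨a, ha, hae, _, _, _, by rw [hna, hnc]; exact hG, fun n => ?_⟩
    have h1 : (taylor fun t => s (σ t)) * null a = taylor fun t => y (σ t) := by
      have h2 : (taylor fun t => s (σ t)) ^ 2 * (taylor fun t => v (σ t)) = 1 :=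
        ((hcomp hs).sq.mul (hcomp hv.1)).unique (HasTaylor.one.congr (hσ0'.eventually hsv))
      rw [hna]
      linear_combination (taylor fun t => y (σ t)) * h2
    rw [h1]
    -- Since ω · dρ/dt = 1, `nullDer ω` acts as d/dρ on functions of ρ = σ(t).
    have h3 : ∀ (n : ℕ) {u : ℂ → ℂ}, AnalyticAt ℂ u 0 →
        PowerSeries.constantCoeff ((nullDer ((taylor fun t => v (σ t) - σ t * deriv v (σ t)) *
          (taylor fun t => s (σ t)) ^ 4))^[n] (taylor fun t => u (σ t))) = iteratedDeriv n u 0 := by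
      intro n
      induction n with
      | zero => intro u hu; simp [constantCoeff_taylor, hσ0]
      | succ n ih =>
        intro u hu
        rw [Function.iterate_succ_apply, nullDer_apply, derivative_taylor_comp hu hσ hσ0,
          mul_left_comm, hωK, mul_one, ih hu.deriv, iteratedDeriv_succ']
    exact h3 n hy
  · refine (HasTaylor.id.mul (hcomp hv.1)).unique (hσσ.congr ?_)
    filter_upwards [hr, hσ0'.eventually hv0'] with t e1 e2
    nth_rewrite 1 [← e1]
    field_simp
  · exact ((hcomp hs).sq.mul (hcomp hv.1)).unique (HasTaylor.one.congr (hσ0'.eventually hsv))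
  · rw [(hcomp hs).constantCoeff, hσ0, hs0]
  · have h1 := derivative_taylor_comp hH.1 hσ hσ0
    rw [h1]
    have h2 := ((HasTaylor.two.mul hσσ).mul (hcomp hΘ.1)).neg
    have h3 := (hcomp hH.1.deriv).unique (h2.congr (hσ0'.eventually hdH))
    rw [h3]; ring
  · exact hKH
  · exact (hcomp hH.1).unique ((hcomp hv.1).sub (hσσ.mul (hcomp hv.deriv.1)))
  · refine (hcomp hΘ.1).unique ((((hcomp hy).add ((HasTaylor.two.mul hσσ).mul (hcomp hy.deriv))).mul
      ((hcomp hZ.1).add ((HasTaylor.two.mul hσσ).mul (hcomp hZ.deriv.1)))).congr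
        (Filter.Eventually.of_forall fun t => ?_))
    simp only [hΘd]
  · have h1 : deriv σ 0 = 1 := by
      have h2 := congrArg PowerSeries.constantCoeff hKH
      rw [map_mul, map_pow, hσd.constantCoeff, (hcomp hv.1).constantCoeff,
        (hcomp hH.1).constantCoeff, hσ0, hv0] at h2
      simpa using h2
    rw [map_mul, (hcomp hv.deriv.1).constantCoeff, hσd.constantCoeff, hσ0, hv1, h1, mul_one]

/-! ### Symmetric trace-free tensors -/

/-- Total symmetry. -/
def IsSymm {n : ℕ} (S : Tensor n) : Prop :=
  ∀ (σ : Equiv.Perm (Fin n)) (I : Fin n → Fin 3), S (I ∘ σ) = S I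

/-- The component `S_{i a_2 …}` as a tensor. -/
def slice {n : ℕ} (S : Tensor (n + 1)) (i : Fin 3) : Tensor n := fun J => S (Fin.cons i J)

/-- The trace in the first two slots. -/
def trace (g : Matrix (Fin 3) (Fin 3) ℝ) {n : ℕ} (S : Tensor (n + 2)) : Tensor n := fun J =>
  ∑ a : Fin 3, ∑ b : Fin 3,
    ((g⁻¹ a b : ℝ) : ℂ) * S (Fin.cons a (Fin.cons b J : Fin (n + 1) → Fin 3))

/-- Symmetric tensors without trace. -/
def IsSymmTraceFree (g : Matrix (Fin 3) (Fin 3) ℝ) : {n : ℕ} → Tensor n → Prop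
  | 0, _ => True
  | 1, S => IsSymm S
  | _ + 2, S => IsSymm S ∧ trace g S = 0

theorem IsSymm.sub {n : ℕ} {S T : Tensor n} (hS : IsSymm S) (hT : IsSymm T) : IsSymm (S - T) :=
  fun σ I => by simp only [Pi.sub_apply, hS σ I, hT σ I]

theorem IsSymm.slice {n : ℕ} {S : Tensor (n + 1)} (hS : IsSymm S) (i : Fin 3) :
    IsSymm (slice S i) := by
  intro σ J
  have h := hS (Equiv.Perm.decomposeFin.symm (0, σ)) (Fin.cons i J)
  rw [AxiErnst.slice, AxiErnst.slice, ← h]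
  congr 1
  funext s
  refine Fin.cases ?_ (fun s => ?_) s
  · simp
  · simp [Equiv.Perm.decomposeFin_symm_apply_succ]

theorem IsSymm.swap {n : ℕ} {S : Tensor (n + 2)} (hS : IsSymm S) (i j : Fin 3) (J : Fin n → Fin 3) :
    S (Fin.cons i (Fin.cons j J : Fin (n + 1) → Fin 3)) =
      S (Fin.cons j (Fin.cons i J : Fin (n + 1) → Fin 3)) := by
  rw [← hS (Equiv.swap 0 1)]
  congr 1
  funext s
  refine Fin.cases ?_ (fun s => Fin.cases ?_ (fun s => ?_) s) s
  · simp
  · have : (Fin.succ 0 : Fin (n + 2)) = 1 := rfl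
    simp [this]
  · have h1 : Equiv.swap (0 : Fin (n + 2)) 1 s.succ.succ = s.succ.succ :=
      Equiv.swap_apply_of_ne_of_ne (Fin.succ_ne_zero _) fun h =>
        Fin.succ_ne_zero s (Fin.succ_injective _ h)
    simp [h1]

theorem IsSymm.trace {g : Matrix (Fin 3) (Fin 3) ℝ} {n : ℕ} {S : Tensor (n + 2)} (hS : IsSymm S) :
    IsSymm (trace g S) := by
  intro σ J
  refine Finset.sum_congr rfl fun a _ => Finset.sum_congr rfl fun b _ => ?_
  exact congrArg _ (((hS.slice a).slice b) σ J)

theorem trace_sub (g : Matrix (Fin 3) (Fin 3) ℝ) {n : ℕ} (S T : Tensor (n + 2)) :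
    trace g (S - T) = trace g S - trace g T := by
  funext J
  simp only [trace, Pi.sub_apply, mul_sub, Finset.sum_sub_distrib]

theorem IsSymmTraceFree.sub {g : Matrix (Fin 3) (Fin 3) ℝ} : ∀ {n : ℕ} {S T : Tensor n},
    IsSymmTraceFree g S → IsSymmTraceFree g T → IsSymmTraceFree g (S - T)
  | 0, _, _, _, _ => trivial
  | 1, _, _, h, h' => IsSymm.sub h h'
  | _ + 2, _, _, h, h' => ⟨h.1.sub h'.1, by rw [trace_sub, h.2, h'.2, sub_zero]⟩

theorem IsSymmTraceFree.isSymm {g : Matrix (Fin 3) (Fin 3) ℝ} : ∀ {n : ℕ} {S : Tensor n},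
    IsSymmTraceFree g S → IsSymm S
  | 0, S, _ => fun _ _ => congrArg S (Subsingleton.elim _ _)
  | 1, _, h => h
  | _ + 2, _, h => h.1

theorem isSymm_one (S : Tensor 1) : IsSymm S := fun σ _ => by
  rw [Subsingleton.elim σ 1]; rfl

theorem IsSymmTraceFree.slice {g : Matrix (Fin 3) (Fin 3) ℝ} (i : Fin 3) : ∀ {n : ℕ}
    {S : Tensor (n + 1)}, IsSymmTraceFree g S → IsSymmTraceFree g (slice S i)
  | 0, _, _ => trivial
  | 1, _, _ => isSymm_one _
  | n + 2, S, h => by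
    refine ⟨h.1.slice i, ?_⟩
    funext J
    refine Eq.trans ?_ (congrFun h.2 (Fin.cons i J))
    refine Finset.sum_congr rfl fun a _ => Finset.sum_congr rfl fun b _ => congrArg _ ?_
    have h2 := h.1.swap i a (Fin.cons b J)
    have h3 := (h.1.slice a).swap i b J
    exact h2.trans h3

theorem contract_slice (ξ : Fin 3 → ℂ) {n : ℕ} (S : Tensor (n + 1)) :
    contract ξ S = ∑ i, ξ i * contract ξ (slice S i) := by
  rw [contract, sum_cons]
  refine Finset.sum_congr rfl fun i _ => ?_
  rw [contract, Finset.mul_sum]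
  refine Finset.sum_congr rfl fun J _ => ?_
  rw [Fin.prod_univ_succ]
  simp only [Fin.cons_zero, Fin.cons_succ, slice]
  ring

/-- By symmetry all n + 1 slots contribute equally. -/
theorem hasDerivAt_contract {ξ ξ' : ℂ → Fin 3 → ℂ} {t : ℂ}
    (hξ : ∀ i, HasDerivAt (fun t => ξ t i) (ξ' t i) t) {n : ℕ} {S : Tensor (n + 1)} (hS : IsSymm S) :
    HasDerivAt (fun t => contract (ξ t) S)
      (((n : ℂ) + 1) * ∑ i, ξ' t i * contract (ξ t) (slice S i)) t := by
  induction n with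
  | zero =>
    have h1 : (fun t => contract (ξ t) S) = fun t => ∑ i, ξ t i * slice S i Fin.elim0 := by
      funext t
      rw [contract_slice]
      simp only [contract_zero]
    rw [h1]
    simp only [contract_zero]
    refine (HasDerivAt.fun_sum fun i _ => (hξ i).mul_const _).congr_deriv ?_
    simp
  | succ n ih =>
    have h1 : (fun t => contract (ξ t) S) = fun t => ∑ i, ξ t i * contract (ξ t) (slice S i) := by
      funext t
      rw [contract_slice]
    rw [h1]
    refine (HasDerivAt.fun_sum fun i _ => (hξ i).mul (ih (hS.slice i))).congr_deriv ?_
    have h2 : ∑ i, ξ t i * ∑ j, ξ' t j * contract (ξ t) (slice (slice S i) j) =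
        ∑ j, ξ' t j * contract (ξ t) (slice S j) := by
      simp only [contract_slice (ξ t) (slice S _), Finset.mul_sum]
      rw [Finset.sum_comm]
      refine Finset.sum_congr rfl fun j _ => Finset.sum_congr rfl fun i _ => ?_
      have h3 : slice (slice S i) j = slice (slice S j) i := by
        funext J; exact hS.swap i j J
      rw [h3]; ring
    have h4 : ∀ i, ξ t i * (((n : ℂ) + 1) * ∑ j, ξ' t j * contract (ξ t) (slice (slice S i) j)) =
        ((n : ℂ) + 1) * (ξ t i * ∑ j, ξ' t j * contract (ξ t) (slice (slice S i) j)) := fun i => by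
      ring
    simp only [h4, Finset.sum_add_distrib]
    rw [← Finset.mul_sum, h2]
    push_cast
    ring

/-! ### Symmetric trace-free tensors and null vectors -/

/-- A parametrization of the null directions of the Euclidean metric. -/
def nullCurve (t : ℂ) : Fin 3 → ℂ := ![Complex.I * (t ^ 2 + 1), t ^ 2 - 1, 2 * t]

/-- The velocity of `nullCurve`. -/
def nullCurve' (t : ℂ) : Fin 3 → ℂ := ![Complex.I * (2 * t), 2 * t, 2]

/-- The acceleration of `nullCurve`. -/
def nullCurve'' (_ : ℂ) : Fin 3 → ℂ := ![Complex.I * 2, 2, 0]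

theorem hasDerivAt_nullCurve (t : ℂ) (i : Fin 3) :
    HasDerivAt (fun t => nullCurve t i) (nullCurve' t i) t := by
  have h := hasDerivAt_pow 2 t
  fin_cases i
  · exact ((h.add_const (1 : ℂ)).const_mul Complex.I).congr_deriv (by simp [nullCurve'])
  · exact (h.sub_const (1 : ℂ)).congr_deriv (by simp [nullCurve'])
  · exact ((hasDerivAt_id t).const_mul (2 : ℂ)).congr_deriv (by simp [nullCurve'])

theorem hasDerivAt_nullCurve' (t : ℂ) (i : Fin 3) :
    HasDerivAt (fun t => nullCurve' t i) (nullCurve'' t i) t := by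
  have h := (hasDerivAt_id t).const_mul (2 : ℂ)
  fin_cases i
  · exact (h.const_mul Complex.I).congr_deriv (by simp [nullCurve''])
  · exact h.congr_deriv (by simp [nullCurve''])
  · exact (hasDerivAt_const t (2 : ℂ)).congr_deriv (by simp [nullCurve''])

/-- Along γ = `nullCurve` the tensor γ′ ⊗ γ′ − γ ⊗ γ″ − γ″ ⊗ γ is four times the identity, and a
trace-free form annihilates the identity. -/
theorem nullCurve_identity {c : Fin 3 → Fin 3 → ℂ} (hc : ∀ i j, c i j = c j i)
    (h0 : ∑ i, c i i = 0) (t : ℂ) :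
    ∑ i, nullCurve' t i * ∑ j, nullCurve' t j * c i j =
      2 * ∑ i, nullCurve'' t i * ∑ j, nullCurve t j * c i j := by
  simp only [Fin.sum_univ_three, nullCurve, nullCurve', nullCurve'', Matrix.cons_val_zero,
    Matrix.cons_val_one, Matrix.cons_val, hc 1 0, hc 2 0, hc 2 1] at h0 ⊢
  linear_combination 4 * h0 - 4 * c 0 0 * Complex.I_sq

/-- Position, velocity and acceleration of the curve form a basis at every t. -/
theorem eq_zero_of_nullCurve {x : Fin 3 → ℂ} {t : ℂ} (h0 : ∑ i, nullCurve t i * x i = 0)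
    (h1 : ∑ i, nullCurve' t i * x i = 0) (h2 : ∑ i, nullCurve'' t i * x i = 0) (i : Fin 3) :
    x i = 0 := by
  simp only [Fin.sum_univ_three, nullCurve, nullCurve', nullCurve'', Matrix.cons_val_zero,
    Matrix.cons_val_one, Matrix.cons_val] at h0 h1 h2
  have e2 : x 2 = 0 := by linear_combination (1 / 2) * h1 - (1 / 2) * t * h2
  have e0 : Complex.I * x 0 = 0 := by
    linear_combination (1 / 2) * h0 - (1 / 4) * (t ^ 2 - 1) * h2 - t * e2
  have e0' := (mul_eq_zero.mp e0).resolve_left Complex.I_ne_zero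
  fin_cases i
  · exact e0'
  · show x 1 = 0
    linear_combination (1 / 2) * h2 - Complex.I * e0'
  · exact e2

theorem trace_one {n : ℕ} (S : Tensor (n + 2)) : trace 1 S = ∑ a, slice (slice S a) a := by
  funext J
  simp only [trace, inv_one, Finset.sum_apply]
  refine Finset.sum_congr rfl fun a _ => ?_
  rw [Finset.sum_eq_single a]
  · simp [slice]
  · intro b _ hb
    simp [Matrix.one_apply_ne hb.symm]
  · simp

theorem contract_sum (ξ : Fin 3 → ℂ) {n : ℕ} (S : Fin 3 → Tensor n) :
    contract ξ (∑ a, S a) = ∑ a, contract ξ (S a) := by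
  simp only [Fin.sum_univ_three, contract_add]

/-- A symmetric trace-free tensor is determined by its values on null vectors. -/
theorem eq_zero_of_contract_nullCurve {n : ℕ} {S : Tensor n} (hS : IsSymmTraceFree 1 S)
    (h : ∀ t : ℂ, t ≠ 0 → contract (nullCurve t) S = 0) : S = 0 := by
  induction n with
  | zero =>
    funext J
    have := h 1 one_ne_zero
    rw [contract_zero] at this
    rw [Subsingleton.elim J Fin.elim0, this]; rfl
  | succ n ih =>
    have hsym := hS.isSymm
    have hev : ∀ {t : ℂ} {u : ℂ → ℂ} {d : ℂ}, t ≠ 0 → (∀ s : ℂ, s ≠ 0 → u s = 0) →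
        HasDerivAt u d t → d = 0 := fun ht hu hd =>
      hd.unique ((hasDerivAt_const _ (0 : ℂ)).congr_of_eventuallyEq
        ((eventually_ne_nhds ht).mono hu))
    have hn : ((n : ℂ) + 1) ≠ 0 := Nat.cast_add_one_ne_zero n
    -- Differentiating along the curve controls the slices in the direction γ′. A second
    -- differentiation, with `nullCurve_identity` and the vanishing trace, controls γ″. Together
    -- with γ this is a basis, so all slices vanish on the curve and the induction hypothesis
    -- applies to them.
    have h1 : ∀ t : ℂ, t ≠ 0 → ∑ i, nullCurve' t i * contract (nullCurve t) (slice S i) = 0 :=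
      fun t ht => (mul_eq_zero.mp (hev ht h
        (hasDerivAt_contract (hasDerivAt_nullCurve t) hsym))).resolve_left hn
    have h2 : ∀ t : ℂ, t ≠ 0 → ∑ i, nullCurve'' t i * contract (nullCurve t) (slice S i) = 0 := by
      intro t ht
      rcases n with _ | n
      · simp only [contract_zero] at h1 ⊢
        exact hev ht h1 (HasDerivAt.fun_sum fun i _ => (hasDerivAt_nullCurve' t i).mul_const _)
      · have h3 := hev ht h1 (HasDerivAt.fun_sum fun i _ => (hasDerivAt_nullCurve' t i).mul
          (hasDerivAt_contract (hasDerivAt_nullCurve t) (hsym.slice i)))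
        have h4 := congrArg (contract (nullCurve t)) hS.2
        rw [trace_one, contract_sum] at h4
        have h5 : contract (nullCurve t) (0 : Tensor n) = 0 := by simp [contract]
        rw [h5] at h4
        have hsw : ∀ i j, contract (nullCurve t) (slice (slice S i) j) =
            contract (nullCurve t) (slice (slice S j) i) := fun i j => by
          congr 1; funext J; exact hsym.swap i j J
        have h6 := nullCurve_identity hsw h4 t
        have h7 : ((n : ℂ) + 1 + (n + 1) + 1) *
            ∑ i, nullCurve'' t i * contract (nullCurve t) (slice S i) = 0 := by
          simp only [Finset.sum_add_distrib, mul_left_comm _ ((((n : ℕ) : ℂ) + 1)), ← Finset.mul_sum] at h3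
          rw [h6] at h3
          simp only [← contract_slice] at h3
          linear_combination h3
        refine (mul_eq_zero.mp h7).resolve_left ?_
        exact_mod_cast Nat.succ_ne_zero (n + 1 + (n + 1))
    have h0 : ∀ t : ℂ, t ≠ 0 → ∑ i, nullCurve t i * contract (nullCurve t) (slice S i) = 0 :=
      fun t ht => by rw [← contract_slice, h t ht]
    have h3 : ∀ i, slice S i = 0 := fun i => ih (hS.slice i) fun t ht => by
      exact eq_zero_of_nullCurve (x := fun i => contract (nullCurve t) (slice S i)) (h0 t ht) (h1 t ht)
        (h2 t ht) i
    funext I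
    have := congrFun (h3 (I 0)) (Fin.tail I)
    rwa [slice, Fin.cons_self_tail] at this

/-! ### Existence of symmetric trace-free parts -/

theorem symmetrize_add {n : ℕ} (S T : Tensor n) : symmetrize (S + T) = symmetrize S + symmetrize T := by
  funext J
  simp only [symmetrize, Pi.add_apply, Finset.sum_add_distrib, mul_add]

theorem symmetrize_smul {n : ℕ} (c : ℂ) (S : Tensor n) : symmetrize (c • S) = c • symmetrize S := by
  funext J
  simp only [symmetrize, Pi.smul_apply, smul_eq_mul, ← Finset.mul_sum]
  ring

theorem isSymm_symmetrize {n : ℕ} (S : Tensor n) : IsSymm (symmetrize S) := by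
  intro σ I
  simp only [symmetrize]
  congr 1
  exact Fintype.sum_equiv (Equiv.mulLeft σ) _ _ fun π => rfl

theorem IsSymm.symmetrize_eq {n : ℕ} {S : Tensor n} (h : IsSymm S) : symmetrize S = S := by
  funext J
  simp only [symmetrize, h _ J, Finset.sum_const, Finset.card_univ, Fintype.card_perm,
    Fintype.card_fin, nsmul_eq_mul]
  rw [inv_mul_cancel_left₀ (by exact_mod_cast n.factorial_ne_zero)]

theorem trace_add (g : Matrix (Fin 3) (Fin 3) ℝ) {n : ℕ} (S T : Tensor (n + 2)) :
    trace g (S + T) = trace g S + trace g T := by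
  funext J
  simp only [trace, Pi.add_apply, mul_add, Finset.sum_add_distrib]

theorem trace_smul (g : Matrix (Fin 3) (Fin 3) ℝ) {n : ℕ} (c : ℂ) (S : Tensor (n + 2)) :
    trace g (c • S) = c • trace g S := by
  funext J
  simp only [trace, Pi.smul_apply, smul_eq_mul, Finset.mul_sum]
  exact Finset.sum_congr rfl fun _ _ => Finset.sum_congr rfl fun _ _ => by ring

/-- The operator whose inverse gives the trace of a symmetric tensor as a multiple of the metric. -/
def traceOp (g : Matrix (Fin 3) (Fin 3) ℝ) (n : ℕ) : Tensor n →ₗ[ℂ] Tensor n where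
  toFun Q := trace g (symmetrize (matMul g Q)) + (Q - symmetrize Q)
  map_add' Q Q' := by
    have : matMul g (Q + Q') = matMul g Q + matMul g Q' := by
      funext J; simp only [matMul, Pi.add_apply, mul_add]
    rw [this, symmetrize_add, symmetrize_add, trace_add]
    abel
  map_smul' c Q := by
    have : matMul g (c • Q) = c • matMul g Q := by
      funext J; simp only [matMul, Pi.smul_apply, smul_eq_mul]; ring
    rw [this, symmetrize_smul, symmetrize_smul, trace_smul, RingHom.id_apply, smul_add, smul_sub]

theorem traceOp_apply (g : Matrix (Fin 3) (Fin 3) ℝ) {n : ℕ} (Q : Tensor n) :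
    traceOp g n Q = trace g (symmetrize (matMul g Q)) + (Q - symmetrize Q) := rfl

theorem symmetrize_traceOp (g : Matrix (Fin 3) (Fin 3) ℝ) {n : ℕ} (Q : Tensor n) :
    symmetrize (traceOp g n Q) = trace g (symmetrize (matMul g Q)) := by
  have h1 : symmetrize (Q - symmetrize Q) = 0 := by
    rw [sub_eq_add_neg, ← neg_one_smul ℂ, symmetrize_add, symmetrize_smul,
      (isSymm_symmetrize Q).symmetrize_eq, neg_one_smul, add_neg_cancel]
  rw [traceOp_apply, symmetrize_add, h1, add_zero, (isSymm_symmetrize _).trace.symmetrize_eq]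

/-- Polarization by differentiating in the coordinate directions. Restricting to vectors off the
quadric x · x = 0 costs nothing, since that condition is open. -/
theorem IsSymm.eq_zero_of_contract {n : ℕ} {S : Tensor n} (hS : IsSymm S)
    (h : ∀ x : Fin 3 → ℂ, ∑ i, x i * x i ≠ 0 → contract x S = 0) : S = 0 := by
  induction n with
  | zero =>
    funext J
    have := h (fun _ => 1) (by simp)
    rw [contract_zero] at this
    rw [Subsingleton.elim J Fin.elim0, this]; rfl
  | succ n ih =>
    have h3 : ∀ i, AxiErnst.slice S i = 0 := fun i => ih (hS.slice i) fun x hx => by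
      have hξ : ∀ j, HasDerivAt (fun t : ℂ => x j + t * (if j = i then 1 else 0))
          (if j = i then 1 else 0) 0 := fun j =>
        (((hasDerivAt_id (0 : ℂ)).mul_const _).const_add _).congr_deriv (one_mul _)
      have h1 := hasDerivAt_contract (ξ := fun t j => x j + t * (if j = i then 1 else 0))
        (ξ' := fun _ j => if j = i then 1 else 0) hξ hS
      have hc : ContinuousAt (fun t : ℂ => ∑ j, (x j + t * (if j = i then 1 else 0)) *
          (x j + t * (if j = i then 1 else 0))) 0 := by fun_prop
      have h2 := hc.eventually_ne (show _ ≠ (0 : ℂ) by simpa using hx)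
      have h4 := h1.unique ((hasDerivAt_const _ (0 : ℂ)).congr_of_eventuallyEq
        (h2.mono fun t ht => h _ ht))
      have h5 := (mul_eq_zero.mp h4).resolve_left (Nat.cast_add_one_ne_zero n)
      simpa using h5
    funext I
    have := congrFun (h3 (I 0)) (Fin.tail I)
    rwa [AxiErnst.slice, Fin.cons_self_tail] at this

/-- The added term Q − `symmetrize Q` makes every element of the kernel symmetric. Its symmetrized
product with the metric is then trace-free and zero on null vectors, hence zero, and evaluation on
non-null vectors gives Q = 0. -/
theorem traceOp_injective (n : ℕ) : Function.Injective (traceOp 1 n) := by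
  rw [injective_iff_map_eq_zero]
  intro Q hQ
  have h1 := symmetrize_traceOp 1 Q
  rw [hQ, show symmetrize (0 : Tensor n) = 0 by
    simpa using symmetrize_smul (0 : ℂ) (0 : Tensor n)] at h1
  have h2 : Q = symmetrize Q := by
    have := traceOp_apply 1 Q
    rw [hQ, ← h1, zero_add, eq_comm, sub_eq_zero] at this
    exact this
  have hs : IsSymm Q := h2 ▸ isSymm_symmetrize Q
  have hcm : ∀ x : Fin 3 → ℂ, contract x (symmetrize (matMul (1 : Matrix (Fin 3) (Fin 3) ℝ) Q)) =
      (∑ i, x i * x i) * contract x Q := by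
    intro x
    rw [contract_symmetrize]
    refine (contract_matMul x (fun i j => (1 : Matrix (Fin 3) (Fin 3) ℝ) i j) Q).trans ?_
    congr 1
    simp [Matrix.one_apply, Fin.sum_univ_three]
  have h3 : symmetrize (matMul (1 : Matrix (Fin 3) (Fin 3) ℝ) Q) = 0 := by
    refine eq_zero_of_contract_nullCurve (n := n + 2) ⟨isSymm_symmetrize _, h1.symm⟩ fun t _ => ?_
    rw [hcm]
    have : ∑ i, nullCurve t i * nullCurve t i = 0 := by
      simp only [Fin.sum_univ_three, nullCurve, Matrix.cons_val_zero, Matrix.cons_val_one,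
        Matrix.cons_val]
      linear_combination (t ^ 2 + 1) ^ 2 * Complex.I_sq
    rw [this, zero_mul]
  refine hs.eq_zero_of_contract fun x hx => ?_
  have h4 := hcm x
  rw [h3, show contract x (0 : Tensor (n + 2)) = 0 by simp [contract]] at h4
  exact (mul_eq_zero.mp h4.symm).resolve_left hx

theorem isSymmTraceFreePart_of_traceOp {g : Matrix (Fin 3) (Fin 3) ℝ} {n : ℕ} {T : Tensor (n + 2)}
    {Q : Tensor n} (h : traceOp g n Q = trace g (symmetrize T)) :
    IsSymmTraceFreePart g T (symmetrize T - symmetrize (matMul g Q)) := by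
  refine ⟨(isSymm_symmetrize _).sub (isSymm_symmetrize _), ?_, Q, (sub_add_cancel _ _).symm⟩
  have h1 := symmetrize_traceOp g Q
  rw [h, (isSymm_symmetrize _).trace.symmetrize_eq] at h1
  exact fun J => congrFun (show trace g (symmetrize T - symmetrize (matMul g Q)) = 0 by
    rw [trace_sub, h1, sub_self]) J

theorem IsSymmTraceFreePart.isSymmTraceFree {g : Matrix (Fin 3) (Fin 3) ℝ} : ∀ {n : ℕ}
    {T S : Tensor n}, IsSymmTraceFreePart g T S → IsSymmTraceFree g S
  | 0, _, _, _ => trivial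
  | 1, _, _, _ => isSymm_one _
  | _ + 2, _, _, h => ⟨h.1, funext h.2.1⟩

section
variable {ι : Type*} [Fintype ι] [DecidableEq ι] {p : E3}

theorem analyticAt_cdet {M : E3 → Matrix ι ι ℂ} (hM : ∀ i j, AnalyticAt ℝ (fun q => M q i j) p) :
    AnalyticAt ℝ (fun q => (M q).det) p := by
  simp only [Matrix.det_apply, zsmul_eq_mul, Units.smul_def]
  exact Finset.analyticAt_fun_sum _ fun σ _ =>
    analyticAt_const.mul (Finset.analyticAt_fun_prod _ fun i _ => hM _ _)

theorem analyticAt_cmatrix_inv {M : E3 → Matrix ι ι ℂ}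
    (hM : ∀ i j, AnalyticAt ℝ (fun q => M q i j) p) (h0 : (M p).det ≠ 0) (i j : ι) :
    AnalyticAt ℝ (fun q => (M q)⁻¹ i j) p := by
  have h1 : AnalyticAt ℝ (fun q => (M q).adjugate i j) p := by
    simp only [Matrix.adjugate_apply]
    refine analyticAt_cdet fun k l => ?_
    by_cases hk : k = j
    · simp only [hk, Matrix.updateRow_self]; exact analyticAt_const
    · simp only [ne_eq, hk, not_false_eq_true, Matrix.updateRow_ne]; exact hM k l
  have h2 : (fun q => (M q)⁻¹ i j) = fun q => ((M q).det)⁻¹ * (M q).adjugate i j := by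
    funext q
    rw [Matrix.inv_def, Ring.inverse_eq_inv', Matrix.smul_apply, smul_eq_mul]
  rw [h2]
  exact ((analyticAt_cdet hM).inv h0).mul h1
end

theorem analyticAt_symmetrize {n : ℕ} {T : E3 → Tensor n} {p : E3}
    (hT : ∀ J, AnalyticAt ℝ (fun q => T q J) p) (J : Fin n → Fin 3) :
    AnalyticAt ℝ (fun q => symmetrize (T q) J) p :=
  analyticAt_const.mul (Finset.analyticAt_fun_sum _ fun _ _ => hT _)

theorem analyticAt_trace {g : MetricField} {n : ℕ} {T : E3 → Tensor (n + 2)}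
    (hg : ∀ i j, AnalyticAt ℝ (fun q => g q i j) 0) (h0 : (g 0).det ≠ 0)
    (hT : ∀ J, AnalyticAt ℝ (fun q => T q J) 0) (J : Fin n → Fin 3) :
    AnalyticAt ℝ (fun q => trace (g q) (T q) J) 0 :=
  Finset.analyticAt_fun_sum _ fun _ _ => Finset.analyticAt_fun_sum _ fun _ _ =>
    (analyticAt_ofReal (analyticAt_matrix_inv hg h0 _ _)).mul (hT _)

/-- Inverting `traceOp` yields the Q to be removed. At Λ the metric is the identity and the operator
is injective; its determinant stays nonzero nearby, and Cramer's rule makes Q analytic. -/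
theorem exists_symmTraceFreePart {g : MetricField} (hg : ∀ i j, AnalyticAt ℝ (fun q => g q i j) 0)
    (h0 : g 0 = 1) {n : ℕ} {T : E3 → Tensor n} (hT : ∀ J, AnalyticAt ℝ (fun q => T q J) 0) :
    ∃ S : E3 → Tensor n, (∀ J, AnalyticAt ℝ (fun q => S q J) 0) ∧
      ∀ᶠ p in 𝓝 (0 : E3), IsSymmTraceFreePart (g p) (T p) (S p) := by
  match n, T, hT with
  | 0, T, hT => exact ⟨T, hT, Filter.Eventually.of_forall fun _ => rfl⟩
  | 1, T, hT => exact ⟨T, hT, Filter.Eventually.of_forall fun _ => rfl⟩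
  | n + 2, T, hT =>
    have hdet : (g 0).det ≠ 0 := by rw [h0, Matrix.det_one]; exact one_ne_zero
    have hmm : ∀ {Q : E3 → Tensor n}, (∀ J, AnalyticAt ℝ (fun q => Q q J) 0) →
        ∀ J, AnalyticAt ℝ (fun q => symmetrize (matMul (g q) (Q q)) J) 0 := fun hQ =>
      analyticAt_symmetrize (analyticAt_matMul (M := fun i j q => g q i j) hg hQ)
    obtain ⟨M, hM⟩ : ∃ M : E3 → Matrix (Fin n → Fin 3) (Fin n → Fin 3) ℂ,
      M = fun p => LinearMap.toMatrix' (traceOp (g p) n) := ⟨_, rfl⟩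
    have hMan : ∀ J K, AnalyticAt ℝ (fun q => M q J K) 0 := by
      intro J K
      have h1 : (fun q => M q J K) = fun q => traceOp (g q) n (Pi.single K 1) J := by
        funext q
        rw [hM]
        exact LinearMap.toMatrix'_apply _ _ _
      rw [h1]
      exact (analyticAt_trace hg hdet (hmm (Q := fun _ => Pi.single K 1) fun _ => analyticAt_const) J).add
        analyticAt_const
    have hM0 : (M 0).det ≠ 0 := by
      rw [hM, LinearMap.det_toMatrix', h0]
      exact (LinearMap.isUnit_det _ (LinearMap.isUnit_iff_ker_eq_bot _ |>.mpr
        (LinearMap.ker_eq_bot.mpr (traceOp_injective n)))).ne_zero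
    have hτ := analyticAt_trace hg hdet (analyticAt_symmetrize hT)
    have hQ : ∀ J, AnalyticAt ℝ
        (fun q => ((M q)⁻¹.mulVec (trace (g q) (symmetrize (T q)))) J) 0 := fun J =>
      Finset.analyticAt_fun_sum _ fun K _ => (analyticAt_cmatrix_inv hMan hM0 J K).mul (hτ K)
    refine ⟨fun q => symmetrize (T q) - symmetrize (matMul (g q)
      ((M q)⁻¹.mulVec (trace (g q) (symmetrize (T q))))),
      fun J => (analyticAt_symmetrize hT J).sub (hmm hQ J), ?_⟩
    filter_upwards [(analyticAt_cdet hMan).continuousAt.eventually_ne hM0] with p hp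
    refine isSymmTraceFreePart_of_traceOp ?_
    have h2 : ∀ Q, traceOp (g p) n Q = (M p).mulVec Q := fun Q => by
      rw [hM, LinearMap.toMatrix'_mulVec]
    rw [h2, Matrix.mulVec_mulVec, Matrix.mul_nonsing_inv _ (isUnit_iff_ne_zero.mpr hp),
      Matrix.one_mulVec]

/-! ### Existence of the moment tensors -/

open Classical in
/-- A choice of the symmetric trace-free part of a tensor field. -/
def traceFreePart (g : MetricField) {n : ℕ} (T : E3 → Tensor n) : E3 → Tensor n :=
  if h : ∃ S : E3 → Tensor n, (∀ J, AnalyticAt ℝ (fun q => S q J) 0) ∧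
      ∀ᶠ p in 𝓝 (0 : E3), IsSymmTraceFreePart (g p) (T p) (S p) then h.choose else 0

theorem traceFreePart_spec {g : MetricField} (hg : ∀ i j, AnalyticAt ℝ (fun q => g q i j) 0)
    (h0 : g 0 = 1) {n : ℕ} {T : E3 → Tensor n} (hT : ∀ J, AnalyticAt ℝ (fun q => T q J) 0) :
    (∀ J, AnalyticAt ℝ (fun q => traceFreePart g T q J) 0) ∧
      ∀ᶠ p in 𝓝 (0 : E3), IsSymmTraceFreePart (g p) (T p) (traceFreePart g T p) := by
  have h := exists_symmTraceFreePart hg h0 hT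
  rw [traceFreePart, dif_pos h]
  exact h.choose_spec

/-- The moment tensors of a potential. -/
def momentTensor (g : MetricField) (ψ : E3 → ℂ) : (n : ℕ) → E3 → Tensor n
  | 0 => fun p _ => ψ p
  | 1 => traceFreePart g fun p => covDeriv g (fun q (_ : Fin 0 → Fin 3) => ψ q) p
  | n + 2 => traceFreePart g fun p => covDeriv g (momentTensor g ψ (n + 1)) p -
      (((n : ℂ) + 1) * (2 * (n : ℂ) + 1) / 2) •
        matMul (fun i j => ricci g i j p) (momentTensor g ψ n p)

theorem isMomentSequence_momentTensor {g : MetricField} {ψ : E3 → ℂ}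
    (hg : ∀ i j, AnalyticAt ℝ (fun q => g q i j) 0) (h0 : g 0 = 1) (hψ : AnalyticAt ℝ ψ 0) :
    IsMomentSequence g ψ (momentTensor g ψ) := by
  have hdet : (g 0).det ≠ 0 := by rw [h0, Matrix.det_one]; exact one_ne_zero
  have hchr := analyticAt_christoffel hg hdet
  have hric := analyticAt_ricci hg hdet
  have hP0 : ∀ J, AnalyticAt ℝ (fun q => momentTensor g ψ 0 q J) 0 := fun _ => hψ
  have hT1 : ∀ J, AnalyticAt ℝ (fun q => covDeriv g (momentTensor g ψ 0) q J) 0 :=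
    analyticAt_covDeriv hchr hP0
  have hT2 : ∀ n, (∀ J, AnalyticAt ℝ (fun q => momentTensor g ψ n q J) 0) →
      (∀ J, AnalyticAt ℝ (fun q => momentTensor g ψ (n + 1) q J) 0) →
      ∀ J, AnalyticAt ℝ (fun q => (covDeriv g (momentTensor g ψ (n + 1)) q -
        (((n : ℂ) + 1) * (2 * (n : ℂ) + 1) / 2) •
          matMul (fun i j => ricci g i j q) (momentTensor g ψ n q)) J) 0 := fun n h1 h2 J =>
    (analyticAt_covDeriv hchr h2 J).sub (analyticAt_const.mul (analyticAt_matMul hric h1 J))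
  have key : ∀ n, (∀ J, AnalyticAt ℝ (fun q => momentTensor g ψ n q J) 0) ∧
      (∀ J, AnalyticAt ℝ (fun q => momentTensor g ψ (n + 1) q J) 0) := by
    intro n
    induction n with
    | zero => exact ⟨hP0, (traceFreePart_spec hg h0 hT1).1⟩
    | succ n ih => exact ⟨ih.2, (traceFreePart_spec hg h0 (hT2 n ih.1 ih.2)).1⟩
  exact ⟨fun n => (key n).1, Filter.Eventually.of_forall fun _ => rfl,
    (traceFreePart_spec hg h0 hT1).2,
    fun n => (traceFreePart_spec hg h0 (hT2 n (key n).1 (key n).2)).2⟩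

/-! ### The moments at `Λ` -/

theorem contract_const_smul {ι : Fin 3 → ℂ} (c : ℂ) {n : ℕ} (T : Tensor n) :
    contract (fun i => c * ι i) T = c ^ n * contract ι T := by
  simp only [contract, Finset.mul_sum, Finset.prod_mul_distrib, Finset.prod_const, Finset.card_univ,
    Fintype.card_fin]
  exact Finset.sum_congr rfl fun _ _ => by ring

theorem contract_axis (ξ : Fin 3 → ℂ) (c : ℂ) (n : ℕ) :
    contract ξ (fun I : Fin n → Fin 3 => c * ∏ s, if I s = 2 then 1 else 0) = c * ξ 2 ^ n := by
  rw [contract, Finset.sum_eq_single fun _ => 2]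
  · simp
  · intro I _ hI
    obtain ⟨s, hs⟩ := Function.ne_iff.mp hI
    rw [Finset.prod_eq_zero (Finset.mem_univ s) (if_neg hs)]
    ring
  · simp

theorem isNullDir_nullCurve {t : ℂ} (ht : t ≠ 0) : IsNullDir fun i => (2 * t)⁻¹ * nullCurve t i := by
  constructor
  · exact inv_mul_cancel₀ (mul_ne_zero two_ne_zero ht)
  · simp only [nullCurve, Matrix.cons_val_zero, Matrix.cons_val_one]
    have h2 : (2 * t)⁻¹ * (2 * t) = 1 := inv_mul_cancel₀ (mul_ne_zero two_ne_zero ht)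
    linear_combination ((2 * t)⁻¹ * (t ^ 2 + 1)) ^ 2 * Complex.I_sq -
      ((2 * t)⁻¹ * (2 * t) + 1) * h2

theorem IsNullDir.sum_mul_self {η : Fin 3 → ℂ} (hη : IsNullDir η) :
    ∑ i, ∑ j, (((1 : Matrix (Fin 3) (Fin 3) ℝ) i j : ℝ) : ℂ) * (η i * η j) = 0 := by
  simp [Matrix.one_apply, Fin.sum_univ_three, hη.two]
  linear_combination hη.sq

/-- Axisymmetric moments are characterized by the values on null directions. -/
theorem isSymmTraceFreePart_axis_iff {n : ℕ} {S : Tensor n} (hS : IsSymmTraceFree 1 S) (c : ℂ) :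
    IsSymmTraceFreePart 1 (fun I : Fin n → Fin 3 => c * ∏ s, if I s = 2 then 1 else 0) S ↔
      ∀ η, IsNullDir η → contract η S = c := by
  constructor
  · intro h η hη
    rw [contract_eq_of_isSymmTraceFreePart hη.sum_mul_self h, contract_axis, hη.two, one_pow, mul_one]
  · intro h
    -- The trace-free part S′ of the axis tensor has the same values on null vectors as S, so the
    -- two coincide.
    obtain ⟨S', -, hS'⟩ := exists_symmTraceFreePart (g := fun _ => 1) (fun _ _ => analyticAt_const) rfl
      (T := fun _ (I : Fin n → Fin 3) => c * ∏ s, if I s = 2 then (1 : ℂ) else 0)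
      fun _ => analyticAt_const
    have h1 := hS'.self_of_nhds
    have h2 : S - S' 0 = 0 := by
      refine eq_zero_of_contract_nullCurve (hS.sub h1.isSymmTraceFree) fun t ht => ?_
      have hη := isNullDir_nullCurve ht
      have h3 : contract (fun i => (2 * t)⁻¹ * nullCurve t i) (S - S' 0) = 0 := by
        rw [contract_sub, h _ hη, contract_eq_of_isSymmTraceFreePart hη.sum_mul_self h1,
          contract_axis, hη.two, one_pow, mul_one, sub_self]
      rw [contract_const_smul] at h3
      exact (mul_eq_zero.mp h3).resolve_left
        (pow_ne_zero _ (inv_ne_zero (mul_ne_zero two_ne_zero ht)))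
    rwa [sub_eq_zero.mp h2]

section
variable {f : E3 → ℂ} {β κ : E3 → ℝ} {a b k c : PS}

theorem tildeMetric_zero (h0 : β 0 = 0) (h0' : κ 0 = 0) : tildeMetric β κ 0 = 1 := by
  simp [tildeMetric, hatMetric, h0, h0']

theorem exists_isNullDir : ∃ η, IsNullDir η :=
  ⟨_, isNullDir_nullCurve one_ne_zero⟩

theorem IsMomentSequence.isSymmTraceFree {g : MetricField} {ψ : E3 → ℂ} {P : (n : ℕ) → E3 → Tensor n}
    (hP : IsMomentSequence g ψ P) : ∀ n, IsSymmTraceFree (g 0) (P n 0)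
  | 0 => trivial
  | 1 => isSymm_one _
  | n + 2 => (hP.add_two n).self_of_nhds.isSymmTraceFree

/-- At Λ the z̃-derivatives at fixed ρ̃² and at fixed r² coincide, because their difference has the
factor 2z̃. -/
theorem IsConformalGauge.constantCoeff {c₀ : ℝ} (hκ : IsConformalGauge c₀ κ)
    (h : IsGaugeData f β κ a b k c) :
    PowerSeries.constantCoeff (PowerSeries.derivative ℂ (null c)) = c₀ := by
  have h0 : inv 0 = 0 := by simp [inv]
  have h1 := ((S_re_hasGrad h.conv_c).self_of_nhds.congr h.κ_eq_re).pd_eq 2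
  rw [hκ.deriv_zero] at h1
  have h2 := ofReal_re_S (a := dZ c) (by rw [cj_dZ, h.real_c]) 0
  have h3 := congrArg PowerSeries.constantCoeff (null_dZ c)
  rw [constantCoeff_null, map_add, map_mul, map_mul, PowerSeries.constantCoeff_X, mul_zero, zero_mul,
    zero_add, ← h0, ← h2] at h3
  rw [← h3, h1]
  simp [axiGrad, rad, axisVec]

/-- The multipole moments as derivatives along the null cone. -/
theorem IsGaugeData.hasMultipoleMoments_iff {c₀ : ℝ} (h : IsGaugeData f β κ a b k c)
    (hκ : IsConformalGauge c₀ κ) (h0 : β 0 = 0) {r E ω : PowerSeries ℂ}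
    (hG : IsNullGauge (PowerSeries.derivative ℂ (null b)) c₀ r E ω) (m : ℕ → ℂ) :
    HasMultipoleMoments f β κ m ↔
      ∀ n, PowerSeries.constantCoeff ((nullDer ω)^[n] (r * null a)) = m n := by
  have hg := tildeMetric_zero h0 hκ.map_zero
  have hc := hκ.constantCoeff h
  obtain ⟨η₀, hη₀⟩ := exists_isNullDir
  constructor
  · rintro ⟨P, hP, hm⟩ n
    have h1 := hm n
    have h2 := hP.isSymmTraceFree n
    rw [hg] at h1 h2
    rw [← h.contract_moment hη₀ h0 hκ.map_zero hP hG hc,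
      (isSymmTraceFreePart_axis_iff h2 _).mp h1 _ hη₀]
  · intro hm
    obtain ⟨e, he, -⟩ := HasDirTaylor.tildePotential h hη₀ h0 hκ.map_zero
    have hP := isMomentSequence_momentTensor h.analyticAt_tildeMetric hg he.1
    refine ⟨_, hP, fun n => ?_⟩
    have h2 := hP.isSymmTraceFree n
    rw [hg] at h2 ⊢
    exact (isSymmTraceFreePart_axis_iff h2 _).mpr fun η hη => by
      rw [h.contract_moment hη h0 hκ.map_zero hP hG hc, hm]
end

/-! ### Existence, uniqueness and convergence -/

theorem series_unique {a a' : PS} (ha : Conv a) (ha' : Conv a')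
    (h : ∀ᶠ p in 𝓝 (0 : E3), S a (inv p) = S a' (inv p)) : a = a' := by
  have hr := ha.rep.sub ha'.rep
  refine sub_eq_zero.mp (hr.eq_zero ?_)
  filter_upwards [h] with p hp _
  exact sub_eq_zero.mpr hp

theorem IsAxisymmetricVacuum.map_zero {f : E3 → ℂ} {β : E3 → ℝ} (h : IsAxisymmetricVacuum f β) :
    β 0 = 0 :=
  (eq_zero_of_rhoSq_eq_zero h).self_of_nhds (by simp [rhoSq])

/-- The data describing a solution with given multipole moments. -/
theorem exists_of_hasMultipoleMoments {f : E3 → ℂ} {β κ : E3 → ℝ} {c : ℝ} {m : ℕ → ℂ}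
    (h : IsAxisymmetricVacuum f β) (hκ : IsConformalGauge c κ) (hm : HasMultipoleMoments f β κ m) :
    ∃ (a b : PS) (R W : ℂ → ℂ) (r E ω : PowerSeries ℂ), IsSeriesSolution a b ∧
      (∀ᶠ p in 𝓝 (0 : E3), f p = S a (inv p)) ∧ HasTaylor R r ∧ HasTaylor W ω ∧
      IsNullGauge (PowerSeries.derivative ℂ (null b)) c r E ω ∧
      ∀ n, PowerSeries.constantCoeff ((nullDer ω)^[n] (r * null a)) = m n := by
  obtain ⟨a, b, k, hd⟩ := exists_isSolutionData h
  obtain ⟨c', hg⟩ := exists_isGaugeData hd hκ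
  obtain ⟨R, W, r, E, ω, hR, hW, hG⟩ := exists_isNullGauge hd.sol (constantCoeff_null_beta hd.axis) c
  exact ⟨a, b, R, W, r, E, ω, hd.sol, hd.f_eq, hR, hW, hG,
    (hg.hasMultipoleMoments_iff hκ h.map_zero hG m).mp hm⟩

theorem exists_solution {y : ℂ → ℂ} (hy : AnalyticAt ℂ y 0) (c : ℝ) :
    ∃ (f : E3 → ℂ) (β : E3 → ℝ), IsAxisymmetricVacuum f β ∧ ∀ κ, IsConformalGauge c κ →
      HasMultipoleMoments f β κ fun n => iteratedDeriv n y 0 := by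
  obtain ⟨a, ha, hae, r, E, ω, hG, hm⟩ := exists_series_of_potential hy c
  obtain ⟨β, hβ⟩ := exists_isAxisymmetricVacuum ha hae
  refine ⟨_, β, hβ, fun κ hκ => ?_⟩
  obtain ⟨a', b, k, hd⟩ := exists_isSolutionData hβ
  -- The series extracted from the constructed solution is the original one, so the null gauge found
  -- with it can be used.
  obtain rfl : a = a' := series_unique ha hd.sol.conv_a hd.f_eq
  obtain ⟨c', hg⟩ := exists_isGaugeData hd hκ
  rw [← derivative_null_beta hd.sol] at hG
  exact (hg.hasMultipoleMoments_iff hκ hβ.map_zero hG _).mpr hm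

theorem eventuallyEq_of_hasMultipoleMoments {f f' : E3 → ℂ} {β β' κ κ' : E3 → ℝ} {c : ℝ} {m : ℕ → ℂ}
    (h : IsAxisymmetricVacuum f β) (hκ : IsConformalGauge c κ) (hm : HasMultipoleMoments f β κ m)
    (h' : IsAxisymmetricVacuum f' β') (hκ' : IsConformalGauge c κ')
    (hm' : HasMultipoleMoments f' β' κ' m) : f' =ᶠ[𝓝 0] f := by
  obtain ⟨a, b, R, W, r, E, ω, hs, hf, -, -, hG, hn⟩ := exists_of_hasMultipoleMoments h hκ hm
  obtain ⟨a', b', R', W', r', E', ω', hs', hf', -, -, hG', hn'⟩ :=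
    exists_of_hasMultipoleMoments h' hκ' hm'
  obtain rfl := eq_of_moments hs hs' hG hG' fun n => by rw [hn, hn']
  filter_upwards [hf, hf'] with p e1 e2
  rw [e1, e2]

/-- For a given solution r and ω come from analytic functions, so the moments are the derivatives at
0 of an analytic function of ρ. -/
theorem hasPositiveRadius_of_hasMultipoleMoments {f : E3 → ℂ} {β κ : E3 → ℝ} {c : ℝ} {m : ℕ → ℂ}
    (h : IsAxisymmetricVacuum f β) (hκ : IsConformalGauge c κ) (hm : HasMultipoleMoments f β κ m) :
    HasPositiveRadius m := by
  obtain ⟨a, b, R, W, r, E, ω, hs, hf, hR, hW, hG, hn⟩ := exists_of_hasMultipoleMoments h hκ hm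
  obtain ⟨y, hy, hyn⟩ := exists_iteratedDeriv_eq hs.conv_a hR hW hG
  exact hasPositiveRadius_iff.mpr ⟨y, hy, fun n => by rw [hyn, hn]⟩

/-- The gauge `κ = c z̃`. -/
theorem isConformalGauge_linear (c : ℝ) : IsConformalGauge c fun p => c * p 2 := by
  have h : HasFDerivAt (fun p : E3 => c * p 2) (c • (EuclideanSpace.proj 2 : E3 →L[ℝ] ℝ)) 0 :=
    ((EuclideanSpace.proj 2 : E3 →L[ℝ] ℝ).hasFDerivAt).const_mul c
  refine ⟨analyticAt_const.mul ((EuclideanSpace.proj 2 : E3 →L[ℝ] ℝ).analyticAt 0),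
    Filter.Eventually.of_forall fun p q _ h2 => congrArg (c * ·) h2, by simp, ?_⟩
  rw [pd, h.fderiv]
  simp

end AxiErnst

end

theorem mainTheorem1 (m : ℕ → ℂ) (c : ℝ) :
    (AxiErnst.HasPositiveRadius m →
      ∃ (f : AxiErnst.E3 → ℂ) (β : AxiErnst.E3 → ℝ),
        AxiErnst.IsAxisymmetricVacuum f β ∧
        (∀ κ : AxiErnst.E3 → ℝ, AxiErnst.IsConformalGauge c κ →
          AxiErnst.HasMultipoleMoments f β κ m) ∧
        ∀ (f' : AxiErnst.E3 → ℂ) (β' κ' : AxiErnst.E3 → ℝ),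
          AxiErnst.IsAxisymmetricVacuum f' β' → AxiErnst.IsConformalGauge c κ' →
          AxiErnst.HasMultipoleMoments f' β' κ' m → f' =ᶠ[𝓝 0] f) ∧
    (∀ (f : AxiErnst.E3 → ℂ) (β κ : AxiErnst.E3 → ℝ),
      AxiErnst.IsAxisymmetricVacuum f β → AxiErnst.IsConformalGauge c κ →
      AxiErnst.HasMultipoleMoments f β κ m → AxiErnst.HasPositiveRadius m) := by
  refine ⟨fun h => ?_, fun f β κ h hκ hm =>
    AxiErnst.hasPositiveRadius_of_hasMultipoleMoments h hκ hm⟩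
  obtain ⟨y, hy, hym⟩ := AxiErnst.hasPositiveRadius_iff.mp h
  obtain rfl : (fun n => iteratedDeriv n y 0) = m := funext hym
  obtain ⟨f, β, hf, hm⟩ := AxiErnst.exists_solution hy c
  -- Any gauge with this c would do; it supplies moments of f for the comparison in the uniqueness
  -- statement.
  have hκ := AxiErnst.isConformalGauge_linear c
  exact ⟨f, β, hf, hm, fun f' β' κ' h' hκ' hm' =>
    AxiErnst.eventuallyEq_of_hasMultipoleMoments hf hκ (hm _ hκ) h' hκ' hm'⟩
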